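/- Let $d\ge 1$, and write points of $\mathbb R^{d+1}$ as $(\rho,x)$ with $\rho\in\mathbb R$, $x\in\mathbb R^d$. For $k\in\mathbb N=\{0,1,2,\dots\}$ and $\mu\in\mathbb N^d$ let $$h_k(x)=(2^k k!\sqrt\pi)^{-1/2}(-1)^k\frac{d^k}{dx^k}\big(e^{-x^2}\big)e^{x^2/2}\quad(x\in\mathbb R),\qquad \Phi_\mu(x)=\prod_{j=1}^d h_{\mu_j}(x_j)\quad(x\in\mathbb R^d)$$ be the Hermite functions, and let $P_kg(x)=\int_{\mathbb R^d}\sum_{|\mu|=k}\Phi_\mu(x)\Phi_\mu(x')g(x')\,dx'$ be the projection onto the eigenspace of $-\Delta_x+|x|^2$ with eigenvalue $2k+d$. Let $\mathcal F_\rho f(\tau,x)=\frac1{\sqrt{2\pi}}\int_{\mathbb R}e^{-i\tau\rho}f(\rho,x)\,d\rho$. For $m:\mathbb R\times\mathbb N\to\mathbb C$ and $f\in C_c^\infty(\mathbb R^{d+1})$ (complex valued) put $$T_mf(\rho,x)=\sum_{k=0}^\infty\frac1{\sqrt{2\pi}}\int_{\mathbb R}e^{i\tau\rho}\,m(\tau,k)\,P_k(\mathcal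 F_\rho f(\tau,\cdot))(x)\,d\tau .$$ **Theorem 1.1 (Mikhlin–Hörmander multiplier theorem for the partial harmonic oscillator $-\partial_\rho^2-\Delta_x+|x|^2$).** Let $1<p<\infty$ and $A\in\mathbb R$. There is a constant $C$, depending only on $d$, $p$ and $A$, such that the following holds. Suppose that $m:\mathbb R\times\mathbb N\to\mathbb C$ is $\lfloor\frac{d+1}2\rfloor+1$ times differentiable in $\tau$ and that, with the forward difference $\triangle_k m(\tau,k)=m(\tau,k+1)-m(\tau,k)$, $$|\partial_\tau^Nm(\tau,k)|\le A(\tau^2+2k+d)^{-N/2}\quad\text{and}\quad|\triangle_k^Nm(\tau,k)|\le A(\tau^2+2k+d)^{-N}$$ for all $(\tau,k)\in\mathbb R\times\mathbb N$ and all integers $0\le N\le\lfloor\frac{d+1}2\rfloor+1$. Then for every $f\in C_c^\infty(\mathbb R^{d+1})$ the integrals and the series defining $T_mf$ converge absolutely at every point, $T_mf\in L^p(\mathbb R^{d+1})$, and $$\|T_mf\|_{L^p(\mathbb R^{d+1})}\le C\,\|f\|_{L^p(\mathbb R^{d+1})}.$$ Consequently $T_m$ extends from $C_c^\infty(\mathbb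 R^{d+1})$ to a bounded linear operator on $L^p(\mathbb R^{d+1})$ of norm at most $C$. -/

import Mathlib

open MeasureTheory
open scoped ENNReal NNReal ContDiff

noncomputable section

namespace PartialOscillator

/-- The normalized one-dimensional Hermite function
`h_k(x) = (2^k k! √π)^{-1/2} (-1)^k (d^k/dx^k e^{-x²}) e^{x²/2}`. -/
def hermiteFun (k : ℕ) (x : ℝ) : ℝ :=
  (Real.sqrt (2 ^ k * (k.factorial : ℝ) * Real.sqrt Real.pi))⁻¹ * (-1) ^ k *
    iteratedDeriv k (fun y : ℝ => Real.exp (-y ^ 2)) x * Real.exp (x ^ 2 / 2)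

/-- The Hermite function `Φ_μ(x) = ∏_j h_{μ_j}(x_j)` on `ℝ^d`. -/
def hermitePhi {d : ℕ} (μ : Fin d → ℕ) (x : EuclideanSpace ℝ (Fin d)) : ℝ :=
  ∏ j, hermiteFun (μ j) (x j)

/-- The kernel `Φ_k(x, x') = ∑_{|μ| = k} Φ_μ(x) Φ_μ(x')`. -/
def hermiteKernel {d : ℕ} (k : ℕ) (x x' : EuclideanSpace ℝ (Fin d)) : ℝ :=
  ∑ μ ∈ Finset.Nat.antidiagonalTuple d k, hermitePhi μ x * hermitePhi μ x'

/-- The spectral projection `P_k` of `-Δ_x + |x|²` on the eigenspace of the eigenvalue `2k + d`. -/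
def hermiteProj {d : ℕ} (k : ℕ) (g : EuclideanSpace ℝ (Fin d) → ℂ)
    (x : EuclideanSpace ℝ (Fin d)) : ℂ :=
  ∫ x', (hermiteKernel k x x' : ℂ) * g x'

/-- The unitary Fourier transform in the first variable:
`(F_ρ f)(τ, x) = (2π)^{-1/2} ∫ e^{-iτρ} f(ρ, x) dρ`. -/
def partialFourier {d : ℕ} (f : ℝ × EuclideanSpace ℝ (Fin d) → ℂ) (τ : ℝ)
    (x : EuclideanSpace ℝ (Fin d)) : ℂ :=
  ((Real.sqrt (2 * Real.pi))⁻¹ : ℂ) * ∫ ρ : ℝ, Complex.exp (-(Complex.I * τ * ρ)) * f (ρ, x)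

/-- The integrand `e^{iτρ} m(τ, k) P_k(F_ρ f(τ, ·))(x)`. -/
def multiplierIntegrand {d : ℕ} (m : ℝ → ℕ → ℂ) (f : ℝ × EuclideanSpace ℝ (Fin d) → ℂ)
    (k : ℕ) (z : ℝ × EuclideanSpace ℝ (Fin d)) (τ : ℝ) : ℂ :=
  Complex.exp (Complex.I * τ * z.1) * m τ k * hermiteProj k (partialFourier f τ) z.2

/-- The multiplier operator
`T_m f(ρ, x) = ∑_k (2π)^{-1/2} ∫ e^{iτρ} m(τ, k) P_k(F_ρ f)(τ, x) dτ`. -/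
def multiplierOp {d : ℕ} (m : ℝ → ℕ → ℂ) (f : ℝ × EuclideanSpace ℝ (Fin d) → ℂ)
    (z : ℝ × EuclideanSpace ℝ (Fin d)) : ℂ :=
  ∑' k : ℕ, ((Real.sqrt (2 * Real.pi))⁻¹ : ℂ) * ∫ τ : ℝ, multiplierIntegrand m f k z τ

/-- The Mikhlin–Hörmander condition with constant `A`: up to the order `⌊(d+1)/2⌋ + 1`, the
derivatives of `m` in `τ` exist, and these and the forward differences in `k` satisfy
`|∂_τ^N m| ≤ A (τ²+2k+d)^{-N/2}` and `|Δ_k^N m| ≤ A (τ²+2k+d)^{-N}`. -/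
structure MikhlinHormander (d : ℕ) (A : ℝ) (m : ℝ → ℕ → ℂ) : Prop where
  differentiable : ∀ k N : ℕ, N < (d + 1) / 2 + 1 →
    Differentiable ℝ (iteratedDeriv N (fun τ : ℝ => m τ k))
  deriv_le : ∀ (N : ℕ), N ≤ (d + 1) / 2 + 1 → ∀ (τ : ℝ) (k : ℕ),
    ‖iteratedDeriv N (fun s : ℝ => m s k) τ‖ ≤ A * (τ ^ 2 + 2 * k + d : ℝ) ^ (-(N : ℝ) / 2)
  diff_le : ∀ (N : ℕ), N ≤ (d + 1) / 2 + 1 → ∀ (τ : ℝ) (k : ℕ),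
    ‖(fwdDiff 1)^[N] (fun j : ℕ => m τ j) k‖ ≤ A * (τ ^ 2 + 2 * k + d : ℝ) ^ (-(N : ℝ))

end PartialOscillator

end

open PartialOscillator

/-! The operator is of Calderón–Zygmund type. Its L² bound is Parseval for the Hermite functions in
x combined with Plancherel in ρ. For the rest one needs the Hörmander condition ∫_{|z-w₁| ≥
2|w₁-w₂|} |K(z,w₁) - K(z,w₂)| dz ≤ C for the kernel, and this is obtained by a decomposition into
dyadic frequency scales.

Write λ = τ²+2k+d and M = ⌊(d+1)/2⌋+1. The functions m·(1 - (1-e^{-tλ})^M) at t = 2^{-n} tend to m,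
and their successive differences are the dyadic pieces of m. With u = e^{-tλ}, the piece at scale s
= √t is m times (1-u²)^M - (1-u)^M = (1-u)^M u ∑_{i<M} (1+u)^i. It decays like e^{-tλ/2}, and its
factor (tλ)^M compensates the losses λ^{-N/2} and λ^{-N} at low frequency. Hence a τ-derivative of
the piece gains s and a k-difference gains s² (`exists_symbolBound_dyadicPiece`). The derivative and
the difference are treated together, as twisted derivations.

Consider a piece g at scale s, with kernel ∑_μ (∫ e^{iτ(ρ-ρ')} g(τ,|μ|) dτ) Φ_μ(x) Φ_μ(x'). By
Parseval and Plancherel, its L² norm in z = (ρ,x) is controlled by the heat kernel on the diagonal,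
of size t^{-(d+1)/2}. The Hermite part of that bound comes from an ODE for ∑ r^n h_n(x)² together
with its integral (`tsum_sq_hermiteFun_le`). Multiplication of the kernel by ρ-ρ' is a τ-derivative.
Multiplication by x_j-x'_j is a commutator: after a shift of the summation index it either removes
one creation operator or trades a k-difference for one more creation operator
(`sub_mul_raiseKernel`). A creation operator costs t^{-1/2} and a difference gains t, so every
factor x_j-x'_j gains √t = s (`exists_lintegral_weightedTwoPoint_le`). The kernel is thus
concentrated at distance s from the diagonal with weight (1+|z-w|/s)^N in L². Since 2N ≥ d+2,
Cauchy–Schwarz turns this into L¹ bounds with some decay to spare. The same computation for the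
difference of the kernels at w₁ and w₂ gains |w₁-w₂|/s, by the mean value theorem. The tail bound
serves when s < |w₁-w₂| and the difference bound when s ≥ |w₁-w₂|; both decay geometrically in the
scale, so the sum of the pieces satisfies the Hörmander condition uniformly in the truncation
(`exists_lintegral_sum_multKer_sub_le`).

The Calderón–Zygmund decomposition is carried out on a lattice, for functions constant on small
cells, where it is a finite statement (`exists_dyadic_decomposition`, `CZFamily.meas_lt_sum_le`).
None of its constants depends on the mesh. Interpolation with L² gives 1 < p < 2, and letting the
mesh tend to zero reaches all continuous functions of compact support. For p > 2 one uses duality,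
since transposing the kernel only replaces τ by -τ (`lintegral_rpow_le_of_transpose`,
`multKer_swap`).

Finally the truncation is removed. The Hermite coefficients of a test function decay rapidly because
the oscillator is symmetric; so the series converge absolutely, the truncated operators converge
pointwise, and Fatou's lemma transfers the bound. Density of test functions gives the operator on
L^p. -/

namespace PartialOscillator

/-! ### One-dimensional Hermite functions -/

theorem contDiff_gaussian : ContDiff ℝ ∞ (fun y : ℝ => Real.exp (-y ^ 2)) := by
  fun_prop

theorem hasDerivAt_iteratedDeriv_gaussian (k : ℕ) (x : ℝ) :
    HasDerivAt (iteratedDeriv k (fun y : ℝ => Real.exp (-y ^ 2)))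
      (iteratedDeriv (k + 1) (fun y : ℝ => Real.exp (-y ^ 2)) x) x := by
  rw [iteratedDeriv_succ]
  exact ((contDiff_gaussian.differentiable_iteratedDeriv k
    (by exact_mod_cast WithTop.coe_lt_top _)) x).hasDerivAt

theorem iteratedDeriv_gaussian_one (x : ℝ) :
    iteratedDeriv 1 (fun y : ℝ => Real.exp (-y ^ 2)) x = -2 * x * Real.exp (-x ^ 2) := by
  rw [iteratedDeriv_one]
  have : HasDerivAt (fun y : ℝ => Real.exp (-y ^ 2)) (Real.exp (-x ^ 2) * (-(2 * x))) x := by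
    simpa using ((hasDerivAt_pow 2 x).neg).exp
  rw [this.deriv]; ring

/-- The Gaussian satisfies y' = -2xy; differentiating this k+1 times leaves only two terms, because
the factor x is linear. -/
theorem iteratedDeriv_gaussian_add_two (k : ℕ) (x : ℝ) :
    iteratedDeriv (k + 2) (fun y : ℝ => Real.exp (-y ^ 2)) x =
      -2 * x * iteratedDeriv (k + 1) (fun y : ℝ => Real.exp (-y ^ 2)) x
        - 2 * (k + 1) * iteratedDeriv k (fun y : ℝ => Real.exp (-y ^ 2)) x := by
  induction k generalizing x with
  | zero =>
    have h1 := hasDerivAt_iteratedDeriv_gaussian 1 x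
    have h0 := hasDerivAt_iteratedDeriv_gaussian 0 x
    have e : iteratedDeriv 1 (fun y : ℝ => Real.exp (-y ^ 2)) =
        fun x => -2 * x * iteratedDeriv 0 (fun y : ℝ => Real.exp (-y ^ 2)) x := by
      funext y; rw [iteratedDeriv_gaussian_one, iteratedDeriv_zero]
    have h2 := ((hasDerivAt_id x).const_mul (-2)).fun_mul h0
    rw [e] at h1
    have := h1.unique h2
    simp only [zero_add, id] at this ⊢
    rw [this]; push_cast; ring
  | succ k ih =>
    have h1 := hasDerivAt_iteratedDeriv_gaussian (k + 2) x
    have e : iteratedDeriv (k + 2) (fun y : ℝ => Real.exp (-y ^ 2)) =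
        fun x => -2 * x * iteratedDeriv (k + 1) (fun y : ℝ => Real.exp (-y ^ 2)) x
        - 2 * (k + 1) * iteratedDeriv k (fun y : ℝ => Real.exp (-y ^ 2)) x := funext ih
    have h2 := (((hasDerivAt_id x).const_mul (-2)).fun_mul
      (hasDerivAt_iteratedDeriv_gaussian (k + 1) x)).fun_sub
        ((hasDerivAt_iteratedDeriv_gaussian k x).const_mul (2 * ((k : ℝ) + 1)))
    rw [e] at h1
    have := h1.unique h2
    simp only [id] at this ⊢
    rw [show k + 1 + 2 = k + 2 + 1 from rfl, this]; push_cast; ring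

theorem hermite_normalization_succ (k : ℕ) :
    (Real.sqrt (2 ^ k * (k.factorial : ℝ) * Real.sqrt Real.pi))⁻¹ = Real.sqrt (2 * (k + 1)) *
      (Real.sqrt (2 ^ (k + 1) * ((k + 1).factorial : ℝ) * Real.sqrt Real.pi))⁻¹ := by
  have : (2 : ℝ) ^ (k + 1) * ((k + 1).factorial : ℝ) * Real.sqrt Real.pi =
      (2 * (k + 1)) * (2 ^ k * (k.factorial : ℝ) * Real.sqrt Real.pi) := by
    rw [Nat.factorial_succ]; push_cast; ring
  rw [this, Real.sqrt_mul (by positivity) (2 ^ k * (k.factorial : ℝ) * Real.sqrt Real.pi), mul_inv,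
    ← mul_assoc, mul_inv_cancel₀, one_mul]
  positivity

/-- This says that x - d/dx is the creation operator: the factor e^{x²/2} contributes x h_n, and one
more derivative of the Gaussian contributes h_{n+1} with the ratio of the normalizations. -/
theorem hasDerivAt_hermiteFun_raise (n : ℕ) (x : ℝ) :
    HasDerivAt (hermiteFun n) (x * hermiteFun n x - Real.sqrt (2 * (n + 1)) * hermiteFun (n + 1) x)
      x := by
  have h1 := hasDerivAt_iteratedDeriv_gaussian n x
  have h2 : HasDerivAt (fun x : ℝ => Real.exp (x ^ 2 / 2)) (Real.exp (x ^ 2 / 2) * x) x := by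
    have := ((hasDerivAt_pow 2 x).div_const 2).exp
    simpa using this
  have h3 := (h1.const_mul ((Real.sqrt (2 ^ n * (n.factorial : ℝ) * Real.sqrt Real.pi))⁻¹ *
    (-1) ^ n)).mul h2
  refine h3.congr_deriv ?_
  simp only [hermiteFun]
  rw [hermite_normalization_succ n]
  ring

/-- The recurrence of the derivatives of the Gaussian, renormalized. At n = 0 the truncated index
n-1 is harmless because its coefficient √(2n) vanishes. -/
theorem two_mul_hermiteFun (n : ℕ) (x : ℝ) :
    2 * x * hermiteFun n x = Real.sqrt (2 * (n + 1)) * hermiteFun (n + 1) x +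
      Real.sqrt (2 * n) * hermiteFun (n - 1) x := by
  rcases n with _ | n
  · simp only [hermiteFun, zero_add, iteratedDeriv_gaussian_one, iteratedDeriv_zero]
    rw [hermite_normalization_succ 0]
    simp
    ring
  · simp only [hermiteFun, Nat.add_sub_cancel, iteratedDeriv_gaussian_add_two]
    rw [hermite_normalization_succ n, hermite_normalization_succ (n + 1)]
    have h : Real.sqrt (2 * (n + 1)) * Real.sqrt (2 * (n + 1)) = 2 * ((n : ℝ) + 1) :=
      Real.mul_self_sqrt (by positivity)
    push_cast
    linear_combination (-(√(2 * (n + 1 + 1)) *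
      (√(2 ^ (n + 1 + 1) * ((n + 1 + 1).factorial : ℝ) * √Real.pi))⁻¹) * (-1) ^ n *
      iteratedDeriv n (fun y : ℝ => Real.exp (-y ^ 2)) x * Real.exp (x ^ 2 / 2)) * h

theorem hasDerivAt_hermiteFun (n : ℕ) (x : ℝ) :
    HasDerivAt (hermiteFun n) ((Real.sqrt (2 * n) * hermiteFun (n - 1) x -
      Real.sqrt (2 * (n + 1)) * hermiteFun (n + 1) x) / 2) x := by
  refine (hasDerivAt_hermiteFun_raise n x).congr_deriv ?_
  have := two_mul_hermiteFun n x
  linarith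

theorem continuous_hermiteFun (n : ℕ) : Continuous (hermiteFun n) :=
  continuous_iff_continuousAt.2 fun x => (hasDerivAt_hermiteFun n x).continuousAt

theorem hermiteFun_zero_apply (x : ℝ) :
    hermiteFun 0 x = (Real.sqrt (Real.sqrt Real.pi))⁻¹ * Real.exp (-(x ^ 2 / 2)) := by
  simp only [hermiteFun, pow_zero, Nat.factorial_zero, Nat.cast_one, one_mul, mul_one,
    iteratedDeriv_zero]
  rw [mul_assoc, ← Real.exp_add]
  ring_nf

theorem exists_polynomial_hermiteFun (n : ℕ) :
    ∃ P : Polynomial ℝ, ∀ x, hermiteFun n x = P.eval x * Real.exp (-(x ^ 2 / 2)) := by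
  induction n using Nat.twoStepInduction with
  | zero => exact ⟨.C (Real.sqrt (Real.sqrt Real.pi))⁻¹, fun x => by simp [hermiteFun_zero_apply]⟩
  | one =>
    refine ⟨.C (Real.sqrt (Real.sqrt Real.pi))⁻¹ * .C (2 * (Real.sqrt 2)⁻¹) * .X, fun x => ?_⟩
    have := two_mul_hermiteFun 0 x
    have h : Real.sqrt 2 ≠ 0 := by positivity
    simp [hermiteFun_zero_apply] at this ⊢
    field_simp at this ⊢
    linarith
  | more n h1 h2 =>
    obtain ⟨P, hP⟩ := h1
    obtain ⟨Q, hQ⟩ := h2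
    have h : Real.sqrt (2 * ((n + 1 : ℕ) + 1)) ≠ 0 := by positivity
    refine ⟨.C (Real.sqrt (2 * ((n + 1 : ℕ) + 1)))⁻¹ * (.C 2 * .X * Q -
      .C (Real.sqrt (2 * (n + 1 : ℕ))) * P), fun x => ?_⟩
    have := two_mul_hermiteFun (n + 1) x
    rw [Nat.add_sub_cancel, hQ, hP] at this
    simp only [Polynomial.eval_mul, Polynomial.eval_sub, Polynomial.eval_C, Polynomial.eval_X]
    rw [mul_assoc, eq_inv_mul_iff_mul_eq₀ h]
    linarith

theorem integrable_polynomial_mul_gaussian (P : Polynomial ℝ) {b : ℝ} (hb : 0 < b) :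
    Integrable fun x : ℝ => P.eval x * Real.exp (-b * x ^ 2) := by
  induction P using Polynomial.induction_on' with
  | add p q hp hq =>
    refine (hp.add hq).congr (.of_forall fun x => ?_)
    simp [add_mul]
  | monomial n a =>
    have := (integrable_rpow_mul_exp_neg_mul_sq hb (s := n)
      (by have : (0 : ℝ) ≤ n := n.cast_nonneg
          linarith)).const_mul a
    simpa [mul_assoc, Real.rpow_natCast] using this

theorem integrable_hermiteFun_mul (n m : ℕ) :
    Integrable fun x => hermiteFun n x * hermiteFun m x := by
  obtain ⟨P, hP⟩ := exists_polynomial_hermiteFun n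
  obtain ⟨Q, hQ⟩ := exists_polynomial_hermiteFun m
  refine (integrable_polynomial_mul_gaussian (P * Q) (b := 1) (by norm_num)).congr
    (.of_forall fun x => ?_)
  simp only [hP, hQ, Polynomial.eval_mul]
  rw [mul_mul_mul_comm, ← Real.exp_add]
  ring_nf

/-- Creation and annihilation are adjoint: the derivative of h_n h_m integrates to zero, and the
terms with x in the two derivatives cancel. It drives the induction for orthonormality. -/
theorem integral_hermiteFun_raise (n m : ℕ) :
    Real.sqrt (2 * (n + 1)) * ∫ x, hermiteFun (n + 1) x * hermiteFun m x =
      Real.sqrt (2 * m) * ∫ x, hermiteFun n x * hermiteFun (m - 1) x := by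
  have h := integral_eq_zero_of_hasDerivAt_of_integrable
    (f := fun x => hermiteFun n x * hermiteFun m x)
    (f' := fun x => Real.sqrt (2 * m) * (hermiteFun n x * hermiteFun (m - 1) x) -
      Real.sqrt (2 * (n + 1)) * (hermiteFun (n + 1) x * hermiteFun m x))
    (fun x => by
      refine ((hasDerivAt_hermiteFun_raise n x).mul (hasDerivAt_hermiteFun m x)).congr_deriv ?_
      have := two_mul_hermiteFun m x
      linear_combination (1 / 2) * hermiteFun n x * this)
    (((integrable_hermiteFun_mul n (m - 1)).const_mul _).sub
      ((integrable_hermiteFun_mul (n + 1) m).const_mul _))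
    (integrable_hermiteFun_mul n m)
  rw [integral_sub ((integrable_hermiteFun_mul n (m - 1)).const_mul _)
      ((integrable_hermiteFun_mul (n + 1) m).const_mul _), integral_const_mul,
      integral_const_mul] at h
  linarith

theorem integral_hermiteFun_mul (n m : ℕ) :
    ∫ x, hermiteFun n x * hermiteFun m x = if n = m then 1 else 0 := by
  induction n generalizing m with
  | zero =>
    rcases m with _ | m
    · simp only [hermiteFun_zero_apply, if_true]
      have e : ∀ x : ℝ, (Real.sqrt (Real.sqrt Real.pi))⁻¹ * Real.exp (-(x ^ 2 / 2)) *
          ((Real.sqrt (Real.sqrt Real.pi))⁻¹ * Real.exp (-(x ^ 2 / 2))) =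
          (Real.sqrt Real.pi)⁻¹ * Real.exp (-1 * x ^ 2) := fun x => by
        rw [mul_mul_mul_comm, ← Real.exp_add, ← mul_inv, Real.mul_self_sqrt (by positivity)]
        ring_nf
      simp only [e]
      rw [integral_const_mul, integral_gaussian, div_one, inv_mul_cancel₀ (by positivity)]
    · have := integral_hermiteFun_raise m 0
      simp only [CharP.cast_eq_zero, mul_zero, Real.sqrt_zero, zero_mul, mul_eq_zero] at this
      have h : Real.sqrt (2 * ((m : ℝ) + 1)) ≠ 0 := by positivity
      simpa [mul_comm (hermiteFun 0 _)] using this.resolve_left h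
  | succ n ih =>
    have := integral_hermiteFun_raise n m
    rw [ih] at this
    have h : Real.sqrt (2 * ((n : ℝ) + 1)) ≠ 0 := by positivity
    rcases m with _ | m
    · simpa using (mul_eq_zero.1 (this.trans (by simp))).resolve_left h
    · rw [Nat.add_sub_cancel] at this
      by_cases hnm : n = m
      · subst hnm
        push_cast at this
        rw [if_pos rfl] at this
        rw [if_pos rfl]
        exact mul_left_cancel₀ h this
      · rw [if_neg hnm, mul_zero] at this
        rw [if_neg (by simpa using hnm)]
        exact (mul_eq_zero.1 this).resolve_left h

theorem sq_deriv_hermiteFun_le (n : ℕ) (x : ℝ) :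
    ((Real.sqrt (2 * n) * hermiteFun (n - 1) x -
      Real.sqrt (2 * (n + 1)) * hermiteFun (n + 1) x) / 2) ^ 2 ≤
      n * hermiteFun (n - 1) x ^ 2 + (n + 1) * hermiteFun (n + 1) x ^ 2 := by
  have h1 : Real.sqrt (2 * n) ^ 2 = 2 * n := Real.sq_sqrt (by positivity)
  have h2 : Real.sqrt (2 * (n + 1)) ^ 2 = 2 * ((n : ℝ) + 1) := Real.sq_sqrt (by positivity)
  nlinarith [sq_nonneg (Real.sqrt (2 * n) * hermiteFun (n - 1) x +
      Real.sqrt (2 * (n + 1)) * hermiteFun (n + 1) x)]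

/-- Write h_n(x)² as ∫_{-∞}^x 2 h_n h_n' and bound the integrand by h_n² + h_n'². The bound is
crude, but polynomial growth in n is all that the convergence arguments need. -/
theorem sq_hermiteFun_le (n : ℕ) (x : ℝ) : hermiteFun n x ^ 2 ≤ 2 * n + 2 := by
  set d : ℝ → ℝ := fun x => (Real.sqrt (2 * n) * hermiteFun (n - 1) x -
      Real.sqrt (2 * (n + 1)) * hermiteFun (n + 1) x) / 2 with hd
  have hder : ∀ y, HasDerivAt (fun y => hermiteFun n y ^ 2) (2 * hermiteFun n y * d y) y :=
    fun y => by simpa only [Nat.cast_ofNat, Nat.add_one_sub_one, pow_one] using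
      (hasDerivAt_hermiteFun n y).fun_pow 2
  have hsq : ∀ k, Integrable fun x => hermiteFun k x ^ 2 := fun k => by
    simpa [sq] using integrable_hermiteFun_mul k k
  have hint1 : ∀ k, ∫ x, hermiteFun k x ^ 2 = 1 := fun k => by
    simpa [sq] using integral_hermiteFun_mul k k
  have hd' : Integrable fun y => 2 * hermiteFun n y * d y := by
    have := ((integrable_hermiteFun_mul n (n - 1)).const_mul (Real.sqrt (2 * n))).sub
      ((integrable_hermiteFun_mul n (n + 1)).const_mul (Real.sqrt (2 * (n + 1))))
    refine this.congr (.of_forall fun y => ?_)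
    simp only [hd, Pi.sub_apply]; ring
  have hlim := tendsto_zero_of_hasDerivAt_of_integrableOn_Iic (a := x) (fun y _ => hder y)
    hd'.integrableOn (hsq n).integrableOn
  have h := integral_Iic_of_hasDerivAt_of_tendsto (hder x).continuousAt.continuousWithinAt
    (fun y _ => hder y) hd'.integrableOn hlim
  rw [sub_zero] at h
  rw [← h]
  set B : ℝ → ℝ := fun y => hermiteFun n y ^ 2 + (n * hermiteFun (n - 1) y ^ 2 +
    (n + 1) * hermiteFun (n + 1) y ^ 2) with hB
  have hBi : Integrable B :=
    (hsq n).add (((hsq (n - 1)).const_mul _).add ((hsq (n + 1)).const_mul _))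
  have hle : ∀ y, 2 * hermiteFun n y * d y ≤ B y := fun y => by
    have := sq_deriv_hermiteFun_le n y
    have h0 := sq_nonneg (hermiteFun n y - d y)
    simp only [hB]
    change d y ^ 2 ≤ _ at this
    linarith
  calc ∫ y in Set.Iic x, 2 * hermiteFun n y * d y ≤ ∫ y in Set.Iic x, B y :=
        integral_mono hd'.integrableOn hBi.integrableOn hle
    _ ≤ ∫ y, B y := setIntegral_le_integral hBi (.of_forall fun y => by positivity)
    _ = 2 * n + 2 := by
      have h1 := (hsq (n - 1)).const_mul (n : ℝ)
      have h2 := (hsq (n + 1)).const_mul ((n : ℝ) + 1)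
      have h3 : Integrable fun x => n * hermiteFun (n - 1) x ^ 2 +
        (n + 1) * hermiteFun (n + 1) x ^ 2 := h1.add h2
      simp only [hB]
      rw [integral_add (hsq n) h3, integral_add h1 h2, integral_const_mul,
        integral_const_mul, hint1, hint1, hint1]
      ring

end PartialOscillator

/-! ### Heat kernel bounds for Hermite functions in one and several variables -/

namespace PartialOscillator

/-! ### The Mehler kernel on the diagonal -/

theorem summable_geometric_mul_sq {r : ℝ} (hr0 : 0 ≤ r) (hr1 : r < 1) :
    Summable fun n : ℕ => r ^ n * (10 * ((n : ℝ) + 1) ^ 2) := by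
  have hr : ‖r‖ < 1 := by rwa [Real.norm_of_nonneg hr0]
  have h0 := summable_pow_mul_geometric_of_norm_lt_one 0 hr
  have h1 := summable_pow_mul_geometric_of_norm_lt_one 1 hr
  have h2 := summable_pow_mul_geometric_of_norm_lt_one 2 hr
  refine (((h2.add (h1.mul_left 2)).add h0).mul_left 10).congr fun n => ?_
  ring

theorem abs_two_mul_hermiteFun_mul_deriv_le (n : ℕ) (x : ℝ) :
    |2 * hermiteFun n x * ((Real.sqrt (2 * n) * hermiteFun (n - 1) x -
      Real.sqrt (2 * (n + 1)) * hermiteFun (n + 1) x) / 2)| ≤ 10 * ((n : ℝ) + 1) ^ 2 := by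
  have h1 := sq_deriv_hermiteFun_le n x
  set d := (Real.sqrt (2 * n) * hermiteFun (n - 1) x -
      Real.sqrt (2 * (n + 1)) * hermiteFun (n + 1) x) / 2
  have h2 : |2 * hermiteFun n x * d| ≤ hermiteFun n x ^ 2 + d ^ 2 := by
    rw [abs_le]
    constructor <;> nlinarith [sq_nonneg (hermiteFun n x - d), sq_nonneg (hermiteFun n x + d)]
  have h3 := sq_hermiteFun_le n x
  have h4 := sq_hermiteFun_le (n - 1) x
  have h5 := sq_hermiteFun_le (n + 1) x
  have h6 : ((n - 1 : ℕ) : ℝ) ≤ n := by exact_mod_cast Nat.sub_le n 1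
  have h7 : (0 : ℝ) ≤ n := n.cast_nonneg
  push_cast at h5
  have h8 : n * hermiteFun (n - 1) x ^ 2 ≤ n * (2 * n + 2) :=
    mul_le_mul_of_nonneg_left (by linarith) h7
  have h9 : ((n : ℝ) + 1) * hermiteFun (n + 1) x ^ 2 ≤ (n + 1) * (2 * (n + 1) + 2) :=
    mul_le_mul_of_nonneg_left h5 (by linarith)
  nlinarith

theorem sq_hermiteFun_le' (n : ℕ) (x : ℝ) : hermiteFun n x ^ 2 ≤ 10 * ((n : ℝ) + 1) ^ 2 := by
  have h3 := sq_hermiteFun_le n x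
  have h7 : (0 : ℝ) ≤ n := n.cast_nonneg
  nlinarith

theorem summable_pow_mul_sq_hermiteFun {r : ℝ} (hr0 : 0 ≤ r) (hr1 : r < 1) (x : ℝ) :
    Summable fun n : ℕ => r ^ n * hermiteFun n x ^ 2 :=
  Summable.of_nonneg_of_le (fun n => by positivity)
    (fun n => mul_le_mul_of_nonneg_left (sq_hermiteFun_le' n x) (by positivity))
    (summable_geometric_mul_sq hr0 hr1)

/-- Let G be the sum. The recurrence expresses xG - G'/2 and xG + G'/2 through the sums of h_n
h_{n+1} and h_n h_{n-1}. These two sums agree up to a factor r after an index shift, which is a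
linear ODE for G. -/
theorem hasDerivAt_tsum_sq_hermiteFun {r : ℝ} (hr0 : 0 ≤ r) (hr1 : r < 1) (x : ℝ) :
    HasDerivAt (fun x => ∑' n : ℕ, r ^ n * hermiteFun n x ^ 2)
      (-(2 * x * ((1 - r) / (1 + r)) * ∑' n : ℕ, r ^ n * hermiteFun n x ^ 2)) x := by
  set d : ℕ → ℝ → ℝ := fun n x => (Real.sqrt (2 * n) * hermiteFun (n - 1) x -
      Real.sqrt (2 * (n + 1)) * hermiteFun (n + 1) x) / 2 with hd
  have hder : ∀ n y, HasDerivAt (fun x => r ^ n * hermiteFun n x ^ 2)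
      (r ^ n * (2 * hermiteFun n y * d n y)) y := fun n y => by
    simpa only [Nat.cast_ofNat, Nat.add_one_sub_one, pow_one] using
      ((hasDerivAt_hermiteFun n y).fun_pow 2).const_mul (r ^ n)
  have hb : ∀ n y, ‖r ^ n * (2 * hermiteFun n y * d n y)‖ ≤ r ^ n * (10 * ((n : ℝ) + 1) ^ 2) :=
    fun n y => by
      rw [norm_mul, Real.norm_of_nonneg (pow_nonneg hr0 n)]
      exact mul_le_mul_of_nonneg_left (abs_two_mul_hermiteFun_mul_deriv_le n y) (by positivity)
  have hsum := summable_geometric_mul_sq hr0 hr1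
  have hG := summable_pow_mul_sq_hermiteFun hr0 hr1 x
  refine (hasDerivAt_tsum hsum hder hb hG x).congr_deriv ?_
  have hD : Summable fun n : ℕ => r ^ n * (2 * hermiteFun n x * d n x) :=
    Summable.of_norm_bounded hsum fun n => hb n x
  set a : ℕ → ℝ := fun n => Real.sqrt (2 * (n + 1)) * (hermiteFun n x * hermiteFun (n + 1) x)
    with ha
  set b : ℕ → ℝ := fun n => Real.sqrt (2 * n) * (hermiteFun n x * hermiteFun (n - 1) x) with hb'
  have e1 : ∀ n : ℕ, r ^ n * a n = x * (r ^ n * hermiteFun n x ^ 2) -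
      (1 / 2) * (r ^ n * (2 * hermiteFun n x * d n x)) := fun n => by
    have := two_mul_hermiteFun n x
    simp only [ha, hd]
    linear_combination (-(1 / 2) * r ^ n * hermiteFun n x) * this
  have e2 : ∀ n : ℕ, r ^ n * b n = x * (r ^ n * hermiteFun n x ^ 2) +
      (1 / 2) * (r ^ n * (2 * hermiteFun n x * d n x)) := fun n => by
    have := two_mul_hermiteFun n x
    simp only [hb', hd]
    linear_combination (-(1 / 2) * r ^ n * hermiteFun n x) * this
  have s1 := ((hG.hasSum.mul_left x).sub (hD.hasSum.mul_left (1 / 2)))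
  have s2 := ((hG.hasSum.mul_left x).add (hD.hasSum.mul_left (1 / 2)))
  simp only [← e1] at s1
  simp only [← e2] at s2
  -- The shift works because b 0 = 0 and b (n + 1) = a n.
  have e3 : ∑' n, r ^ n * b n = r * ∑' n, r ^ n * a n := by
    rw [s2.summable.tsum_eq_zero_add, ← tsum_mul_left]
    simp only [hb', ha, pow_zero, CharP.cast_eq_zero, mul_zero, Real.sqrt_zero, zero_mul, zero_add,
      Nat.add_sub_cancel]
    refine tsum_congr fun n => ?_
    push_cast
    ring
  rw [s1.tsum_eq, s2.tsum_eq] at e3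
  have : 1 + r ≠ 0 := by positivity
  generalize ∑' n : ℕ, r ^ n * (2 * hermiteFun n x * d n x) = S1 at e3 ⊢
  generalize ∑' n : ℕ, r ^ n * hermiteFun n x ^ 2 = S2 at e3 ⊢
  field_simp
  linarith

theorem tsum_sq_hermiteFun_eq {r : ℝ} (hr0 : 0 ≤ r) (hr1 : r < 1) (x : ℝ) :
    ∑' n : ℕ, r ^ n * hermiteFun n x ^ 2 = (∑' n : ℕ, r ^ n * hermiteFun n 0 ^ 2) *
      Real.exp (-((1 - r) / (1 + r)) * x ^ 2) := by
  set c := (1 - r) / (1 + r) with hc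
  set G : ℝ → ℝ := fun x => ∑' n : ℕ, r ^ n * hermiteFun n x ^ 2 with hG
  have hder : ∀ y, HasDerivAt (fun y => G y * Real.exp (c * y ^ 2)) 0 y := fun y => by
    have h1 : HasDerivAt (fun y : ℝ => Real.exp (c * y ^ 2))
        (Real.exp (c * y ^ 2) * (c * (2 * y))) y := by
      simpa using ((hasDerivAt_pow 2 y).const_mul c).exp
    refine ((hasDerivAt_tsum_sq_hermiteFun hr0 hr1 y).fun_mul h1).congr_deriv ?_
    ring
  have := is_const_of_deriv_eq_zero (fun y => (hder y).differentiableAt)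
    (fun y => (hder y).deriv) x 0
  simp only [ne_eq, OfNat.ofNat_ne_zero, not_false_eq_true, zero_pow, mul_zero, Real.exp_zero,
    mul_one] at this
  change G x = G 0 * _
  rw [← this, mul_assoc, ← Real.exp_add]
  simp

theorem integral_tsum_sq_hermiteFun {r : ℝ} (hr0 : 0 ≤ r) (hr1 : r < 1) :
    ∫ x, ∑' n : ℕ, r ^ n * hermiteFun n x ^ 2 = (1 - r)⁻¹ := by
  have hint : ∀ n : ℕ, Integrable fun x => r ^ n * hermiteFun n x ^ 2 := fun n => by
    simpa [sq] using (integrable_hermiteFun_mul n n).const_mul (r ^ n)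
  have hval : ∀ n : ℕ, ∫ x, r ^ n * hermiteFun n x ^ 2 = r ^ n := fun n => by
    rw [integral_const_mul]
    simp only [sq, integral_hermiteFun_mul, if_true, mul_one]
  have hval' : ∀ n : ℕ, ∫ x, ‖r ^ n * hermiteFun n x ^ 2‖ = r ^ n := fun n => by
    refine Eq.trans ?_ (hval n)
    exact integral_congr_ae (.of_forall fun x => Real.norm_of_nonneg (by positivity))
  have := hasSum_integral_of_summable_integral_norm hint (by
    simp only [hval']; exact summable_geometric_of_lt_one hr0 hr1)
  rw [← this.tsum_eq]
  simp only [hval]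
  exact tsum_geometric_of_lt_one hr0 hr1

/-- Mehler's formula is not needed: the ODE makes the sum a Gaussian G(0) e^{-cx²} with c =
(1-r)/(1+r), and orthonormality gives its integral (1-r)^{-1}. Comparing the two determines G(0),
which is also the maximum. -/
theorem tsum_sq_hermiteFun_le {r : ℝ} (hr0 : 0 ≤ r) (hr1 : r < 1) (x : ℝ) :
    ∑' n : ℕ, r ^ n * hermiteFun n x ^ 2 ≤ (Real.sqrt (1 - r))⁻¹ := by
  have h1 := integral_tsum_sq_hermiteFun hr0 hr1
  rw [integral_congr_ae (.of_forall fun y => tsum_sq_hermiteFun_eq hr0 hr1 y),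
    integral_const_mul, integral_gaussian] at h1
  have hr : 0 < 1 - r := by linarith
  set c := (1 - r) / (1 + r) with hc
  have hc0 : 0 < c := by positivity
  set S := ∑' n : ℕ, r ^ n * hermiteFun n 0 ^ 2 with hS
  have hS0 : 0 ≤ S := tsum_nonneg fun n => by positivity
  rw [tsum_sq_hermiteFun_eq hr0 hr1]
  have h2 : S * Real.exp (-c * x ^ 2) ≤ S :=
    mul_le_of_le_one_right hS0 (Real.exp_le_one_iff.2 (by nlinarith [sq_nonneg x]))
  refine h2.trans ?_
  -- Here π/c = π(1+r)/(1-r) exceeds 1/(1-r), so dividing the total mass by √(π/c) leaves at most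
  -- (1-r)^{-1/2}.
  have h3 : Real.sqrt (1 - r)⁻¹ ≤ Real.sqrt (Real.pi / c) := by
    apply Real.sqrt_le_sqrt
    rw [inv_eq_one_div, div_le_div_iff₀ hr hc0, hc]
    have := Real.pi_gt_three
    have h4 : (1 - r) / (1 + r) ≤ 1 - r := div_le_self hr.le (by linarith)
    nlinarith
  rw [Real.sqrt_inv] at h3
  have h5 : S * (Real.sqrt (1 - r))⁻¹ ≤ (1 - r)⁻¹ :=
    (mul_le_mul_of_nonneg_left h3 hS0).trans h1.le
  have h6 : (1 - r)⁻¹ = (Real.sqrt (1 - r))⁻¹ * (Real.sqrt (1 - r))⁻¹ := by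
    rw [← mul_inv, Real.mul_self_sqrt hr.le]
  rw [h6] at h5
  exact le_of_mul_le_mul_right h5 (by positivity)

theorem half_le_one_sub_exp_neg {t : ℝ} (h0 : 0 ≤ t) (h1 : t ≤ 1) : t / 2 ≤ 1 - Real.exp (-t) := by
  have h2 : Real.exp (-t) ≤ (1 + t)⁻¹ := by
    rw [Real.exp_neg]
    exact inv_anti₀ (by linarith) (by linarith [Real.add_one_le_exp t])
  have h3 : (1 + t)⁻¹ ≤ 1 - t / 2 := by
    rw [inv_le_iff_one_le_mul₀ (by linarith)]
    nlinarith
  linarith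

/-- On the diagonal, the heat kernel of the one-dimensional Hermite operator is `O(t^{-1/2})`. -/
theorem tsum_exp_mul_sq_hermiteFun_le {t : ℝ} (h0 : 0 < t) (h1 : t ≤ 1) (x : ℝ) :
    ∑' n : ℕ, ENNReal.ofReal (Real.exp (-(t * n)) * hermiteFun n x ^ 2) ≤
      ENNReal.ofReal (2 * t ^ (-(1 / 2) : ℝ)) := by
  have hr1 : Real.exp (-t) < 1 := Real.exp_lt_one_iff.2 (by linarith)
  have e : ∀ n : ℕ, Real.exp (-(t * n)) = Real.exp (-t) ^ n := fun n => by
    rw [← Real.exp_nat_mul]; ring_nf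
  simp only [e]
  rw [← ENNReal.ofReal_tsum_of_nonneg (fun n => by positivity)
    (summable_pow_mul_sq_hermiteFun (Real.exp_pos _).le hr1 x)]
  refine ENNReal.ofReal_le_ofReal ((tsum_sq_hermiteFun_le (Real.exp_pos _).le hr1 x).trans ?_)
  rw [Real.rpow_neg h0.le, ← Real.sqrt_eq_rpow]
  have h2 : Real.sqrt (t / 4) ≤ Real.sqrt (1 - Real.exp (-t)) :=
    Real.sqrt_le_sqrt (by linarith [half_le_one_sub_exp_neg h0.le h1])
  have h3 : Real.sqrt (t / 4) = Real.sqrt t / 2 := by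
    rw [Real.sqrt_div h0.le, show (4 : ℝ) = 2 ^ 2 by norm_num, Real.sqrt_sq (by norm_num)]
  have h4 : 0 < Real.sqrt t := Real.sqrt_pos.2 h0
  rw [h3] at h2
  calc (Real.sqrt (1 - Real.exp (-t)))⁻¹ ≤ (Real.sqrt t / 2)⁻¹ := inv_anti₀ (by positivity) h2
    _ = 2 * (Real.sqrt t)⁻¹ := by rw [inv_div]; rfl

theorem mul_exp_neg_le {t : ℝ} (h0 : 0 < t) (a : ℝ) :
    a * Real.exp (-(t * a)) ≤ (2 / t) * Real.exp (-(t / 2 * a)) := by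
  have h : (t / 2 * a) ≤ Real.exp (t / 2 * a) := by linarith [Real.add_one_le_exp (t / 2 * a)]
  have e : Real.exp (-(t * a)) = Real.exp (-(t / 2 * a)) * Real.exp (-(t / 2 * a)) := by
    rw [← Real.exp_add]; ring_nf
  have e2 : Real.exp (t / 2 * a) * Real.exp (-(t / 2 * a)) = 1 := by
    rw [← Real.exp_add]; simp
  have hp := Real.exp_pos (-(t / 2 * a))
  have h5 : (t / 2 * a) * Real.exp (-(t / 2 * a)) ≤ 1 := by
    rw [← e2]; exact mul_le_mul_of_nonneg_right h hp.le
  rw [e, ← mul_assoc]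
  refine mul_le_mul_of_nonneg_right ?_ hp.le
  rw [le_div_iff₀ h0]
  linarith

/-- The derivative of `h_n`. -/
noncomputable def hermiteDeriv (n : ℕ) (x : ℝ) : ℝ :=
  (Real.sqrt (2 * n) * hermiteFun (n - 1) x - Real.sqrt (2 * (n + 1)) * hermiteFun (n + 1) x) / 2

/-- The square of h_n' is at most n h_{n-1}² + (n+1) h_{n+1}². The extra factor n is absorbed by
half of the exponential at the price 2/t, which reduces the sum to the previous one at time t/2. -/
theorem tsum_exp_mul_sq_hermiteDeriv_le {t : ℝ} (h0 : 0 < t) (h1 : t ≤ 1) (x : ℝ) :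
    ∑' n : ℕ, ENNReal.ofReal (Real.exp (-(t * n)) * hermiteDeriv n x ^ 2) ≤
      ENNReal.ofReal (40 * t ^ (-(1 / 2) : ℝ) * t⁻¹) := by
  have hh := tsum_exp_mul_sq_hermiteFun_le (t := t / 2) (by linarith) (by linarith) x
  have hA : ∀ n : ℕ, ENNReal.ofReal (Real.exp (-(t * n)) * hermiteDeriv n x ^ 2) ≤
      ENNReal.ofReal (n * Real.exp (-(t * n)) * hermiteFun (n - 1) x ^ 2) +
      ENNReal.ofReal (3 * ((((n + 1 : ℕ) : ℝ) * Real.exp (-(t * ((n + 1 : ℕ) : ℝ)))) *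
        hermiteFun (n + 1) x ^ 2)) := fun n => by
    rw [← ENNReal.ofReal_add (by positivity) (by positivity)]
    apply ENNReal.ofReal_le_ofReal
    have h2 := mul_le_mul_of_nonneg_left (sq_deriv_hermiteFun_le n x) (Real.exp_pos (-(t * n))).le
    refine h2.trans ?_
    -- The index shift costs e^t ≤ e < 3.
    have e : Real.exp (-(t * n)) ≤ 3 * Real.exp (-(t * ((n + 1 : ℕ) : ℝ))) := by
      have : Real.exp (-(t * n)) = Real.exp t * Real.exp (-(t * ((n + 1 : ℕ) : ℝ))) := by
        rw [← Real.exp_add]; push_cast; ring_nf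
      rw [this]
      refine mul_le_mul_of_nonneg_right ?_ (Real.exp_pos _).le
      exact (Real.exp_le_exp.2 h1).trans (by linarith [Real.exp_one_lt_d9])
    have e2 := mul_le_mul_of_nonneg_right e
      (by positivity : 0 ≤ ((n : ℝ) + 1) * hermiteFun (n + 1) x ^ 2)
    push_cast at e2 ⊢
    linarith
  have hB : ∀ n : ℕ, ENNReal.ofReal (n * Real.exp (-(t * n)) * hermiteFun n x ^ 2) ≤
      ENNReal.ofReal (2 / t) * ENNReal.ofReal (Real.exp (-(t / 2 * n)) * hermiteFun n x ^ 2) :=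
    fun n => by
      rw [← ENNReal.ofReal_mul (by positivity), ← mul_assoc]
      exact ENNReal.ofReal_le_ofReal
        (mul_le_mul_of_nonneg_right (mul_exp_neg_le h0 n) (sq_nonneg _))
  have hB' : ∀ n : ℕ,
      ENNReal.ofReal (((n + 1 : ℕ) : ℝ) * Real.exp (-(t * (n + 1 : ℕ))) * hermiteFun n x ^ 2) ≤
      ENNReal.ofReal (2 / t) * ENNReal.ofReal (Real.exp (-(t / 2 * n)) * hermiteFun n x ^ 2) :=
    fun n => by
      rw [← ENNReal.ofReal_mul (by positivity), ← mul_assoc]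
      refine ENNReal.ofReal_le_ofReal (mul_le_mul_of_nonneg_right ?_ (sq_nonneg _))
      refine (mul_exp_neg_le h0 _).trans (mul_le_mul_of_nonneg_left (Real.exp_le_exp.2 ?_)
        (by positivity))
      push_cast
      nlinarith
  have hC : (t / 2) ^ (-(1 / 2) : ℝ) ≤ 2 * t ^ (-(1 / 2) : ℝ) := by
    rw [Real.div_rpow h0.le (by norm_num), div_eq_mul_inv, mul_comm, ← Real.rpow_neg (by norm_num)]
    refine mul_le_mul_of_nonneg_right ?_ (by positivity)
    calc (2 : ℝ) ^ (-(-(1 / 2)) : ℝ) ≤ 2 ^ (1 : ℝ) :=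
          Real.rpow_le_rpow_of_exponent_le (by norm_num) (by norm_num)
      _ = 2 := by simp
  calc ∑' n : ℕ, ENNReal.ofReal (Real.exp (-(t * n)) * hermiteDeriv n x ^ 2)
      ≤ ∑' n : ℕ, ENNReal.ofReal (n * Real.exp (-(t * n)) * hermiteFun (n - 1) x ^ 2) +
        ∑' n : ℕ, ENNReal.ofReal (3 * ((((n + 1 : ℕ) : ℝ) * Real.exp (-(t * ((n + 1 : ℕ) : ℝ)))) *
        hermiteFun (n + 1) x ^ 2)) := by
          rw [← ENNReal.tsum_add]; exact ENNReal.tsum_le_tsum hA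
    _ ≤ ENNReal.ofReal (2 / t) * ENNReal.ofReal (2 * (t / 2) ^ (-(1 / 2) : ℝ)) +
        ENNReal.ofReal 3 * (ENNReal.ofReal (2 / t) *
          ENNReal.ofReal (2 * (t / 2) ^ (-(1 / 2) : ℝ))) := by
        refine add_le_add ?_ ?_
        · rw [tsum_eq_zero_add' ENNReal.summable]
          simp only [CharP.cast_eq_zero, zero_mul, ENNReal.ofReal_zero, zero_add,
            Nat.add_sub_cancel]
          refine (ENNReal.tsum_le_tsum hB').trans ?_
          rw [ENNReal.tsum_mul_left]
          gcongr
        · simp only [ENNReal.ofReal_mul (show (0 : ℝ) ≤ 3 by norm_num)]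
          rw [ENNReal.tsum_mul_left]
          gcongr
          refine le_trans ?_ (mul_le_mul_right hh _)
          rw [← ENNReal.tsum_mul_left]
          refine le_trans ?_ (ENNReal.tsum_le_tsum hB)
          exact ENNReal.tsum_comp_le_tsum_of_injective (Nat.succ_injective)
            (fun n : ℕ => ENNReal.ofReal (n * Real.exp (-(t * n)) * hermiteFun n x ^ 2))
    _ ≤ ENNReal.ofReal (40 * t ^ (-(1 / 2) : ℝ) * t⁻¹) := by
        rw [← ENNReal.ofReal_mul (by positivity), ← ENNReal.ofReal_mul (by positivity),
          ← ENNReal.ofReal_add (by positivity) (by positivity)]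
        apply ENNReal.ofReal_le_ofReal
        have : 0 < t⁻¹ := by positivity
        rw [div_eq_mul_inv]
        nlinarith [mul_le_mul_of_nonneg_right hC this.le,
          (by positivity : 0 < t ^ (-(1 / 2) : ℝ) * t⁻¹)]

end PartialOscillator

namespace PartialOscillator

/-! ### Sums over multi-indices -/

theorem ENNReal_tsum_pi_prod {d : ℕ} (F : Fin d → ℕ → ℝ≥0∞) :
    ∑' μ : Fin d → ℕ, ∏ j, F j (μ j) = ∏ j, ∑' n, F j n := by
  induction d with
  | zero => simp [tsum_fintype]
  | succ d ih =>
    rw [← (Fin.consEquiv fun _ => ℕ).tsum_eq, ENNReal.tsum_prod', Fin.prod_univ_succ, ← ih,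
      ← ENNReal.tsum_mul_right]
    refine tsum_congr fun n => ?_
    rw [← ENNReal.tsum_mul_left]
    refine tsum_congr fun μ => ?_
    rw [Fin.prod_univ_succ]
    simp [Fin.consEquiv]

theorem tsum_ofReal_pi_prod {d : ℕ} (F : Fin d → ℕ → ℝ) (hF : ∀ j n, 0 ≤ F j n) :
    ∑' μ : Fin d → ℕ, ENNReal.ofReal (∏ j, F j (μ j)) =
      ∏ j, ∑' n, ENNReal.ofReal (F j n) := by
  rw [← ENNReal_tsum_pi_prod fun j n => ENNReal.ofReal (F j n)]
  exact tsum_congr fun μ => ENNReal.ofReal_prod_of_nonneg fun j _ => hF j (μ j)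

theorem prod_exp_neg_mul {d : ℕ} (t : ℝ) (μ : Fin d → ℕ) :
    ∏ j, Real.exp (-(t * μ j)) = Real.exp (-(t * (∑ j, μ j : ℕ))) := by
  rw [← Real.exp_sum, Finset.sum_neg_distrib, ← Finset.mul_sum]
  push_cast
  rfl

/-! ### Hermite functions in several variables -/

variable {d : ℕ}

theorem continuous_hermitePhi (μ : Fin d → ℕ) : Continuous (hermitePhi μ) := by
  unfold hermitePhi
  exact continuous_finsetProd _ fun j _ => (continuous_hermiteFun _).comp (by fun_prop)

theorem integral_euclidean_prod (f : Fin d → ℝ → ℝ) :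
    ∫ x : EuclideanSpace ℝ (Fin d), ∏ j, f j (x j) = ∏ j, ∫ x, f j x := by
  rw [← integral_fintype_prod_volume_eq_prod]
  exact (PiLp.volume_preserving_ofLp (Fin d)).integral_comp
    (MeasurableEquiv.toLp 2 (Fin d → ℝ)).symm.measurableEmbedding (fun x => ∏ j, f j (x j))

theorem integrable_euclidean_prod {f : Fin d → ℝ → ℝ} (hf : ∀ j, Integrable (f j)) :
    Integrable fun x : EuclideanSpace ℝ (Fin d) => ∏ j, f j (x j) :=
  ((PiLp.volume_preserving_ofLp (Fin d)).integrable_comp_emb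
    (MeasurableEquiv.toLp 2 (Fin d → ℝ)).symm.measurableEmbedding
    (g := fun x => ∏ j, f j (x j))).2 (Integrable.fintype_prod hf)

theorem integral_hermitePhi_mul (μ ν : Fin d → ℕ) :
    ∫ x, hermitePhi μ x * hermitePhi ν x = if μ = ν then 1 else 0 := by
  simp only [hermitePhi, ← Finset.prod_mul_distrib]
  rw [integral_euclidean_prod fun j x => hermiteFun (μ j) x * hermiteFun (ν j) x]
  simp only [integral_hermiteFun_mul]
  split_ifs with h
  · simp [h]
  · obtain ⟨j, hj⟩ := Function.ne_iff.1 h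
    exact Finset.prod_eq_zero (Finset.mem_univ j) (by simp [hj])

theorem integrable_hermitePhi_mul (μ ν : Fin d → ℕ) :
    Integrable fun x => hermitePhi μ x * hermitePhi ν x := by
  simp only [hermitePhi, ← Finset.prod_mul_distrib]
  exact integrable_euclidean_prod fun j => integrable_hermiteFun_mul (μ j) (ν j)

theorem memLp_hermitePhi (μ : Fin d → ℕ) : MemLp (fun x => (hermitePhi μ x : ℂ)) 2 volume := by
  have : MemLp (hermitePhi μ) 2 volume := by
    rw [memLp_two_iff_integrable_sq (continuous_hermitePhi μ).aestronglyMeasurable]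
    simpa only [sq] using integrable_hermitePhi_mul μ μ
  exact this.ofReal

theorem orthonormal_hermitePhi :
    Orthonormal ℂ fun μ : Fin d → ℕ => (memLp_hermitePhi μ).toLp _ := by
  classical
  rw [orthonormal_iff_ite]
  intro μ ν
  rw [L2.inner_def]
  have : (if μ = ν then (1 : ℂ) else 0) = ((if μ = ν then (1 : ℝ) else 0 : ℝ) : ℂ) := by
    split_ifs <;> simp
  rw [this, ← integral_hermitePhi_mul, ← integral_complex_ofReal]
  refine integral_congr_ae ?_
  filter_upwards [(memLp_hermitePhi μ).coeFn_toLp, (memLp_hermitePhi ν).coeFn_toLp] with x h1 h2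
  rw [h1, h2]
  simp [mul_comm]

theorem enorm_toLp_sq {α : Type*} [MeasurableSpace α] {m : Measure α} {f : α → ℂ}
    (hf : MemLp f 2 m) : ‖hf.toLp f‖ₑ ^ 2 = ∫⁻ x, ‖f x‖ₑ ^ 2 ∂m := by
  have := eLpNorm_nnreal_pow_eq_lintegral (f := f) (μ := m) (p := 2) (by norm_num)
  rw [Lp.enorm_toLp]
  simpa using this

/-- Bessel's inequality for the Hermite functions. -/
theorem tsum_enorm_integral_hermitePhi_mul_sq_le {g : EuclideanSpace ℝ (Fin d) → ℂ}
    (hg : AEStronglyMeasurable g) :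
    ∑' μ : Fin d → ℕ, ‖∫ x, (hermitePhi μ x : ℂ) * g x‖ₑ ^ 2 ≤ ∫⁻ x, ‖g x‖ₑ ^ 2 := by
  by_cases hfin : ∫⁻ x, ‖g x‖ₑ ^ 2 = ⊤
  · simp [hfin]
  have hg2 : MemLp g 2 volume := by
    refine ⟨hg, ?_⟩
    have := eLpNorm_nnreal_pow_eq_lintegral (f := g) (μ := volume) (p := 2) (by norm_num)
    by_contra h
    rw [not_lt, top_le_iff] at h
    rw [ENNReal.coe_ofNat, h] at this
    simp at this
    exact hfin this.symm
  rw [← enorm_toLp_sq hg2, ENNReal.tsum_eq_iSup_sum]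
  refine iSup_le fun s => ?_
  have h := orthonormal_hermitePhi.sum_inner_products_le (s := s) (hg2.toLp g)
  have h' : ∀ μ : Fin d → ℕ, inner ℂ ((memLp_hermitePhi μ).toLp _) (hg2.toLp g) =
      ∫ x, (hermitePhi μ x : ℂ) * g x := fun μ => by
    rw [L2.inner_def]
    refine integral_congr_ae ?_
    filter_upwards [(memLp_hermitePhi μ).coeFn_toLp, hg2.coeFn_toLp] with x h1 h2
    rw [h1, h2]
    simp [mul_comm]
  simp only [h'] at h
  have := ENNReal.ofReal_le_ofReal h
  rw [ENNReal.ofReal_sum_of_nonneg fun _ _ => by positivity] at this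
  simpa only [ENNReal.ofReal_pow (norm_nonneg _), ofReal_norm] using this

theorem lintegral_enorm_sum_hermitePhi_sq (s : Finset (Fin d → ℕ)) (a : (Fin d → ℕ) → ℂ) :
    ∫⁻ x, ‖∑ μ ∈ s, a μ * hermitePhi μ x‖ₑ ^ 2 = ∑ μ ∈ s, ‖a μ‖ₑ ^ 2 := by
  have hm : ∀ μ ∈ s, MemLp (fun x => a μ * (hermitePhi μ x : ℂ)) 2 volume :=
    fun μ _ => (memLp_hermitePhi μ).const_mul (a μ)
  have hsum := memLp_finsetSum' s hm
  have e : hsum.toLp _ = ∑ μ ∈ s, a μ • (memLp_hermitePhi μ).toLp _ := by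
    rw [Lp.ext_iff]
    refine hsum.coeFn_toLp.trans ?_
    refine .trans ?_ (Lp.coeFn_finsetSum _ _).symm
    have h1 : ∀ᵐ x : EuclideanSpace ℝ (Fin d), ∀ μ ∈ s,
        (a μ • (memLp_hermitePhi μ).toLp _ : Lp ℂ 2 volume) x = a μ * (hermitePhi μ x : ℂ) := by
      refine (ae_ball_iff (S := (s : Set (Fin d → ℕ))) s.countable_toSet).2 fun μ _ => ?_
      filter_upwards [Lp.coeFn_smul (a μ) ((memLp_hermitePhi μ).toLp _),
        (memLp_hermitePhi μ).coeFn_toLp] with x h1 h2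
      rw [h1, Pi.smul_apply, h2, smul_eq_mul]
    filter_upwards [h1] with x hx
    simp only [Finset.sum_apply]
    exact Finset.sum_congr rfl fun μ hμ => (hx μ hμ).symm
  have h2 := enorm_toLp_sq hsum
  simp only [Finset.sum_apply] at h2
  rw [← h2, e]
  have h3 := orthonormal_hermitePhi.inner_sum a a s
  rw [inner_self_eq_norm_sq_to_K] at h3
  have h4 : ‖∑ μ ∈ s, a μ • (memLp_hermitePhi μ).toLp _‖ ^ 2 = ∑ μ ∈ s, ‖a μ‖ ^ 2 := by
    have : ∀ μ, (starRingEnd ℂ) (a μ) * a μ = ((‖a μ‖ ^ 2 : ℝ) : ℂ) := fun μ => by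
      rw [mul_comm, Complex.mul_conj, Complex.normSq_eq_norm_sq]
    simp only [this] at h3
    refine Complex.ofReal_injective ?_
    push_cast
    push_cast at h3
    exact h3
  have h5 := congrArg ENNReal.ofReal h4
  rw [ENNReal.ofReal_sum_of_nonneg fun _ _ => by positivity] at h5
  simpa only [ENNReal.ofReal_pow (norm_nonneg _), ofReal_norm] using h5

/-- Fatou along the net of finite partial sums, for which the identity is Parseval. Only pointwise
convergence is assumed, so no completeness of the Hermite system enters. -/
theorem lintegral_enorm_hasSum_hermitePhi_sq_le {ι : Type*} [Countable ι] {e : ι → Fin d → ℕ}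
    (he : Function.Injective e) {a : ι → ℂ} {F : EuclideanSpace ℝ (Fin d) → ℂ}
    (hF : ∀ x, HasSum (fun i => a i * hermitePhi (e i) x) (F x)) :
    ∫⁻ x, ‖F x‖ₑ ^ 2 ≤ ∑' i, ‖a i‖ₑ ^ 2 := by
  classical
  have hlim : ∀ x, ‖F x‖ₑ ^ 2 = Filter.liminf
      (fun s : Finset ι => ‖∑ i ∈ s, a i * hermitePhi (e i) x‖ₑ ^ 2) Filter.atTop := fun x =>
    (((ENNReal.continuous_pow 2).comp continuous_enorm).continuousAt.tendsto.comp
      (hF x)).liminf_eq.symm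
  simp only [hlim]
  refine (lintegral_liminf_le fun s => ?_).trans ?_
  · refine Continuous.measurable ?_
    refine ((ENNReal.continuous_pow 2).comp continuous_enorm).comp ?_
    exact continuous_finsetSum _ fun i _ => continuous_const.mul
      (Complex.continuous_ofReal.comp (continuous_hermitePhi _))
  · refine Filter.liminf_le_of_frequently_le' (.of_forall fun s => ?_)
    have h1 : ∀ x, ∑ i ∈ s, a i * (hermitePhi (e i) x : ℂ) =
        ∑ μ ∈ s.map ⟨e, he⟩, Function.extend e a 0 μ * (hermitePhi μ x : ℂ) := fun x => by
      rw [Finset.sum_map]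
      refine Finset.sum_congr rfl fun i _ => ?_
      simp [he.extend_apply]
    simp only [h1]
    rw [lintegral_enorm_sum_hermitePhi_sq, Finset.sum_map]
    simp only [Function.Embedding.coeFn_mk, he.extend_apply]
    exact ENNReal.sum_le_tsum s

/-- On the diagonal, the heat kernel of the Hermite operator is `O(t^{-d/2})`. -/
theorem tsum_exp_mul_sq_hermitePhi_le {t : ℝ} (h0 : 0 < t) (h1 : t ≤ 1)
    (x : EuclideanSpace ℝ (Fin d)) :
    ∑' μ : Fin d → ℕ, ENNReal.ofReal (Real.exp (-(t * (∑ j, μ j : ℕ))) * hermitePhi μ x ^ 2) ≤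
      ENNReal.ofReal ((2 * t ^ (-(1 / 2) : ℝ)) ^ d) := by
  have e : ∀ μ : Fin d → ℕ, Real.exp (-(t * (∑ j, μ j : ℕ))) * hermitePhi μ x ^ 2 =
      ∏ j, Real.exp (-(t * μ j)) * hermiteFun (μ j) (x j) ^ 2 := fun μ => by
    rw [Finset.prod_mul_distrib, prod_exp_neg_mul, hermitePhi, Finset.prod_pow]
  simp only [e]
  rw [tsum_ofReal_pi_prod (fun j n => Real.exp (-(t * n)) * hermiteFun n (x j) ^ 2)
    fun j n => by positivity]
  calc _ ≤ ∏ _j : Fin d, ENNReal.ofReal (2 * t ^ (-(1 / 2) : ℝ)) :=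
        Finset.prod_le_prod' fun j _ => tsum_exp_mul_sq_hermiteFun_le h0 h1 (x j)
    _ = _ := by
      rw [Finset.prod_const, Finset.card_univ, Fintype.card_fin, ENNReal.ofReal_pow (by positivity)]

theorem hasDerivAt_hermitePhi_segment (μ : Fin d → ℕ) (y v : EuclideanSpace ℝ (Fin d)) (s : ℝ) :
    HasDerivAt (fun s : ℝ => hermitePhi μ (y + s • v))
      (∑ i, (∏ j ∈ Finset.univ.erase i, hermiteFun (μ j) ((y + s • v) j)) *
        (hermiteDeriv (μ i) ((y + s • v) i) * v i)) s := by
  have h : ∀ i ∈ (Finset.univ : Finset (Fin d)), HasDerivAt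
      (fun s : ℝ => hermiteFun (μ i) ((y + s • v) i))
      (hermiteDeriv (μ i) ((y + s • v) i) * v i) s := fun i _ => by
    have h1 : HasDerivAt (fun s : ℝ => (y + s • v) i) (v i) s := by
      simpa using ((hasDerivAt_id s).mul_const (v i)).const_add (y i)
    exact (hasDerivAt_hermiteFun (μ i) _).comp s h1
  simpa only [smul_eq_mul, hermitePhi] using HasDerivAt.fun_finsetProd h

/-- After Cauchy–Schwarz over the d partial derivatives, each sum over multi-indices factors into
one-dimensional sums. Exactly one factor contains a derivative, and it is responsible for the extra
t⁻¹. -/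
theorem sum_exp_mul_sq_deriv_segment_le {t : ℝ} (h0 : 0 < t) (h1 : t ≤ 1)
    (S : Finset (Fin d → ℕ)) (z v : EuclideanSpace ℝ (Fin d)) :
    ∑ μ ∈ S, Real.exp (-(t * (∑ j, μ j : ℕ))) *
      (∑ i, (∏ j ∈ Finset.univ.erase i, hermiteFun (μ j) (z j)) *
        (hermiteDeriv (μ i) (z i) * v i)) ^ 2 ≤
      d ^ 2 * (40 * t ^ (-(1 / 2) : ℝ)) ^ d * t⁻¹ * ‖v‖ ^ 2 := by
  classical
  set H : Fin d → Fin d → ℕ → ℝ := fun i j n => Real.exp (-(t * n)) *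
    (if j = i then hermiteDeriv n (z j) else hermiteFun n (z j)) ^ 2 with hH
  have hHnn : ∀ i j n, 0 ≤ H i j n := fun i j n => by positivity
  have hterm : ∀ μ : Fin d → ℕ, Real.exp (-(t * (∑ j, μ j : ℕ))) *
      (∑ i, (∏ j ∈ Finset.univ.erase i, hermiteFun (μ j) (z j)) *
        (hermiteDeriv (μ i) (z i) * v i)) ^ 2 ≤
      d * ‖v‖ ^ 2 * ∑ i, ∏ j, H i j (μ j) := fun μ => by
    have e : ∀ i, ∏ j, H i j (μ j) = Real.exp (-(t * (∑ j, μ j : ℕ))) *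
        ((∏ j ∈ Finset.univ.erase i, hermiteFun (μ j) (z j)) * hermiteDeriv (μ i) (z i)) ^ 2 :=
      fun i => by
        simp only [hH]
        rw [Finset.prod_mul_distrib, prod_exp_neg_mul, Finset.prod_pow,
          ← Finset.prod_erase_mul _ _ (Finset.mem_univ i), if_pos rfl]
        congr 3
        exact Finset.prod_congr rfl fun j hj => if_neg (Finset.ne_of_mem_erase hj)
    simp only [e]
    rw [← Finset.mul_sum, mul_left_comm]
    refine mul_le_mul_of_nonneg_left ?_ (Real.exp_pos _).le
    refine (sq_sum_le_card_mul_sum_sq).trans ?_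
    rw [Finset.card_univ, Fintype.card_fin, mul_assoc, Finset.mul_sum _ _ (‖v‖ ^ 2)]
    refine mul_le_mul_of_nonneg_left (Finset.sum_le_sum fun i _ => ?_) (Nat.cast_nonneg d)
    have hv : (v i) ^ 2 ≤ ‖v‖ ^ 2 := by
      rw [← sq_abs (v i), ← Real.norm_eq_abs]
      exact pow_le_pow_left₀ (norm_nonneg _) (PiLp.norm_apply_le v i) 2
    rw [← mul_assoc, mul_pow _ (v i), mul_comm]
    exact mul_le_mul_of_nonneg_right hv (sq_nonneg _)
  have hprod : ∀ i, ∑ μ ∈ S, ∏ j, H i j (μ j) ≤ (40 * t ^ (-(1 / 2) : ℝ)) ^ d * t⁻¹ := fun i => by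
    have hb : ∀ j, ∑' n, ENNReal.ofReal (H i j n) ≤
        ENNReal.ofReal (40 * t ^ (-(1 / 2) : ℝ) * if j = i then t⁻¹ else 1) := fun j => by
      simp only [hH]
      split_ifs with hj
      · exact tsum_exp_mul_sq_hermiteDeriv_le h0 h1 (z j)
      · refine (tsum_exp_mul_sq_hermiteFun_le h0 h1 (z j)).trans (ENNReal.ofReal_le_ofReal ?_)
        have : 0 < t ^ (-(1 / 2) : ℝ) := by positivity
        linarith
    have h2 : ENNReal.ofReal (∑ μ ∈ S, ∏ j, H i j (μ j)) ≤
        ENNReal.ofReal ((40 * t ^ (-(1 / 2) : ℝ)) ^ d * t⁻¹) := by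
      have hnn : ∀ μ ∈ S, 0 ≤ ∏ j, H i j (μ j) :=
        fun μ _ => Finset.prod_nonneg fun j _ => hHnn _ _ _
      rw [ENNReal.ofReal_sum_of_nonneg hnn]
      refine (ENNReal.sum_le_tsum S).trans ?_
      rw [tsum_ofReal_pi_prod (H i) (hHnn i)]
      refine (Finset.prod_le_prod' fun j _ => hb j).trans ?_
      rw [← ENNReal.ofReal_prod_of_nonneg
        (f := fun j => 40 * t ^ (-(1 / 2) : ℝ) * if j = i then t⁻¹ else 1)
        fun j _ => by split_ifs <;> positivity]
      refine ENNReal.ofReal_le_ofReal (le_of_eq ?_)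
      rw [Finset.prod_mul_distrib, Finset.prod_const, Finset.card_univ, Fintype.card_fin]
      simp
    exact (ENNReal.ofReal_le_ofReal_iff (by positivity)).1 h2
  calc _ ≤ ∑ μ ∈ S, d * ‖v‖ ^ 2 * ∑ i, ∏ j, H i j (μ j) := Finset.sum_le_sum fun μ _ => hterm μ
    _ = d * ‖v‖ ^ 2 * ∑ i, ∑ μ ∈ S, ∏ j, H i j (μ j) := by rw [← Finset.mul_sum, Finset.sum_comm]
    _ ≤ d * ‖v‖ ^ 2 * ∑ _i : Fin d, (40 * t ^ (-(1 / 2) : ℝ)) ^ d * t⁻¹ :=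
        mul_le_mul_of_nonneg_left (Finset.sum_le_sum fun i _ => hprod i) (by positivity)
    _ = _ := by
      rw [Finset.sum_const, Finset.card_univ, Fintype.card_fin, nsmul_eq_mul]
      ring

/-- Let D be a finite partial sum with weights w. It is the increment along the segment of the
scalar function ∑ w (Φ_μ(x)-Φ_μ(y)) Φ_μ(·). The mean value theorem and Cauchy–Schwarz give D² ≤ D·C,
hence D ≤ C. -/
theorem tsum_exp_mul_sq_hermitePhi_sub_le {t : ℝ} (h0 : 0 < t) (h1 : t ≤ 1)
    (x y : EuclideanSpace ℝ (Fin d)) :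
    ∑' μ : Fin d → ℕ, ENNReal.ofReal (Real.exp (-(t * (∑ j, μ j : ℕ))) *
      (hermitePhi μ x - hermitePhi μ y) ^ 2) ≤
      ENNReal.ofReal (d ^ 2 * (40 * t ^ (-(1 / 2) : ℝ)) ^ d * t⁻¹ * ‖x - y‖ ^ 2) := by
  rw [ENNReal.tsum_eq_iSup_sum]
  refine iSup_le fun S => ?_
  rw [← ENNReal.ofReal_sum_of_nonneg fun μ _ => by positivity]
  apply ENNReal.ofReal_le_ofReal
  set w : (Fin d → ℕ) → ℝ := fun μ => Real.exp (-(t * (∑ j, μ j : ℕ))) with hw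
  set D := ∑ μ ∈ S, w μ * (hermitePhi μ x - hermitePhi μ y) ^ 2 with hD
  set C := d ^ 2 * (40 * t ^ (-(1 / 2) : ℝ)) ^ d * t⁻¹ * ‖x - y‖ ^ 2 with hC
  have hD0 : 0 ≤ D := Finset.sum_nonneg fun μ _ => by positivity
  set g : (Fin d → ℕ) → ℝ → ℝ := fun μ s =>
    ∑ i, (∏ j ∈ Finset.univ.erase i, hermiteFun (μ j) ((y + s • (x - y)) j)) *
        (hermiteDeriv (μ i) ((y + s • (x - y)) i) * (x - y) i) with hg
  have hder : ∀ s : ℝ, HasDerivAt (fun s : ℝ => ∑ μ ∈ S, w μ * (hermitePhi μ x - hermitePhi μ y) *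
      hermitePhi μ (y + s • (x - y)))
      (∑ μ ∈ S, w μ * (hermitePhi μ x - hermitePhi μ y) * g μ s) s := fun s =>
    HasDerivAt.fun_sum fun μ _ => (hasDerivAt_hermitePhi_segment μ y (x - y) s).const_mul _
  -- Applying the mean value theorem to the weighted sum gives one intermediate point common to all
  -- μ; termwise application would not.
  obtain ⟨s, -, hs⟩ := exists_hasDerivAt_eq_slope _ _ (zero_lt_one' ℝ)
    (fun s _ => (hder s).continuousAt.continuousWithinAt) fun s _ => hder s
  have e : (∑ μ ∈ S, w μ * (hermitePhi μ x - hermitePhi μ y) * g μ s) = D := by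
    rw [hs, sub_zero, div_one, ← Finset.sum_sub_distrib]
    refine Finset.sum_congr rfl fun μ _ => ?_
    simp only [one_smul, zero_smul, add_sub_cancel, add_zero]
    ring
  have hcs : D ^ 2 ≤ D * ∑ μ ∈ S, w μ * g μ s ^ 2 := by
    nth_rw 1 [← e]
    rw [hD]
    refine Finset.sum_sq_le_sum_mul_sum_of_sq_le_mul S (fun μ _ => by positivity)
      (fun μ _ => by positivity) fun μ _ => le_of_eq ?_
    ring
  have hle : ∑ μ ∈ S, w μ * g μ s ^ 2 ≤ C := sum_exp_mul_sq_deriv_segment_le h0 h1 S _ _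
  by_contra! hlt
  have hC0 : 0 ≤ C := by positivity
  nlinarith [mul_le_mul_of_nonneg_left hle hD0]

end PartialOscillator

/-! ### Plancherel, creation operators and weighted square estimates of kernels -/

namespace PartialOscillator

/-! ### Plancherel's theorem for integrable functions -/

-- Plancherel holds for the L² Fourier transform of classes. It agrees almost everywhere with the
-- Fourier integral because both give the same pairing with every smooth function of compact
-- support, by the multiplication formula.
open FourierTransform in
theorem lintegral_enorm_fourier_sq {g : ℝ → ℂ} (h1 : Integrable g) (h2 : MemLp g 2 volume) :
    ∫⁻ w, ‖𝓕 g w‖ₑ ^ 2 = ∫⁻ v, ‖g v‖ₑ ^ 2 := by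
  have hc : Continuous (𝓕 g) := VectorFourier.fourierIntegral_continuous
    Real.continuous_fourierChar (by exact continuous_inner) h1
  have hae : ∀ᵐ w : ℝ, 𝓕 g w = (𝓕 (h2.toLp g) : Lp ℂ 2 (volume : Measure ℝ)) w := by
    refine ae_eq_of_integral_contDiff_smul_eq hc.locallyIntegrable
      ((Lp.memLp _).locallyIntegrable (by norm_num)) fun φ hφ hφc => ?_
    have hφ' : HasCompactSupport fun x => (φ x : ℂ) := hφc.comp_left Complex.ofReal_zero
    set ψ : SchwartzMap ℝ ℂ := hφ'.toSchwartzMap (Complex.ofRealCLM.contDiff.comp hφ) with hψ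
    have hψe : ∀ x, ψ x = (φ x : ℂ) := fun x => rfl
    have e1 := congrArg (fun T => T ψ) (Lp.fourier_toTemperedDistribution_eq (h2.toLp g))
    simp only [TemperedDistribution.fourier_apply, Lp.toTemperedDistribution_apply] at e1
    have e2 : ∫ x, (𝓕 ψ) x • (h2.toLp g) x = ∫ x, (𝓕 ψ) x • g x := by
      refine integral_congr_ae ?_
      filter_upwards [h2.coeFn_toLp] with x hx
      rw [hx]
    have e3 : ∫ x, (𝓕 ψ) x • g x = ∫ x, ψ x • 𝓕 g x := by
      rw [SchwartzMap.fourier_coe]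
      have := VectorFourier.integral_fourierIntegral_smul_eq_flip (𝕜 := ℝ) (V := ℝ) (W := ℝ)
        (e := Real.fourierChar) (L := innerₗ ℝ) (μ := volume) (ν := volume) (f := ψ) (g := g)
        Real.continuous_fourierChar (by exact continuous_inner) ψ.integrable h1
      rw [flip_innerₗ] at this
      exact this
    rw [e2, e3] at e1
    simpa [hψe] using e1
  calc ∫⁻ w, ‖𝓕 g w‖ₑ ^ 2
      = ∫⁻ w, ‖(𝓕 (h2.toLp g) : Lp ℂ 2 (volume : Measure ℝ)) w‖ₑ ^ 2 :=
        lintegral_congr_ae (hae.mono fun w hw => by simp only [hw])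
    _ = ‖(𝓕 (h2.toLp g) : Lp ℂ 2 (volume : Measure ℝ))‖ₑ ^ 2 := by
        rw [← enorm_toLp_sq (Lp.memLp _), Lp.toLp_coeFn]
    _ = ‖h2.toLp g‖ₑ ^ 2 := by
        rw [← ofReal_norm, Lp.norm_fourier_eq, ofReal_norm]
    _ = _ := enorm_toLp_sq h2

/-- The unnormalized inverse Fourier transform `ρ ↦ ∫ e^{iτρ} g(τ) dτ`. -/
noncomputable def expIntegral (g : ℝ → ℂ) (ρ : ℝ) : ℂ :=
  ∫ τ : ℝ, Complex.exp (Complex.I * τ * ρ) * g τ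

theorem norm_exp_I_mul_mul (τ ρ : ℝ) : ‖Complex.exp (Complex.I * τ * ρ)‖ = 1 := by
  rw [show Complex.I * τ * ρ = ((τ * ρ : ℝ) : ℂ) * Complex.I by push_cast; ring]
  exact Complex.norm_exp_ofReal_mul_I _

theorem continuous_exp_I_mul_mul (ρ : ℝ) :
    Continuous fun τ : ℝ => Complex.exp (Complex.I * τ * ρ) := by fun_prop

theorem integrable_exp_mul {g : ℝ → ℂ} (hg : Integrable g) (ρ : ℝ) :
    Integrable fun τ : ℝ => Complex.exp (Complex.I * τ * ρ) * g τ :=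
  hg.bdd_mul (c := 1) (continuous_exp_I_mul_mul ρ).aestronglyMeasurable
    (.of_forall fun τ => (norm_exp_I_mul_mul τ ρ).le)

open FourierTransform in
theorem expIntegral_eq_fourier (g : ℝ → ℂ) (ρ : ℝ) :
    expIntegral g ρ = 𝓕 g ((-(2 * Real.pi)⁻¹) * ρ) := by
  rw [expIntegral, Real.fourier_eq']
  refine integral_congr_ae (.of_forall fun τ => ?_)
  simp only [smul_eq_mul]
  congr 2
  have : (Real.pi : ℂ) ≠ 0 := Complex.ofReal_ne_zero.2 Real.pi_ne_zero
  simp only [RCLike.inner_apply, conj_trivial]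
  push_cast
  field_simp

theorem continuous_expIntegral {g : ℝ → ℂ} (hg : Integrable g) : Continuous (expIntegral g) := by
  have h := VectorFourier.fourierIntegral_continuous (L := innerₗ ℝ)
    Real.continuous_fourierChar (by exact continuous_inner) hg
  have : expIntegral g = fun ρ => FourierTransform.fourier g ((-(2 * Real.pi)⁻¹) * ρ) :=
    funext fun ρ => expIntegral_eq_fourier g ρ
  rw [this]
  exact h.comp (continuous_const.mul continuous_id)

theorem lintegral_enorm_expIntegral_sq {g : ℝ → ℂ} (h1 : Integrable g) (h2 : MemLp g 2 volume) :
    ∫⁻ ρ, ‖expIntegral g ρ‖ₑ ^ 2 = ENNReal.ofReal (2 * Real.pi) * ∫⁻ v, ‖g v‖ₑ ^ 2 := by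
  simp only [expIntegral_eq_fourier]
  have hne : -(2 * Real.pi)⁻¹ ≠ 0 := by simp [Real.pi_ne_zero]
  rw [← lintegral_enorm_fourier_sq h1 h2]
  have hm := Real.map_volume_mul_left hne
  have hemb : MeasurableEmbedding fun x : ℝ => -(2 * Real.pi)⁻¹ * x :=
    (Homeomorph.mulLeft₀ _ hne).measurableEmbedding
  have := hemb.lintegral_map (μ := volume) (fun w => ‖FourierTransform.fourier g w‖ₑ ^ 2)
  rw [← this, hm, lintegral_smul_measure]
  congr 2
  rw [inv_neg, inv_inv, abs_neg, abs_of_pos (by positivity)]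

theorem norm_expIntegral_le (g : ℝ → ℂ) (ρ : ℝ) : ‖expIntegral g ρ‖ ≤ ∫ τ, ‖g τ‖ := by
  refine (norm_integral_le_integral_norm _).trans (le_of_eq ?_)
  simp only [norm_mul, norm_exp_I_mul_mul, one_mul]

open FourierTransform in
theorem mul_expIntegral {g : ℝ → ℂ} (h1 : Integrable g) (h2 : Differentiable ℝ g)
    (h3 : Integrable (deriv g)) (ρ : ℝ) :
    (ρ : ℂ) * expIntegral g ρ = Complex.I * expIntegral (deriv g) ρ := by
  rw [expIntegral_eq_fourier, expIntegral_eq_fourier, Real.fourier_deriv h1 h2 h3]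
  have : (Real.pi : ℂ) ≠ 0 := Complex.ofReal_ne_zero.2 Real.pi_ne_zero
  simp only [smul_eq_mul]
  push_cast
  field_simp
  rw [Complex.I_sq]
  ring

theorem pow_mul_expIntegral {g : ℝ → ℂ} {N : ℕ}
    (hd : ∀ n < N, Differentiable ℝ (iteratedDeriv n g))
    (hi : ∀ n ≤ N, Integrable (iteratedDeriv n g)) (ρ : ℝ) :
    (ρ : ℂ) ^ N * expIntegral g ρ = Complex.I ^ N * expIntegral (iteratedDeriv N g) ρ := by
  induction N with
  | zero => simp [iteratedDeriv_zero]
  | succ N ih =>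
    have h := mul_expIntegral (hi N (Nat.le_succ N)) (hd N (Nat.lt_succ_self N))
      (by rw [← iteratedDeriv_succ]; exact hi (N + 1) le_rfl) ρ
    rw [pow_succ', mul_assoc, ih (fun n hn => hd n (hn.trans (Nat.lt_succ_self N)))
      fun n hn => hi n (hn.trans (Nat.le_succ N)), mul_left_comm, h, iteratedDeriv_succ, pow_succ']
    ring

end PartialOscillator

namespace PartialOscillator

/-! ### Powers of the creation operator -/

/-- The norm `(2^a (n+1)⋯(n+a))^{1/2}` of the `a`-th power of the creation operator on `h_n`. -/
noncomputable def raiseCoeff (n a : ℕ) : ℝ :=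
  Real.sqrt (2 ^ a * ((n + 1).ascFactorial a : ℝ))

theorem raiseCoeff_zero (n : ℕ) : raiseCoeff n 0 = 1 := by simp [raiseCoeff]

theorem raiseCoeff_succ (n a : ℕ) :
    raiseCoeff n (a + 1) = Real.sqrt (2 * ((n + a : ℕ) + 1)) * raiseCoeff n a := by
  rw [raiseCoeff, raiseCoeff, ← Real.sqrt_mul (by positivity), Nat.ascFactorial_succ]
  congr 1
  push_cast
  ring

theorem raiseCoeff_succ' (n a : ℕ) :
    raiseCoeff n (a + 1) = Real.sqrt (2 * (n + 1)) * raiseCoeff (n + 1) a := by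
  rw [raiseCoeff, raiseCoeff, ← Real.sqrt_mul (by positivity)]
  congr 1
  have := Nat.succ_ascFactorial (n + 1) a
  have h2 : (n + 1).ascFactorial (a + 1) = (n + 1) * (n + 2).ascFactorial a := by
    rw [Nat.ascFactorial_succ, ← this]
  rw [h2]
  push_cast
  ring

/-- Each of the a factors is linear in n and is absorbed by part of the exponential at the cost of
s⁻¹; the induction spends half of the exponent at every step. Thus one creation operator costs
s^{-1/2}. -/
theorem exists_raiseCoeff_sq_le (a : ℕ) : ∃ C : ℝ, 0 < C ∧ ∀ s : ℝ, 0 < s → s ≤ 1 → ∀ n : ℕ,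
    raiseCoeff n a ^ 2 ≤ C * (s⁻¹) ^ a * Real.exp (s * n) := by
  induction a with
  | zero =>
    refine ⟨1, one_pos, fun s hs _ n => ?_⟩
    rw [raiseCoeff_zero]
    simpa using by positivity
  | succ a ih =>
    obtain ⟨C, hC, h⟩ := ih
    refine ⟨C * 2 ^ a * (4 + 2 * (a + 1)), by positivity, fun s hs hs1 n => ?_⟩
    have h1 := h (s / 2) (by positivity) (by linarith) n
    have h2 : 2 * ((n + a : ℕ) + 1 : ℝ) ≤ (4 + 2 * (a + 1)) * s⁻¹ * Real.exp (s / 2 * n) := by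
      have e1 : (s / 2) * n ≤ Real.exp (s / 2 * n) := by
        linarith [Real.add_one_le_exp (s / 2 * n)]
      have e2 : 1 ≤ Real.exp (s / 2 * n) := Real.one_le_exp (by positivity)
      have e3 : 1 ≤ s⁻¹ := (one_le_inv₀ hs).2 hs1
      have e4 : (n : ℝ) ≤ 2 * s⁻¹ * Real.exp (s / 2 * n) := by
        have := mul_le_mul_of_nonneg_left e1 (by positivity : 0 ≤ 2 * s⁻¹)
        calc (n : ℝ) = 2 * s⁻¹ * (s / 2 * n) := by field_simp
          _ ≤ _ := this
      have e5 : 1 ≤ s⁻¹ * Real.exp (s / 2 * n) := one_le_mul_of_one_le_of_one_le e3 e2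
      have e6 : ((a : ℝ) + 1) ≤ (a + 1) * (s⁻¹ * Real.exp (s / 2 * n)) :=
        le_mul_of_one_le_right (by positivity) e5
      push_cast
      linarith
    have e : Real.exp (s * n) = Real.exp (s / 2 * n) * Real.exp (s / 2 * n) := by
      rw [← Real.exp_add]; ring_nf
    rw [raiseCoeff_succ, mul_pow, Real.sq_sqrt (by positivity)]
    calc _ ≤ ((4 + 2 * (a + 1)) * s⁻¹ * Real.exp (s / 2 * n)) *
          (C * ((s / 2)⁻¹) ^ a * Real.exp (s / 2 * n)) :=
          mul_le_mul h2 h1 (sq_nonneg _) (by positivity)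
      _ = _ := by
        rw [e, inv_div, div_pow, pow_succ, inv_pow]
        field_simp

variable {d : ℕ}

/-- The `a`-th power of the `j`-th creation operator applied to `Φ_μ`. -/
noncomputable def raisePhi (j : Fin d) (a : ℕ) (μ : Fin d → ℕ) (x : EuclideanSpace ℝ (Fin d)) : ℝ :=
  raiseCoeff (μ j) a * hermitePhi (μ + Pi.single j a) x

theorem continuous_raisePhi (j : Fin d) (a : ℕ) (μ : Fin d → ℕ) : Continuous (raisePhi j a μ) :=
  continuous_const.mul (continuous_hermitePhi _)

theorem raisePhi_zero (j : Fin d) (μ : Fin d → ℕ) : raisePhi j 0 μ = hermitePhi μ := by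
  funext x
  simp [raisePhi, raiseCoeff_zero]

theorem hermitePhi_add_single (j : Fin d) (a : ℕ) (μ : Fin d → ℕ) (x : EuclideanSpace ℝ (Fin d)) :
    hermitePhi (μ + Pi.single j a) x =
      (∏ i ∈ Finset.univ.erase j, hermiteFun (μ i) (x i)) * hermiteFun (μ j + a) (x j) := by
  rw [hermitePhi, ← Finset.prod_erase_mul _ _ (Finset.mem_univ j)]
  congr 1
  · refine Finset.prod_congr rfl fun i hi => ?_
    simp [Finset.ne_of_mem_erase hi]
  · simp

theorem hermitePhi_eq_erase_mul (j : Fin d) (μ : Fin d → ℕ) (x : EuclideanSpace ℝ (Fin d)) :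
    hermitePhi μ x =
      (∏ i ∈ Finset.univ.erase j, hermiteFun (μ i) (x i)) * hermiteFun (μ j) (x j) := by
  simpa using hermitePhi_add_single j 0 μ x

theorem sqrt_mul_raisePhi_add_single (j : Fin d) (a : ℕ) (μ : Fin d → ℕ)
    (x : EuclideanSpace ℝ (Fin d)) :
    Real.sqrt (2 * (μ j + 1)) * raisePhi j a (μ + Pi.single j 1) x = raisePhi j (a + 1) μ x := by
  rw [raisePhi, raisePhi, raiseCoeff_succ', add_assoc, ← Pi.single_add, add_comm 1 a]
  simp only [Pi.add_apply, Pi.single_eq_same]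
  ring

/-- Multiplication by x_j is half the sum of the creation operator A* and the annihilation operator
A. The commutator [A, A*] = 2 moves A through A*^a and produces the term with a. The truncated
indices a-1 and μ_j-1 occur only with vanishing coefficients. -/
theorem coord_mul_raisePhi (j : Fin d) (a : ℕ) (μ : Fin d → ℕ) (x : EuclideanSpace ℝ (Fin d)) :
    x j * raisePhi j a μ x = raisePhi j (a + 1) μ x / 2 + a * raisePhi j (a - 1) μ x +
      Real.sqrt (2 * μ j) * raisePhi j a (Function.update μ j (μ j - 1)) x / 2 := by
  have e : hermitePhi (Function.update μ j (μ j - 1) + Pi.single j a) x =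
      (∏ i ∈ Finset.univ.erase j, hermiteFun (μ i) (x i)) * hermiteFun (μ j - 1 + a) (x j) := by
    rw [hermitePhi_add_single]
    congr 1
    · refine Finset.prod_congr rfl fun i hi => ?_
      simp [Finset.ne_of_mem_erase hi]
    · simp
  simp only [raisePhi, e, Function.update_self, hermitePhi_add_single]
  generalize (∏ i ∈ Finset.univ.erase j, hermiteFun (μ i) (x i)) = Q
  generalize μ j = n
  generalize x j = y
  have h1 := two_mul_hermiteFun (n + a) y
  rcases a with _ | a
  · simp only [raiseCoeff_zero, raiseCoeff_succ, add_zero] at h1 ⊢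
    push_cast
    linear_combination Q / 2 * h1
  · have h2 : Real.sqrt (2 * n) * raiseCoeff (n - 1) (a + 1) * hermiteFun (n - 1 + (a + 1)) y =
        2 * n * raiseCoeff n a * hermiteFun (n + a) y := by
      rcases n with _ | n
      · simp
      · have h3 : Real.sqrt (2 * ((n + 1 : ℕ) : ℝ)) * Real.sqrt (2 * ((n + 1 : ℕ) : ℝ)) =
          2 * ((n + 1 : ℕ) : ℝ) := Real.mul_self_sqrt (by positivity)
        rw [Nat.add_sub_cancel, raiseCoeff_succ', show n + (a + 1) = n + 1 + a by ring]
        push_cast at h3 ⊢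
        linear_combination (raiseCoeff (n + 1) a * hermiteFun (n + 1 + a) y) * h3
    have h4 : Real.sqrt (2 * ((n + (a + 1) : ℕ) : ℝ)) * Real.sqrt (2 * ((n + (a + 1) : ℕ) : ℝ)) =
          2 * ((n + (a + 1) : ℕ) : ℝ) := Real.mul_self_sqrt (by positivity)
    have h5 : Real.sqrt (2 * ((n + (a + 1) : ℕ) : ℝ)) * raiseCoeff n a = raiseCoeff n (a + 1) := by
      rw [raiseCoeff_succ]
      push_cast
      ring_nf
    rw [Nat.add_sub_cancel, raiseCoeff_succ n (a + 1), show n + (a + 1 + 1) = n + (a + 1) + 1 by ring]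
    rw [show n + (a + 1) - 1 = n + a by omega] at h1
    push_cast at h1 h2 h4 h5 ⊢
    linear_combination (Q / 2 * raiseCoeff n (a + 1)) * h1 - Q / 2 * h2 +
      (Q / 2 * raiseCoeff n a * hermiteFun (n + a) y) * h4 -
      (Q / 2 * Real.sqrt (2 * ((n : ℝ) + (a + 1))) * hermiteFun (n + a) y) * h5

/-- The commutator of multiplication by a coordinate with the bilinear expression in creation
operators. -/
theorem sub_mul_raisePhi_mul (j : Fin d) (a b : ℕ) (μ : Fin d → ℕ)
    (x y : EuclideanSpace ℝ (Fin d)) :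
    (x j - y j) * (raisePhi j a μ x * raisePhi j b μ y) =
      a * (raisePhi j (a - 1) μ x * raisePhi j b μ y) -
      b * (raisePhi j a μ x * raisePhi j (b - 1) μ y) +
      (raisePhi j (a + 1) μ x * raisePhi j b μ y - raisePhi j a μ x * raisePhi j (b + 1) μ y) / 2 +
      (Real.sqrt (2 * μ j) * raisePhi j a (Function.update μ j (μ j - 1)) x * raisePhi j b μ y -
        raisePhi j a μ x * (Real.sqrt (2 * μ j) *
          raisePhi j b (Function.update μ j (μ j - 1)) y)) / 2 := by
  linear_combination raisePhi j b μ y * coord_mul_raisePhi j a μ x -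
    raisePhi j a μ x * coord_mul_raisePhi j b μ y

/-- At the index ν + e_j, the annihilation operator on one side takes Φ back to Φ_ν, and the factor
√(2(ν_j+1)) turns the other side into one more creation operator on Φ_ν. This prepares a summation
by parts in μ. -/
theorem lower_raisePhi_add_single (j : Fin d) (a b : ℕ) (ν : Fin d → ℕ)
    (x y : EuclideanSpace ℝ (Fin d)) :
    (Real.sqrt (2 * (ν + Pi.single j 1 : Fin d → ℕ) j) * raisePhi j a
      (Function.update (ν + Pi.single j 1) j ((ν + Pi.single j 1 : Fin d → ℕ) j - 1)) x *
        raisePhi j b (ν + Pi.single j 1) y -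
      raisePhi j a (ν + Pi.single j 1) x * (Real.sqrt (2 * (ν + Pi.single j 1 : Fin d → ℕ) j) *
        raisePhi j b
          (Function.update (ν + Pi.single j 1) j ((ν + Pi.single j 1 : Fin d → ℕ) j - 1)) y)) =
      raisePhi j a ν x * raisePhi j (b + 1) ν y - raisePhi j (a + 1) ν x * raisePhi j b ν y := by
  have e : Function.update (ν + Pi.single j 1) j ((ν + Pi.single j 1 : Fin d → ℕ) j - 1) = ν := by
    funext i
    by_cases hi : i = j
    · subst hi; simp
    · simp [hi]
  have h1 := sqrt_mul_raisePhi_add_single j a ν x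
  have h2 := sqrt_mul_raisePhi_add_single j b ν y
  rw [e]
  simp only [Pi.add_apply, Pi.single_eq_same, Nat.cast_add, Nat.cast_one]
  linear_combination raisePhi j a ν x * h2 - raisePhi j b ν y * h1

theorem sum_add_single (j : Fin d) (a : ℕ) (μ : Fin d → ℕ) :
    ∑ i, (μ + Pi.single j a : Fin d → ℕ) i = (∑ i, μ i) + a := by
  simp only [Pi.add_apply, Finset.sum_add_distrib]
  congr 1
  simp [Finset.sum_pi_single']

theorem add_single_injective (j : Fin d) (a : ℕ) :
    Function.Injective fun μ : Fin d → ℕ => μ + Pi.single j a :=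
  fun _ _ h => add_right_cancel h

theorem apply_le_sum (μ : Fin d → ℕ) (j : Fin d) : μ j ≤ ∑ i, μ i :=
  Finset.single_le_sum (f := μ) (fun _ _ => Nat.zero_le _) (Finset.mem_univ j)

theorem summable_exp_mul_raiseCoeff_sq_mul (j : Fin d) (a : ℕ) {t : ℝ} (h0 : 0 < t) (h1 : t ≤ 1)
    {H : (Fin d → ℕ) → ℝ} (hH : ∀ μ, 0 ≤ H μ)
    (hs : Summable fun μ : Fin d → ℕ => Real.exp (-(t / 2 * (∑ i, μ i : ℕ))) * H μ) :
    Summable fun μ : Fin d → ℕ => Real.exp (-(t * (∑ i, μ i : ℕ))) *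
      (raiseCoeff (μ j) a ^ 2 * H (μ + Pi.single j a)) := by
  obtain ⟨C, hC, hle⟩ := exists_raiseCoeff_sq_le a
  have hs' := (hs.comp_injective (add_single_injective j a)).mul_left
    (C * ((t / 2)⁻¹) ^ a * Real.exp (t / 2 * a))
  refine Summable.of_nonneg_of_le (fun μ => by have := hH (μ + Pi.single j a); positivity)
    (fun μ => ?_) hs'
  simp only [Function.comp_apply, sum_add_single]
  have h2 := hle (t / 2) (by linarith) (by linarith) (μ j)
  have h3 : Real.exp (t / 2 * μ j) ≤ Real.exp (t / 2 * (∑ i, μ i : ℕ)) :=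
    Real.exp_le_exp.2 (mul_le_mul_of_nonneg_left (by exact_mod_cast apply_le_sum μ j) (by linarith))
  have h4 : raiseCoeff (μ j) a ^ 2 ≤
      C * ((t / 2)⁻¹) ^ a * Real.exp (t / 2 * (∑ i, μ i : ℕ)) :=
    h2.trans (mul_le_mul_of_nonneg_left h3 (by positivity))
  have e : Real.exp (-(t * (∑ i, μ i : ℕ))) * Real.exp (t / 2 * (∑ i, μ i : ℕ)) =
      Real.exp (t / 2 * a) * Real.exp (-(t / 2 * ((∑ i, μ i : ℕ) + a : ℕ))) := by
    rw [← Real.exp_add, ← Real.exp_add]; push_cast; ring_nf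
  have h5 := hH (μ + Pi.single j a)
  calc _ ≤ Real.exp (-(t * (∑ i, μ i : ℕ))) * ((C * ((t / 2)⁻¹) ^ a *
        Real.exp (t / 2 * (∑ i, μ i : ℕ))) * H (μ + Pi.single j a)) := by gcongr
    _ = (C * ((t / 2)⁻¹) ^ a) * (Real.exp (-(t * (∑ i, μ i : ℕ))) *
        Real.exp (t / 2 * (∑ i, μ i : ℕ))) * H (μ + Pi.single j a) := by ring
    _ = _ := by rw [e]; ring

/-- A uniform bound for `Φ_μ²`. -/
theorem sq_hermitePhi_le (μ : Fin d → ℕ) (x : EuclideanSpace ℝ (Fin d)) :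
    hermitePhi μ x ^ 2 ≤ ∏ i, (2 * (μ i : ℝ) + 2) := by
  rw [hermitePhi, ← Finset.prod_pow]
  exact Finset.prod_le_prod (fun i _ => sq_nonneg _) fun i _ => sq_hermiteFun_le _ _

theorem summable_exp_mul_prod {t : ℝ} (h0 : 0 < t) : Summable fun μ : Fin d → ℕ =>
    Real.exp (-(t * (∑ i, μ i : ℕ))) * ∏ i, (2 * (μ i : ℝ) + 2) := by
  have h1 : Summable fun n : ℕ => Real.exp (-(t * n)) * (2 * (n : ℝ) + 2) := by
    have e : ∀ n : ℕ, Real.exp (-(t * n)) = Real.exp (-t) ^ n := fun n => by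
      rw [← Real.exp_nat_mul]; ring_nf
    simp only [e]
    refine Summable.of_nonneg_of_le (fun n => by positivity) (fun n => ?_)
      (summable_geometric_mul_sq (Real.exp_pos (-t)).le (Real.exp_lt_one_iff.2 (by linarith)))
    gcongr
    nlinarith [(n.cast_nonneg : (0 : ℝ) ≤ n)]
  have h2 : ∑' μ : Fin d → ℕ, ENNReal.ofReal (∏ i, Real.exp (-(t * μ i)) * (2 * (μ i : ℝ) + 2)) ≠
      ⊤ := by
    rw [tsum_ofReal_pi_prod (fun _ n => Real.exp (-(t * n)) * (2 * (n : ℝ) + 2))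
      fun _ _ => by positivity]
    refine (ENNReal.prod_lt_top fun i _ => ?_).ne
    exact h1.tsum_ofReal_lt_top
  refine (ENNReal.summable_toReal h2).congr fun μ => ?_
  rw [ENNReal.toReal_ofReal (by positivity), Finset.prod_mul_distrib, prod_exp_neg_mul]

/-- A uniform bound for the square of `A_j^{*a} Φ_μ`. -/
noncomputable def raiseBound (j : Fin d) (a : ℕ) (μ : Fin d → ℕ) : ℝ :=
  raiseCoeff (μ j) a ^ 2 * ∏ i, (2 * ((μ + Pi.single j a : Fin d → ℕ) i : ℝ) + 2)

theorem sq_raisePhi_le (j : Fin d) (a : ℕ) (μ : Fin d → ℕ) (x : EuclideanSpace ℝ (Fin d)) :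
    raisePhi j a μ x ^ 2 ≤ raiseBound j a μ := by
  rw [raisePhi, mul_pow]
  exact mul_le_mul_of_nonneg_left (sq_hermitePhi_le _ x) (sq_nonneg _)

theorem summable_exp_mul_raiseBound (j : Fin d) (a : ℕ) {t : ℝ} (h0 : 0 < t) (h1 : t ≤ 1) :
    Summable fun μ : Fin d → ℕ => Real.exp (-(t * (∑ i, μ i : ℕ))) * raiseBound j a μ :=
  summable_exp_mul_raiseCoeff_sq_mul j a h0 h1
    (H := fun μ => ∏ i, (2 * (μ i : ℝ) + 2)) (fun μ => by positivity)
    (summable_exp_mul_prod (by linarith))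

theorem norm_mul_raisePhi_mul_le (j : Fin d) (a b : ℕ) {t R : ℝ}
    {c : ℕ → ℂ} (hc : ∀ k, ‖c k‖ ≤ R * Real.exp (-(t * k))) (μ : Fin d → ℕ)
    (x y : EuclideanSpace ℝ (Fin d)) :
    ‖c (∑ i, μ i) * ((raisePhi j a μ x * raisePhi j b μ y : ℝ) : ℂ)‖ ≤
      R * (Real.exp (-(t * (∑ i, μ i : ℕ))) * raiseBound j a μ +
        Real.exp (-(t * (∑ i, μ i : ℕ))) * raiseBound j b μ) := by
  have hR : 0 ≤ R := by simpa using (norm_nonneg _).trans (hc 0)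
  rw [norm_mul, Complex.norm_real, Real.norm_eq_abs, ← mul_add, ← mul_assoc]
  refine mul_le_mul (hc _) ?_ (abs_nonneg _) (by positivity)
  have h1 := sq_raisePhi_le j a μ x
  have h2 := sq_raisePhi_le j b μ y
  rw [abs_le]
  constructor <;> nlinarith [sq_nonneg (raisePhi j a μ x - raisePhi j b μ y),
    sq_nonneg (raisePhi j a μ x + raisePhi j b μ y), sq_nonneg (raisePhi j a μ x),
    sq_nonneg (raisePhi j b μ y)]

theorem summable_mul_raisePhi_mul (j : Fin d) (a b : ℕ) {t R : ℝ} (h0 : 0 < t) (h1 : t ≤ 1)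
    {c : ℕ → ℂ} (hc : ∀ k, ‖c k‖ ≤ R * Real.exp (-(t * k))) (x y : EuclideanSpace ℝ (Fin d)) :
    Summable fun μ : Fin d → ℕ =>
      c (∑ i, μ i) * ((raisePhi j a μ x * raisePhi j b μ y : ℝ) : ℂ) := by
  exact Summable.of_norm_bounded (((summable_exp_mul_raiseBound j a h0 h1).add
    (summable_exp_mul_raiseBound j b h0 h1)).mul_left R)
    fun μ => norm_mul_raisePhi_mul_le j a b hc μ x y

theorem norm_fwdDiff_le {R t : ℝ} (h0 : 0 < t) {c : ℕ → ℂ}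
    (hc : ∀ k, ‖c k‖ ≤ R * Real.exp (-(t * k))) (k : ℕ) :
    ‖fwdDiff 1 c k‖ ≤ (2 * R) * Real.exp (-(t * k)) := by
  have hR : 0 ≤ R := by simpa using (norm_nonneg _).trans (hc 0)
  have h2 : Real.exp (-(t * (k + 1 : ℕ))) ≤ Real.exp (-(t * k)) :=
    Real.exp_le_exp.2 (by push_cast; nlinarith)
  have h3 := mul_le_mul_of_nonneg_left h2 hR
  calc _ ≤ ‖c (k + 1)‖ + ‖c k‖ := norm_sub_le _ _
    _ ≤ _ := by linarith [hc k, hc (k + 1)]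

/-- The kernel `∑_μ c(|μ|) (A_j^{*a} Φ_μ)(x) (A_j^{*b} Φ_μ)(y)`. -/
noncomputable def raiseKernel (j : Fin d) (a b : ℕ) (c : ℕ → ℂ) (x y : EuclideanSpace ℝ (Fin d)) :
    ℂ :=
  ∑' μ : Fin d → ℕ, c (∑ i, μ i) * ((raisePhi j a μ x * raisePhi j b μ y : ℝ) : ℂ)

/-- Summation by parts: in the annihilation terms shift μ by e_j, which replaces c(|μ|) by c + Δc.
The part with c cancels the creation terms of the commutator, so only the part with Δc and the two
terms of lower order survive. -/
theorem sub_mul_raiseKernel (j : Fin d) (a b : ℕ) {t R : ℝ} (h0 : 0 < t) (h1 : t ≤ 1)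
    {c : ℕ → ℂ} (hc : ∀ k, ‖c k‖ ≤ R * Real.exp (-(t * k))) (x y : EuclideanSpace ℝ (Fin d)) :
    ((x j - y j : ℝ) : ℂ) * raiseKernel j a b c x y =
      a * raiseKernel j (a - 1) b c x y - b * raiseKernel j a (b - 1) c x y +
      (raiseKernel j a (b + 1) (fwdDiff 1 c) x y - raiseKernel j (a + 1) b (fwdDiff 1 c) x y) / 2 := by
  have hs : ∀ a b, HasSum (fun μ : Fin d → ℕ =>
      c (∑ i, μ i) * ((raisePhi j a μ x * raisePhi j b μ y : ℝ) : ℂ)) (raiseKernel j a b c x y) :=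
    fun a b => (summable_mul_raisePhi_mul j a b h0 h1 hc x y).hasSum
  have hs' : ∀ a b, HasSum (fun μ : Fin d → ℕ =>
      fwdDiff 1 c (∑ i, μ i) * ((raisePhi j a μ x * raisePhi j b μ y : ℝ) : ℂ))
        (raiseKernel j a b (fwdDiff 1 c) x y) :=
    fun a b => (summable_mul_raisePhi_mul j a b h0 h1 (norm_fwdDiff_le h0 hc) x y).hasSum
  set L : (Fin d → ℕ) → ℝ := fun μ =>
    Real.sqrt (2 * μ j) * raisePhi j a (Function.update μ j (μ j - 1)) x * raisePhi j b μ y -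
        raisePhi j a μ x * (Real.sqrt (2 * μ j) *
          raisePhi j b (Function.update μ j (μ j - 1)) y) with hL
  have hlow : HasSum (fun μ : Fin d → ℕ => c (∑ i, μ i) * ((L μ : ℝ) : ℂ))
      ((raiseKernel j a (b + 1) (fwdDiff 1 c) x y - raiseKernel j (a + 1) b (fwdDiff 1 c) x y) +
        (raiseKernel j a (b + 1) c x y - raiseKernel j (a + 1) b c x y)) := by
    rw [← (add_single_injective j 1).hasSum_iff]
    · refine (((hs' a (b + 1)).sub (hs' (a + 1) b)).add
        ((hs a (b + 1)).sub (hs (a + 1) b))).congr_fun fun ν => ?_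
      have e := lower_raisePhi_add_single j a b ν x y
      simp only [Function.comp_apply, hL, e, sum_add_single]
      simp only [fwdDiff]
      push_cast
      ring
    -- Indices missed by the shift have μ_j = 0, where the factor √(2μ_j) vanishes.
    · intro μ hμ
      have : μ j = 0 := by
        by_contra h
        refine hμ ⟨Function.update μ j (μ j - 1), ?_⟩
        funext i
        by_cases hi : i = j
        · subst hi; simp; omega
        · simp [hi]
      simp [hL, this]
  have hmain := ((((hs (a - 1) b).mul_left (a : ℂ)).sub ((hs a (b - 1)).mul_left (b : ℂ))).add
    (((hs (a + 1) b).sub (hs a (b + 1))).div_const 2)).add (hlow.div_const 2)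
  have hleft := (hs a b).mul_left ((x j - y j : ℝ) : ℂ)
  have := hleft.unique (hmain.congr_fun fun μ => ?_)
  · rw [this]; ring
  · have e := congrArg (fun r : ℝ => c (∑ i, μ i) * (r : ℂ)) (sub_mul_raisePhi_mul j a b μ x y)
    simp only at e
    rw [mul_left_comm, ← Complex.ofReal_mul, e]
    simp only [hL]
    push_cast
    ring

end PartialOscillator

namespace PartialOscillator

/-! ### Kernels of multipliers with Gaussian decay -/

/-- `g` is measurable in `τ`, and of size at most `R e^{-tτ²/2} e^{-tk}`. -/
structure HeatBound (g : ℝ → ℕ → ℂ) (R t : ℝ) : Prop where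
  measurable : ∀ k, Measurable fun τ => g τ k
  bound : ∀ τ k, ‖g τ k‖ ≤ R * Real.exp (-(t / 2 * τ ^ 2)) * Real.exp (-(t * k))

variable {d : ℕ} {g : ℝ → ℕ → ℂ} {R t : ℝ}

theorem HeatBound.nonneg (h : HeatBound g R t) : 0 ≤ R := by
  simpa using (norm_nonneg _).trans (h.bound 0 0)

theorem integrable_exp_neg_half_mul_sq (h0 : 0 < t) :
    Integrable fun τ : ℝ => Real.exp (-(t / 2 * τ ^ 2)) := by
  simpa using integrable_exp_neg_mul_sq (b := t / 2) (by positivity)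

theorem HeatBound.integrable (h : HeatBound g R t) (h0 : 0 < t) (k : ℕ) :
    Integrable fun τ => g τ k := by
  refine Integrable.mono' (((integrable_exp_neg_half_mul_sq h0).const_mul R).mul_const
    (Real.exp (-(t * k)))) (h.measurable k).aestronglyMeasurable (.of_forall fun τ => ?_)
  exact h.bound τ k

theorem HeatBound.memLp (h : HeatBound g R t) (h0 : 0 < t) (k : ℕ) :
    MemLp (fun τ => g τ k) 2 volume := by
  rw [memLp_two_iff_integrable_sq_norm (h.measurable k).aestronglyMeasurable]
  refine Integrable.mono' ((h.integrable h0 k).norm.mul_const R)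
    ((h.measurable k).norm.pow_const 2).aestronglyMeasurable (.of_forall fun τ => ?_)
  rw [Real.norm_of_nonneg (sq_nonneg _), sq]
  refine mul_le_mul_of_nonneg_left ((h.bound τ k).trans ?_) (norm_nonneg _)
  rw [mul_assoc]
  refine mul_le_of_le_one_right h.nonneg ?_
  rw [← Real.exp_add, Real.exp_le_one_iff]
  have : 0 ≤ t / 2 * τ ^ 2 := by positivity
  have : 0 ≤ t * k := by positivity
  linarith

theorem HeatBound.norm_expIntegral_le (h : HeatBound g R t) (h0 : 0 < t) (ρ : ℝ) (k : ℕ) :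
    ‖expIntegral (fun τ => g τ k) ρ‖ ≤
      R * (∫ τ : ℝ, Real.exp (-(t / 2 * τ ^ 2))) * Real.exp (-(t * k)) := by
  refine (PartialOscillator.norm_expIntegral_le _ ρ).trans ?_
  rw [← integral_const_mul, ← integral_mul_const]
  exact integral_mono (h.integrable h0 k).norm
    (((integrable_exp_neg_half_mul_sq h0).const_mul R).mul_const _) fun τ => h.bound τ k

theorem fwdDiff_expIntegral (h : HeatBound g R t) (h0 : 0 < t) (ρ : ℝ) :
    fwdDiff 1 (fun k => expIntegral (fun τ => g τ k) ρ) =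
      fun k => expIntegral (fun τ => fwdDiff 1 (g τ) k) ρ := by
  funext k
  simp only [_root_.fwdDiff, expIntegral, mul_sub]
  exact (integral_sub (integrable_exp_mul (h.integrable h0 (k + 1)) ρ)
    (integrable_exp_mul (h.integrable h0 k) ρ)).symm

/-- The kernel `∑_μ (∫ e^{iτ(ρ-ρ')} g(τ,|μ|) dτ) (A_j^{*a} Φ_μ)(x) (A_j^{*b} Φ_μ)(x')`. -/
noncomputable def raiseKer (j : Fin d) (a b : ℕ) (g : ℝ → ℕ → ℂ)
    (z w : ℝ × EuclideanSpace ℝ (Fin d)) : ℂ :=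
  raiseKernel j a b (fun k => expIntegral (fun τ => g τ k) (z.1 - w.1)) z.2 w.2

theorem sub_mul_raiseKer (h : HeatBound g R t) (h0 : 0 < t) (h1 : t ≤ 1) (j : Fin d) (a b : ℕ)
    (z w : ℝ × EuclideanSpace ℝ (Fin d)) :
    ((z.2 j - w.2 j : ℝ) : ℂ) * raiseKer j a b g z w =
      a * raiseKer j (a - 1) b g z w - b * raiseKer j a (b - 1) g z w +
      (raiseKer j a (b + 1) (fun τ => fwdDiff 1 (g τ)) z w -
        raiseKer j (a + 1) b (fun τ => fwdDiff 1 (g τ)) z w) / 2 := by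
  simp only [raiseKer, ← fwdDiff_expIntegral h h0]
  exact sub_mul_raiseKernel j a b h0 h1 (h.norm_expIntegral_le h0 _) z.2 w.2

theorem continuous_raiseKer (h : HeatBound g R t) (h0 : 0 < t) (h1 : t ≤ 1) (j : Fin d) (a b : ℕ) :
    Continuous fun p : (ℝ × EuclideanSpace ℝ (Fin d)) × (ℝ × EuclideanSpace ℝ (Fin d)) =>
      raiseKer j a b g p.1 p.2 := by
  unfold raiseKer raiseKernel
  have hs := ((summable_exp_mul_raiseBound j a h0 h1).add
    (summable_exp_mul_raiseBound j b h0 h1)).mul_left (R * ∫ τ : ℝ, Real.exp (-(t / 2 * τ ^ 2)))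
  refine continuous_tsum (fun μ => ?_) hs fun μ p => norm_mul_raisePhi_mul_le j a b
    (c := fun k => expIntegral (fun τ => g τ k) (p.1.1 - p.2.1))
      (h.norm_expIntegral_le h0 (p.1.1 - p.2.1)) μ p.1.2 p.2.2
  · have h2 : Continuous fun p : (ℝ × EuclideanSpace ℝ (Fin d)) × (ℝ × EuclideanSpace ℝ (Fin d)) =>
        expIntegral (fun τ => g τ (∑ i, μ i)) (p.1.1 - p.2.1) :=
      (continuous_expIntegral (h.integrable h0 _)).comp
        ((continuous_fst.comp continuous_fst).sub (continuous_fst.comp continuous_snd))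
    have h3 : Continuous fun p : (ℝ × EuclideanSpace ℝ (Fin d)) × (ℝ × EuclideanSpace ℝ (Fin d)) =>
        raisePhi j a μ p.1.2 * raisePhi j b μ p.2.2 :=
      ((continuous_raisePhi j a μ).comp (continuous_snd.comp continuous_fst)).mul
        ((continuous_raisePhi j b μ).comp (continuous_snd.comp continuous_snd))
    exact h2.mul (Complex.continuous_ofReal.comp h3)

theorem enorm_sq_le_ofReal_sq {c : ℂ} {r : ℝ} (h : ‖c‖ ≤ r) : ‖c‖ₑ ^ 2 ≤ ENNReal.ofReal (r ^ 2) := by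
  rw [← ofReal_norm, ← ENNReal.ofReal_pow (norm_nonneg _)]
  exact ENNReal.ofReal_le_ofReal (pow_le_pow_left₀ (norm_nonneg _) h 2)

/-- The function `e₁ e^{-iτρ₁} Φ_ν(x₁) + e₂ e^{-iτρ₂} Φ_ν(x₂)` of `τ` and `ν`. -/
noncomputable def twoPoint (e₁ e₂ : ℂ) (w₁ w₂ : ℝ × EuclideanSpace ℝ (Fin d)) (ν : Fin d → ℕ)
    (τ : ℝ) : ℂ :=
  e₁ * (Complex.exp (Complex.I * τ * (-w₁.1 : ℝ)) * hermitePhi ν w₁.2) +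
    e₂ * (Complex.exp (Complex.I * τ * (-w₂.1 : ℝ)) * hermitePhi ν w₂.2)

/-- The squared `L²` norm of `twoPoint` against the heat weight. -/
noncomputable def twoPointMass (t : ℝ) (e₁ e₂ : ℂ) (w₁ w₂ : ℝ × EuclideanSpace ℝ (Fin d)) : ℝ≥0∞ :=
  ∑' ν : Fin d → ℕ, ENNReal.ofReal (Real.exp (-(t * (∑ i, ν i : ℕ)))) *
    ∫⁻ τ : ℝ, ENNReal.ofReal (Real.exp (-(t * τ ^ 2))) * ‖twoPoint e₁ e₂ w₁ w₂ ν τ‖ₑ ^ 2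

theorem continuous_twoPoint (e₁ e₂ : ℂ) (w₁ w₂ : ℝ × EuclideanSpace ℝ (Fin d)) (ν : Fin d → ℕ) :
    Continuous (twoPoint e₁ e₂ w₁ w₂ ν) := by
  unfold twoPoint
  fun_prop

theorem expIntegral_sub {g : ℝ → ℂ} (ρ ρ' : ℝ) : expIntegral g (ρ - ρ') =
    expIntegral (fun τ => Complex.exp (Complex.I * τ * (-ρ' : ℝ)) * g τ) ρ := by
  unfold expIntegral
  refine integral_congr_ae (.of_forall fun τ => ?_)
  simp only
  rw [← mul_assoc, ← Complex.exp_add]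
  push_cast
  ring_nf

theorem norm_twoPoint_le (e₁ e₂ : ℂ) (w₁ w₂ : ℝ × EuclideanSpace ℝ (Fin d)) (ν : Fin d → ℕ)
    (τ : ℝ) : ‖twoPoint e₁ e₂ w₁ w₂ ν τ‖ ≤
      ‖e₁‖ * |hermitePhi ν w₁.2| + ‖e₂‖ * |hermitePhi ν w₂.2| := by
  refine (norm_add_le _ _).trans (le_of_eq ?_)
  simp only [norm_mul, norm_exp_I_mul_mul, one_mul, Complex.norm_real, Real.norm_eq_abs]

/-- Squaring g gives e^{-2tk}. One factor e^{-tk} pays for the two creation coefficients, each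
e^{tn/2} with n ≤ k; the other one is kept as the heat weight. Moving the weight from k to k+b costs
e^{tb} ≤ e^b. -/
theorem HeatBound.norm_sq_mul_raiseCoeff_sq_le (h : HeatBound g R t) (h0 : 0 < t) (h1 : t ≤ 1)
    {a b : ℕ} {Ca Cb : ℝ} (hCa : 0 < Ca) (hCb : 0 < Cb)
    (hlea : ∀ s : ℝ, 0 < s → s ≤ 1 → ∀ n : ℕ,
      raiseCoeff n a ^ 2 ≤ Ca * (s⁻¹) ^ a * Real.exp (s * n))
    (hleb : ∀ s : ℝ, 0 < s → s ≤ 1 → ∀ n : ℕ,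
      raiseCoeff n b ^ 2 ≤ Cb * (s⁻¹) ^ b * Real.exp (s * n)) (τ : ℝ) {n k : ℕ} (hn : n ≤ k) :
    ‖g τ k‖ ^ 2 * (raiseCoeff n a ^ 2 * raiseCoeff n b ^ 2) ≤
      (Ca * Cb * 2 ^ (a + b) * Real.exp b * R ^ 2 * t⁻¹ ^ (a + b)) *
        (Real.exp (-(t * (k + b : ℕ))) * Real.exp (-(t * τ ^ 2))) := by
  have hn' : (n : ℝ) ≤ k := by exact_mod_cast hn
  have e1 : ‖g τ k‖ ^ 2 ≤ R ^ 2 * Real.exp (-(t * τ ^ 2)) * Real.exp (-(2 * t * k)) := by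
    refine (pow_le_pow_left₀ (norm_nonneg _) (h.bound τ k) 2).trans (le_of_eq ?_)
    rw [mul_pow, mul_pow, ← Real.exp_nat_mul, ← Real.exp_nat_mul]
    push_cast
    ring_nf
  have e2 := hlea (t / 2) (by linarith) (by linarith) n
  have e3 := hleb (t / 2) (by linarith) (by linarith) n
  have e4 : Real.exp (-(2 * t * k)) * (Real.exp (t / 2 * n) * Real.exp (t / 2 * n)) ≤
      Real.exp b * Real.exp (-(t * (k + b : ℕ))) := by
    rw [← Real.exp_add, ← Real.exp_add, ← Real.exp_add, Real.exp_le_exp]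
    push_cast
    have : t * b ≤ b := mul_le_of_le_one_left (Nat.cast_nonneg b) h1
    nlinarith [mul_le_mul_of_nonneg_left hn' h0.le]
  calc _ ≤ (R ^ 2 * Real.exp (-(t * τ ^ 2)) * Real.exp (-(2 * t * k))) *
        ((Ca * ((t / 2)⁻¹) ^ a * Real.exp (t / 2 * n)) *
          (Cb * ((t / 2)⁻¹) ^ b * Real.exp (t / 2 * n))) := by gcongr
    _ = (R ^ 2 * Real.exp (-(t * τ ^ 2)) * (Ca * Cb * 2 ^ (a + b) * t⁻¹ ^ (a + b))) *
        (Real.exp (-(2 * t * k)) * (Real.exp (t / 2 * n) * Real.exp (t / 2 * n))) := by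
      rw [inv_div, div_eq_mul_inv, mul_pow, mul_pow, pow_add, pow_add]
      ring
    _ ≤ (R ^ 2 * Real.exp (-(t * τ ^ 2)) * (Ca * Cb * 2 ^ (a + b) * t⁻¹ ^ (a + b))) *
        (Real.exp b * Real.exp (-(t * (k + b : ℕ)))) := by gcongr
    _ = _ := by ring

theorem enorm_sq_eq_ofReal (c : ℂ) : ‖c‖ₑ ^ 2 = ENNReal.ofReal (‖c‖ ^ 2) := by
  rw [← ofReal_norm, ← ENNReal.ofReal_pow (norm_nonneg _)]

/-- The Fourier coefficients of `e₁ raiseKer(·, w₁) + e₂ raiseKer(·, w₂)`. -/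
noncomputable def twoPointCoeff (j : Fin d) (a b : ℕ) (g : ℝ → ℕ → ℂ) (e₁ e₂ : ℂ)
    (w₁ w₂ : ℝ × EuclideanSpace ℝ (Fin d)) (μ : Fin d → ℕ) (τ : ℝ) : ℂ :=
  g τ (∑ i, μ i) * (((raiseCoeff (μ j) a * raiseCoeff (μ j) b : ℝ) : ℂ) *
      twoPoint e₁ e₂ w₁ w₂ (μ + Pi.single j b) τ)

theorem HeatBound.measurable_twoPointCoeff (hg : HeatBound g R t) (j : Fin d) (a b : ℕ) (e₁ e₂ : ℂ)
    (w₁ w₂ : ℝ × EuclideanSpace ℝ (Fin d)) (μ : Fin d → ℕ) :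
    Measurable (twoPointCoeff j a b g e₁ e₂ w₁ w₂ μ) :=
  (hg.measurable _).mul (measurable_const.mul (continuous_twoPoint _ _ _ _ _).measurable)

theorem norm_twoPointCoeff_le (j : Fin d) (a b : ℕ) (g : ℝ → ℕ → ℂ) (e₁ e₂ : ℂ)
    (w₁ w₂ : ℝ × EuclideanSpace ℝ (Fin d)) (μ : Fin d → ℕ) (τ : ℝ) :
    ‖twoPointCoeff j a b g e₁ e₂ w₁ w₂ μ τ‖ ≤
      ‖g τ (∑ i, μ i)‖ * (|raiseCoeff (μ j) a * raiseCoeff (μ j) b| *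
      (‖e₁‖ * |hermitePhi (μ + Pi.single j b) w₁.2| +
        ‖e₂‖ * |hermitePhi (μ + Pi.single j b) w₂.2|)) := by
  rw [twoPointCoeff, norm_mul, norm_mul, Complex.norm_real, Real.norm_eq_abs]
  exact mul_le_mul_of_nonneg_left (mul_le_mul_of_nonneg_left (norm_twoPoint_le _ _ _ _ _ _)
    (abs_nonneg _)) (norm_nonneg _)

theorem HeatBound.integrable_twoPointCoeff (hg : HeatBound g R t) (h0 : 0 < t) (j : Fin d) (a b : ℕ)
    (e₁ e₂ : ℂ) (w₁ w₂ : ℝ × EuclideanSpace ℝ (Fin d)) (μ : Fin d → ℕ) :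
    Integrable (twoPointCoeff j a b g e₁ e₂ w₁ w₂ μ) :=
  Integrable.mono' ((hg.integrable h0 _).norm.mul_const _)
    (hg.measurable_twoPointCoeff j a b e₁ e₂ w₁ w₂ μ).aestronglyMeasurable
    (.of_forall (norm_twoPointCoeff_le j a b g e₁ e₂ w₁ w₂ μ))

theorem HeatBound.memLp_twoPointCoeff (hg : HeatBound g R t) (h0 : 0 < t) (j : Fin d) (a b : ℕ)
    (e₁ e₂ : ℂ) (w₁ w₂ : ℝ × EuclideanSpace ℝ (Fin d)) (μ : Fin d → ℕ) :
    MemLp (twoPointCoeff j a b g e₁ e₂ w₁ w₂ μ) 2 volume := by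
  have h := (hg.memLp h0 (∑ i, μ i)).norm.mul_const (|raiseCoeff (μ j) a * raiseCoeff (μ j) b| *
      (‖e₁‖ * |hermitePhi (μ + Pi.single j b) w₁.2| +
        ‖e₂‖ * |hermitePhi (μ + Pi.single j b) w₂.2|))
  refine h.of_le (hg.measurable_twoPointCoeff j a b e₁ e₂ w₁ w₂ μ).aestronglyMeasurable
    (.of_forall fun τ => ?_)
  exact (norm_twoPointCoeff_le j a b g e₁ e₂ w₁ w₂ μ τ).trans (Real.le_norm_self _)

theorem HeatBound.expIntegral_twoPointCoeff (hg : HeatBound g R t) (h0 : 0 < t) (j : Fin d)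
    (a b : ℕ) (e₁ e₂ : ℂ) (w₁ w₂ : ℝ × EuclideanSpace ℝ (Fin d)) (μ : Fin d → ℕ) (ρ : ℝ) :
    expIntegral (twoPointCoeff j a b g e₁ e₂ w₁ w₂ μ) ρ =
      ((raiseCoeff (μ j) a * raiseCoeff (μ j) b : ℝ) : ℂ) *
        (e₁ * hermitePhi (μ + Pi.single j b) w₁.2 *
            expIntegral (fun τ => g τ (∑ i, μ i)) (ρ - w₁.1) +
          e₂ * hermitePhi (μ + Pi.single j b) w₂.2 *
            expIntegral (fun τ => g τ (∑ i, μ i)) (ρ - w₂.1)) := by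
  rw [expIntegral_sub, expIntegral_sub]
  unfold expIntegral
  have hi := fun w : ℝ × EuclideanSpace ℝ (Fin d) => integrable_exp_mul
    (integrable_exp_mul (hg.integrable h0 (∑ i, μ i)) (-w.1)) ρ
  rw [← integral_const_mul, ← integral_const_mul, ← integral_add ((hi w₁).const_mul _)
    ((hi w₂).const_mul _), ← integral_const_mul]
  refine integral_congr_ae (.of_forall fun τ => ?_)
  simp only [twoPointCoeff, twoPoint]
  ring

theorem HeatBound.hasSum_twoPointCoeff (hg : HeatBound g R t) (h0 : 0 < t) (h1 : t ≤ 1) (j : Fin d)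
    (a b : ℕ) (e₁ e₂ : ℂ) (w₁ w₂ : ℝ × EuclideanSpace ℝ (Fin d)) (ρ : ℝ)
    (x : EuclideanSpace ℝ (Fin d)) :
    HasSum (fun μ : Fin d → ℕ => expIntegral (twoPointCoeff j a b g e₁ e₂ w₁ w₂ μ) ρ *
      (hermitePhi (μ + Pi.single j a) x : ℂ))
      (e₁ * raiseKer j a b g (ρ, x) w₁ + e₂ * raiseKer j a b g (ρ, x) w₂) := by
  have hs := fun w : ℝ × EuclideanSpace ℝ (Fin d) =>
    (summable_mul_raisePhi_mul j a b h0 h1 (hg.norm_expIntegral_le h0 (ρ - w.1)) x w.2).hasSum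
  refine (((hs w₁).mul_left e₁).add ((hs w₂).mul_left e₂)).congr_fun fun μ => ?_
  rw [hg.expIntegral_twoPointCoeff h0]
  simp only [raisePhi]
  push_cast
  ring

theorem HeatBound.enorm_twoPointCoeff_sq_le (hg : HeatBound g R t) (h0 : 0 < t) (h1 : t ≤ 1)
    {a b : ℕ} {Ca Cb : ℝ} (hCa : 0 < Ca) (hCb : 0 < Cb)
    (hlea : ∀ s : ℝ, 0 < s → s ≤ 1 → ∀ n : ℕ,
      raiseCoeff n a ^ 2 ≤ Ca * (s⁻¹) ^ a * Real.exp (s * n))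
    (hleb : ∀ s : ℝ, 0 < s → s ≤ 1 → ∀ n : ℕ,
      raiseCoeff n b ^ 2 ≤ Cb * (s⁻¹) ^ b * Real.exp (s * n)) (j : Fin d) (e₁ e₂ : ℂ)
    (w₁ w₂ : ℝ × EuclideanSpace ℝ (Fin d)) (μ : Fin d → ℕ) (τ : ℝ) :
    ‖twoPointCoeff j a b g e₁ e₂ w₁ w₂ μ τ‖ₑ ^ 2 ≤
      ENNReal.ofReal (Ca * Cb * 2 ^ (a + b) * Real.exp b * R ^ 2 * t⁻¹ ^ (a + b)) *
      (ENNReal.ofReal (Real.exp (-(t * (∑ i, (μ + Pi.single j b : Fin d → ℕ) i : ℕ)))) *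
      (ENNReal.ofReal (Real.exp (-(t * τ ^ 2))) *
        ‖twoPoint e₁ e₂ w₁ w₂ (μ + Pi.single j b) τ‖ₑ ^ 2)) := by
  have h2 := hg.norm_sq_mul_raiseCoeff_sq_le h0 h1 hCa hCb hlea hleb τ (apply_le_sum μ j)
  rw [← mul_assoc, ← mul_assoc, ← ENNReal.ofReal_mul (by positivity),
    ← ENNReal.ofReal_mul (by positivity), sum_add_single, twoPointCoeff, ← mul_assoc, enorm_mul,
    mul_pow]
  refine mul_le_mul_left ?_ _
  rw [enorm_sq_eq_ofReal, norm_mul, mul_pow, Complex.norm_real, Real.norm_eq_abs, sq_abs, mul_pow]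
  refine ENNReal.ofReal_le_ofReal (h2.trans (le_of_eq ?_))
  ring

/-- For fixed ρ the kernel is a Hermite series in the orthonormal functions Φ_{μ+ae_j}, so Parseval
applies in x and Plancherel in ρ. What remains is the heat weighted mass of the second variable,
times t^{-(a+b)} for the creation operators. Two base points are carried along so that one estimate
covers both single kernels and differences. -/
theorem exists_lintegral_twoPoint_raiseKer_le (j : Fin d) (a b : ℕ) : ∃ C : ℝ, 0 ≤ C ∧
    ∀ (t R : ℝ) (g : ℝ → ℕ → ℂ), 0 < t → t ≤ 1 → HeatBound g R t →
    ∀ (e₁ e₂ : ℂ) (w₁ w₂ : ℝ × EuclideanSpace ℝ (Fin d)),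
    ∫⁻ z, ‖e₁ * raiseKer j a b g z w₁ + e₂ * raiseKer j a b g z w₂‖ₑ ^ 2 ≤
      ENNReal.ofReal (C * R ^ 2 * t⁻¹ ^ (a + b)) * twoPointMass t e₁ e₂ w₁ w₂ := by
  obtain ⟨Ca, hCa, hlea⟩ := exists_raiseCoeff_sq_le a
  obtain ⟨Cb, hCb, hleb⟩ := exists_raiseCoeff_sq_le b
  refine ⟨2 * Real.pi * (Ca * Cb * 2 ^ (a + b) * Real.exp b), by positivity,
    fun t R g h0 h1 hg e₁ e₂ w₁ w₂ => ?_⟩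
  have hR := hg.nonneg
  have hK0 : 0 ≤ Ca * Cb * 2 ^ (a + b) * Real.exp b := by positivity
  generalize hK : Ca * Cb * 2 ^ (a + b) * Real.exp b = K at hK0
  obtain ⟨Q, hQ⟩ : ∃ Q : (Fin d → ℕ) → ℝ≥0∞, Q = fun ν =>
    ENNReal.ofReal (Real.exp (-(t * (∑ i, ν i : ℕ)))) *
    ∫⁻ τ : ℝ, ENNReal.ofReal (Real.exp (-(t * τ ^ 2))) * ‖twoPoint e₁ e₂ w₁ w₂ ν τ‖ₑ ^ 2 := ⟨_, rfl⟩
  have hM : twoPointMass t e₁ e₂ w₁ w₂ = ∑' ν, Q ν := by rw [hQ]; rfl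
  rw [hM]
  have hterm : ∀ μ, ∫⁻ ρ : ℝ, ‖expIntegral (twoPointCoeff j a b g e₁ e₂ w₁ w₂ μ) ρ‖ₑ ^ 2 ≤
      ENNReal.ofReal (2 * Real.pi * K * R ^ 2 * t⁻¹ ^ (a + b)) * Q (μ + Pi.single j b) := fun μ => by
    rw [lintegral_enorm_expIntegral_sq (hg.integrable_twoPointCoeff h0 j a b e₁ e₂ w₁ w₂ μ)
      (hg.memLp_twoPointCoeff h0 j a b e₁ e₂ w₁ w₂ μ)]
    refine (mul_le_mul_right (lintegral_mono fun τ =>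
      hg.enorm_twoPointCoeff_sq_le h0 h1 hCa hCb hlea hleb j e₁ e₂ w₁ w₂ μ τ) _).trans
      (le_of_eq ?_)
    rw [hK, lintegral_const_mul' _ _ ENNReal.ofReal_ne_top,
        lintegral_const_mul' _ _ ENNReal.ofReal_ne_top, ← mul_assoc,
        ← ENNReal.ofReal_mul (by positivity)]
    simp only [hQ]
    congr 2
    ring
  calc ∫⁻ z, ‖e₁ * raiseKer j a b g z w₁ + e₂ * raiseKer j a b g z w₂‖ₑ ^ 2
      ≤ ∫⁻ ρ : ℝ, ∫⁻ x, ‖e₁ * raiseKer j a b g (ρ, x) w₁ + e₂ * raiseKer j a b g (ρ, x) w₂‖ₑ ^ 2 :=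
        lintegral_prod_le _
    _ ≤ ∫⁻ ρ : ℝ, ∑' μ, ‖expIntegral (twoPointCoeff j a b g e₁ e₂ w₁ w₂ μ) ρ‖ₑ ^ 2 :=
        -- The shift μ ↦ μ + a e_j is injective, hence the functions Φ_{μ+ae_j} stay orthonormal.
        lintegral_mono fun ρ => lintegral_enorm_hasSum_hermitePhi_sq_le (add_single_injective j a)
          (hg.hasSum_twoPointCoeff h0 h1 j a b e₁ e₂ w₁ w₂ ρ)
    _ = ∑' μ, ∫⁻ ρ : ℝ, ‖expIntegral (twoPointCoeff j a b g e₁ e₂ w₁ w₂ μ) ρ‖ₑ ^ 2 :=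
        lintegral_tsum fun μ => ((ENNReal.continuous_pow 2).comp (continuous_enorm.comp
          (continuous_expIntegral
            (hg.integrable_twoPointCoeff h0 j a b e₁ e₂ w₁ w₂ μ)))).measurable.aemeasurable
    _ ≤ ∑' μ, ENNReal.ofReal (2 * Real.pi * K * R ^ 2 * t⁻¹ ^ (a + b)) * Q (μ + Pi.single j b) :=
      ENNReal.tsum_le_tsum hterm
    _ ≤ _ := by
      rw [ENNReal.tsum_mul_left]
      exact mul_le_mul_right
        (ENNReal.tsum_comp_le_tsum_of_injective (add_single_injective j b) Q) _

end PartialOscillator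

namespace PartialOscillator

variable {d : ℕ} {g : ℝ → ℕ → ℂ} {R t : ℝ}

/-! ### Bounds for the mass -/

theorem lintegral_exp_neg_mul_sq_le (h0 : 0 < t) :
    ∫⁻ τ : ℝ, ENNReal.ofReal (Real.exp (-(t * τ ^ 2))) ≤
      ENNReal.ofReal (2 * t ^ (-(1 / 2) : ℝ)) := by
  simp only [← neg_mul]
  rw [← ofReal_integral_eq_lintegral_ofReal (integrable_exp_neg_mul_sq h0)
    (.of_forall fun τ => (Real.exp_pos _).le), integral_gaussian]
  apply ENNReal.ofReal_le_ofReal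
  rw [Real.sqrt_div Real.pi_pos.le, Real.rpow_neg h0.le, ← Real.sqrt_eq_rpow, div_eq_mul_inv]
  gcongr
  rw [Real.sqrt_le_left (by norm_num)]
  linarith [Real.pi_lt_four]

theorem lintegral_sq_mul_exp_neg_mul_sq_le (h0 : 0 < t) :
    ∫⁻ τ : ℝ, ENNReal.ofReal (τ ^ 2 * Real.exp (-(t * τ ^ 2))) ≤
      ENNReal.ofReal (8 * t ^ (-(1 / 2) : ℝ) * t⁻¹) := by
  calc ∫⁻ τ : ℝ, ENNReal.ofReal (τ ^ 2 * Real.exp (-(t * τ ^ 2)))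
      ≤ ∫⁻ τ : ℝ, ENNReal.ofReal (2 / t) * ENNReal.ofReal (Real.exp (-(t / 2 * τ ^ 2))) := by
        refine lintegral_mono fun τ => ?_
        rw [← ENNReal.ofReal_mul (by positivity)]
        exact ENNReal.ofReal_le_ofReal (mul_exp_neg_le h0 _)
    _ ≤ ENNReal.ofReal (2 / t) * ENNReal.ofReal (2 * (t / 2) ^ (-(1 / 2) : ℝ)) := by
        rw [lintegral_const_mul' _ _ ENNReal.ofReal_ne_top]
        gcongr
        exact lintegral_exp_neg_mul_sq_le (by positivity)
    _ ≤ _ := by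
        rw [← ENNReal.ofReal_mul (by positivity)]
        apply ENNReal.ofReal_le_ofReal
        have hC : (t / 2) ^ (-(1 / 2) : ℝ) ≤ 2 * t ^ (-(1 / 2) : ℝ) := by
          rw [Real.div_rpow h0.le (by norm_num), div_eq_mul_inv, mul_comm,
            ← Real.rpow_neg (by norm_num)]
          refine mul_le_mul_of_nonneg_right ?_ (by positivity)
          calc (2 : ℝ) ^ (-(-(1 / 2)) : ℝ) ≤ 2 ^ (1 : ℝ) :=
                Real.rpow_le_rpow_of_exponent_le (by norm_num) (by norm_num)
            _ = 2 := by simp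
        calc 2 / t * (2 * (t / 2) ^ (-(1 / 2) : ℝ)) ≤ 2 / t * (2 * (2 * t ^ (-(1 / 2) : ℝ))) := by
              gcongr
          _ = _ := by ring

/-- The phase has modulus one, so the mass is the diagonal Hermite heat kernel times a Gaussian
integral, which supplies the additional factor t^{-1/2} for the variable ρ. -/
theorem twoPointMass_one_zero_le (h0 : 0 < t) (h1 : t ≤ 1) (w w' : ℝ × EuclideanSpace ℝ (Fin d)) :
    twoPointMass t 1 0 w w' ≤ ENNReal.ofReal ((2 * t ^ (-(1 / 2) : ℝ)) ^ (d + 1)) := by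
  have e : ∀ (ν : Fin d → ℕ) τ, ‖twoPoint 1 0 w w' ν τ‖ₑ ^ 2 =
      ENNReal.ofReal (hermitePhi ν w.2 ^ 2) := fun ν τ => by
    rw [enorm_sq_eq_ofReal, twoPoint, zero_mul, add_zero, one_mul, norm_mul, norm_exp_I_mul_mul,
      one_mul, Complex.norm_real, Real.norm_eq_abs, sq_abs]
  calc
    twoPointMass t 1 0 w w' = (∑' ν : Fin d → ℕ,
        ENNReal.ofReal (Real.exp (-(t * (∑ i, ν i : ℕ))) * hermitePhi ν w.2 ^ 2)) *
        ∫⁻ τ : ℝ, ENNReal.ofReal (Real.exp (-(t * τ ^ 2))) := by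
      rw [twoPointMass, ← ENNReal.tsum_mul_right]
      refine tsum_congr fun ν => ?_
      simp only [e]
      rw [lintegral_mul_const' _ _ ENNReal.ofReal_ne_top, ENNReal.ofReal_mul (by positivity)]
      ring
    _ ≤ ENNReal.ofReal ((2 * t ^ (-(1 / 2) : ℝ)) ^ d) * ENNReal.ofReal (2 * t ^ (-(1 / 2) : ℝ)) :=
      mul_le_mul' (tsum_exp_mul_sq_hermitePhi_le h0 h1 w.2) (lintegral_exp_neg_mul_sq_le h0)
    _ = _ := by rw [← ENNReal.ofReal_mul (by positivity), pow_succ]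

theorem norm_exp_I_sub_exp_I_le (τ a b : ℝ) :
    ‖Complex.exp (Complex.I * τ * a) - Complex.exp (Complex.I * τ * b)‖ ≤ |τ| * |a - b| := by
  have e : Complex.exp (Complex.I * τ * a) - Complex.exp (Complex.I * τ * b) =
      Complex.exp (Complex.I * τ * b) * (Complex.exp (Complex.I * (τ * (a - b) : ℝ)) - 1) := by
    rw [mul_sub, mul_one, ← Complex.exp_add]
    push_cast
    ring_nf
  rw [e, norm_mul, norm_exp_I_mul_mul, one_mul]
  refine (Real.norm_exp_I_mul_ofReal_sub_one_le).trans ?_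
  rw [Real.norm_eq_abs, abs_mul]

theorem norm_twoPoint_sub_sq_le (w₁ w₂ : ℝ × EuclideanSpace ℝ (Fin d)) (ν : Fin d → ℕ) (τ : ℝ) :
    ‖twoPoint 1 (-1) w₁ w₂ ν τ‖ ^ 2 ≤ 2 * (hermitePhi ν w₁.2 - hermitePhi ν w₂.2) ^ 2 +
      2 * ‖w₁ - w₂‖ ^ 2 * (τ ^ 2 * hermitePhi ν w₂.2 ^ 2) := by
  have e : twoPoint 1 (-1) w₁ w₂ ν τ = Complex.exp (Complex.I * τ * (-w₁.1 : ℝ)) *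
      ((hermitePhi ν w₁.2 - hermitePhi ν w₂.2 : ℝ) : ℂ) +
      (Complex.exp (Complex.I * τ * (-w₁.1 : ℝ)) - Complex.exp (Complex.I * τ * (-w₂.1 : ℝ))) *
        hermitePhi ν w₂.2 := by
    simp only [twoPoint]
    push_cast
    ring
  have h : ‖twoPoint 1 (-1) w₁ w₂ ν τ‖ ≤ |hermitePhi ν w₁.2 - hermitePhi ν w₂.2| +
      ‖w₁ - w₂‖ * (|τ| * |hermitePhi ν w₂.2|) := by
    rw [e]
    refine (norm_add_le _ _).trans ?_
    rw [norm_mul, norm_mul, norm_exp_I_mul_mul, one_mul, Complex.norm_real, Complex.norm_real,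
      Real.norm_eq_abs, Real.norm_eq_abs]
    have h2 : ‖Complex.exp (Complex.I * τ * (-w₁.1 : ℝ)) -
        Complex.exp (Complex.I * τ * (-w₂.1 : ℝ))‖ ≤ |τ| * ‖w₁ - w₂‖ := by
      refine (norm_exp_I_sub_exp_I_le _ _ _).trans (mul_le_mul_of_nonneg_left ?_ (abs_nonneg _))
      rw [show -w₁.1 - -w₂.1 = -((w₁ - w₂).1) by simp; ring, abs_neg]
      exact norm_fst_le (w₁ - w₂)
    have := mul_le_mul_of_nonneg_right h2 (abs_nonneg (hermitePhi ν w₂.2))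
    linarith
  refine (pow_le_pow_left₀ (norm_nonneg _) h 2).trans ?_
  have h3 : ∀ a b : ℝ, (a + b) ^ 2 ≤ 2 * a ^ 2 + 2 * b ^ 2 := fun a b => by
    nlinarith [sq_nonneg (a - b)]
  refine (h3 _ _).trans (le_of_eq ?_)
  rw [mul_pow, mul_pow, sq_abs, sq_abs, sq_abs]
  ring

/-- Change x first and ρ second: the difference of the Φ_ν is controlled by the mean value bound
above, and the difference of the phases by |τ| |w₁-w₂|, where τ² against the Gaussian costs t⁻¹. -/
theorem exists_twoPointMass_sub_le (d : ℕ) : ∃ C : ℝ, 0 ≤ C ∧ ∀ (t : ℝ), 0 < t → t ≤ 1 →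
    ∀ w₁ w₂ : ℝ × EuclideanSpace ℝ (Fin d), twoPointMass t 1 (-1) w₁ w₂ ≤
      ENNReal.ofReal (C * (t ^ (-(1 / 2) : ℝ)) ^ (d + 1) * (‖w₁ - w₂‖ ^ 2 * t⁻¹)) := by
  refine ⟨4 * (d ^ 2 * 40 ^ d) + 16 * 2 ^ d, by positivity, fun t h0 h1 w₁ w₂ => ?_⟩
  set q := t ^ (-(1 / 2) : ℝ) with hq
  have hq0 : 0 < q := by positivity
  have e : ∀ (ν : Fin d → ℕ), ∫⁻ τ : ℝ, ENNReal.ofReal (Real.exp (-(t * τ ^ 2))) *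
        ‖twoPoint 1 (-1) w₁ w₂ ν τ‖ₑ ^ 2 ≤
      ENNReal.ofReal (2 * (hermitePhi ν w₁.2 - hermitePhi ν w₂.2) ^ 2) * ENNReal.ofReal (2 * q) +
      ENNReal.ofReal (2 * ‖w₁ - w₂‖ ^ 2 * hermitePhi ν w₂.2 ^ 2) *
        ENNReal.ofReal (8 * q * t⁻¹) := fun ν => by
    calc _ ≤ ∫⁻ τ : ℝ, (ENNReal.ofReal (2 * (hermitePhi ν w₁.2 - hermitePhi ν w₂.2) ^ 2) *
          ENNReal.ofReal (Real.exp (-(t * τ ^ 2))) +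
          ENNReal.ofReal (2 * ‖w₁ - w₂‖ ^ 2 * hermitePhi ν w₂.2 ^ 2) *
          ENNReal.ofReal (τ ^ 2 * Real.exp (-(t * τ ^ 2)))) := by
          refine lintegral_mono fun τ => ?_
          rw [enorm_sq_eq_ofReal, ← ENNReal.ofReal_mul (by positivity),
            ← ENNReal.ofReal_mul (by positivity), ← ENNReal.ofReal_mul (by positivity),
            ← ENNReal.ofReal_add (by positivity) (by positivity)]
          apply ENNReal.ofReal_le_ofReal
          have := mul_le_mul_of_nonneg_left (norm_twoPoint_sub_sq_le w₁ w₂ ν τ)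
            (Real.exp_pos (-(t * τ ^ 2))).le
          refine this.trans (le_of_eq ?_)
          ring
      _ ≤ _ := by
          rw [lintegral_add_left (by fun_prop), lintegral_const_mul' _ _ ENNReal.ofReal_ne_top,
            lintegral_const_mul' _ _ ENNReal.ofReal_ne_top]
          gcongr
          · exact lintegral_exp_neg_mul_sq_le h0
          · exact lintegral_sq_mul_exp_neg_mul_sq_le h0
  have hx : ‖w₁.2 - w₂.2‖ ≤ ‖w₁ - w₂‖ := norm_snd_le (w₁ - w₂)
  calc twoPointMass t 1 (-1) w₁ w₂
      ≤ ∑' ν : Fin d → ℕ, (ENNReal.ofReal (4 * q) *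
        ENNReal.ofReal (Real.exp (-(t * (∑ i, ν i : ℕ))) *
          (hermitePhi ν w₁.2 - hermitePhi ν w₂.2) ^ 2) +
        ENNReal.ofReal (16 * q * t⁻¹ * ‖w₁ - w₂‖ ^ 2) *
        ENNReal.ofReal (Real.exp (-(t * (∑ i, ν i : ℕ))) * hermitePhi ν w₂.2 ^ 2)) := by
        refine ENNReal.tsum_le_tsum fun ν => (mul_le_mul_right (e ν) _).trans (le_of_eq ?_)
        rw [← ENNReal.ofReal_mul (by positivity), ← ENNReal.ofReal_mul (by positivity), mul_add,
          ← ENNReal.ofReal_mul (by positivity), ← ENNReal.ofReal_mul (by positivity),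
          ← ENNReal.ofReal_mul (by positivity), ← ENNReal.ofReal_mul (by positivity)]
        congr 2 <;> ring
    _ ≤ ENNReal.ofReal (4 * q) *
          ENNReal.ofReal (d ^ 2 * (40 * q) ^ d * t⁻¹ * ‖w₁.2 - w₂.2‖ ^ 2) +
        ENNReal.ofReal (16 * q * t⁻¹ * ‖w₁ - w₂‖ ^ 2) * ENNReal.ofReal ((2 * q) ^ d) := by
        rw [ENNReal.tsum_add, ENNReal.tsum_mul_left, ENNReal.tsum_mul_left]
        gcongr
        · exact tsum_exp_mul_sq_hermitePhi_sub_le h0 h1 _ _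
        · exact tsum_exp_mul_sq_hermitePhi_le h0 h1 _
    _ ≤ ENNReal.ofReal (4 * q) *
          ENNReal.ofReal (d ^ 2 * (40 * q) ^ d * t⁻¹ * ‖w₁ - w₂‖ ^ 2) +
        ENNReal.ofReal (16 * q * t⁻¹ * ‖w₁ - w₂‖ ^ 2) * ENNReal.ofReal ((2 * q) ^ d) := by gcongr
    _ = _ := by
        rw [← ENNReal.ofReal_mul (by positivity), ← ENNReal.ofReal_mul (by positivity),
          ← ENNReal.ofReal_add (by positivity) (by positivity)]
        congr 1
        rw [mul_pow, mul_pow, pow_succ]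
        ring

/-! ### Weighted bounds -/

theorem enorm_add_four_sq_le (a b c e : ℂ) :
    ‖a + b + c + e‖ₑ ^ 2 ≤ 4 * (‖a‖ₑ ^ 2 + ‖b‖ₑ ^ 2 + ‖c‖ₑ ^ 2 + ‖e‖ₑ ^ 2) := by
  simp only [enorm_sq_eq_ofReal]
  rw [← ENNReal.ofReal_add (by positivity) (by positivity),
    ← ENNReal.ofReal_add (by positivity) (by positivity),
    ← ENNReal.ofReal_add (by positivity) (by positivity),
    show (4 : ℝ≥0∞) = ENNReal.ofReal 4 by simp, ← ENNReal.ofReal_mul (by norm_num)]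
  apply ENNReal.ofReal_le_ofReal
  have h : ‖a + b + c + e‖ ≤ ‖a‖ + ‖b‖ + ‖c‖ + ‖e‖ := norm_add₄_le
  have := pow_le_pow_left₀ (norm_nonneg _) h 2
  linarith [sq_nonneg (‖a‖ - ‖b‖), sq_nonneg (‖a‖ - ‖c‖), sq_nonneg (‖a‖ - ‖e‖),
    sq_nonneg (‖b‖ - ‖c‖), sq_nonneg (‖b‖ - ‖e‖), sq_nonneg (‖c‖ - ‖e‖),
    show (‖a‖ + ‖b‖ + ‖c‖ + ‖e‖) ^ 2 = 4 * (‖a‖ ^ 2 + ‖b‖ ^ 2 + ‖c‖ ^ 2 + ‖e‖ ^ 2) -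
      ((‖a‖ - ‖b‖) ^ 2 + (‖a‖ - ‖c‖) ^ 2 + (‖a‖ - ‖e‖) ^ 2 + (‖b‖ - ‖c‖) ^ 2 +
        (‖b‖ - ‖e‖) ^ 2 + (‖c‖ - ‖e‖) ^ 2) by ring]

/-- The combination of the kernels based at two points, weighted by a power of a coordinate
difference. -/
noncomputable def weightedTwoPoint (j : Fin d) (N a b : ℕ) (g : ℝ → ℕ → ℂ) (e₁ e₂ : ℂ)
    (w₁ w₂ z : ℝ × EuclideanSpace ℝ (Fin d)) : ℂ :=
  e₁ * (((z.2 j - w₁.2 j : ℝ) : ℂ) ^ N * raiseKer j a b g z w₁) +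
    e₂ * (((z.2 j - w₂.2 j : ℝ) : ℂ) ^ N * raiseKer j a b g z w₂)

theorem HeatBound.continuous_weightedTwoPoint (h : HeatBound g R t) (h0 : 0 < t) (h1 : t ≤ 1)
    (j : Fin d) (N a b : ℕ) (e₁ e₂ : ℂ) (w₁ w₂ : ℝ × EuclideanSpace ℝ (Fin d)) :
    Continuous (weightedTwoPoint j N a b g e₁ e₂ w₁ w₂) := by
  have hp : ∀ w : ℝ × EuclideanSpace ℝ (Fin d), Continuous
      fun z : ℝ × EuclideanSpace ℝ (Fin d) => (z, w) := fun w => by fun_prop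
  have hk : ∀ w, Continuous fun z : ℝ × EuclideanSpace ℝ (Fin d) => raiseKer j a b g z w :=
    fun w => by
      have := Continuous.comp (continuous_raiseKer h h0 h1 j a b) (hp w)
      simpa only [Function.comp_def] using this
  have hc : ∀ w : ℝ × EuclideanSpace ℝ (Fin d), Continuous
      fun z : ℝ × EuclideanSpace ℝ (Fin d) => ((z.2 j - w.2 j : ℝ) : ℂ) ^ N := fun w => by
    fun_prop
  exact (continuous_const.mul ((hc w₁).mul (hk w₁))).add
    (continuous_const.mul ((hc w₂).mul (hk w₂)))

theorem HeatBound.weightedTwoPoint_succ (h : HeatBound g R t) (h0 : 0 < t) (h1 : t ≤ 1)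
    (j : Fin d) (N a b : ℕ) (e₁ e₂ : ℂ) (w₁ w₂ z : ℝ × EuclideanSpace ℝ (Fin d)) :
    weightedTwoPoint j (N + 1) a b g e₁ e₂ w₁ w₂ z =
      a * weightedTwoPoint j N (a - 1) b g e₁ e₂ w₁ w₂ z +
      -b * weightedTwoPoint j N a (b - 1) g e₁ e₂ w₁ w₂ z +
      (1 / 2) * weightedTwoPoint j N a (b + 1) (fun τ => _root_.fwdDiff 1 (g τ)) e₁ e₂ w₁ w₂ z +
      (-1 / 2) * weightedTwoPoint j N (a + 1) b (fun τ => _root_.fwdDiff 1 (g τ)) e₁ e₂ w₁ w₂ z := by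
  have h2 := sub_mul_raiseKer h h0 h1 j a b z w₁
  have h3 := sub_mul_raiseKer h h0 h1 j a b z w₂
  simp only [weightedTwoPoint, pow_succ]
  linear_combination (e₁ * ((z.2 j - w₁.2 j : ℝ) : ℂ) ^ N) * h2 +
    (e₂ * ((z.2 j - w₂.2 j : ℝ) : ℂ) ^ N) * h3

/-- Induction on the power of the weight. For squared norms a creation operator costs t⁻¹ and a
difference of g gains t². Both types of terms in the commutator identity, losing a creation operator
or gaining one with a difference, therefore gain exactly one factor t. -/
theorem exists_lintegral_weightedTwoPoint_le (j : Fin d) (N a b : ℕ) : ∃ C : ℝ, 0 ≤ C ∧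
    ∀ (t R : ℝ) (g : ℝ → ℕ → ℂ), 0 < t → t ≤ 1 →
    (∀ l ≤ N, HeatBound (fun τ => (fwdDiff 1)^[l] (g τ)) (R * t ^ l) t) →
    ∀ (e₁ e₂ : ℂ) (w₁ w₂ : ℝ × EuclideanSpace ℝ (Fin d)),
    ∫⁻ z, ‖weightedTwoPoint j N a b g e₁ e₂ w₁ w₂ z‖ₑ ^ 2 ≤
      ENNReal.ofReal (C * (R ^ 2 * t ^ N * t⁻¹ ^ (a + b))) * twoPointMass t e₁ e₂ w₁ w₂ := by
  induction N generalizing a b with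
  | zero =>
    obtain ⟨C, hC, h⟩ := exists_lintegral_twoPoint_raiseKer_le j a b
    refine ⟨C, hC, fun t R g h0 h1 hg e₁ e₂ w₁ w₂ => ?_⟩
    have := h t R g h0 h1 (by simpa using hg 0 le_rfl) e₁ e₂ w₁ w₂
    simpa [weightedTwoPoint, mul_assoc] using this
  | succ N ih =>
    obtain ⟨C1, hC1, ih1⟩ := ih (a - 1) b
    obtain ⟨C2, hC2, ih2⟩ := ih a (b - 1)
    obtain ⟨C3, hC3, ih3⟩ := ih a (b + 1)
    obtain ⟨C4, hC4, ih4⟩ := ih (a + 1) b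
    refine ⟨4 * (a ^ 2 * C1 + b ^ 2 * C2 + 1 / 4 * C3 + 1 / 4 * C4), by positivity,
      fun t R g h0 h1 hg e₁ e₂ w₁ w₂ => ?_⟩
    have hg0 : HeatBound g R t := by simpa using hg 0 (Nat.zero_le _)
    have hR := hg0.nonneg
    have hg1 : ∀ l ≤ N, HeatBound (fun τ => (fwdDiff 1)^[l] (g τ)) (R * t ^ l) t :=
      fun l hl => hg l (hl.trans (Nat.le_succ N))
    have hg2 : ∀ l ≤ N, HeatBound (fun τ => (fwdDiff 1)^[l] (fwdDiff 1 (g τ)))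
        (R * t * t ^ l) t := fun l hl => by
      have := hg (l + 1) (Nat.succ_le_succ hl)
      rwa [pow_succ', ← mul_assoc] at this
    have hg3 : HeatBound (fun τ => fwdDiff 1 (g τ)) (R * t) t := by
      simpa using hg2 0 (Nat.zero_le _)
    have i1 := ih1 t R g h0 h1 hg1 e₁ e₂ w₁ w₂
    have i2 := ih2 t R g h0 h1 hg1 e₁ e₂ w₁ w₂
    have i3 := ih3 t (R * t) _ h0 h1 hg2 e₁ e₂ w₁ w₂
    have i4 := ih4 t (R * t) _ h0 h1 hg2 e₁ e₂ w₁ w₂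
    have m1 := hg0.continuous_weightedTwoPoint h0 h1 j N (a - 1) b e₁ e₂ w₁ w₂
    have m2 := hg0.continuous_weightedTwoPoint h0 h1 j N a (b - 1) e₁ e₂ w₁ w₂
    have m3 := hg3.continuous_weightedTwoPoint h0 h1 j N a (b + 1) e₁ e₂ w₁ w₂
    have hms : ∀ (c : ℂ) {f : ℝ × EuclideanSpace ℝ (Fin d) → ℂ}, Continuous f →
        Measurable fun z => ‖c * f z‖ₑ ^ 2 := fun c f hf => by
      have := (continuous_const (y := c)).mul hf
      exact this.measurable.enorm.pow_const 2
    have hpull : ∀ (c : ℂ) (r : ℝ), ‖c‖ ^ 2 = r → ∀ f : ℝ × EuclideanSpace ℝ (Fin d) → ℂ,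
        ∫⁻ z, ‖c * f z‖ₑ ^ 2 = ENNReal.ofReal r * ∫⁻ z, ‖f z‖ₑ ^ 2 := fun c r hr f => by
      simp only [enorm_mul, mul_pow]
      rw [lintegral_const_mul' _ _ (by simp), enorm_sq_eq_ofReal, hr]
    set S := R ^ 2 * t ^ (N + 1) * t⁻¹ ^ (a + b) with hS
    have hS0 : 0 ≤ S := by positivity
    have htt : t * t⁻¹ = 1 := mul_inv_cancel₀ h0.ne'
    -- For a = 0 the truncated a-1 would give the wrong power of t⁻¹, but the prefactor a² is zero.
    have s1 : (a : ℝ) ^ 2 * (C1 * (R ^ 2 * t ^ N * t⁻¹ ^ (a - 1 + b))) = a ^ 2 * C1 * S := by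
      rcases a with _ | a
      · simp
      · rw [hS, Nat.add_sub_cancel, show a + 1 + b = a + b + 1 by ring, pow_succ, pow_succ _ (a + b)]
        linear_combination (-((a + 1 : ℕ) : ℝ) ^ 2 * C1 * R ^ 2 * t ^ N * t⁻¹ ^ (a + b)) * htt
    have s2 : (b : ℝ) ^ 2 * (C2 * (R ^ 2 * t ^ N * t⁻¹ ^ (a + (b - 1)))) = b ^ 2 * C2 * S := by
      rcases b with _ | b
      · simp
      · rw [hS, Nat.add_sub_cancel, show a + (b + 1) = a + b + 1 by ring, pow_succ,
          pow_succ _ (a + b)]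
        linear_combination (-((b + 1 : ℕ) : ℝ) ^ 2 * C2 * R ^ 2 * t ^ N * t⁻¹ ^ (a + b)) * htt
    -- The difference replaces R by Rt, and t² t⁻¹ = t is the net gain.
    have s3 : (R * t) ^ 2 * t ^ N * t⁻¹ ^ (a + (b + 1)) = S := by
      rw [hS, show a + (b + 1) = a + b + 1 by ring, pow_succ _ (a + b), pow_succ]
      linear_combination (R ^ 2 * t * t ^ N * t⁻¹ ^ (a + b)) * htt
    have s4 : (R * t) ^ 2 * t ^ N * t⁻¹ ^ (a + 1 + b) = S := by
      rw [← s3]; ring_nf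
    rw [s3] at i3
    rw [s4] at i4
    calc _ ≤ ∫⁻ z, 4 * (‖(a : ℂ) * weightedTwoPoint j N (a - 1) b g e₁ e₂ w₁ w₂ z‖ₑ ^ 2 +
          ‖-(b : ℂ) * weightedTwoPoint j N a (b - 1) g e₁ e₂ w₁ w₂ z‖ₑ ^ 2 +
          ‖(1 / 2) * weightedTwoPoint j N a (b + 1)
            (fun τ => fwdDiff 1 (g τ)) e₁ e₂ w₁ w₂ z‖ₑ ^ 2 +
          ‖(-1 / 2) * weightedTwoPoint j N (a + 1) b
            (fun τ => fwdDiff 1 (g τ)) e₁ e₂ w₁ w₂ z‖ₑ ^ 2) := by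
          refine lintegral_mono fun z => ?_
          rw [hg0.weightedTwoPoint_succ h0 h1]
          exact enorm_add_four_sq_le _ _ _ _
      _ = ENNReal.ofReal 4 * (ENNReal.ofReal (a ^ 2) *
            (∫⁻ z, ‖weightedTwoPoint j N (a - 1) b g e₁ e₂ w₁ w₂ z‖ₑ ^ 2) +
          ENNReal.ofReal (b ^ 2) *
            (∫⁻ z, ‖weightedTwoPoint j N a (b - 1) g e₁ e₂ w₁ w₂ z‖ₑ ^ 2) +
          ENNReal.ofReal (1 / 4) * (∫⁻ z, ‖weightedTwoPoint j N a (b + 1)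
            (fun τ => fwdDiff 1 (g τ)) e₁ e₂ w₁ w₂ z‖ₑ ^ 2) +
          ENNReal.ofReal (1 / 4) * ∫⁻ z, ‖weightedTwoPoint j N (a + 1) b
            (fun τ => fwdDiff 1 (g τ)) e₁ e₂ w₁ w₂ z‖ₑ ^ 2) := by
          have n1 := hms a m1
          have n2 := hms (-b) m2
          have n3 := hms (1 / 2) m3
          rw [lintegral_const_mul' _ _ (by norm_num), lintegral_add_left (n1.fun_add n2 |>.fun_add n3),
            lintegral_add_left (n1.fun_add n2), lintegral_add_left n1,
            hpull (a : ℂ) (a ^ 2) (by simp), hpull (-(b : ℂ)) (b ^ 2) (by simp),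
            hpull (1 / 2) (1 / 4) (by norm_num), hpull (-1 / 2) (1 / 4) (by norm_num)]
          simp
      _ ≤ ENNReal.ofReal 4 * (ENNReal.ofReal (a ^ 2) *
            (ENNReal.ofReal (C1 * (R ^ 2 * t ^ N * t⁻¹ ^ (a - 1 + b))) *
              twoPointMass t e₁ e₂ w₁ w₂) +
          ENNReal.ofReal (b ^ 2) *
            (ENNReal.ofReal (C2 * (R ^ 2 * t ^ N * t⁻¹ ^ (a + (b - 1)))) *
              twoPointMass t e₁ e₂ w₁ w₂) +
          ENNReal.ofReal (1 / 4) * (ENNReal.ofReal (C3 * S) * twoPointMass t e₁ e₂ w₁ w₂) +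
          ENNReal.ofReal (1 / 4) * (ENNReal.ofReal (C4 * S) * twoPointMass t e₁ e₂ w₁ w₂)) := by
          gcongr
      _ = _ := by
          generalize twoPointMass t e₁ e₂ w₁ w₂ = M
          have hc : ∀ x y r : ℝ, 0 ≤ x → x * y = r → ENNReal.ofReal x * (ENNReal.ofReal y * M) =
              ENNReal.ofReal r * M := fun x y r hx hr => by
            rw [← mul_assoc, ← ENNReal.ofReal_mul hx, hr]
          rw [hc _ _ _ (sq_nonneg _) s1, hc _ _ _ (sq_nonneg _) s2, hc _ _ _ (by norm_num) rfl,
            hc _ _ _ (by norm_num) rfl, ← add_mul, ← add_mul, ← add_mul,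
            ← ENNReal.ofReal_add (by positivity) (by positivity),
            ← ENNReal.ofReal_add (by positivity) (by positivity),
            ← ENNReal.ofReal_add (by positivity) (by positivity)]
          refine hc _ _ _ (by norm_num) ?_
          ring

end PartialOscillator

/-! ### The Hörmander condition for multiplier kernels -/

namespace PartialOscillator

variable {d : ℕ} {g : ℝ → ℕ → ℂ} {R t : ℝ}

/-! ### From weighted square integrals to integrals -/

instance isAddHaarMeasure_volume_prod :
    (volume : Measure (ℝ × EuclideanSpace ℝ (Fin d))).IsAddHaarMeasure :=
  inferInstanceAs ((volume : Measure ℝ).prod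
    (volume : Measure (EuclideanSpace ℝ (Fin d)))).IsAddHaarMeasure

/-- The coordinates of `(ρ, x)`, indexed by `Option (Fin d)`. -/
def coord (v : ℝ × EuclideanSpace ℝ (Fin d)) : Option (Fin d) → ℝ
  | none => v.1
  | some j => v.2 j

theorem continuous_coord (i : Option (Fin d)) :
    Continuous fun v : ℝ × EuclideanSpace ℝ (Fin d) => coord v i := by
  rcases i with _ | j
  · exact continuous_fst
  · simp only [coord]
    fun_prop

theorem coord_sub (v w : ℝ × EuclideanSpace ℝ (Fin d)) (i : Option (Fin d)) :
    coord (v - w) i = coord v i - coord w i := by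
  rcases i with _ | j <;> simp [coord]

theorem abs_coord_le (v : ℝ × EuclideanSpace ℝ (Fin d)) (i : Option (Fin d)) :
    |coord v i| ≤ ‖v‖ := by
  rcases i with _ | j
  · exact norm_fst_le v
  · exact (PiLp.norm_apply_le v.2 j).trans (norm_snd_le v)

theorem exists_norm_le_coord (v : ℝ × EuclideanSpace ℝ (Fin d)) :
    ∃ i, ‖v‖ ≤ (d + 1) * |coord v i| := by
  have hd : (0 : ℝ) ≤ d := Nat.cast_nonneg d
  obtain ⟨i, -, hi⟩ := Finset.exists_max_image Finset.univ (fun i => |coord v i|)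
    ⟨none, Finset.mem_univ _⟩
  refine ⟨i, ?_⟩
  rw [Prod.norm_def]
  refine max_le ?_ ?_
  · have := hi none (Finset.mem_univ _)
    rw [Real.norm_eq_abs]
    change |v.1| ≤ _ at this
    nlinarith [abs_nonneg (coord v i)]
  · rw [EuclideanSpace.norm_eq]
    refine Real.sqrt_le_iff.2 ⟨by positivity, ?_⟩
    calc ∑ j, ‖v.2 j‖ ^ 2 ≤ ∑ j : Fin d, |coord v i| ^ 2 := Finset.sum_le_sum fun j _ =>
          pow_le_pow_left₀ (norm_nonneg _) (hi (some j) (Finset.mem_univ _)) 2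
      _ = d * |coord v i| ^ 2 := by simp
      _ ≤ _ := by
        rw [mul_pow]
        gcongr
        nlinarith

theorem one_add_norm_div_pow_le (N : ℕ) {s : ℝ} (hs : 0 < s) (v : ℝ × EuclideanSpace ℝ (Fin d)) :
    ((1 + ‖v‖ / s) ^ N) ^ 2 ≤ 2 ^ (N * 2) * (d + 1) ^ (N * 2) *
      (1 + ∑ i, (s⁻¹ ^ N) ^ 2 * (coord v i ^ N) ^ 2) := by
  obtain ⟨i, hi⟩ := exists_norm_le_coord v
  have h1 : (1 : ℝ) ≤ (d + 1) ^ (N * 2) := one_le_pow₀ (by simp)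
  have h2 : (s⁻¹ ^ N) ^ 2 * (coord v i ^ N) ^ 2 ≤
      ∑ i, (s⁻¹ ^ N) ^ 2 * (coord v i ^ N) ^ 2 :=
    Finset.single_le_sum (f := fun i => (s⁻¹ ^ N) ^ 2 * (coord v i ^ N) ^ 2)
      (fun i _ => by positivity) (Finset.mem_univ i)
  calc ((1 + ‖v‖ / s) ^ N) ^ 2 = (1 + ‖v‖ / s) ^ (N * 2) := (pow_mul _ _ _).symm
    _ ≤ 2 ^ (N * 2) * (1 ^ (N * 2) + (‖v‖ / s) ^ (N * 2)) :=
      (add_pow_le zero_le_one (by positivity) _).trans (mul_le_mul_of_nonneg_right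
        (pow_le_pow_right₀ one_le_two (Nat.sub_le _ _)) (by positivity))
    _ ≤ 2 ^ (N * 2) * (1 ^ (N * 2) + ((d + 1) * |coord v i| / s) ^ (N * 2)) := by gcongr
    _ = 2 ^ (N * 2) * (1 + (d + 1) ^ (N * 2) * ((s⁻¹ ^ N) ^ 2 * (coord v i ^ N) ^ 2)) := by
      rw [one_pow, div_eq_mul_inv, mul_pow, mul_pow, mul_comm N 2, pow_mul |coord v i|, sq_abs,
        ← pow_mul, ← pow_mul, ← pow_mul]
      ring
    _ ≤ _ := by
      rw [mul_assoc]
      gcongr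
      rw [mul_add, mul_one]
      gcongr

theorem lintegral_weight_le (N : ℕ) {s B : ℝ} (hs : 0 < s) (hB : 0 ≤ B)
    (w : ℝ × EuclideanSpace ℝ (Fin d)) {F : ℝ × EuclideanSpace ℝ (Fin d) → ℂ} (hF : Continuous F)
    (h1 : ∫⁻ z, ‖F z‖ₑ ^ 2 ≤ ENNReal.ofReal B)
    (h2 : ∀ i, ∫⁻ z, ‖((coord z i - coord w i : ℝ) : ℂ) ^ N * F z‖ₑ ^ 2 ≤
      ENNReal.ofReal (B * (s ^ N) ^ 2)) :
    ∫⁻ z, (‖F z‖ₑ * ENNReal.ofReal ((1 + ‖z - w‖ / s) ^ N)) ^ 2 ≤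
      ENNReal.ofReal (2 ^ (N * 2) * (d + 1) ^ (N * 2) * (d + 2) * B) := by
  have hm : ∀ i, Measurable fun z : ℝ × EuclideanSpace ℝ (Fin d) =>
      ‖((coord z i - coord w i : ℝ) : ℂ) ^ N * F z‖ₑ ^ 2 := fun i => by
    have : Continuous fun z : ℝ × EuclideanSpace ℝ (Fin d) =>
        ((coord z i - coord w i : ℝ) : ℂ) ^ N * F z :=
      ((Complex.continuous_ofReal.comp ((continuous_coord i).sub continuous_const)).pow N).mul hF
    exact this.measurable.enorm.pow_const 2
  have hF2 : Measurable fun z => ‖F z‖ₑ ^ 2 := hF.measurable.enorm.pow_const 2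
  calc _ ≤ ∫⁻ z, ENNReal.ofReal (2 ^ (N * 2) * (d + 1) ^ (N * 2)) * (‖F z‖ₑ ^ 2 +
        ∑ i, ENNReal.ofReal ((s⁻¹ ^ N) ^ 2) *
          ‖((coord z i - coord w i : ℝ) : ℂ) ^ N * F z‖ₑ ^ 2) := by
        refine lintegral_mono fun z => ?_
        simp only [enorm_sq_eq_ofReal, mul_pow]
        rw [← ENNReal.ofReal_pow (by positivity), ← ENNReal.ofReal_mul (by positivity)]
        simp only [← ENNReal.ofReal_mul (sq_nonneg (s⁻¹ ^ N))]
        rw [← ENNReal.ofReal_sum_of_nonneg (fun i _ => by positivity),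
          ← ENNReal.ofReal_add (by positivity) (Finset.sum_nonneg fun i _ => by positivity),
          ← ENNReal.ofReal_mul (by positivity)]
        refine ENNReal.ofReal_le_ofReal ?_
        refine (mul_le_mul_of_nonneg_left (one_add_norm_div_pow_le N hs (z - w))
          (sq_nonneg _)).trans (le_of_eq ?_)
        have : ∀ i, ‖((coord z i - coord w i : ℝ) : ℂ) ^ N * F z‖ ^ 2 =
            (coord (z - w) i ^ N) ^ 2 * ‖F z‖ ^ 2 := fun i => by
          rw [norm_mul, norm_pow, Complex.norm_real, Real.norm_eq_abs, mul_pow, coord_sub,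
            ← abs_pow, sq_abs]
        simp only [this, mul_add, Finset.mul_sum, mul_one]
        congr 1
        · ring
        · exact Finset.sum_congr rfl fun i _ => by ring
    _ = ENNReal.ofReal (2 ^ (N * 2) * (d + 1) ^ (N * 2)) * ((∫⁻ z, ‖F z‖ₑ ^ 2) +
        ∑ i, ENNReal.ofReal ((s⁻¹ ^ N) ^ 2) *
          ∫⁻ z, ‖((coord z i - coord w i : ℝ) : ℂ) ^ N * F z‖ₑ ^ 2) := by
        rw [lintegral_const_mul' _ _ ENNReal.ofReal_ne_top, lintegral_add_left hF2,
          lintegral_finsetSum _ fun i _ => (hm i).const_mul _]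
        congr 2
        refine Finset.sum_congr rfl fun i _ => ?_
        rw [lintegral_const_mul' _ _ ENNReal.ofReal_ne_top]
    _ ≤ ENNReal.ofReal (2 ^ (N * 2) * (d + 1) ^ (N * 2)) * (ENNReal.ofReal B +
        ∑ i : Option (Fin d), ENNReal.ofReal ((s⁻¹ ^ N) ^ 2) *
          ENNReal.ofReal (B * (s ^ N) ^ 2)) := by
        gcongr with i
        exact h2 i
    _ = _ := by
        have e : (s⁻¹ ^ N) ^ 2 * (B * (s ^ N) ^ 2) = B := by
          rw [inv_pow]
          field_simp
        rw [← ENNReal.ofReal_mul (by positivity), e, ← ENNReal.ofReal_sum_of_nonneg fun _ _ => hB,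
          ← ENNReal.ofReal_add hB (Finset.sum_nonneg fun _ _ => hB),
          ← ENNReal.ofReal_mul (by positivity)]
        congr 1
        simp
        ring

theorem lintegral_comp_sub_div (f : ℝ × EuclideanSpace ℝ (Fin d) → ℝ≥0∞) (hf : Measurable f)
    {s : ℝ} (hs : 0 < s) (w : ℝ × EuclideanSpace ℝ (Fin d)) :
    ∫⁻ z, f (s⁻¹ • (z - w)) = ENNReal.ofReal (s ^ (d + 1)) * ∫⁻ z, f z := by
  have hs' : s⁻¹ ≠ 0 := (inv_pos.2 hs).ne'
  rw [lintegral_sub_right_eq_self (fun z => f (s⁻¹ • z)) w,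
    ← lintegral_map (f := f) (g := fun z => s⁻¹ • z) hf (measurable_const_smul _)]
  rw [Measure.map_addHaar_smul volume hs', lintegral_smul_measure]
  have hr : Module.finrank ℝ (ℝ × EuclideanSpace ℝ (Fin d)) = d + 1 := by
    simp [add_comm]
  rw [hr, inv_pow, inv_inv, abs_of_pos (by positivity), smul_eq_mul]

/-- This is where the order of smoothness enters: the exponent 2N is at least d+2, while
integrability on ℝ^{d+1} needs only more than d+1. The surplus is split, one half for convergence
and one half for decay in r/s. -/
theorem exists_lintegral_weight_inv_le (d : ℕ) {N : ℕ} (hN : d + 2 ≤ N * 2) : ∃ C : ℝ, 0 ≤ C ∧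
    ∀ (s r : ℝ) (w : ℝ × EuclideanSpace ℝ (Fin d)), 0 < s → 0 ≤ r →
    ∫⁻ z in {z | r ≤ ‖z - w‖}, ENNReal.ofReal (((1 + ‖z - w‖ / s) ^ N)⁻¹) ^ 2 ≤
      ENNReal.ofReal (C * s ^ (d + 1) * (1 + r / s) ^ (-(1 / 2) : ℝ)) := by
  have hr : Module.finrank ℝ (ℝ × EuclideanSpace ℝ (Fin d)) = d + 1 := by
    simp [add_comm]
  have hfin := finite_integral_one_add_norm
    (μ := (volume : Measure (ℝ × EuclideanSpace ℝ (Fin d)))) (r := d + 1 + 1 / 2)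
    (by rw [hr]; push_cast; linarith)
  refine ⟨(∫⁻ x : ℝ × EuclideanSpace ℝ (Fin d),
    ENNReal.ofReal ((1 + ‖x‖) ^ (-(d + 1 + 1 / 2 : ℝ)))).toReal, ENNReal.toReal_nonneg,
    fun s r w hs hr0 => ?_⟩
  have hmeas : Measurable fun x : ℝ × EuclideanSpace ℝ (Fin d) =>
      ENNReal.ofReal ((1 + ‖x‖) ^ (-(d + 1 + 1 / 2 : ℝ))) := by fun_prop
  have hsc := lintegral_comp_sub_div _ hmeas hs w
  have hb : 0 < 1 + r / s := by positivity
  calc _ ≤ ∫⁻ z in {z | r ≤ ‖z - w‖}, ENNReal.ofReal ((1 + r / s) ^ (-(1 / 2) : ℝ)) *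
        ENNReal.ofReal ((1 + ‖s⁻¹ • (z - w)‖) ^ (-(d + 1 + 1 / 2 : ℝ))) := by
        refine setLIntegral_mono' (measurableSet_le measurable_const (by fun_prop)) fun z hz => ?_
        rw [← ENNReal.ofReal_pow (by positivity), ← ENNReal.ofReal_mul (by positivity)]
        refine ENNReal.ofReal_le_ofReal ?_
        have e1 : ‖s⁻¹ • (z - w)‖ = ‖z - w‖ / s := by
          rw [norm_smul, Real.norm_of_nonneg (by positivity), inv_mul_eq_div]
        rw [e1]
        have hz' : r ≤ ‖z - w‖ := hz
        have hle : 1 + r / s ≤ 1 + ‖z - w‖ / s := by gcongr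
        have ha1 : 1 ≤ 1 + ‖z - w‖ / s := le_add_of_nonneg_right (by positivity)
        generalize 1 + ‖z - w‖ / s = a at hle ha1
        have ha : 0 < a := by linarith
        calc ((a ^ N)⁻¹) ^ 2 = a ^ (-(N * 2 : ℕ) : ℝ) := by
              rw [Real.rpow_neg ha.le, Real.rpow_natCast, pow_mul, inv_pow]
          -- The exponents add up to -(d+2), which is at least -2N.
          _ ≤ a ^ (-(1 / 2) + -(d + 1 + 1 / 2) : ℝ) := by
              refine Real.rpow_le_rpow_of_exponent_le ha1 ?_
              have : ((d + 2 : ℕ) : ℝ) ≤ (N * 2 : ℕ) := by exact_mod_cast hN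
              push_cast at this ⊢
              linarith
          _ = a ^ (-(1 / 2) : ℝ) * a ^ (-(d + 1 + 1 / 2) : ℝ) := Real.rpow_add ha _ _
          _ ≤ _ := by
              refine mul_le_mul_of_nonneg_right ?_ (by positivity)
              exact Real.rpow_le_rpow_of_nonpos hb hle (by norm_num)
    _ ≤ ∫⁻ z, ENNReal.ofReal ((1 + r / s) ^ (-(1 / 2) : ℝ)) *
        ENNReal.ofReal ((1 + ‖s⁻¹ • (z - w)‖) ^ (-(d + 1 + 1 / 2 : ℝ))) :=
      setLIntegral_le_lintegral _ _
    _ = _ := by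
      rw [lintegral_const_mul' _ _ ENNReal.ofReal_ne_top, hsc, ENNReal.ofReal_mul (by positivity),
        ENNReal.ofReal_mul ENNReal.toReal_nonneg, ENNReal.ofReal_toReal hfin.ne]
      ring

/-- Cauchy–Schwarz with the weight (1+|z-w|/s)^N and its inverse. The volume s^{d+1} of the inverse
weight cancels the normalization s^{-(d+1)} of F, and the square root turns the decay exponent 1/2
into 1/4. -/
theorem exists_lintegral_tail_le (d : ℕ) {N : ℕ} (hN : d + 2 ≤ N * 2) : ∃ C : ℝ, 0 ≤ C ∧
    ∀ (s B : ℝ) (w : ℝ × EuclideanSpace ℝ (Fin d)) (F : ℝ × EuclideanSpace ℝ (Fin d) → ℂ),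
    0 < s → 0 ≤ B → Continuous F → ∫⁻ z, ‖F z‖ₑ ^ 2 ≤ ENNReal.ofReal (B ^ 2 * s⁻¹ ^ (d + 1)) →
    (∀ i, ∫⁻ z, ‖((coord z i - coord w i : ℝ) : ℂ) ^ N * F z‖ₑ ^ 2 ≤
      ENNReal.ofReal (B ^ 2 * s⁻¹ ^ (d + 1) * (s ^ N) ^ 2)) →
    ∀ r : ℝ, 0 ≤ r → ∫⁻ z in {z | r ≤ ‖z - w‖}, ‖F z‖ₑ ≤
      ENNReal.ofReal (C * B * (1 + r / s) ^ (-(1 / 4) : ℝ)) := by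
  obtain ⟨C1, hC1, h1⟩ := exists_lintegral_weight_inv_le d hN
  obtain ⟨C2, hC2, hK2⟩ : ∃ C2 : ℝ, 0 ≤ C2 ∧ C2 = 2 ^ (N * 2) * (d + 1) ^ (N * 2) * (d + 2) :=
    ⟨_, by positivity, rfl⟩
  refine ⟨√(C1 * C2), Real.sqrt_nonneg _, fun s B w F hs hB hF hF1 hF2 r hr => ?_⟩
  have h2 := lintegral_weight_le N hs (by positivity) w hF hF1 hF2
  rw [← hK2] at h2
  have h3 := h1 s r w hs hr
  have hb : 0 < 1 + r / s := by positivity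
  obtain ⟨u, hu⟩ : ∃ u : ℝ × EuclideanSpace ℝ (Fin d) → ℝ, u = fun z => (1 + ‖z - w‖ / s) ^ N :=
    ⟨_, rfl⟩
  have hu0 : ∀ z, 0 < u z := fun z => by rw [hu]; positivity
  have huc : Continuous u := by rw [hu]; fun_prop
  have huE : ∀ z, (1 + ‖z - w‖ / s) ^ N = u z := fun z => by rw [hu]
  simp only [huE] at h2 h3
  have hprod : ∀ z, ‖F z‖ₑ = (‖F z‖ₑ * ENNReal.ofReal (u z)) * ENNReal.ofReal ((u z)⁻¹) := fun z => by
    rw [mul_assoc, ← ENNReal.ofReal_mul (hu0 z).le, mul_inv_cancel₀ (hu0 z).ne',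
      ENNReal.ofReal_one, mul_one]
  have hm1 : Measurable fun z => ‖F z‖ₑ * ENNReal.ofReal (u z) :=
    hF.measurable.enorm.mul huc.measurable.ennreal_ofReal
  have hm2 : Measurable fun z => ENNReal.ofReal ((u z)⁻¹) := huc.measurable.inv.ennreal_ofReal
  have hcs := ENNReal.lintegral_mul_le_Lp_mul_Lq
    (volume.restrict {z : ℝ × EuclideanSpace ℝ (Fin d) | r ≤ ‖z - w‖}) Real.HolderConjugate.two_two
    hm1.aemeasurable hm2.aemeasurable
  have hcs' : ∫⁻ z in {z | r ≤ ‖z - w‖}, ‖F z‖ₑ ≤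
      (ENNReal.ofReal (C2 * (B ^ 2 * s⁻¹ ^ (d + 1)))) ^ (1 / 2 : ℝ) *
      (ENNReal.ofReal (C1 * s ^ (d + 1) * (1 + r / s) ^ (-(1 / 2) : ℝ))) ^ (1 / 2 : ℝ) := by
    rw [lintegral_congr hprod]
    refine hcs.trans (mul_le_mul' (ENNReal.rpow_le_rpow ?_ (by norm_num))
      (ENNReal.rpow_le_rpow ?_ (by norm_num)))
    · simp only [ENNReal.rpow_two]
      exact (setLIntegral_le_lintegral _ _).trans h2
    · simp only [ENNReal.rpow_two]
      exact h3
  refine hcs'.trans (le_of_eq ?_)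
  rw [← ENNReal.mul_rpow_of_nonneg _ _ (by norm_num), ← ENNReal.ofReal_mul (by positivity),
    ENNReal.ofReal_rpow_of_nonneg (by positivity) (by norm_num), ← Real.sqrt_eq_rpow]
  congr 1
  have e : s⁻¹ ^ (d + 1) * s ^ (d + 1) = 1 := by
    rw [← mul_pow, inv_mul_cancel₀ hs.ne', one_pow]
  have e2 : (1 + r / s) ^ (-(1 / 2) : ℝ) = ((1 + r / s) ^ (-(1 / 4) : ℝ)) ^ 2 := by
    rw [← Real.rpow_natCast, ← Real.rpow_mul hb.le]
    norm_num
  rw [show C2 * (B ^ 2 * s⁻¹ ^ (d + 1)) * (C1 * s ^ (d + 1) * (1 + r / s) ^ (-(1 / 2) : ℝ)) =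
    C1 * C2 * (B * (1 + r / s) ^ (-(1 / 4) : ℝ)) ^ 2 * (s⁻¹ ^ (d + 1) * s ^ (d + 1)) by
      rw [e2]; ring, e, mul_one, Real.sqrt_mul (by positivity), Real.sqrt_sq (by positivity)]
  ring

end PartialOscillator

namespace PartialOscillator

variable {d : ℕ} {g : ℝ → ℕ → ℂ} {R s t : ℝ}

/-! ### Kernels of symbols at a given scale -/

/-- The kernel `∑_μ (∫ e^{iτ(ρ-ρ')} g(τ,|μ|) dτ) Φ_μ(x) Φ_μ(x')`, which is `2π` times the kernel of
the operator with multiplier `g`. -/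
noncomputable def multKer (g : ℝ → ℕ → ℂ) (z w : ℝ × EuclideanSpace ℝ (Fin d)) : ℂ :=
  ∑' μ : Fin d → ℕ, expIntegral (fun τ => g τ (∑ i, μ i)) (z.1 - w.1) *
    ((hermitePhi μ z.2 * hermitePhi μ w.2 : ℝ) : ℂ)

theorem raiseKer_zero_zero (j : Fin d) (g : ℝ → ℕ → ℂ) (z w : ℝ × EuclideanSpace ℝ (Fin d)) :
    raiseKer j 0 0 g z w = multKer g z w := by
  simp only [raiseKer, raiseKernel, raisePhi_zero, multKer]

/-- The symbol estimates at scale `s` up to the order `N`. -/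
structure SymbolBound (N : ℕ) (g : ℝ → ℕ → ℂ) (R s : ℝ) : Prop where
  differentiable : ∀ k, ∀ l < N, Differentiable ℝ (iteratedDeriv l fun τ => g τ k)
  fwdDiff : ∀ l ≤ N, HeatBound (fun τ => (fwdDiff 1)^[l] (g τ)) (R * (s ^ 2) ^ l) (s ^ 2)
  deriv : ∀ l ≤ N, HeatBound (fun τ k => iteratedDeriv l (fun σ => g σ k) τ) (R * s ^ l) (s ^ 2)

theorem SymbolBound.heatBound {N : ℕ} (h : SymbolBound N g R s) : HeatBound g R (s ^ 2) := by
  simpa using h.fwdDiff 0 (Nat.zero_le N)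

theorem HeatBound.continuous_multKer (h : HeatBound g R t) (h0 : 0 < t) (h1 : t ≤ 1) (hd : 1 ≤ d) :
    Continuous fun p : (ℝ × EuclideanSpace ℝ (Fin d)) × (ℝ × EuclideanSpace ℝ (Fin d)) =>
      multKer g p.1 p.2 := by
  have := continuous_raiseKer h h0 h1 ⟨0, hd⟩ 0 0
  simpa only [raiseKer_zero_zero] using this

theorem HeatBound.continuous_multKer_left (h : HeatBound g R t) (h0 : 0 < t) (h1 : t ≤ 1)
    (hd : 1 ≤ d) (w : ℝ × EuclideanSpace ℝ (Fin d)) : Continuous fun z => multKer g z w := by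
  have hp : Continuous fun z : ℝ × EuclideanSpace ℝ (Fin d) => (z, w) := by fun_prop
  have := Continuous.comp (h.continuous_multKer h0 h1 hd) hp
  simpa only [Function.comp_def] using this

theorem SymbolBound.sub_fst_pow_mul_multKer {N : ℕ} (h : SymbolBound N g R s) (h0 : 0 < s) {n : ℕ}
    (hn : n ≤ N) (z w : ℝ × EuclideanSpace ℝ (Fin d)) :
    ((z.1 - w.1 : ℝ) : ℂ) ^ n * multKer g z w =
      Complex.I ^ n * multKer (fun τ k => iteratedDeriv n (fun σ => g σ k) τ) z w := by
  unfold multKer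
  rw [← tsum_mul_left, ← tsum_mul_left]
  refine tsum_congr fun μ => ?_
  rw [← mul_assoc, ← mul_assoc, pow_mul_expIntegral
    (fun l hl => h.differentiable _ l (hl.trans_le hn))
    (fun l hl => (h.deriv l (hl.trans hn)).integrable (by positivity) _)]

/-- The unweighted bound and the bounds with each coordinate weight together. In the direction ρ the
weight is N derivatives of g in τ, and in the direction x_j it is the commutator estimate with a = b
= 0 and t = s². -/
theorem exists_lintegral_coord_multKer_le (hd : 1 ≤ d) (N : ℕ) : ∃ C : ℝ, 0 ≤ C ∧
    ∀ (s R : ℝ) (g : ℝ → ℕ → ℂ), 0 < s → s ≤ 1 → SymbolBound N g R s →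
    ∀ (e₁ e₂ : ℂ) (w₁ w₂ : ℝ × EuclideanSpace ℝ (Fin d)),
    (∫⁻ z, ‖e₁ * multKer g z w₁ + e₂ * multKer g z w₂‖ₑ ^ 2 ≤
      ENNReal.ofReal (C * R ^ 2) * twoPointMass (s ^ 2) e₁ e₂ w₁ w₂) ∧
    ∀ i, ∫⁻ z, ‖e₁ * (((coord z i - coord w₁ i : ℝ) : ℂ) ^ N * multKer g z w₁) +
      e₂ * (((coord z i - coord w₂ i : ℝ) : ℂ) ^ N * multKer g z w₂)‖ₑ ^ 2 ≤
      ENNReal.ofReal (C * (R ^ 2 * (s ^ N) ^ 2)) * twoPointMass (s ^ 2) e₁ e₂ w₁ w₂ := by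
  obtain ⟨C0, hC0, h0⟩ := exists_lintegral_twoPoint_raiseKer_le (⟨0, hd⟩ : Fin d) 0 0
  choose C1 hC1 h1 using fun j : Fin d => exists_lintegral_weightedTwoPoint_le j N 0 0
  have hle : ∀ j, C1 j ≤ C0 + ∑ j, C1 j := fun j =>
    (Finset.single_le_sum (fun j _ => hC1 j) (Finset.mem_univ j)).trans (by linarith)
  have hs0 : 0 ≤ ∑ j, C1 j := Finset.sum_nonneg fun j _ => hC1 j
  refine ⟨C0 + ∑ j, C1 j, by linarith, fun s R g hs hs1 hg e₁ e₂ w₁ w₂ => ⟨?_, fun i => ?_⟩⟩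
  · have := h0 (s ^ 2) R g (by positivity) (by nlinarith) hg.heatBound e₁ e₂ w₁ w₂
    simp only [raiseKer_zero_zero, add_zero, pow_zero, mul_one] at this
    refine this.trans ?_
    gcongr
    linarith
  · rcases i with _ | j
    · have := h0 (s ^ 2) (R * s ^ N) _ (by positivity) (by nlinarith) (hg.deriv N le_rfl)
        e₁ e₂ w₁ w₂
      simp only [raiseKer_zero_zero, add_zero, pow_zero, mul_one] at this
      have e : ∀ z : ℝ × EuclideanSpace ℝ (Fin d),
          ‖e₁ * (((coord z none - coord w₁ none : ℝ) : ℂ) ^ N * multKer g z w₁) +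
          e₂ * (((coord z none - coord w₂ none : ℝ) : ℂ) ^ N * multKer g z w₂)‖ₑ =
          ‖e₁ * multKer (fun τ k => iteratedDeriv N (fun σ => g σ k) τ) z w₁ +
          e₂ * multKer (fun τ k => iteratedDeriv N (fun σ => g σ k) τ) z w₂‖ₑ := fun z => by
        simp only [coord]
        rw [hg.sub_fst_pow_mul_multKer hs le_rfl, hg.sub_fst_pow_mul_multKer hs le_rfl,
          mul_left_comm, mul_left_comm e₂, ← mul_add, enorm_mul]
        simp [← ofReal_norm]
      simp only [e]
      refine this.trans ?_
      rw [mul_pow]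
      gcongr
      linarith
    · have := h1 j (s ^ 2) R g (by positivity) (by nlinarith) hg.fwdDiff e₁ e₂ w₁ w₂
      simp only [weightedTwoPoint, raiseKer_zero_zero, add_zero, pow_zero, mul_one] at this
      simp only [coord]
      refine this.trans ?_
      rw [pow_right_comm]
      gcongr
      exact hle j

theorem sq_rpow_neg_half (hs : 0 < s) : (s ^ 2) ^ (-(1 / 2) : ℝ) = s⁻¹ := by
  rw [Real.rpow_neg (by positivity), ← Real.sqrt_eq_rpow, Real.sqrt_sq hs.le]

theorem exists_lintegral_coord_multKer_one_le (hd : 1 ≤ d) (N : ℕ) : ∃ C : ℝ, 0 ≤ C ∧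
    ∀ (s R : ℝ) (g : ℝ → ℕ → ℂ), 0 < s → s ≤ 1 → SymbolBound N g R s →
    ∀ (w : ℝ × EuclideanSpace ℝ (Fin d)),
    (∫⁻ z, ‖multKer g z w‖ₑ ^ 2 ≤ ENNReal.ofReal ((C * R) ^ 2 * s⁻¹ ^ (d + 1))) ∧
    ∀ i, ∫⁻ z, ‖((coord z i - coord w i : ℝ) : ℂ) ^ N * multKer g z w‖ₑ ^ 2 ≤
      ENNReal.ofReal ((C * R) ^ 2 * s⁻¹ ^ (d + 1) * (s ^ N) ^ 2) := by
  obtain ⟨C, hC, h⟩ := exists_lintegral_coord_multKer_le hd N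
  refine ⟨√(C * 2 ^ (d + 1)), Real.sqrt_nonneg _, fun s R g hs hs1 hg w => ?_⟩
  have hM := twoPointMass_one_zero_le (t := s ^ 2) (by positivity) (by nlinarith) w w
  rw [sq_rpow_neg_half hs] at hM
  have h' := h s R g hs hs1 hg 1 0 w w
  simp only [zero_mul, add_zero, one_mul] at h'
  rw [mul_pow, Real.sq_sqrt (by positivity)]
  refine ⟨h'.1.trans ((mul_le_mul_right hM _).trans (le_of_eq ?_)), fun i =>
    (h'.2 i).trans ((mul_le_mul_right hM _).trans (le_of_eq ?_))⟩
  · rw [← ENNReal.ofReal_mul (by positivity), mul_pow]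
    ring_nf
  · rw [← ENNReal.ofReal_mul (by positivity), mul_pow 2]
    ring_nf

theorem exists_lintegral_multKer_tail_le (hd : 1 ≤ d) {N : ℕ} (hN : d + 2 ≤ N * 2) :
    ∃ C : ℝ, 0 ≤ C ∧
    ∀ (s R : ℝ) (g : ℝ → ℕ → ℂ), 0 < s → s ≤ 1 → SymbolBound N g R s →
    ∀ (w : ℝ × EuclideanSpace ℝ (Fin d)) (r : ℝ), 0 ≤ r →
    ∫⁻ z in {z | r ≤ ‖z - w‖}, ‖multKer g z w‖ₑ ≤
      ENNReal.ofReal (C * R * (1 + r / s) ^ (-(1 / 4) : ℝ)) := by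
  obtain ⟨C1, hC1, h1⟩ := exists_lintegral_coord_multKer_one_le hd N
  obtain ⟨C2, hC2, h2⟩ := exists_lintegral_tail_le d hN
  refine ⟨C2 * C1, by positivity, fun s R g hs hs1 hg w r hr => ?_⟩
  have h3 := h1 s R g hs hs1 hg w
  have hR := hg.heatBound.nonneg
  have h4 := h2 s (C1 * R) w (fun z => multKer g z w) hs (by positivity)
    (hg.heatBound.continuous_multKer_left (by positivity) (by nlinarith) hd w) h3.1 h3.2 r hr
  rwa [mul_assoc C2 C1 R]

/-- The cost of recentring the weight from one point to another at distance δ ≤ s: still of order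
δ/s, relative to the full weight. -/
theorem abs_pow_sub_pow_le_weight {a b δ m : ℝ} (N : ℕ) (hs : 0 < s) (hab : |a - b| ≤ δ) (hδ : δ ≤ s)
    (ha : |a| ≤ m) : |a ^ N - b ^ N| ≤ N * (δ / s) * s ^ N * (1 + m / s) ^ N := by
  have hδ0 : 0 ≤ δ := (abs_nonneg _).trans hab
  have hm0 : 0 ≤ m := (abs_nonneg _).trans ha
  rcases N with _ | N
  · simp
  have hb : |b| ≤ s * (1 + m / s) := by
    have h3 : s * (1 + m / s) = s + m := by field_simp
    have h4 : |b| ≤ |a| + |a - b| := by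
      have := abs_sub_abs_le_abs_sub b a
      rw [abs_sub_comm] at this
      linarith
    linarith
  have ha' : |a| ≤ s * (1 + m / s) := by
    have h3 : s * (1 + m / s) = s + m := by field_simp
    linarith
  have h1 : 1 ≤ 1 + m / s := le_add_of_nonneg_right (by positivity)
  calc |a ^ (N + 1) - b ^ (N + 1)| ≤ |a - b| * (N + 1 : ℕ) * max |a| |b| ^ (N + 1 - 1) :=
        abs_pow_sub_pow_le _ _ _
    _ ≤ δ * (N + 1 : ℕ) * (s * (1 + m / s)) ^ N := by
        rw [Nat.add_sub_cancel]
        gcongr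
        exact max_le ha' hb
    _ = (N + 1 : ℕ) * (δ / s) * s ^ (N + 1) * (1 + m / s) ^ N := by
        rw [mul_pow, pow_succ]
        field_simp
    _ ≤ _ := by
        gcongr
        exact Nat.le_succ N

theorem enorm_add_sq_le (a b : ℂ) : ‖a + b‖ₑ ^ 2 ≤ 2 * (‖a‖ₑ ^ 2 + ‖b‖ₑ ^ 2) := by
  simp only [enorm_sq_eq_ofReal]
  rw [← ENNReal.ofReal_add (by positivity) (by positivity),
    show (2 : ℝ≥0∞) = ENNReal.ofReal 2 by simp, ← ENNReal.ofReal_mul (by norm_num)]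
  apply ENNReal.ofReal_le_ofReal
  have := pow_le_pow_left₀ (norm_nonneg _) (norm_add_le a b) 2
  linarith [sq_nonneg (‖a‖ - ‖b‖), show (‖a‖ + ‖b‖) ^ 2 = 2 * (‖a‖ ^ 2 + ‖b‖ ^ 2) -
    (‖a‖ - ‖b‖) ^ 2 by ring]

/-- The two-point estimate weights each kernel around its own base point, whereas a common centre is
needed. The correction involves only the kernel at w₂ and a difference of powers, and it is of the
same order |w₁-w₂|/s. -/
theorem exists_lintegral_coord_multKer_sub_le (hd : 1 ≤ d) (N : ℕ) : ∃ C : ℝ, 0 ≤ C ∧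
    ∀ (s R : ℝ) (g : ℝ → ℕ → ℂ), 0 < s → s ≤ 1 → SymbolBound N g R s →
    ∀ (w₁ w₂ : ℝ × EuclideanSpace ℝ (Fin d)), ‖w₁ - w₂‖ ≤ s →
    (∫⁻ z, ‖multKer g z w₁ - multKer g z w₂‖ₑ ^ 2 ≤
      ENNReal.ofReal ((C * R * (‖w₁ - w₂‖ / s)) ^ 2 * s⁻¹ ^ (d + 1))) ∧
    ∀ i, ∫⁻ z, ‖((coord z i - coord w₁ i : ℝ) : ℂ) ^ N *
        (multKer g z w₁ - multKer g z w₂)‖ₑ ^ 2 ≤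
      ENNReal.ofReal ((C * R * (‖w₁ - w₂‖ / s)) ^ 2 * s⁻¹ ^ (d + 1) * (s ^ N) ^ 2) := by
  obtain ⟨C1, hC1, h1⟩ := exists_lintegral_coord_multKer_le hd N
  obtain ⟨C2, hC2, h2⟩ := exists_lintegral_coord_multKer_one_le hd N
  obtain ⟨C3, hC3, h3⟩ := exists_twoPointMass_sub_le d
  obtain ⟨C4, hC4, hK4⟩ : ∃ C4 : ℝ, 0 ≤ C4 ∧ C4 = 2 ^ (N * 2) * (d + 1) ^ (N * 2) * (d + 2) :=
    ⟨_, by positivity, rfl⟩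
  obtain ⟨C5, hC5, hK5⟩ : ∃ C5 : ℝ, 0 ≤ C5 ∧ C5 = 2 * (C1 * C3 + N ^ 2 * (C4 * C2 ^ 2)) :=
    ⟨_, by positivity, rfl⟩
  refine ⟨√C5, Real.sqrt_nonneg _, fun s R g hs hs1 hg w₁ w₂ hw => ?_⟩
  have hR := hg.heatBound.nonneg
  have hM := h3 (s ^ 2) (by positivity) (by nlinarith) w₁ w₂
  rw [sq_rpow_neg_half hs] at hM
  have h1' := h1 s R g hs hs1 hg 1 (-1) w₁ w₂
  have h2' := h2 s R g hs hs1 hg w₂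
  have hc := fun w => hg.heatBound.continuous_multKer_left (by positivity) (by nlinarith) hd w
  have hW := lintegral_weight_le N hs (by positivity) w₂ (hc w₂) h2'.1 h2'.2
  rw [← hK4] at hW
  simp only [one_mul, neg_one_mul, ← sub_eq_add_neg] at h1'
  have hδ0 : 0 ≤ ‖w₁ - w₂‖ := norm_nonneg _
  have hcd : ∀ i, |coord w₁ i - coord w₂ i| ≤ ‖w₁ - w₂‖ := fun i => by
    rw [← coord_sub]
    exact abs_coord_le _ _
  generalize ‖w₁ - w₂‖ = δ at hM hw hδ0 hcd ⊢
  rw [mul_pow, mul_pow, Real.sq_sqrt hC5]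
  have hA : ∀ A : ℝ, 0 ≤ A → ENNReal.ofReal (C1 * (R ^ 2 * A)) * twoPointMass (s ^ 2) 1 (-1) w₁ w₂ ≤
      ENNReal.ofReal (C1 * C3 * R ^ 2 * (δ / s) ^ 2 * s⁻¹ ^ (d + 1) * A) := fun A hA => by
    refine (mul_le_mul_right hM _).trans (le_of_eq ?_)
    rw [← ENNReal.ofReal_mul (by positivity)]
    congr 1
    rw [div_pow, div_eq_mul_inv]
    ring
  have hle : C1 * C3 ≤ C5 := by
    have : 0 ≤ C1 * C3 := by positivity
    have : 0 ≤ N ^ 2 * (C4 * C2 ^ 2) := by positivity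
    rw [hK5]
    linarith
  refine ⟨?_, fun i => ?_⟩
  · have h5 := h1'.1
    rw [← mul_one (R ^ 2)] at h5
    refine (h5.trans (hA 1 zero_le_one)).trans (ENNReal.ofReal_le_ofReal ?_)
    rw [mul_one]
    gcongr
  · have e : ∀ z, ((coord z i - coord w₁ i : ℝ) : ℂ) ^ N * (multKer g z w₁ - multKer g z w₂) =
        (((coord z i - coord w₁ i : ℝ) : ℂ) ^ N * multKer g z w₁ -
          ((coord z i - coord w₂ i : ℝ) : ℂ) ^ N * multKer g z w₂) +
        (((coord z i - coord w₂ i) ^ N - (coord z i - coord w₁ i) ^ N : ℝ) : ℂ) *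
          multKer g z w₂ := fun z => by
      push_cast
      ring
    have hb : ∀ z, ‖(((coord z i - coord w₂ i) ^ N - (coord z i - coord w₁ i) ^ N : ℝ) : ℂ) *
          multKer g z w₂‖ₑ ^ 2 ≤ ENNReal.ofReal ((N * (δ / s) * s ^ N) ^ 2) *
          (‖multKer g z w₂‖ₑ * ENNReal.ofReal ((1 + ‖z - w₂‖ / s) ^ N)) ^ 2 := fun z => by
      have h6 := abs_pow_sub_pow_le_weight (a := coord z i - coord w₂ i)
        (b := coord z i - coord w₁ i) (m := ‖z - w₂‖) N hs
        (by rw [sub_sub_sub_cancel_left]; exact hcd i) hw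
        (by rw [← coord_sub]; exact abs_coord_le _ _)
      rw [enorm_mul, ENNReal.ofReal_pow (by positivity), ← mul_pow]
      refine pow_le_pow_left₀ zero_le ?_ 2
      rw [mul_left_comm, ← ENNReal.ofReal_mul (by positivity), mul_comm]
      refine mul_le_mul_right ?_ _
      rw [← ofReal_norm, Complex.norm_real]
      exact ENNReal.ofReal_le_ofReal h6
    have hcm : Continuous fun z : ℝ × EuclideanSpace ℝ (Fin d) =>
        ((coord z i - coord w₁ i : ℝ) : ℂ) ^ N * multKer g z w₁ -
          ((coord z i - coord w₂ i : ℝ) : ℂ) ^ N * multKer g z w₂ :=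
      (((Complex.continuous_ofReal.comp ((continuous_coord i).sub continuous_const)).pow N).mul
        (hc w₁)).sub (((Complex.continuous_ofReal.comp
          ((continuous_coord i).sub continuous_const)).pow N).mul (hc w₂))
    have hmeas : Measurable fun z : ℝ × EuclideanSpace ℝ (Fin d) =>
        ‖((coord z i - coord w₁ i : ℝ) : ℂ) ^ N * multKer g z w₁ -
          ((coord z i - coord w₂ i : ℝ) : ℂ) ^ N * multKer g z w₂‖ₑ ^ 2 :=
      hcm.measurable.enorm.pow_const 2
    calc _ ≤ ∫⁻ z, 2 * (‖((coord z i - coord w₁ i : ℝ) : ℂ) ^ N * multKer g z w₁ -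
          ((coord z i - coord w₂ i : ℝ) : ℂ) ^ N * multKer g z w₂‖ₑ ^ 2 +
          ENNReal.ofReal ((N * (δ / s) * s ^ N) ^ 2) *
          (‖multKer g z w₂‖ₑ * ENNReal.ofReal ((1 + ‖z - w₂‖ / s) ^ N)) ^ 2) :=
          lintegral_mono fun z => by
            rw [e]
            exact (enorm_add_sq_le _ _).trans
              (mul_le_mul_right (add_le_add le_rfl (hb z)) _)
      _ = 2 * ((∫⁻ z, ‖((coord z i - coord w₁ i : ℝ) : ℂ) ^ N * multKer g z w₁ -
          ((coord z i - coord w₂ i : ℝ) : ℂ) ^ N * multKer g z w₂‖ₑ ^ 2) +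
          ENNReal.ofReal ((N * (δ / s) * s ^ N) ^ 2) *
          ∫⁻ z, (‖multKer g z w₂‖ₑ * ENNReal.ofReal ((1 + ‖z - w₂‖ / s) ^ N)) ^ 2) := by
          rw [lintegral_const_mul' _ _ (by norm_num), lintegral_add_left hmeas,
            lintegral_const_mul' _ _ ENNReal.ofReal_ne_top]
      _ ≤ ENNReal.ofReal 2 * (ENNReal.ofReal
            (C1 * C3 * R ^ 2 * (δ / s) ^ 2 * s⁻¹ ^ (d + 1) * (s ^ N) ^ 2) +
          ENNReal.ofReal ((N * (δ / s) * s ^ N) ^ 2) *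
            ENNReal.ofReal (C4 * ((C2 * R) ^ 2 * s⁻¹ ^ (d + 1)))) := by
          rw [show ENNReal.ofReal 2 = 2 by simp]
          gcongr
          exact (h1'.2 i).trans (hA _ (by positivity))
      _ = _ := by
          rw [← ENNReal.ofReal_mul (by positivity), ← ENNReal.ofReal_add (by positivity)
            (by positivity), ← ENNReal.ofReal_mul (by positivity), hK5]
          congr 1
          ring

theorem exists_lintegral_multKer_sub_le (hd : 1 ≤ d) {N : ℕ} (hN : d + 2 ≤ N * 2) :
    ∃ C : ℝ, 0 ≤ C ∧
    ∀ (s R : ℝ) (g : ℝ → ℕ → ℂ), 0 < s → s ≤ 1 → SymbolBound N g R s →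
    ∀ (w₁ w₂ : ℝ × EuclideanSpace ℝ (Fin d)), ‖w₁ - w₂‖ ≤ s →
    ∫⁻ z, ‖multKer g z w₁ - multKer g z w₂‖ₑ ≤ ENNReal.ofReal (C * R * (‖w₁ - w₂‖ / s)) := by
  obtain ⟨C1, hC1, h1⟩ := exists_lintegral_coord_multKer_sub_le hd N
  obtain ⟨C2, hC2, h2⟩ := exists_lintegral_tail_le d hN
  refine ⟨C2 * C1, by positivity, fun s R g hs hs1 hg w₁ w₂ hw => ?_⟩
  have h3 := h1 s R g hs hs1 hg w₁ w₂ hw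
  have hR := hg.heatBound.nonneg
  have hc := fun w => hg.heatBound.continuous_multKer_left (by positivity) (by nlinarith) hd w
  have h4 := h2 s (C1 * R * (‖w₁ - w₂‖ / s)) w₁ (fun z => multKer g z w₁ - multKer g z w₂) hs
    (by positivity) ((hc w₁).sub (hc w₂)) h3.1 h3.2 0 le_rfl
  -- The tail estimate at radius zero is an estimate over the whole space.
  have hu : {z : ℝ × EuclideanSpace ℝ (Fin d) | 0 ≤ ‖z - w₁‖} = Set.univ :=
    Set.eq_univ_of_forall fun z => norm_nonneg _
  rw [hu, Measure.restrict_univ, zero_div, add_zero, Real.one_rpow, mul_one] at h4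
  refine h4.trans (le_of_eq ?_)
  congr 1
  ring

end PartialOscillator

namespace PartialOscillator

variable {d : ℕ}

/-! ### The Hörmander condition for sums over the scales -/

/-- Uniform in y and n: terms below the crossover q^j y = 1 form a geometric series, and so do those
above it, read backwards. -/
theorem sum_min_geometric_le {q : ℝ} (hq0 : 0 < q) (hq1 : q < 1) (n : ℕ) {y : ℝ} (hy : 0 < y) :
    ∑ j ∈ Finset.range n, min (q ^ j * y) (q ^ j * y)⁻¹ ≤ 2 / (1 - q) := by
  have h1q : 0 < 1 - q := by linarith
  have small : ∀ {y : ℝ}, 0 < y → y ≤ 1 →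
      ∑ j ∈ Finset.range n, min (q ^ j * y) (q ^ j * y)⁻¹ ≤ 1 / (1 - q) := fun {y} hy hy1 => by
    have hs := hasSum_geometric_of_lt_one hq0.le hq1
    calc _ ≤ ∑ j ∈ Finset.range n, q ^ j := Finset.sum_le_sum fun j _ =>
          (min_le_left _ _).trans (mul_le_of_le_one_right (by positivity) hy1)
      _ ≤ (1 - q)⁻¹ := sum_le_hasSum _ (fun j _ => by positivity) hs
      _ = _ := (one_div _).symm
  -- The subtracted term q/(1-q)·y⁻¹ makes the bound reproduce itself exactly when the first summand
  -- y⁻¹ is added and y is replaced by qy.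
  have large : ∀ (n : ℕ) {y : ℝ}, 1 ≤ y → (∀ y : ℝ, 0 < y → y ≤ 1 →
      ∑ j ∈ Finset.range n, min (q ^ j * y) (q ^ j * y)⁻¹ ≤ 1 / (1 - q)) →
      ∑ j ∈ Finset.range n, min (q ^ j * y) (q ^ j * y)⁻¹ ≤ 2 / (1 - q) - q / (1 - q) * y⁻¹ := by
    intro n
    induction n with
    | zero =>
      intro y hy _
      have : y⁻¹ ≤ 1 := inv_le_one_of_one_le₀ hy
      have h2 : q / (1 - q) * y⁻¹ ≤ q / (1 - q) * 1 := by gcongr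
      have h3 : 0 ≤ 2 / (1 - q) - q / (1 - q) := by
        rw [← sub_div]
        exact div_nonneg (by linarith) h1q.le
      simp only [Finset.range_zero, Finset.sum_empty]
      linarith
    | succ n ih =>
      intro y hy hsm
      have hsm' : ∀ y : ℝ, 0 < y → y ≤ 1 →
          ∑ j ∈ Finset.range n, min (q ^ j * y) (q ^ j * y)⁻¹ ≤ 1 / (1 - q) := fun y h0 h1 =>
        (Finset.sum_le_sum_of_subset_of_nonneg (Finset.range_subset_range.2 n.le_succ)
          fun j _ _ => le_min (by positivity) (by positivity)).trans (hsm y h0 h1)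
      have hy0 : 0 < y := by linarith
      rw [Finset.sum_range_succ']
      simp only [pow_zero, one_mul, pow_succ, mul_assoc]
      have hlast : min y y⁻¹ ≤ y⁻¹ := min_le_right _ _
      have hrest : ∑ j ∈ Finset.range n, min (q ^ j * (q * y)) (q ^ j * (q * y))⁻¹ ≤
          2 / (1 - q) - q / (1 - q) * y⁻¹ - y⁻¹ := by
        rcases le_total 1 (q * y) with h | h
        · refine (ih h hsm').trans (le_of_eq ?_)
          field_simp
          ring
        · refine (hsm' _ (by positivity) h).trans ?_
          have : y⁻¹ ≤ 1 := inv_le_one_of_one_le₀ hy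
          rw [← sub_nonneg]
          have e : 2 / (1 - q) - q / (1 - q) * y⁻¹ - y⁻¹ - 1 / (1 - q) =
              (1 - y⁻¹) / (1 - q) := by
            field_simp
            ring
          rw [e]
          exact div_nonneg (by linarith) h1q.le
      linarith
  rcases le_total y 1 with h | h
  · exact (small hy h).trans (by gcongr; norm_num)
  · refine (large n h fun y => small).trans ?_
    have : 0 ≤ q / (1 - q) * y⁻¹ := by positivity
    linarith

/-- If s ≥ |w₁-w₂|, use the smoothness bound. Otherwise estimate the two kernels separately by their
tails, since z is at distance at least |w₁-w₂| from both points. The smoothness exponent 1 is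
weakened to 1/4 to match the tail. -/
theorem exists_lintegral_multKer_sub_far_le (hd : 1 ≤ d) {N : ℕ} (hN : d + 2 ≤ N * 2) :
    ∃ C : ℝ, 0 ≤ C ∧
    ∀ (s R : ℝ) (g : ℝ → ℕ → ℂ), 0 < s → s ≤ 1 → SymbolBound N g R s →
    ∀ (w₁ w₂ : ℝ × EuclideanSpace ℝ (Fin d)), 0 < ‖w₁ - w₂‖ →
    ∫⁻ z in {z | 2 * ‖w₁ - w₂‖ ≤ ‖z - w₁‖}, ‖multKer g z w₁ - multKer g z w₂‖ₑ ≤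
      ENNReal.ofReal (C * R * min ((s / ‖w₁ - w₂‖) ^ (1 / 4 : ℝ))
        ((s / ‖w₁ - w₂‖) ^ (1 / 4 : ℝ))⁻¹) := by
  obtain ⟨C1, hC1, h1⟩ := exists_lintegral_multKer_tail_le hd hN
  obtain ⟨C2, hC2, h2⟩ := exists_lintegral_multKer_sub_le hd hN
  refine ⟨2 * C1 + C2, by positivity, fun s R g hs hs1 hg w₁ w₂ hr => ?_⟩
  have hR := hg.heatBound.nonneg
  have hc := fun w => hg.heatBound.continuous_multKer_left (by positivity) (by nlinarith) hd w
  rcases le_or_gt ‖w₁ - w₂‖ s with hle | hlt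
  · refine (setLIntegral_le_lintegral _ _).trans ((h2 s R g hs hs1 hg w₁ w₂ hle).trans ?_)
    refine ENNReal.ofReal_le_ofReal ?_
    generalize ‖w₁ - w₂‖ = r at hle hr
    have hx : 1 ≤ s / r := (one_le_div hr).2 hle
    have h3 : 1 ≤ (s / r) ^ (1 / 4 : ℝ) := Real.one_le_rpow hx (by norm_num)
    have h4 : (s / r) ^ (1 / 4 : ℝ) ≤ s / r := by
      conv_rhs => rw [← Real.rpow_one (s / r)]
      exact Real.rpow_le_rpow_of_exponent_le hx (by norm_num)
    have h5 : r / s ≤ ((s / r) ^ (1 / 4 : ℝ))⁻¹ := by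
      rw [← inv_div]
      exact inv_anti₀ (by positivity) h4
    have h6 : ((s / r) ^ (1 / 4 : ℝ))⁻¹ ≤ (s / r) ^ (1 / 4 : ℝ) :=
      (inv_le_one_of_one_le₀ h3).trans h3
    rw [min_eq_right h6]
    gcongr
    linarith
  · have hsub : ∀ z ∈ {z : ℝ × EuclideanSpace ℝ (Fin d) | 2 * ‖w₁ - w₂‖ ≤ ‖z - w₁‖},
        ‖w₁ - w₂‖ ≤ ‖z - w₂‖ := fun z hz => by
      have hz' : 2 * ‖w₁ - w₂‖ ≤ ‖z - w₁‖ := hz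
      have : ‖z - w₁‖ ≤ ‖z - w₂‖ + ‖w₁ - w₂‖ := by
        rw [norm_sub_rev w₁ w₂]
        simpa using norm_add_le (z - w₂) (w₂ - w₁)
      linarith
    have hm : Measurable fun z => ‖multKer g z w₁‖ₑ := (hc w₁).measurable.enorm
    have i1 : ∫⁻ z in {z | 2 * ‖w₁ - w₂‖ ≤ ‖z - w₁‖}, ‖multKer g z w₁‖ₑ ≤
        ENNReal.ofReal (C1 * R * (1 + ‖w₁ - w₂‖ / s) ^ (-(1 / 4) : ℝ)) :=
      (lintegral_mono_set fun z (hz : 2 * ‖w₁ - w₂‖ ≤ ‖z - w₁‖) =>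
        (show ‖w₁ - w₂‖ ≤ ‖z - w₁‖ by linarith)).trans (h1 s R g hs hs1 hg w₁ _ hr.le)
    have i2 : ∫⁻ z in {z | 2 * ‖w₁ - w₂‖ ≤ ‖z - w₁‖}, ‖multKer g z w₂‖ₑ ≤
        ENNReal.ofReal (C1 * R * (1 + ‖w₁ - w₂‖ / s) ^ (-(1 / 4) : ℝ)) :=
      (lintegral_mono_set hsub).trans (h1 s R g hs hs1 hg w₂ _ hr.le)
    calc _ ≤ ∫⁻ z in {z | 2 * ‖w₁ - w₂‖ ≤ ‖z - w₁‖}, (‖multKer g z w₁‖ₑ + ‖multKer g z w₂‖ₑ) :=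
          lintegral_mono fun z => enorm_sub_le
      _ ≤ ENNReal.ofReal (C1 * R * (1 + ‖w₁ - w₂‖ / s) ^ (-(1 / 4) : ℝ)) +
          ENNReal.ofReal (C1 * R * (1 + ‖w₁ - w₂‖ / s) ^ (-(1 / 4) : ℝ)) := by
          rw [lintegral_add_left hm]
          exact add_le_add i1 i2
      _ ≤ _ := by
          generalize ‖w₁ - w₂‖ = r at hlt hr
          rw [← ENNReal.ofReal_add (by positivity) (by positivity)]
          refine ENNReal.ofReal_le_ofReal ?_
          have hx : s / r ≤ 1 := (div_le_one hr).2 hlt.le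
          have h3 : (s / r) ^ (1 / 4 : ℝ) ≤ 1 := Real.rpow_le_one (by positivity) hx (by norm_num)
          have h6 : (s / r) ^ (1 / 4 : ℝ) ≤ ((s / r) ^ (1 / 4 : ℝ))⁻¹ :=
            h3.trans ((one_le_inv₀ (by positivity)).2 h3)
          have h7 : (1 + r / s) ^ (-(1 / 4) : ℝ) ≤ (s / r) ^ (1 / 4 : ℝ) := by
            rw [← inv_div r s, Real.inv_rpow (by positivity), ← Real.rpow_neg (by positivity)]
            exact Real.rpow_le_rpow_of_nonpos (by positivity) (by linarith) (by norm_num)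
          rw [min_eq_left h6]
          calc _ = 2 * C1 * R * (1 + r / s) ^ (-(1 / 4) : ℝ) := by ring
            _ ≤ (2 * C1 + C2) * R * (s / r) ^ (1 / 4 : ℝ) := by gcongr; linarith

/-- The bounds at the scales s = 2^{-j/2} are min(q^j y, (q^j y)⁻¹) with q = 2^{-1/8} and y =
|w₁-w₂|^{-1/4}. They sum to a constant that depends neither on the number of pieces nor on the two
points. -/
theorem exists_lintegral_sum_multKer_sub_le (hd : 1 ≤ d) {N : ℕ} (hN : d + 2 ≤ N * 2) :
    ∃ C : ℝ, 0 ≤ C ∧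
    ∀ (R : ℝ) (n : ℕ) (g : ℕ → ℝ → ℕ → ℂ), 0 ≤ R →
    (∀ j < n, SymbolBound N (g j) R ((√2)⁻¹ ^ j)) →
    ∀ (w₁ w₂ : ℝ × EuclideanSpace ℝ (Fin d)),
    ∫⁻ z in {z | 2 * ‖w₁ - w₂‖ ≤ ‖z - w₁‖},
      ‖∑ j ∈ Finset.range n, multKer (g j) z w₁ - ∑ j ∈ Finset.range n, multKer (g j) z w₂‖ₑ ≤
      ENNReal.ofReal (C * R) := by
  obtain ⟨C, hC, h⟩ := exists_lintegral_multKer_sub_far_le hd hN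
  have hσ0 : 0 < (√2)⁻¹ := by positivity
  have hσ1 : (√2)⁻¹ < 1 := inv_lt_one_of_one_lt₀ (by
    rw [Real.lt_sqrt zero_le_one]
    norm_num)
  generalize (√2)⁻¹ = σ at hσ0 hσ1
  have hq0 : 0 < σ ^ (1 / 4 : ℝ) := by positivity
  have hq1 : σ ^ (1 / 4 : ℝ) < 1 := Real.rpow_lt_one hσ0.le hσ1 (by norm_num)
  have hqp : ∀ j : ℕ, (σ ^ j) ^ (1 / 4 : ℝ) = (σ ^ (1 / 4 : ℝ)) ^ j := fun j => by
    rw [← Real.rpow_natCast, ← Real.rpow_natCast, ← Real.rpow_mul hσ0.le, ← Real.rpow_mul hσ0.le,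
      mul_comm]
  refine ⟨C * (2 / (1 - σ ^ (1 / 4 : ℝ))), mul_nonneg hC (div_nonneg (by norm_num) (by linarith)),
    fun R n g hR hg w₁ w₂ => ?_⟩
  rcases (norm_nonneg (w₁ - w₂)).eq_or_lt with h0 | hr
  · rw [eq_comm, norm_eq_zero, sub_eq_zero] at h0
    simp [h0]
  have hgj : ∀ j ∈ Finset.range n, SymbolBound N (g j) R (σ ^ j) := fun j hj =>
    hg j (Finset.mem_range.1 hj)
  have hs : ∀ j, σ ^ j ≤ 1 := fun j => pow_le_one₀ hσ0.le hσ1.le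
  have hm : ∀ j ∈ Finset.range n, Measurable fun z => ‖multKer (g j) z w₁ - multKer (g j) z w₂‖ₑ :=
    fun j hj => by
      have hc := fun w => (hgj j hj).heatBound.continuous_multKer_left (by positivity)
        (pow_le_one₀ (by positivity) (hs j)) hd w
      exact ((hc w₁).sub (hc w₂)).measurable.enorm
  calc _ ≤ ∫⁻ z in {z | 2 * ‖w₁ - w₂‖ ≤ ‖z - w₁‖},
        ∑ j ∈ Finset.range n, ‖multKer (g j) z w₁ - multKer (g j) z w₂‖ₑ :=
        lintegral_mono fun z => by
          rw [← Finset.sum_sub_distrib]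
          exact enorm_sum_le _ _
    _ = ∑ j ∈ Finset.range n, ∫⁻ z in {z | 2 * ‖w₁ - w₂‖ ≤ ‖z - w₁‖},
        ‖multKer (g j) z w₁ - multKer (g j) z w₂‖ₑ := lintegral_finsetSum' _ fun j hj =>
          (hm j hj).aemeasurable
    _ ≤ ∑ j ∈ Finset.range n, ENNReal.ofReal (C * R *
        min ((σ ^ (1 / 4 : ℝ)) ^ j * (‖w₁ - w₂‖ ^ (1 / 4 : ℝ))⁻¹)
          ((σ ^ (1 / 4 : ℝ)) ^ j * (‖w₁ - w₂‖ ^ (1 / 4 : ℝ))⁻¹)⁻¹) := by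
        refine Finset.sum_le_sum fun j hj => ?_
        have := h (σ ^ j) R (g j) (by positivity) (hs j) (hgj j hj) w₁ w₂ hr
        rwa [Real.div_rpow (by positivity) (norm_nonneg _), hqp, div_eq_mul_inv] at this
    _ ≤ _ := by
        rw [← ENNReal.ofReal_sum_of_nonneg fun j _ => mul_nonneg (by positivity)
          (le_min (by positivity) (by positivity)), ← Finset.mul_sum]
        refine ENNReal.ofReal_le_ofReal ?_
        rw [mul_right_comm C, mul_right_comm C _ R, mul_right_comm C R]
        refine mul_le_mul_of_nonneg_right ?_ hR
        exact mul_le_mul_of_nonneg_left (sum_min_geometric_le hq0 hq1 n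
          (inv_pos.2 (Real.rpow_pos_of_pos hr _))) hC

end PartialOscillator

/-! ### Calderón–Zygmund theory: weak type, interpolation and duality -/

namespace PartialOscillator

/-! ### Dyadic Calderón–Zygmund decomposition on a lattice -/

variable {ι : Type*} [Fintype ι] [DecidableEq ι]

/-- The dyadic cube of side `2^k` and index `q` in the lattice `ι → ℤ`. -/
noncomputable def dyadicCube (k : ℕ) (q : ι → ℤ) : Finset (ι → ℤ) :=
  Fintype.piFinset fun i => Finset.Ico (q i * 2 ^ k) ((q i + 1) * 2 ^ k)

theorem mem_dyadicCube {k : ℕ} {q n : ι → ℤ} : n ∈ dyadicCube k q ↔ ∀ i, n i / 2 ^ k = q i := by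
  simp only [dyadicCube, Fintype.mem_piFinset, Finset.mem_Ico]
  refine forall_congr' fun i => ?_
  have h2 : (0 : ℤ) < 2 ^ k := by positivity
  rw [← Int.le_ediv_iff_mul_le h2, ← Int.ediv_lt_iff_lt_mul h2]
  omega

theorem card_dyadicCube (k : ℕ) (q : ι → ℤ) :
    (dyadicCube k q).card = (2 ^ k) ^ Fintype.card ι := by
  have : ∀ i, (Finset.Ico (q i * 2 ^ k) ((q i + 1) * 2 ^ k)).card = 2 ^ k := fun i => by
    rw [Int.card_Ico, add_mul, add_sub_cancel_left, one_mul]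
    exact Int.toNat_natCast (2 ^ k)
  simp [dyadicCube, Fintype.card_piFinset, this]

theorem mem_dyadicCube_self (k : ℕ) (n : ι → ℤ) : n ∈ dyadicCube k fun i => n i / 2 ^ k :=
  mem_dyadicCube.2 fun _ => rfl

theorem dyadicCube_eq_of_mem {k : ℕ} {q n : ι → ℤ} (h : n ∈ dyadicCube k q) :
    q = fun i => n i / 2 ^ k :=
  funext fun i => (mem_dyadicCube.1 h i).symm

/-- Take the maximal dyadic cubes with average above α. There are finitely many, since the total
mass bounds their size and each must meet Λ. The parent of a maximal cube has average at most α,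
which gives the upper bound, and dyadic cubes are nested or disjoint. -/
theorem exists_dyadic_decomposition [Nonempty ι] (Λ : Finset (ι → ℤ)) (a : (ι → ℤ) → ℝ)
    (ha : ∀ n, 0 ≤ a n) (hΛ : ∀ n ∉ Λ, a n = 0) {α : ℝ} (hα : 0 < α) :
    ∃ 𝒬 : Finset (ℕ × (ι → ℤ)),
      (∀ Q ∈ 𝒬, α * (2 ^ Q.1) ^ Fintype.card ι < ∑ n ∈ dyadicCube Q.1 Q.2, a n ∧
        ∑ n ∈ dyadicCube Q.1 Q.2, a n ≤ α * (2 ^ (Q.1 + 1)) ^ Fintype.card ι) ∧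
      (𝒬 : Set (ℕ × (ι → ℤ))).PairwiseDisjoint (fun Q => dyadicCube Q.1 Q.2) ∧
      ∀ n, (∀ Q ∈ 𝒬, n ∉ dyadicCube Q.1 Q.2) → a n ≤ α := by
  classical
  let H : Set (ℕ × (ι → ℤ)) :=
    {Q | α * (2 ^ Q.1) ^ Fintype.card ι < ∑ n ∈ dyadicCube Q.1 Q.2, a n}
  have hH : ∀ Q, Q ∈ H ↔ α * (2 ^ Q.1) ^ Fintype.card ι < ∑ n ∈ dyadicCube Q.1 Q.2, a n :=
    fun _ => Iff.rfl
  -- Cubes of level K or more are too large to have average above α. Here the lattice has positive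
  -- dimension.
  obtain ⟨K, hK⟩ := pow_unbounded_of_one_lt ((∑ n ∈ Λ, a n) / α) one_lt_two
  have hHK : ∀ Q ∈ H, Q.1 < K := fun Q hQ => by
    have h1 : ∑ n ∈ dyadicCube Q.1 Q.2, a n ≤ ∑ n ∈ Λ, a n := by
      rw [← Finset.sum_filter_of_ne (p := fun n => n ∈ Λ) fun n _ hn => by
        by_contra h; exact hn (hΛ n h)]
      exact Finset.sum_le_sum_of_subset_of_nonneg
        (fun n hn => (Finset.mem_filter.1 hn).2) fun n _ _ => ha n
    have h2 : α * 2 ^ Q.1 ≤ α * (2 ^ Q.1) ^ Fintype.card ι := by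
      refine mul_le_mul_of_nonneg_left ?_ hα.le
      exact le_self_pow₀ (one_le_pow₀ one_le_two) Fintype.card_ne_zero
    have h3 : (2 : ℝ) ^ Q.1 < 2 ^ K := by
      refine lt_of_le_of_lt ?_ hK
      rw [le_div_iff₀ hα, mul_comm]
      exact h2.trans ((show _ < _ from hQ).le.trans h1)
    exact (pow_lt_pow_iff_right₀ one_lt_two).1 h3
  have hHfin : H.Finite := by
    refine Set.Finite.subset (((Finset.range K ×ˢ Λ).image
      fun p : ℕ × (ι → ℤ) => (p.1, fun i => p.2 i / 2 ^ p.1)).finite_toSet) fun Q hQ => ?_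
    have hpos : 0 < ∑ n ∈ dyadicCube Q.1 Q.2, a n :=
      lt_trans (by positivity) (show _ < _ from hQ)
    obtain ⟨n, hn, hn0⟩ := Finset.exists_ne_zero_of_sum_ne_zero hpos.ne'
    have hnΛ : n ∈ Λ := by
      by_contra h
      exact hn0 (hΛ n h)
    refine Finset.mem_coe.2 (Finset.mem_image.2 ⟨(Q.1, n), Finset.mem_product.2
      ⟨Finset.mem_range.2 (hHK Q hQ), hnΛ⟩, ?_⟩)
    exact Prod.ext rfl (dyadicCube_eq_of_mem hn).symm
  -- Maximality: no strict dyadic ancestor of Q is heavy.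
  refine ⟨hHfin.toFinset.filter fun Q => ∀ l, Q.1 < l →
    (l, fun i => Q.2 i / 2 ^ (l - Q.1)) ∉ H, ?_, ?_, ?_⟩
  · intro Q hQ
    obtain ⟨hQ1, hQ2⟩ := Finset.mem_filter.1 hQ
    refine ⟨hHfin.mem_toFinset.1 hQ1, ?_⟩
    have h1 := not_lt.1 (mt (hH _).2 (hQ2 (Q.1 + 1) (Nat.lt_succ_self _)))
    refine (Finset.sum_le_sum_of_subset_of_nonneg (fun n hn => ?_) fun n _ _ => ha n).trans h1
    rw [mem_dyadicCube] at hn ⊢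
    intro i
    simp only [Nat.add_sub_cancel_left, pow_one]
    rw [← hn i, pow_succ, Int.ediv_ediv_of_nonneg (by positivity)]
  · intro Q hQ Q' hQ' hne
    obtain ⟨hQ1, hQ2⟩ := Finset.mem_filter.1 (Finset.mem_coe.1 hQ)
    obtain ⟨hQ1', hQ2'⟩ := Finset.mem_filter.1 (Finset.mem_coe.1 hQ')
    have key : ∀ P P' : ℕ × (ι → ℤ), ∀ n ∈ dyadicCube P.1 P.2, n ∈ dyadicCube P'.1 P'.2 →
        P'.1 - P.1 + P.1 = P'.1 → P' = (P'.1, fun i => P.2 i / 2 ^ (P'.1 - P.1)) :=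
      fun P P' n hn hn' hle => by
        refine Prod.ext rfl ?_
        rw [dyadicCube_eq_of_mem hn, dyadicCube_eq_of_mem hn']
        funext i
        simp only
        rw [Int.ediv_ediv_of_nonneg (by positivity), ← pow_add, add_comm, hle]
    refine Finset.disjoint_left.2 fun n hn hn' => ?_
    rcases lt_trichotomy Q.1 Q'.1 with h | h | h
    · refine hQ2 _ h ?_
      rw [← key Q Q' n hn hn' (Nat.sub_add_cancel h.le)]
      exact hHfin.mem_toFinset.1 hQ1'
    · refine hne (Prod.ext h ?_)
      rw [dyadicCube_eq_of_mem hn, dyadicCube_eq_of_mem hn', h]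
    · refine hQ2' _ h ?_
      rw [← key Q' Q n hn' hn (Nat.sub_add_cancel h.le)]
      exact hHfin.mem_toFinset.1 hQ1
  · intro n hn
    by_contra! hlt
    have h0 : (0, fun i => n i / 2 ^ 0) ∈ H := by
      have e : dyadicCube 0 (fun i => n i / 2 ^ 0) = {n} := by
        ext m
        rw [mem_dyadicCube, Finset.mem_singleton]
        simp [funext_iff]
      rw [hH]
      simp only [e]
      simpa using hlt
    have hP : ∃ k, k ≤ K ∧ (k, fun i => n i / 2 ^ k) ∈ H := ⟨0, Nat.zero_le _, h0⟩
    obtain ⟨k, ⟨hk1, hk2⟩, hmax⟩ : ∃ k, (k ≤ K ∧ (k, fun i => n i / 2 ^ k) ∈ H) ∧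
        ∀ l, k < l → (l, fun i => n i / 2 ^ l) ∉ H := by
      have hs := Nat.findGreatest_spec (P := fun k => (k, fun i => n i / 2 ^ k) ∈ H)
        (Nat.zero_le K) h0
      refine ⟨Nat.findGreatest (fun k => (k, fun i => n i / 2 ^ k) ∈ H) K,
        ⟨Nat.findGreatest_le K, hs⟩, fun l hl hlH => ?_⟩
      exact Nat.findGreatest_is_greatest hl (hHK _ hlH).le hlH
    refine hn (k, fun i => n i / 2 ^ k) (Finset.mem_filter.2
      ⟨hHfin.mem_toFinset.2 hk2, fun l hl hlH => hmax l hl ?_⟩) (mem_dyadicCube_self k n)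
    have e : (fun i => n i / 2 ^ k / 2 ^ (l - k)) = fun i => n i / 2 ^ l := by
      funext i
      have hl' : k < l := hl
      rw [Int.ediv_ediv_of_nonneg (by positivity), ← pow_add, Nat.add_sub_cancel' hl'.le]
    simpa only [e] using hlH

end PartialOscillator

namespace PartialOscillator

/-! ### The weak type (1,1) inequality -/

variable {ι : Type*} [Fintype ι] [DecidableEq ι] {X : Type*} [MeasurableSpace X] {ν : Measure X}

/-- The data of a discretized Calderón–Zygmund operator: `κ n` is the image of the indicator
function of the cell `n`. -/
structure CZFamily (ν : Measure X) (κ : (ι → ℤ) → X → ℂ) (A₁ A₂ A₃ : ℝ≥0∞)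
    (star : ℕ → (ι → ℤ) → Set X) : Prop where
  measurable : ∀ n, Measurable (κ n)
  measurableSet : ∀ k q, MeasurableSet (star k q)
  measure_star : ∀ k q, ν (star k q) ≤ A₃ * ENNReal.ofReal ((2 ^ k) ^ Fintype.card ι)
  l2 : ∀ (Λ : Finset (ι → ℤ)) (a : (ι → ℤ) → ℂ),
    ∫⁻ x, ‖∑ n ∈ Λ, a n * κ n x‖ₑ ^ 2 ∂ν ≤ A₂ * ENNReal.ofReal (∑ n ∈ Λ, ‖a n‖ ^ 2)
  hormander : ∀ k q, ∀ n ∈ dyadicCube k q, ∀ m ∈ dyadicCube k q,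
    ∫⁻ x in (star k q)ᶜ, ‖κ n x - κ m x‖ₑ ∂ν ≤ A₁

variable {κ : (ι → ℤ) → X → ℂ} {A₁ A₂ A₃ : ℝ≥0∞} {star : ℕ → (ι → ℤ) → Set X}

theorem CZFamily.measurable_sum (h : CZFamily ν κ A₁ A₂ A₃ star) (Λ : Finset (ι → ℤ))
    (a : (ι → ℤ) → ℂ) : Measurable fun x => ∑ n ∈ Λ, a n * κ n x :=
  Finset.measurable_fun_sum _ fun n _ => (h.measurable n).const_mul _

theorem CZFamily.meas_lt_sum_le_l2 (h : CZFamily ν κ A₁ A₂ A₃ star) (Λ : Finset (ι → ℤ))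
    (a : (ι → ℤ) → ℂ) {α : ℝ} (hα : 0 < α) :
    ν {x | α ≤ ‖∑ n ∈ Λ, a n * κ n x‖} ≤
      A₂ * ENNReal.ofReal ((∑ n ∈ Λ, ‖a n‖ ^ 2) / α ^ 2) := by
  have hm : Measurable fun x => ‖∑ n ∈ Λ, a n * κ n x‖ₑ ^ 2 :=
    (h.measurable_sum Λ a).enorm.pow_const 2
  have h1 := mul_meas_ge_le_lintegral₀ (μ := ν) hm.aemeasurable (ENNReal.ofReal (α ^ 2))
  have h2 : {x | α ≤ ‖∑ n ∈ Λ, a n * κ n x‖} =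
      {x | ENNReal.ofReal (α ^ 2) ≤ ‖∑ n ∈ Λ, a n * κ n x‖ₑ ^ 2} := by
    ext x
    simp only [Set.mem_ofPred_eq]
    rw [enorm_sq_eq_ofReal, ENNReal.ofReal_le_ofReal_iff (by positivity)]
    exact (pow_le_pow_iff_left₀ hα.le (norm_nonneg _) two_ne_zero).symm
  rw [h2, ENNReal.ofReal_div_of_pos (by positivity), ← mul_div_assoc,
    ENNReal.le_div_iff_mul_le (Or.inl (by simp; positivity)) (Or.inl ENNReal.ofReal_ne_top), mul_comm]
  exact h1.trans (h.l2 Λ a)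

/-- As the coefficients sum to zero, a fixed κ m can be subtracted from every κ n, and the Hörmander
condition applies to the differences. -/
theorem CZFamily.lintegral_compl_star_le (h : CZFamily ν κ A₁ A₂ A₃ star) (k : ℕ) (q : ι → ℤ)
    (b : (ι → ℤ) → ℂ) (hb : ∑ n ∈ dyadicCube k q, b n = 0) :
    ∫⁻ x in (star k q)ᶜ, ‖∑ n ∈ dyadicCube k q, b n * κ n x‖ₑ ∂ν ≤
      A₁ * ENNReal.ofReal (∑ n ∈ dyadicCube k q, ‖b n‖) := by
  obtain ⟨m, hm⟩ : (dyadicCube k q).Nonempty := by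
    rw [← Finset.card_pos, card_dyadicCube]
    positivity
  have e : ∀ x, ∑ n ∈ dyadicCube k q, b n * κ n x =
      ∑ n ∈ dyadicCube k q, b n * (κ n x - κ m x) := fun x => by
    simp only [mul_sub, Finset.sum_sub_distrib]
    rw [← Finset.sum_mul, hb, zero_mul, sub_zero]
  have hmeas : ∀ n ∈ dyadicCube k q, Measurable fun x => ‖b n * (κ n x - κ m x)‖ₑ := fun n _ =>
    (((h.measurable n).sub (h.measurable m)).const_mul _).enorm
  calc _ ≤ ∫⁻ x in (star k q)ᶜ, ∑ n ∈ dyadicCube k q, ‖b n * (κ n x - κ m x)‖ₑ ∂ν :=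
        lintegral_mono fun x => by
          rw [e]
          exact enorm_sum_le _ _
    _ = ∑ n ∈ dyadicCube k q, ‖b n‖ₑ * ∫⁻ x in (star k q)ᶜ, ‖κ n x - κ m x‖ₑ ∂ν := by
        rw [lintegral_finsetSum _ hmeas]
        refine Finset.sum_congr rfl fun n _ => ?_
        simp only [enorm_mul]
        rw [lintegral_const_mul' _ _ (by simp)]
    _ ≤ ∑ n ∈ dyadicCube k q, ‖b n‖ₑ * A₁ := Finset.sum_le_sum fun n hn =>
        mul_le_mul_right (h.hormander k q n hn m hm) _
    _ = _ := by
        rw [← Finset.sum_mul, mul_comm, ENNReal.ofReal_sum_of_nonneg fun _ _ => norm_nonneg _]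
        simp only [ofReal_norm]

/-- The decomposition replaces the coefficients on each selected cube by their average. The good
part is at most 2^D α and is handled by L² and Chebyshev. The bad part has mean zero on each cube
and is integrable off the enlarged cubes, whose total measure is bounded by the selection rule. -/
theorem CZFamily.meas_lt_sum_le [Nonempty ι] (h : CZFamily ν κ A₁ A₂ A₃ star)
    (Λ : Finset (ι → ℤ)) (a : (ι → ℤ) → ℂ) {α : ℝ} (hα : 0 < α) :
    ν {x | α < ‖∑ n ∈ Λ, a n * κ n x‖} ≤
      (A₃ + 4 * A₁ + ENNReal.ofReal (4 * 2 ^ Fintype.card ι) * A₂) *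
        ENNReal.ofReal ((∑ n ∈ Λ, ‖a n‖) / α) := by
  obtain ⟨D, hD⟩ : ∃ D, D = Fintype.card ι := ⟨_, rfl⟩
  obtain ⟨c, hc⟩ : ∃ c : (ι → ℤ) → ℂ, c = fun n => if n ∈ Λ then a n else 0 := ⟨_, rfl⟩
  have hcΛ : ∀ n ∉ Λ, c n = 0 := fun n hn => by simp [hc, hn]
  have hca : ∀ n ∈ Λ, c n = a n := fun n hn => by simp [hc, hn]
  obtain ⟨𝒬, h1, h2, h3⟩ := exists_dyadic_decomposition Λ (fun n => ‖c n‖)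
    (fun n => norm_nonneg _) (fun n hn => by simp [hcΛ n hn]) hα
  simp only [← hD] at h1 ⊢
  set U : Finset (ι → ℤ) := 𝒬.biUnion fun Q => dyadicCube Q.1 Q.2 with hU
  obtain ⟨avg, havg⟩ : ∃ avg : ℕ × (ι → ℤ) → ℂ, avg = fun Q =>
    (∑ n ∈ dyadicCube Q.1 Q.2, c n) / ((2 ^ Q.1) ^ D : ℝ) := ⟨_, rfl⟩
  obtain ⟨g, hg⟩ : ∃ g : (ι → ℤ) → ℂ, g = fun n => (∑ Q ∈ 𝒬,
    if n ∈ dyadicCube Q.1 Q.2 then avg Q else 0) + if n ∈ U then 0 else c n := ⟨_, rfl⟩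
  have hgQ : ∀ Q ∈ 𝒬, ∀ n ∈ dyadicCube Q.1 Q.2, g n = avg Q := fun Q hQ n hn => by
    have hnU : n ∈ U := Finset.mem_biUnion.2 ⟨Q, hQ, hn⟩
    rw [hg]
    simp only [hnU, if_true, add_zero]
    rw [Finset.sum_eq_single Q, if_pos hn]
    · intro Q' hQ' hne
      exact if_neg fun hn' => Finset.disjoint_left.1 (h2 hQ' hQ hne) hn' hn
    · exact fun h => absurd hQ h
  have hgU : ∀ n ∉ U, g n = c n := fun n hn => by
    rw [hg]
    simp only [hn, if_false]
    rw [Finset.sum_eq_zero, zero_add]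
    exact fun Q hQ => if_neg fun hn' => hn (Finset.mem_biUnion.2 ⟨Q, hQ, hn'⟩)
  have hcard : ∀ Q : ℕ × (ι → ℤ), ((dyadicCube Q.1 Q.2).card : ℝ) = (2 ^ Q.1) ^ D := fun Q => by
    rw [card_dyadicCube, hD]
    push_cast
    rfl
  have hnavg : ∀ Q, ‖avg Q‖ * (2 ^ Q.1) ^ D ≤ ∑ n ∈ dyadicCube Q.1 Q.2, ‖c n‖ := fun Q => by
    have hp : (0 : ℝ) < (2 ^ Q.1) ^ D := by positivity
    rw [havg]
    simp only [norm_div, Complex.norm_real]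
    rw [Real.norm_of_nonneg hp.le, div_mul_cancel₀ _ hp.ne']
    exact norm_sum_le _ _
  -- On a selected cube the factor 2^D compares its cardinality with that of the parent; off the
  -- cubes the coefficients are at most α.
  have hgle : ∀ n, ‖g n‖ ≤ 2 ^ D * α := fun n => by
    by_cases hn : n ∈ U
    · obtain ⟨Q, hQ, hnQ⟩ := Finset.mem_biUnion.1 hn
      rw [hgQ Q hQ n hnQ]
      have hp : (0 : ℝ) < (2 ^ Q.1) ^ D := by positivity
      refine le_of_mul_le_mul_right ((hnavg Q).trans ((h1 Q hQ).2.trans (le_of_eq ?_))) hp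
      rw [pow_succ, mul_pow]
      ring
    · rw [hgU n hn]
      refine (h3 n fun Q hQ hnQ => hn (Finset.mem_biUnion.2 ⟨Q, hQ, hnQ⟩)).trans ?_
      exact le_mul_of_one_le_left hα.le (one_le_pow₀ one_le_two)
  have hbi : ∀ {β : Type} [AddCommMonoid β] (f : (ι → ℤ) → β),
      ∑ n ∈ U, f n = ∑ Q ∈ 𝒬, ∑ n ∈ dyadicCube Q.1 Q.2, f n := fun f =>
    Finset.sum_biUnion h2
  have hS : ∀ M : Finset (ι → ℤ), ∑ n ∈ M, ‖c n‖ ≤ ∑ n ∈ Λ, ‖a n‖ := fun M => by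
    calc ∑ n ∈ M, ‖c n‖ = ∑ n ∈ M.filter (· ∈ Λ), ‖c n‖ := by
          rw [Finset.sum_filter_of_ne]
          intro n _ hn
          by_contra hnΛ
          exact hn (by rw [hcΛ n hnΛ, norm_zero])
      _ ≤ ∑ n ∈ Λ, ‖c n‖ := Finset.sum_le_sum_of_subset_of_nonneg
          (fun n hn => (Finset.mem_filter.1 hn).2) fun n _ _ => norm_nonneg _
      _ = _ := Finset.sum_congr rfl fun n hn => by rw [hca n hn]
  set S := ∑ n ∈ Λ, ‖a n‖ with hSdef
  have hS0 : 0 ≤ S := Finset.sum_nonneg fun _ _ => norm_nonneg _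
  have hsplit : ∀ {β : Type} [AddCommMonoid β] (f : (ι → ℤ) → β),
      ∑ n ∈ Λ ∪ U, f n = ∑ n ∈ Λ \ U, f n + ∑ n ∈ U, f n := fun f => by
    rw [← Finset.sdiff_union_self_eq_union, Finset.sum_union Finset.sdiff_disjoint]
  have hg1 : ∑ n ∈ Λ ∪ U, ‖g n‖ ≤ S := by
    refine le_trans ?_ (hS (Λ ∪ U))
    rw [hsplit, hsplit]
    refine add_le_add (Finset.sum_le_sum fun n hn => ?_) ?_
    · rw [hgU n (Finset.mem_sdiff.1 hn).2]
    · rw [hbi, hbi]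
      refine Finset.sum_le_sum fun Q hQ => ?_
      rw [Finset.sum_congr rfl fun n hn => by rw [hgQ Q hQ n hn], Finset.sum_const, nsmul_eq_mul,
        hcard, mul_comm]
      exact hnavg Q
  have hg2 : ∑ n ∈ Λ ∪ U, ‖g n‖ ^ 2 ≤ 2 ^ D * α * S := by
    calc _ ≤ ∑ n ∈ Λ ∪ U, 2 ^ D * α * ‖g n‖ := Finset.sum_le_sum fun n _ => by
          rw [sq]
          exact mul_le_mul_of_nonneg_right (hgle n) (norm_nonneg _)
      _ ≤ _ := by
          rw [← Finset.mul_sum]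
          exact mul_le_mul_of_nonneg_left hg1 (by positivity)
  have hdecomp : ∀ x, ∑ n ∈ Λ, a n * κ n x = ∑ n ∈ Λ ∪ U, g n * κ n x +
      ∑ Q ∈ 𝒬, ∑ n ∈ dyadicCube Q.1 Q.2, (c n - avg Q) * κ n x := fun x => by
    have e1 : ∑ n ∈ Λ, a n * κ n x = ∑ n ∈ Λ ∪ U, c n * κ n x := by
      rw [← Finset.sum_subset Finset.subset_union_left fun n _ hn => by rw [hcΛ n hn, zero_mul]]
      exact Finset.sum_congr rfl fun n hn => by rw [hca n hn]
    have e2 : ∑ Q ∈ 𝒬, ∑ n ∈ dyadicCube Q.1 Q.2, (c n - avg Q) * κ n x =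
        ∑ n ∈ U, (c n - g n) * κ n x := by
      rw [hbi]
      refine Finset.sum_congr rfl fun Q hQ => Finset.sum_congr rfl fun n hn => ?_
      rw [hgQ Q hQ n hn]
    rw [e1, e2, hsplit, hsplit, add_assoc, ← Finset.sum_add_distrib]
    congr 1
    · exact Finset.sum_congr rfl fun n hn => by rw [hgU n (Finset.mem_sdiff.1 hn).2]
    · exact Finset.sum_congr rfl fun n _ => by ring
  set W : Set X := ⋃ Q ∈ 𝒬, star Q.1 Q.2 with hW
  have hWm : MeasurableSet W := Finset.measurableSet_biUnion _ fun Q _ => h.measurableSet _ _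
  have hWle : ν W ≤ A₃ * ENNReal.ofReal (S / α) := by
    calc ν W ≤ ∑ Q ∈ 𝒬, ν (star Q.1 Q.2) := measure_biUnion_finset_le _ _
      _ ≤ ∑ Q ∈ 𝒬, A₃ * ENNReal.ofReal ((∑ n ∈ dyadicCube Q.1 Q.2, ‖c n‖) / α) := by
          refine Finset.sum_le_sum fun Q hQ => (h.measure_star _ _).trans ?_
          refine mul_le_mul_right (ENNReal.ofReal_le_ofReal ?_) _
          rw [← hD, le_div_iff₀ hα, mul_comm]
          exact (h1 Q hQ).1.le
      _ = A₃ * ENNReal.ofReal ((∑ n ∈ U, ‖c n‖) / α) := by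
          rw [← Finset.mul_sum, hbi, Finset.sum_div, ENNReal.ofReal_sum_of_nonneg]
          exact fun Q _ => div_nonneg (Finset.sum_nonneg fun _ _ => norm_nonneg _) hα.le
      _ ≤ _ := by
          gcongr
          exact hS U
  have hbad : ∫⁻ x in Wᶜ, ‖∑ Q ∈ 𝒬, ∑ n ∈ dyadicCube Q.1 Q.2, (c n - avg Q) * κ n x‖ₑ ∂ν ≤
      A₁ * ENNReal.ofReal (2 * S) := by
    have hmQ : ∀ Q ∈ 𝒬, Measurable fun x =>
        ‖∑ n ∈ dyadicCube Q.1 Q.2, (c n - avg Q) * κ n x‖ₑ := fun Q _ =>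
      (h.measurable_sum _ fun n => c n - avg Q).enorm
    calc _ ≤ ∫⁻ x in Wᶜ, ∑ Q ∈ 𝒬, ‖∑ n ∈ dyadicCube Q.1 Q.2, (c n - avg Q) * κ n x‖ₑ ∂ν :=
          lintegral_mono fun x => enorm_sum_le _ _
      _ = ∑ Q ∈ 𝒬, ∫⁻ x in Wᶜ, ‖∑ n ∈ dyadicCube Q.1 Q.2, (c n - avg Q) * κ n x‖ₑ ∂ν :=
          lintegral_finsetSum _ hmQ
      _ ≤ ∑ Q ∈ 𝒬, A₁ * ENNReal.ofReal (2 * ∑ n ∈ dyadicCube Q.1 Q.2, ‖c n‖) := by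
          refine Finset.sum_le_sum fun Q hQ => ?_
          have hsub : Wᶜ ⊆ (star Q.1 Q.2)ᶜ :=
            Set.compl_subset_compl.2 (Set.subset_biUnion_of_mem (u := fun Q : ℕ × (ι → ℤ) =>
              star Q.1 Q.2) hQ)
          refine (lintegral_mono_set hsub).trans ((h.lintegral_compl_star_le Q.1 Q.2
            (fun n => c n - avg Q) ?_).trans (mul_le_mul_right (ENNReal.ofReal_le_ofReal ?_) _))
          · have hp : (((2 ^ Q.1) ^ D : ℝ) : ℂ) ≠ 0 := by
              rw [Complex.ofReal_ne_zero]
              positivity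
            rw [Finset.sum_sub_distrib, Finset.sum_const, nsmul_eq_mul,
              show ((dyadicCube Q.1 Q.2).card : ℂ) = (((2 ^ Q.1) ^ D : ℝ) : ℂ) by
                rw [← hcard, Complex.ofReal_natCast], havg]
            simp only
            rw [mul_div_cancel₀ _ hp, sub_self]
          · calc _ ≤ ∑ n ∈ dyadicCube Q.1 Q.2, (‖c n‖ + ‖avg Q‖) :=
                  Finset.sum_le_sum fun n _ => norm_sub_le _ _
              _ = ∑ n ∈ dyadicCube Q.1 Q.2, ‖c n‖ + ‖avg Q‖ * (2 ^ Q.1) ^ D := by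
                  rw [Finset.sum_add_distrib, Finset.sum_const, nsmul_eq_mul, hcard, mul_comm ‖_‖]
              _ ≤ _ := by linarith [hnavg Q]
      _ = A₁ * ENNReal.ofReal (2 * ∑ n ∈ U, ‖c n‖) := by
          rw [← Finset.mul_sum, hbi]
          congr 1
          rw [Finset.mul_sum, ENNReal.ofReal_sum_of_nonneg]
          exact fun Q _ => mul_nonneg zero_le_two (Finset.sum_nonneg fun _ _ => norm_nonneg _)
      _ ≤ _ := by
          gcongr
          exact hS U
  have hbm : Measurable fun x =>
      ‖∑ Q ∈ 𝒬, ∑ n ∈ dyadicCube Q.1 Q.2, (c n - avg Q) * κ n x‖ₑ :=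
    (Finset.measurable_fun_sum _ fun Q _ => h.measurable_sum _ fun n => c n - avg Q).enorm
  have hch := mul_meas_ge_le_lintegral₀ (μ := ν.restrict Wᶜ) hbm.aemeasurable
    (ENNReal.ofReal (α / 2))
  have hchm : ν.restrict Wᶜ {x | ENNReal.ofReal (α / 2) ≤
      ‖∑ Q ∈ 𝒬, ∑ n ∈ dyadicCube Q.1 Q.2, (c n - avg Q) * κ n x‖ₑ} ≤
      4 * A₁ * ENNReal.ofReal (S / α) := by
    have h5 : ENNReal.ofReal (α / 2) * (4 * A₁ * ENNReal.ofReal (S / α)) =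
        A₁ * ENNReal.ofReal (2 * S) := by
      rw [show (4 : ℝ≥0∞) = ENNReal.ofReal 4 by simp, mul_comm (ENNReal.ofReal 4), mul_assoc,
        mul_left_comm, ← ENNReal.ofReal_mul (by norm_num), ← ENNReal.ofReal_mul (by positivity)]
      congr 2
      field_simp
      ring
    refine (ENNReal.mul_le_mul_iff_right (a := ENNReal.ofReal (α / 2)) (by simp [hα])
      ENNReal.ofReal_ne_top).1 ?_
    rw [h5]
    exact hch.trans hbad
  rw [Measure.restrict_apply (measurableSet_le measurable_const hbm)] at hchm
  have hsub : {x | α < ‖∑ n ∈ Λ, a n * κ n x‖} ⊆ {x | α / 2 ≤ ‖∑ n ∈ Λ ∪ U, g n * κ n x‖} ∪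
      (W ∪ ({x | ENNReal.ofReal (α / 2) ≤
      ‖∑ Q ∈ 𝒬, ∑ n ∈ dyadicCube Q.1 Q.2, (c n - avg Q) * κ n x‖ₑ} ∩ Wᶜ)) := by
    intro x hx
    by_cases hxW : x ∈ W
    · exact Or.inr (Or.inl hxW)
    by_cases hx1 : α / 2 ≤ ‖∑ n ∈ Λ ∪ U, g n * κ n x‖
    · exact Or.inl hx1
    refine Or.inr (Or.inr ⟨?_, hxW⟩)
    have hx' : α < ‖∑ n ∈ Λ, a n * κ n x‖ := hx
    rw [hdecomp] at hx'
    have := hx'.trans_le (norm_add_le _ _)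
    rw [Set.mem_ofPred_eq, ← ofReal_norm]
    exact ENNReal.ofReal_le_ofReal (by linarith)
  have hgood := h.meas_lt_sum_le_l2 (Λ ∪ U) g (half_pos hα)
  have hgood' : ν {x | α / 2 ≤ ‖∑ n ∈ Λ ∪ U, g n * κ n x‖} ≤
      ENNReal.ofReal (4 * 2 ^ D) * A₂ * ENNReal.ofReal (S / α) := by
    refine hgood.trans ?_
    rw [mul_comm (ENNReal.ofReal _) A₂, mul_assoc, ← ENNReal.ofReal_mul (by positivity)]
    refine mul_le_mul_right (ENNReal.ofReal_le_ofReal ?_) _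
    rw [div_le_iff₀ (by positivity)]
    refine hg2.trans (le_of_eq ?_)
    field_simp
    ring
  calc _ ≤ _ := measure_mono hsub
    _ ≤ _ := measure_union_le _ _
    _ ≤ _ := add_le_add hgood' ((measure_union_le _ _).trans (add_le_add hWle hchm))
    _ = _ := by ring

end PartialOscillator

namespace PartialOscillator

/-! ### Interpolation -/

theorem lintegral_Ioi_ite_lt_rpow_le {p b : ℝ} (hp : 1 < p) (hb : 0 ≤ b) :
    ∫⁻ t in Set.Ioi (0 : ℝ), ENNReal.ofReal (if t < b then t ^ (p - 2) else 0) ≤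
      ENNReal.ofReal (b ^ (p - 1) / (p - 1)) := by
  have hr : -1 < p - 2 := by linarith
  have hint : IntegrableOn (fun t : ℝ => t ^ (p - 2)) (Set.Ioc 0 b) :=
    (intervalIntegrable_iff_integrableOn_Ioc_of_le hb).1 (intervalIntegral.intervalIntegrable_rpow' hr)
  calc _ ≤ ∫⁻ t in Set.Ioi (0 : ℝ), (Set.Ioc 0 b).indicator
        (fun t => ENNReal.ofReal (t ^ (p - 2))) t := by
        refine setLIntegral_mono' measurableSet_Ioi fun t ht => ?_
        split_ifs with h
        · rw [Set.indicator_of_mem (show t ∈ Set.Ioc 0 b from ⟨ht, h.le⟩)]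
        · simp
    _ ≤ ∫⁻ t, (Set.Ioc 0 b).indicator (fun t => ENNReal.ofReal (t ^ (p - 2))) t :=
        setLIntegral_le_lintegral _ _
    _ = ∫⁻ t in Set.Ioc 0 b, ENNReal.ofReal (t ^ (p - 2)) := lintegral_indicator measurableSet_Ioc _
    _ = ENNReal.ofReal (∫ t in Set.Ioc 0 b, t ^ (p - 2)) :=
        (ofReal_integral_eq_lintegral_ofReal hint ((ae_restrict_iff' measurableSet_Ioc).2
          (.of_forall fun t ht => Real.rpow_nonneg ht.1.le _))).symm
    _ ≤ _ := by
        rw [← intervalIntegral.integral_of_le hb, integral_rpow (Or.inl hr),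
          show p - 2 + 1 = p - 1 by ring, Real.zero_rpow (by linarith), sub_zero]

theorem lintegral_Ioi_ite_le_rpow_le {p b : ℝ} (hp : p < 2) (hb : 0 < b) :
    ∫⁻ t in Set.Ioi (0 : ℝ), ENNReal.ofReal (if b ≤ t then t ^ (p - 3) else 0) ≤
      ENNReal.ofReal (b ^ (p - 2) / (2 - p)) := by
  have hr : p - 3 < -1 := by linarith
  have hint : IntegrableOn (fun t : ℝ => t ^ (p - 3)) (Set.Ioi b) :=
    integrableOn_Ioi_rpow_of_lt hr hb
  calc _ ≤ ∫⁻ t in Set.Ioi (0 : ℝ), (Set.Ici b).indicator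
        (fun t => ENNReal.ofReal (t ^ (p - 3))) t := by
        refine setLIntegral_mono' measurableSet_Ioi fun t ht => ?_
        split_ifs with h
        · rw [Set.indicator_of_mem (show t ∈ Set.Ici b from h)]
        · simp
    _ ≤ ∫⁻ t, (Set.Ici b).indicator (fun t => ENNReal.ofReal (t ^ (p - 3))) t :=
        setLIntegral_le_lintegral _ _
    _ = ∫⁻ t in Set.Ioi b, ENNReal.ofReal (t ^ (p - 3)) := by
        rw [lintegral_indicator measurableSet_Ici, setLIntegral_congr Ioi_ae_eq_Ici.symm]
    _ = ENNReal.ofReal (∫ t in Set.Ioi b, t ^ (p - 3)) :=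
        (ofReal_integral_eq_lintegral_ofReal hint ((ae_restrict_iff' measurableSet_Ioi).2
          (.of_forall fun t ht => Real.rpow_nonneg (hb.trans ht).le _))).symm
    _ ≤ _ := by
        rw [integral_Ioi_rpow_of_lt hr hb, show p - 3 + 1 = p - 2 by ring, ← neg_div_neg_eq]
        simp

variable {ι : Type*} [Fintype ι] [DecidableEq ι] {X : Type*} [MeasurableSpace X] {ν : Measure X}
  {κ : (ι → ℤ) → X → ℂ} {A₁ A₂ A₃ : ℝ≥0∞} {star : ℕ → (ι → ℤ) → Set X}

/-- The Marcinkiewicz splitting at height α: coefficients above α go through the weak type (1,1)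
bound, the others through Chebyshev in L². The factor α^{p-1} is the weight in the layer cake
formula. -/
theorem CZFamily.meas_lt_sum_mul_rpow_le [Nonempty ι] (h : CZFamily ν κ A₁ A₂ A₃ star)
    (Λ : Finset (ι → ℤ)) (a : (ι → ℤ) → ℂ) (p : ℝ) {α : ℝ} (hα : 0 < α) :
    ν {x | α < ‖∑ n ∈ Λ, a n * κ n x‖} * ENNReal.ofReal (α ^ (p - 1)) ≤
      (A₃ + 4 * A₁ + ENNReal.ofReal (4 * 2 ^ Fintype.card ι) * A₂) * ∑ n ∈ Λ,
        (ENNReal.ofReal (2 * ‖a n‖) * ENNReal.ofReal (if α < ‖a n‖ then α ^ (p - 2) else 0) +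
        ENNReal.ofReal (4 * ‖a n‖ ^ 2) *
          ENNReal.ofReal (if ‖a n‖ ≤ α then α ^ (p - 3) else 0)) := by
  have hsub : {x | α < ‖∑ n ∈ Λ, a n * κ n x‖} ⊆
      {x | α / 2 < ‖∑ n ∈ Λ.filter (fun n => α < ‖a n‖), a n * κ n x‖} ∪
      {x | α / 2 ≤ ‖∑ n ∈ Λ.filter (fun n => ¬ α < ‖a n‖), a n * κ n x‖} := fun x hx => by
    have hx' : α < ‖∑ n ∈ Λ, a n * κ n x‖ := hx
    rw [← Finset.sum_filter_add_sum_filter_not Λ (fun n => α < ‖a n‖)] at hx'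
    have h1 := hx'.trans_le (norm_add_le _ _)
    by_contra hn
    have hn1 : ‖∑ n ∈ Λ.filter (fun n => α < ‖a n‖), a n * κ n x‖ ≤ α / 2 :=
      not_lt.1 fun hh => hn (Or.inl hh)
    have hn2 : ‖∑ n ∈ Λ.filter (fun n => ¬ α < ‖a n‖), a n * κ n x‖ < α / 2 :=
      not_le.1 fun hh => hn (Or.inr hh)
    linarith
  -- The L² constant is dominated by the weak type constant, so a single constant serves both
  -- halves.
  have hle : A₂ ≤ A₃ + 4 * A₁ + ENNReal.ofReal (4 * 2 ^ Fintype.card ι) * A₂ := by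
    refine le_trans ?_ le_add_self
    refine le_mul_of_one_le_left zero_le ?_
    rw [← ENNReal.ofReal_one]
    refine ENNReal.ofReal_le_ofReal ?_
    have : (1 : ℝ) ≤ 2 ^ Fintype.card ι := one_le_pow₀ one_le_two
    linarith
  have h1 := h.meas_lt_sum_le (Λ.filter fun n => α < ‖a n‖) a (half_pos hα)
  have h2 := (h.meas_lt_sum_le_l2 (Λ.filter fun n => ¬ α < ‖a n‖) a (half_pos hα)).trans
    (mul_le_mul_left hle _)
  generalize A₃ + 4 * A₁ + ENNReal.ofReal (4 * 2 ^ Fintype.card ι) * A₂ = B at h1 h2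
  have e1 : α ^ (p - 1) / (α / 2) = 2 * α ^ (p - 2) := by
    rw [show p - 1 = (p - 2) + 1 by ring, Real.rpow_add_one hα.ne']
    field_simp
  have e2 : α ^ (p - 1) / (α / 2) ^ 2 = 4 * α ^ (p - 3) := by
    rw [show p - 1 = (p - 3) + (2 : ℕ) by push_cast; ring, Real.rpow_add_natCast hα.ne']
    field_simp
    ring
  have hp0 : ∀ r : ℝ, 0 ≤ α ^ r := fun r => Real.rpow_nonneg hα.le r
  calc _ ≤ (B * ENNReal.ofReal ((∑ n ∈ Λ.filter (fun n => α < ‖a n‖), ‖a n‖) / (α / 2)) +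
        B * ENNReal.ofReal ((∑ n ∈ Λ.filter (fun n => ¬ α < ‖a n‖), ‖a n‖ ^ 2) / (α / 2) ^ 2)) *
        ENNReal.ofReal (α ^ (p - 1)) :=
        mul_le_mul_left ((measure_mono hsub).trans
          ((measure_union_le _ _).trans (add_le_add h1 h2))) _
    _ = B * (ENNReal.ofReal (∑ n ∈ Λ.filter (fun n => α < ‖a n‖), 2 * ‖a n‖ * α ^ (p - 2)) +
        ENNReal.ofReal (∑ n ∈ Λ.filter (fun n => ¬ α < ‖a n‖), 4 * ‖a n‖ ^ 2 * α ^ (p - 3))) := by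
        rw [← mul_add, mul_assoc, add_mul, ← ENNReal.ofReal_mul (by positivity),
          ← ENNReal.ofReal_mul (by positivity), div_mul_eq_mul_div, div_mul_eq_mul_div,
          mul_div_assoc, mul_div_assoc, e1, e2, Finset.sum_mul, Finset.sum_mul]
        congr 3
        · exact Finset.sum_congr rfl fun n _ => by ring
        · exact Finset.sum_congr rfl fun n _ => by ring
    _ = _ := by
        rw [ENNReal.ofReal_sum_of_nonneg fun n _ => mul_nonneg (by positivity) (hp0 _),
          ENNReal.ofReal_sum_of_nonneg fun n _ => mul_nonneg (by positivity) (hp0 _),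
          Finset.sum_filter, Finset.sum_filter, ← Finset.sum_add_distrib]
        congr 1
        refine Finset.sum_congr rfl fun n _ => ?_
        rw [← ENNReal.ofReal_mul (by positivity), ← ENNReal.ofReal_mul (by positivity)]
        by_cases hn : α < ‖a n‖
        · simp [hn, not_le.2 hn]
        · simp [hn, not_lt.1 hn]

/-- Integrate the previous bound in α. The weak type half converges at zero because p > 1 and the L²
half at infinity because p < 2, which explains the constants 1/(p-1) and 1/(2-p). -/
theorem CZFamily.lintegral_rpow_le [Nonempty ι] (h : CZFamily ν κ A₁ A₂ A₃ star)
    (Λ : Finset (ι → ℤ)) (a : (ι → ℤ) → ℂ) {p : ℝ} (hp1 : 1 < p) (hp2 : p < 2) :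
    ∫⁻ x, ‖∑ n ∈ Λ, a n * κ n x‖ₑ ^ p ∂ν ≤ ENNReal.ofReal (p * (2 / (p - 1) + 4 / (2 - p))) *
      (A₃ + 4 * A₁ + ENNReal.ofReal (4 * 2 ^ Fintype.card ι) * A₂) *
      ENNReal.ofReal (∑ n ∈ Λ, ‖a n‖ ^ p) := by
  have hp0 : 0 < p := by linarith
  have hq1 : 0 < p - 1 := by linarith
  have hq2 : 0 < 2 - p := by linarith
  have h1 := lintegral_rpow_eq_lintegral_meas_lt_mul ν
    (f := fun x => ‖∑ n ∈ Λ, a n * κ n x‖) (.of_forall fun x => norm_nonneg _)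
    (h.measurable_sum Λ a).norm.aemeasurable hp0
  have h2 : ∀ α ∈ Set.Ioi (0 : ℝ), _ := fun α hα => h.meas_lt_sum_mul_rpow_le Λ a p hα
  generalize A₃ + 4 * A₁ + ENNReal.ofReal (4 * 2 ^ Fintype.card ι) * A₂ = B at h2
  have hm1 : ∀ b : ℝ, Measurable fun α : ℝ =>
      ENNReal.ofReal (if α < b then α ^ (p - 2) else 0) := fun b =>
    (Measurable.ite measurableSet_Iio (by fun_prop) measurable_const).ennreal_ofReal
  have hm2 : ∀ b : ℝ, Measurable fun α : ℝ =>
      ENNReal.ofReal (if b ≤ α then α ^ (p - 3) else 0) := fun b =>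
    (Measurable.ite measurableSet_Ici (by fun_prop) measurable_const).ennreal_ofReal
  have hpt : ∀ b : ℝ, 0 ≤ b → ∫⁻ α in Set.Ioi (0 : ℝ),
      (ENNReal.ofReal (2 * b) * ENNReal.ofReal (if α < b then α ^ (p - 2) else 0) +
        ENNReal.ofReal (4 * b ^ 2) * ENNReal.ofReal (if b ≤ α then α ^ (p - 3) else 0)) ≤
      ENNReal.ofReal ((2 / (p - 1) + 4 / (2 - p)) * b ^ p) := fun b hb => by
    rcases hb.eq_or_lt with h0 | hb0
    · simp [← h0]
    rw [lintegral_add_left ((hm1 b).const_mul _), lintegral_const_mul' _ _ ENNReal.ofReal_ne_top,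
      lintegral_const_mul' _ _ ENNReal.ofReal_ne_top]
    calc _ ≤ ENNReal.ofReal (2 * b) * ENNReal.ofReal (b ^ (p - 1) / (p - 1)) +
          ENNReal.ofReal (4 * b ^ 2) * ENNReal.ofReal (b ^ (p - 2) / (2 - p)) := by
          gcongr
          · exact lintegral_Ioi_ite_lt_rpow_le hp1 hb
          · exact lintegral_Ioi_ite_le_rpow_le hp2 hb0
      _ = _ := by
          have e1 : b ^ p = b ^ (p - 1) * b := by
            rw [← Real.rpow_add_one hb0.ne']
            ring_nf
          have e2 : b ^ p = b ^ (p - 2) * b ^ 2 := by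
            rw [← Real.rpow_add_natCast hb0.ne']
            push_cast
            ring_nf
          rw [← ENNReal.ofReal_mul (by positivity), ← ENNReal.ofReal_mul (by positivity),
            ← ENNReal.ofReal_add (by positivity) (by positivity), add_mul]
          nth_rewrite 1 [e1]
          rw [e2]
          congr 1
          ring
  calc ∫⁻ x, ‖∑ n ∈ Λ, a n * κ n x‖ₑ ^ p ∂ν
      = ∫⁻ x, ENNReal.ofReal (‖∑ n ∈ Λ, a n * κ n x‖ ^ p) ∂ν := by
        refine lintegral_congr fun x => ?_
        rw [← ofReal_norm, ENNReal.ofReal_rpow_of_nonneg (norm_nonneg _) hp0.le]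
    _ ≤ ENNReal.ofReal p * ∫⁻ α in Set.Ioi (0 : ℝ), B * ∑ n ∈ Λ,
        (ENNReal.ofReal (2 * ‖a n‖) * ENNReal.ofReal (if α < ‖a n‖ then α ^ (p - 2) else 0) +
        ENNReal.ofReal (4 * ‖a n‖ ^ 2) *
          ENNReal.ofReal (if ‖a n‖ ≤ α then α ^ (p - 3) else 0)) := by
        rw [h1]
        exact mul_le_mul_right (setLIntegral_mono' measurableSet_Ioi h2) _
    _ = ENNReal.ofReal p * (B * ∑ n ∈ Λ, ∫⁻ α in Set.Ioi (0 : ℝ),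
        (ENNReal.ofReal (2 * ‖a n‖) * ENNReal.ofReal (if α < ‖a n‖ then α ^ (p - 2) else 0) +
        ENNReal.ofReal (4 * ‖a n‖ ^ 2) *
          ENNReal.ofReal (if ‖a n‖ ≤ α then α ^ (p - 3) else 0))) := by
        have hm : ∀ n ∈ Λ, Measurable fun α : ℝ =>
          ENNReal.ofReal (2 * ‖a n‖) * ENNReal.ofReal (if α < ‖a n‖ then α ^ (p - 2) else 0) +
          ENNReal.ofReal (4 * ‖a n‖ ^ 2) *
            ENNReal.ofReal (if ‖a n‖ ≤ α then α ^ (p - 3) else 0) := fun n _ =>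
          ((hm1 _).const_mul _).fun_add ((hm2 _).const_mul _)
        rw [lintegral_const_mul _ (Finset.measurable_fun_sum _ hm), lintegral_finsetSum _ hm]
    _ ≤ ENNReal.ofReal p * (B * ∑ n ∈ Λ,
        ENNReal.ofReal ((2 / (p - 1) + 4 / (2 - p)) * ‖a n‖ ^ p)) := by
        gcongr with n
        exact hpt _ (norm_nonneg _)
    _ = _ := by
        rw [← ENNReal.ofReal_sum_of_nonneg fun n _ => mul_nonneg (by positivity)
          (Real.rpow_nonneg (norm_nonneg _) _), ← Finset.mul_sum, ENNReal.ofReal_mul hp0.le,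
          ENNReal.ofReal_mul (by positivity)]
        ring

end PartialOscillator

namespace PartialOscillator

/-! ### Calderón–Zygmund kernels on `ℝ × ℝ^d` -/

variable {d : ℕ}

/-- The point of the lattice of mesh `ε` with index `n`. -/
noncomputable def latticePoint (ε : ℝ) (n : Option (Fin d) → ℤ) : ℝ × EuclideanSpace ℝ (Fin d) :=
  (ε * n none, WithLp.toLp 2 fun j => ε * n (some j))

theorem coord_latticePoint (ε : ℝ) (n : Option (Fin d) → ℤ) (i : Option (Fin d)) :
    coord (latticePoint ε n) i = ε * n i := by
  rcases i with _ | j <;> simp [latticePoint, coord]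

/-- The half-open cell of side `ε` at the lattice point with index `n`. -/
def latticeCell (ε : ℝ) (n : Option (Fin d) → ℤ) : Set (ℝ × EuclideanSpace ℝ (Fin d)) :=
  {w | ∀ i, ⌊coord w i / ε⌋ = n i}

theorem mem_latticeCell {ε : ℝ} (hε : 0 < ε) {n : Option (Fin d) → ℤ}
    {w : ℝ × EuclideanSpace ℝ (Fin d)} :
    w ∈ latticeCell ε n ↔ ∀ i, ε * n i ≤ coord w i ∧ coord w i < ε * n i + ε := by
  refine forall_congr' fun i => ?_
  rw [Int.floor_eq_iff, le_div_iff₀ hε, div_lt_iff₀ hε, mul_comm, add_mul, one_mul, mul_comm ε]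

theorem mem_latticeCell_floor (ε : ℝ) (w : ℝ × EuclideanSpace ℝ (Fin d)) :
    w ∈ latticeCell ε fun i => ⌊coord w i / ε⌋ := fun _ => rfl

theorem eq_floor_of_mem_latticeCell {ε : ℝ} {n : Option (Fin d) → ℤ}
    {w : ℝ × EuclideanSpace ℝ (Fin d)} (h : w ∈ latticeCell ε n) :
    n = fun i => ⌊coord w i / ε⌋ := funext fun i => (h i).symm

theorem measurableSet_latticeCell (ε : ℝ) (n : Option (Fin d) → ℤ) :
    MeasurableSet (latticeCell ε n) := by
  have : latticeCell ε n = ⋂ i, {w | ⌊coord w i / ε⌋ = n i} := by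
    ext w
    rw [Set.mem_iInter]
    rfl
  rw [this]
  refine MeasurableSet.iInter fun i => ?_
  exact (Int.measurable_floor.comp ((continuous_coord i).measurable.div_const ε))
    (measurableSet_singleton (n i))

theorem preimage_add_latticeCell {ε : ℝ} (hε : 0 < ε) (n : Option (Fin d) → ℤ) :
    (fun w => w + latticePoint ε n) ⁻¹' latticeCell ε n = latticeCell (d := d) ε 0 := by
  ext w
  rw [Set.mem_preimage, mem_latticeCell hε, mem_latticeCell hε]
  refine forall_congr' fun i => ?_
  have e : coord (w + latticePoint ε n) i = coord w i + ε * n i := by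
    rw [← coord_latticePoint]
    rcases i with _ | j <;> simp [coord]
  rw [e, Pi.zero_apply, Int.cast_zero, mul_zero]
  constructor <;> rintro ⟨h1, h2⟩ <;> constructor <;> linarith

theorem volume_latticeCell {ε : ℝ} (hε : 0 < ε) (n : Option (Fin d) → ℤ) :
    volume (latticeCell ε n) = volume (latticeCell (d := d) ε 0) := by
  rw [← preimage_add_latticeCell hε n, measure_preimage_add_right]

theorem norm_sub_latticePoint_le {ε : ℝ} (hε : 0 < ε) {n : Option (Fin d) → ℤ}
    {w : ℝ × EuclideanSpace ℝ (Fin d)} (h : w ∈ latticeCell ε n) :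
    ‖w - latticePoint ε n‖ ≤ (d + 1) * ε := by
  obtain ⟨i, hi⟩ := exists_norm_le_coord (w - latticePoint ε n)
  refine hi.trans (mul_le_mul_of_nonneg_left ?_ (by positivity))
  rw [coord_sub, coord_latticePoint, abs_le]
  have := (mem_latticeCell hε).1 h i
  constructor <;> linarith [this.1, this.2]

theorem volume_latticeCell_zero_lt_top {ε : ℝ} (hε : 0 < ε) :
    volume (latticeCell (d := d) ε 0) < ⊤ := by
  refine (measure_mono fun w hw => ?_).trans_lt
    (measure_closedBall_lt_top (x := latticePoint (d := d) ε 0) (r := (d + 1) * ε))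
  rw [mem_closedBall_iff_norm]
  exact norm_sub_latticePoint_le hε hw

/-- The union of the cells near the dyadic cube of index `q` and level `k`. -/
def latticeStar (ε : ℝ) (k : ℕ) (q : Option (Fin d) → ℤ) : Set (ℝ × EuclideanSpace ℝ (Fin d)) :=
  ⋃ n ∈ Fintype.piFinset fun i => Finset.Ico (q i * 2 ^ k - (2 * d + 4) * 2 ^ k)
    (q i * 2 ^ k + (2 * d + 5) * 2 ^ k), latticeCell ε n

theorem volume_latticeStar_le {ε : ℝ} (hε : 0 < ε) (k : ℕ) (q : Option (Fin d) → ℤ) :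
    volume (latticeStar ε k q) ≤
      ENNReal.ofReal ((4 * d + 9) ^ (d + 1)) * volume (latticeCell (d := d) ε 0) *
        ENNReal.ofReal ((2 ^ k) ^ Fintype.card (Option (Fin d))) := by
  have hcard : ∀ i, (Finset.Ico (q i * 2 ^ k - (2 * d + 4) * 2 ^ k)
      (q i * 2 ^ k + (2 * d + 5) * 2 ^ k)).card = (4 * d + 9) * 2 ^ k := fun i => by
    rw [Int.card_Ico, show q i * 2 ^ k + (2 * d + 5) * 2 ^ k -
      (q i * 2 ^ k - (2 * d + 4) * 2 ^ k) = (((4 * d + 9) * 2 ^ k : ℕ) : ℤ) by push_cast; ring,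
      Int.toNat_natCast]
  refine (measure_biUnion_finset_le _ _).trans (le_of_eq ?_)
  simp only [volume_latticeCell hε, Finset.sum_const, Fintype.card_piFinset, hcard,
    Finset.prod_const, Finset.card_univ, Fintype.card_option, Fintype.card_fin, nsmul_eq_mul]
  rw [mul_right_comm, ← ENNReal.ofReal_mul (by positivity), ← mul_pow]
  congr 1
  rw [← ENNReal.ofReal_natCast]
  congr 1
  push_cast
  ring

/-- Off the enlarged cube, some coordinate of z is far from the dyadic cube, and this provides the
separation required in the Hörmander condition for all points of the corresponding cells. -/
theorem two_mul_norm_sub_le_of_notMem_latticeStar {ε : ℝ} (hε : 0 < ε) {k : ℕ}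
    {q n m : Option (Fin d) → ℤ} (hn : n ∈ dyadicCube k q) (hm : m ∈ dyadicCube k q)
    {z w : ℝ × EuclideanSpace ℝ (Fin d)} (hz : z ∉ latticeStar ε k q)
    (hw : w ∈ latticeCell ε 0) :
    2 * ‖(w + latticePoint ε n) - (w + latticePoint ε m)‖ ≤ ‖z - (w + latticePoint ε n)‖ := by
  rw [dyadicCube, Fintype.mem_piFinset] at hn hm
  simp only [Finset.mem_Ico] at hn hm
  have hn' : ∀ i, (q i * 2 ^ k : ℝ) ≤ n i ∧ (n i + 1 : ℝ) ≤ (q i + 1) * 2 ^ k := fun i =>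
    ⟨by exact_mod_cast (hn i).1, by exact_mod_cast (hn i).2⟩
  have hm' : ∀ i, (q i * 2 ^ k : ℝ) ≤ m i ∧ (m i + 1 : ℝ) ≤ (q i + 1) * 2 ^ k := fun i =>
    ⟨by exact_mod_cast (hm i).1, by exact_mod_cast (hm i).2⟩
  have h1 : ‖(w + latticePoint ε n) - (w + latticePoint ε m)‖ ≤ (d + 1) * (ε * 2 ^ k) := by
    rw [add_sub_add_left_eq_sub]
    obtain ⟨i, hi⟩ := exists_norm_le_coord (latticePoint ε n - latticePoint ε m)
    refine hi.trans (mul_le_mul_of_nonneg_left ?_ (by positivity))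
    rw [coord_sub, coord_latticePoint, coord_latticePoint, ← mul_sub, abs_mul, abs_of_pos hε]
    refine mul_le_mul_of_nonneg_left ?_ hε.le
    rw [abs_le]
    constructor <;> linarith [(hn' i).1, (hn' i).2, (hm' i).1, (hm' i).2]
  obtain ⟨p, hp⟩ : ∃ p : Option (Fin d) → ℤ, p = fun i => ⌊coord z i / ε⌋ := ⟨_, rfl⟩
  have hzp : z ∈ latticeCell ε p := by
    rw [hp]
    exact mem_latticeCell_floor ε z
  have hpn : p ∉ Fintype.piFinset fun i => Finset.Ico (q i * 2 ^ k - (2 * d + 4) * 2 ^ k)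
      (q i * 2 ^ k + (2 * d + 5) * 2 ^ k) := fun h => hz (Set.mem_biUnion h hzp)
  rw [Fintype.mem_piFinset] at hpn
  obtain ⟨i, hi⟩ := not_forall.1 hpn
  rw [Finset.mem_Ico, not_and_or, not_le, not_lt] at hi
  have h2k : (1 : ℝ) ≤ 2 ^ k := one_le_pow₀ one_le_two
  have hzi := (mem_latticeCell hε).1 hzp i
  have hwi := (mem_latticeCell hε).1 hw i
  rw [Pi.zero_apply, Int.cast_zero, mul_zero] at hwi
  have h3 := abs_coord_le (z - (w + latticePoint ε n)) i
  have e : coord (z - (w + latticePoint ε n)) i = coord z i - coord w i - ε * n i := by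
    rw [← coord_latticePoint]
    rcases i with _ | j <;> simp [coord] <;> ring
  rw [e] at h3
  refine le_trans ?_ h3
  -- Two points of the cube differ by at most (d+1)ε2^k, and the margin 2d+4 of the enlarged cube
  -- exceeds twice d+1. The upper end carries one more side length, because the cube itself lies on
  -- that side of its corner.
  have h4 : 2 * ((d + 1) * (ε * 2 ^ k)) ≤ |coord z i - coord w i - ε * n i| := by
    rcases hi with hi | hi
    · have hi' : (p i + 1 : ℝ) ≤ q i * 2 ^ k - (2 * d + 4) * 2 ^ k := by exact_mod_cast hi
      refine le_trans ?_ (neg_le_abs _)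
      nlinarith [mul_le_mul_of_nonneg_left hi' hε.le, mul_le_mul_of_nonneg_left (hn' i).1 hε.le,
        mul_le_mul_of_nonneg_left h2k hε.le]
    · have hi' : (q i * 2 ^ k + (2 * d + 5) * 2 ^ k : ℝ) ≤ p i := by exact_mod_cast hi
      refine le_trans ?_ (le_abs_self _)
      nlinarith [mul_le_mul_of_nonneg_left hi' hε.le, mul_le_mul_of_nonneg_left (hn' i).2 hε.le,
        mul_le_mul_of_nonneg_left h2k hε.le]
  linarith

/-- Continuous bounded kernels satisfying the Hörmander condition and an `L²` bound. -/
structure CZKernel (K : ℝ × EuclideanSpace ℝ (Fin d) → ℝ × EuclideanSpace ℝ (Fin d) → ℂ) (M : ℝ)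
    (B₁ B₂ : ℝ≥0∞) : Prop where
  continuous : Continuous fun p : (ℝ × EuclideanSpace ℝ (Fin d)) × (ℝ × EuclideanSpace ℝ (Fin d)) =>
    K p.1 p.2
  bounded : ∀ z w, ‖K z w‖ ≤ M
  l2 : ∀ f : ℝ × EuclideanSpace ℝ (Fin d) → ℂ, Integrable f → MemLp f 2 volume →
    ∫⁻ z, ‖∫ w, K z w * f w‖ₑ ^ 2 ≤ B₂ * ∫⁻ w, ‖f w‖ₑ ^ 2
  hormander : ∀ w₁ w₂, ∫⁻ z in {z | 2 * ‖w₁ - w₂‖ ≤ ‖z - w₁‖}, ‖K z w₁ - K z w₂‖ₑ ≤ B₁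

variable {K : ℝ × EuclideanSpace ℝ (Fin d) → ℝ × EuclideanSpace ℝ (Fin d) → ℂ} {M : ℝ}
  {B₁ B₂ : ℝ≥0∞}

theorem CZKernel.integrable_mul (h : CZKernel K M B₁ B₂) {f : ℝ × EuclideanSpace ℝ (Fin d) → ℂ}
    (hf : Integrable f) (z : ℝ × EuclideanSpace ℝ (Fin d)) : Integrable fun w => K z w * f w := by
  have hp : Continuous fun w : ℝ × EuclideanSpace ℝ (Fin d) => (z, w) := by fun_prop
  have hc := Continuous.comp h.continuous hp
  refine Integrable.mono' (hf.norm.const_mul M) (hc.aestronglyMeasurable.mul hf.1)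
    (.of_forall fun w => ?_)
  rw [norm_mul]
  exact mul_le_mul_of_nonneg_right (h.bounded z w) (norm_nonneg _)

/-- The function with the value `a n` on the cell with index `n`, for `n ∈ Λ`. -/
noncomputable def stepFun (ε : ℝ) (Λ : Finset (Option (Fin d) → ℤ))
    (a : (Option (Fin d) → ℤ) → ℂ) (w : ℝ × EuclideanSpace ℝ (Fin d)) : ℂ :=
  ∑ n ∈ Λ, (latticeCell ε n).indicator (fun _ => a n) w

theorem stepFun_eq {ε : ℝ} {Λ : Finset (Option (Fin d) → ℤ)} {a : (Option (Fin d) → ℤ) → ℂ}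
    (ha : ∀ n ∉ Λ, a n = 0) (w : ℝ × EuclideanSpace ℝ (Fin d)) :
    stepFun ε Λ a w = a fun i => ⌊coord w i / ε⌋ := by
  rw [stepFun, Finset.sum_eq_single fun i => ⌊coord w i / ε⌋]
  · rw [Set.indicator_of_mem (mem_latticeCell_floor ε w)]
  · intro n _ hn
    exact Set.indicator_of_notMem (fun h => hn (eq_floor_of_mem_latticeCell h)) _
  · intro h
    rw [ha _ h, Set.indicator_zero]

theorem enorm_stepFun_rpow (ε : ℝ) (Λ : Finset (Option (Fin d) → ℤ))
    (a : (Option (Fin d) → ℤ) → ℂ) {p : ℝ} (hp : 0 < p) (w : ℝ × EuclideanSpace ℝ (Fin d)) :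
    ‖stepFun ε Λ a w‖ₑ ^ p = ∑ n ∈ Λ, (latticeCell ε n).indicator (fun _ => ‖a n‖ₑ ^ p) w := by
  have hz : ∀ n, n ≠ (fun i => ⌊coord w i / ε⌋) → w ∉ latticeCell ε n := fun n hn h =>
    hn (eq_floor_of_mem_latticeCell h)
  by_cases hΛ : (fun i => ⌊coord w i / ε⌋) ∈ Λ
  · rw [stepFun, Finset.sum_eq_single_of_mem _ hΛ fun n _ hn => Set.indicator_of_notMem (hz n hn) _,
      Finset.sum_eq_single_of_mem _ hΛ fun n _ hn => Set.indicator_of_notMem (hz n hn) _,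
      Set.indicator_of_mem (mem_latticeCell_floor ε w),
      Set.indicator_of_mem (mem_latticeCell_floor ε w)]
  · rw [stepFun, Finset.sum_eq_zero, Finset.sum_eq_zero, enorm_zero, ENNReal.zero_rpow_of_pos hp]
    · exact fun n hn => Set.indicator_of_notMem (hz n fun h => hΛ (h ▸ hn)) _
    · exact fun n hn => Set.indicator_of_notMem (hz n fun h => hΛ (h ▸ hn)) _

theorem lintegral_enorm_stepFun_rpow {ε : ℝ} (hε : 0 < ε) (Λ : Finset (Option (Fin d) → ℤ))
    (a : (Option (Fin d) → ℤ) → ℂ) {p : ℝ} (hp : 0 < p) :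
    ∫⁻ w, ‖stepFun ε Λ a w‖ₑ ^ p =
      volume (latticeCell (d := d) ε 0) * ENNReal.ofReal (∑ n ∈ Λ, ‖a n‖ ^ p) := by
  simp only [enorm_stepFun_rpow ε Λ a hp]
  rw [lintegral_finsetSum _ fun n _ => measurable_const.indicator (measurableSet_latticeCell ε n),
    ENNReal.ofReal_sum_of_nonneg fun n _ => Real.rpow_nonneg (norm_nonneg _) _, Finset.mul_sum]
  refine Finset.sum_congr rfl fun n _ => ?_
  rw [lintegral_indicator (measurableSet_latticeCell ε n), setLIntegral_const,
    volume_latticeCell hε, mul_comm, ← ENNReal.ofReal_rpow_of_nonneg (norm_nonneg _) hp.le,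
    ofReal_norm]

theorem memLp_stepFun {ε : ℝ} (hε : 0 < ε) (Λ : Finset (Option (Fin d) → ℤ))
    (a : (Option (Fin d) → ℤ) → ℂ) (p : ℝ≥0∞) : MemLp (stepFun ε Λ a) p volume := by
  unfold stepFun
  refine memLp_finsetSum Λ fun n _ => ?_
  exact memLp_indicator_const p (measurableSet_latticeCell ε n) _
    (Or.inr (by rw [volume_latticeCell hε]; exact (volume_latticeCell_zero_lt_top hε).ne))

/-- The image under the operator with kernel `K` of the indicator function of a cell. -/
noncomputable def cellImage
    (K : ℝ × EuclideanSpace ℝ (Fin d) → ℝ × EuclideanSpace ℝ (Fin d) → ℂ) (ε : ℝ)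
    (n : Option (Fin d) → ℤ) (z : ℝ × EuclideanSpace ℝ (Fin d)) : ℂ :=
  ∫ w in latticeCell ε n, K z w

theorem CZKernel.integral_mul_stepFun (h : CZKernel K M B₁ B₂) {ε : ℝ} (hε : 0 < ε)
    (Λ : Finset (Option (Fin d) → ℤ)) (a : (Option (Fin d) → ℤ) → ℂ)
    (z : ℝ × EuclideanSpace ℝ (Fin d)) :
    ∫ w, K z w * stepFun ε Λ a w = ∑ n ∈ Λ, a n * cellImage K ε n z := by
  have hi : ∀ n ∈ Λ, Integrable fun w => K z w * (latticeCell ε n).indicator (fun _ => a n) w :=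
    fun n _ => h.integrable_mul (memLp_one_iff_integrable.1 (memLp_indicator_const 1
      (measurableSet_latticeCell ε n) _ (Or.inr (by
        rw [volume_latticeCell hε]; exact (volume_latticeCell_zero_lt_top hε).ne)))) z
  simp only [stepFun, Finset.mul_sum]
  rw [integral_finsetSum _ hi]
  refine Finset.sum_congr rfl fun n _ => ?_
  rw [cellImage, ← integral_const_mul, ← integral_indicator (measurableSet_latticeCell ε n)]
  refine integral_congr_ae (.of_forall fun w => ?_)
  simp only
  by_cases hw : w ∈ latticeCell ε n
  · rw [Set.indicator_of_mem hw, Set.indicator_of_mem hw, mul_comm]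
  · rw [Set.indicator_of_notMem hw, Set.indicator_of_notMem hw, mul_zero]

theorem cellImage_eq {ε : ℝ} (hε : 0 < ε) (n : Option (Fin d) → ℤ)
    (z : ℝ × EuclideanSpace ℝ (Fin d)) :
    cellImage K ε n z = ∫ w in latticeCell ε 0, K z (w + latticePoint ε n) := by
  rw [cellImage, ← preimage_add_latticeCell hε n]
  exact ((measurePreserving_add_right volume (latticePoint ε n)).setIntegral_preimage_emb
    (MeasurableEquiv.addRight (latticePoint ε n)).measurableEmbedding (fun w => K z w) _).symm

end PartialOscillator

namespace PartialOscillator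

open Filter Topology

variable {d : ℕ} {K : ℝ × EuclideanSpace ℝ (Fin d) → ℝ × EuclideanSpace ℝ (Fin d) → ℂ} {M : ℝ}
  {B₁ B₂ : ℝ≥0∞}

theorem CZKernel.measurable_cellImage (h : CZKernel K M B₁ B₂) (ε : ℝ) (n : Option (Fin d) → ℤ) :
    Measurable (cellImage K ε n) := by
  have : StronglyMeasurable (Function.uncurry K) := h.continuous.stronglyMeasurable
  exact (this.integral_prod_right (ν := volume.restrict (latticeCell ε n))).measurable

/-- Both cell images are integrals over the same cell at the origin after translation, so Tonelli
reduces the claim to the Hörmander condition for pairs of points with difference independent of w.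
-/
theorem CZKernel.lintegral_compl_latticeStar_le (h : CZKernel K M B₁ B₂) {ε : ℝ} (hε : 0 < ε)
    {k : ℕ} {q n m : Option (Fin d) → ℤ} (hn : n ∈ dyadicCube k q) (hm : m ∈ dyadicCube k q) :
    ∫⁻ z in (latticeStar ε k q)ᶜ, ‖cellImage K ε n z - cellImage K ε m z‖ₑ ≤
      volume (latticeCell (d := d) ε 0) * B₁ := by
  have : IsFiniteMeasure (volume.restrict (latticeCell (d := d) ε 0)) :=
    ⟨by rw [Measure.restrict_apply_univ]; exact volume_latticeCell_zero_lt_top hε⟩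
  have hc : ∀ n, Continuous fun p : (ℝ × EuclideanSpace ℝ (Fin d)) × (ℝ × EuclideanSpace ℝ (Fin d))
      => K p.1 (p.2 + latticePoint ε n) := fun n => by
    have hp : Continuous fun p : (ℝ × EuclideanSpace ℝ (Fin d)) × (ℝ × EuclideanSpace ℝ (Fin d)) =>
        (p.1, p.2 + latticePoint ε n) := by fun_prop
    exact Continuous.comp h.continuous hp
  have hi : ∀ n z, Integrable (fun w => K z (w + latticePoint ε n))
      (volume.restrict (latticeCell ε 0)) := fun n z => by
    have hp : Continuous fun w : ℝ × EuclideanSpace ℝ (Fin d) => (z, w) := by fun_prop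
    exact Integrable.of_bound (Continuous.comp (hc n) hp).aestronglyMeasurable M
      (.of_forall fun w => h.bounded _ _)
  have hmeas : Measurable fun p : (ℝ × EuclideanSpace ℝ (Fin d)) × (ℝ × EuclideanSpace ℝ (Fin d)) =>
      ‖K p.1 (p.2 + latticePoint ε n) - K p.1 (p.2 + latticePoint ε m)‖ₑ :=
    ((hc n).sub (hc m)).measurable.enorm
  calc _ ≤ ∫⁻ z in (latticeStar ε k q)ᶜ, ∫⁻ w in latticeCell ε 0,
        ‖K z (w + latticePoint ε n) - K z (w + latticePoint ε m)‖ₑ := by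
        refine lintegral_mono fun z => ?_
        rw [cellImage_eq hε, cellImage_eq hε, ← integral_sub (hi n z) (hi m z)]
        exact enorm_integral_le_lintegral_enorm _
    _ = ∫⁻ w in latticeCell ε 0, ∫⁻ z in (latticeStar ε k q)ᶜ,
        ‖K z (w + latticePoint ε n) - K z (w + latticePoint ε m)‖ₑ :=
        lintegral_lintegral_swap hmeas.aemeasurable
    _ ≤ ∫⁻ w in latticeCell (d := d) ε 0, B₁ := by
        refine setLIntegral_mono' (measurableSet_latticeCell ε 0) fun w hw => ?_
        exact (lintegral_mono_set fun z hz =>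
          two_mul_norm_sub_le_of_notMem_latticeStar hε hn hm hz hw).trans (h.hormander _ _)
    _ = _ := by rw [setLIntegral_const, mul_comm]

/-- All three constants are proportional to the volume of a cell. The same volume appears in the
norm of a step function, so the resulting L^p bound does not depend on the mesh. -/
theorem CZKernel.czFamily (h : CZKernel K M B₁ B₂) {ε : ℝ} (hε : 0 < ε) :
    CZFamily volume (cellImage K ε) (volume (latticeCell (d := d) ε 0) * B₁)
      (volume (latticeCell (d := d) ε 0) * B₂)
      (ENNReal.ofReal ((4 * d + 9) ^ (d + 1)) * volume (latticeCell (d := d) ε 0))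
      (latticeStar ε) where
  measurable := h.measurable_cellImage ε
  measurableSet k q := Finset.measurableSet_biUnion _ fun n _ => measurableSet_latticeCell ε n
  measure_star := volume_latticeStar_le hε
  hormander k q n hn m hm := h.lintegral_compl_latticeStar_le hε hn hm
  l2 Λ a := by
    have h1 := h.l2 (stepFun ε Λ a) (memLp_one_iff_integrable.1 (memLp_stepFun hε Λ a 1))
      (memLp_stepFun hε Λ a 2)
    simp only [h.integral_mul_stepFun hε] at h1
    refine h1.trans (le_of_eq ?_)
    have h2 := lintegral_enorm_stepFun_rpow hε Λ a zero_lt_two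
    simp only [ENNReal.rpow_two, Real.rpow_two] at h2
    rw [h2]
    ring

/-- The constant in the `L^p` inequality for Calderón–Zygmund operators. -/
noncomputable def czConst (d : ℕ) (p : ℝ) (B₁ B₂ : ℝ≥0∞) : ℝ≥0∞ :=
  ENNReal.ofReal (p * (2 / (p - 1) + 4 / (2 - p))) *
    (ENNReal.ofReal ((4 * d + 9) ^ (d + 1)) + 4 * B₁ + ENNReal.ofReal (4 * 2 ^ (d + 1)) * B₂)

theorem czConst_lt_top (d : ℕ) (p : ℝ) (h1 : B₁ < ⊤) (h2 : B₂ < ⊤) : czConst d p B₁ B₂ < ⊤ :=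
  ENNReal.mul_lt_top ENNReal.ofReal_lt_top (ENNReal.add_lt_top.2 ⟨ENNReal.add_lt_top.2
    ⟨ENNReal.ofReal_lt_top, ENNReal.mul_lt_top (by norm_num) h1⟩,
    ENNReal.mul_lt_top ENNReal.ofReal_lt_top h2⟩)

theorem CZKernel.lintegral_stepFun_rpow_le (h : CZKernel K M B₁ B₂) {ε : ℝ} (hε : 0 < ε)
    (Λ : Finset (Option (Fin d) → ℤ)) (a : (Option (Fin d) → ℤ) → ℂ) {p : ℝ} (hp1 : 1 < p)
    (hp2 : p < 2) :
    ∫⁻ z, ‖∫ w, K z w * stepFun ε Λ a w‖ₑ ^ p ≤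
      czConst d p B₁ B₂ * ∫⁻ w, ‖stepFun ε Λ a w‖ₑ ^ p := by
  simp only [h.integral_mul_stepFun hε]
  rw [lintegral_enorm_stepFun_rpow hε Λ a (by linarith)]
  refine ((h.czFamily hε).lintegral_rpow_le Λ a hp1 hp2).trans (le_of_eq ?_)
  rw [czConst, Fintype.card_option, Fintype.card_fin]
  ring

theorem exists_finset_latticePoint {f : ℝ × EuclideanSpace ℝ (Fin d) → ℂ} {R ε : ℝ} (hε : 0 < ε)
    (hR : ∀ x, R < ‖x‖ → f x = 0) :
    ∃ Λ : Finset (Option (Fin d) → ℤ), ∀ n ∉ Λ, f (latticePoint ε n) = 0 := by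
  refine ⟨Fintype.piFinset fun _ => Finset.Icc (-⌈R / ε⌉) ⌈R / ε⌉, fun n hn => hR _ ?_⟩
  rw [Fintype.mem_piFinset] at hn
  obtain ⟨i, hi⟩ := not_forall.1 hn
  by_contra! hle
  have h1 := (abs_coord_le (latticePoint ε n) i).trans hle
  rw [coord_latticePoint, abs_mul, abs_of_pos hε, mul_comm, ← le_div_iff₀ hε] at h1
  have h2 := abs_le.1 (h1.trans (Int.le_ceil _))
  refine hi (Finset.mem_Icc.2 ⟨?_, ?_⟩)
  · exact_mod_cast h2.1
  · exact_mod_cast h2.2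

/-- Sample f on lattices of mesh 1/(m+1). The step functions converge pointwise under a common
bounded dominating function of compact support, so their L^p norms converge, and Fatou handles the
left side. -/
theorem CZKernel.lintegral_rpow_le (h : CZKernel K M B₁ B₂)
    {f : ℝ × EuclideanSpace ℝ (Fin d) → ℂ} (hf : Continuous f) (hfc : HasCompactSupport f) {p : ℝ}
    (hp1 : 1 < p) (hp2 : p < 2) (hB : czConst d p B₁ B₂ < ⊤) :
    ∫⁻ z, ‖∫ w, K z w * f w‖ₑ ^ p ≤ czConst d p B₁ B₂ * ∫⁻ w, ‖f w‖ₑ ^ p := by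
  have hp0 : 0 < p := by linarith
  have hM : 0 ≤ M := (norm_nonneg _).trans (h.bounded 0 0)
  obtain ⟨B, hBf⟩ := hfc.exists_bound_of_continuous hf
  have hB0 : 0 ≤ B := (norm_nonneg _).trans (hBf 0)
  obtain ⟨R, hR⟩ : ∃ R : ℝ, ∀ x, R < ‖x‖ → f x = 0 := by
    obtain ⟨R, hR⟩ := hfc.isBounded.subset_closedBall 0
    refine ⟨R, fun x hx => ?_⟩
    by_contra hne
    have := hR (subset_tsupport f hne)
    rw [mem_closedBall_zero_iff] at this
    linarith
  obtain ⟨ε, hεdef⟩ : ∃ ε : ℕ → ℝ, ε = fun m : ℕ => 1 / ((m : ℝ) + 1) := ⟨_, rfl⟩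
  have hε : ∀ m, 0 < ε m := fun m => by rw [hεdef]; positivity
  have hε1 : ∀ m, ε m ≤ 1 := fun m => by
    rw [hεdef]
    exact (div_le_one (by positivity)).2 (by simp)
  have hεlim : Tendsto ε atTop (𝓝 0) := by
    rw [hεdef]
    exact tendsto_one_div_add_atTop_nhds_zero_nat
  choose Λ hΛ using fun m => exists_finset_latticePoint (hε m) hR
  obtain ⟨F, hF⟩ : ∃ F : ℕ → ℝ × EuclideanSpace ℝ (Fin d) → ℂ, F = fun m =>
    stepFun (ε m) (Λ m) fun n => f (latticePoint (ε m) n) := ⟨_, rfl⟩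
  have hFeq : ∀ m w, F m w = f (latticePoint (ε m) fun i => ⌊coord w i / ε m⌋) := fun m w => by
    rw [hF]
    exact stepFun_eq (hΛ m) w
  have hdist : ∀ m w, ‖w - latticePoint (ε m) fun i => ⌊coord w i / ε m⌋‖ ≤ (d + 1) * ε m :=
    fun m w => norm_sub_latticePoint_le (hε m) (mem_latticeCell_floor _ w)
  have hFlim : ∀ w, Tendsto (fun m => F m w) atTop (𝓝 (f w)) := fun w => by
    simp only [hFeq]
    refine (hf.tendsto w).comp ?_
    rw [tendsto_iff_norm_sub_tendsto_zero]
    have h0 : Tendsto (fun m => (d + 1) * ε m) atTop (𝓝 0) := by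
      simpa using hεlim.const_mul ((d : ℝ) + 1)
    refine squeeze_zero (fun m => norm_nonneg _) (fun m => ?_) h0
    rw [norm_sub_rev]
    exact hdist m w
  obtain ⟨S, hS⟩ : ∃ S : Set (ℝ × EuclideanSpace ℝ (Fin d)),
    S = Metric.closedBall 0 (R + (d + 1)) := ⟨_, rfl⟩
  have hSm : MeasurableSet S := by rw [hS]; exact measurableSet_closedBall
  have hSfin : volume S < ⊤ := by rw [hS]; exact measure_closedBall_lt_top
  have hFbd : ∀ m w, ‖F m w‖ ≤ S.indicator (fun _ => B) w := fun m w => by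
    by_cases hw : w ∈ S
    · rw [Set.indicator_of_mem hw, hFeq]
      exact hBf _
    · rw [Set.indicator_of_notMem hw, hFeq, hR, norm_zero]
      rw [hS, mem_closedBall_zero_iff, not_le] at hw
      have h1 := hdist m w
      have h2 := norm_sub_norm_le w (latticePoint (ε m) fun i => ⌊coord w i / ε m⌋)
      have h3 : ((d : ℝ) + 1) * ε m ≤ (d + 1) * 1 :=
        mul_le_mul_of_nonneg_left (hε1 m) (by positivity)
      linarith
  have hFmeas : ∀ m, Measurable (F m) := fun m => by
    rw [hF]
    exact Finset.measurable_fun_sum _ fun n _ =>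
      measurable_const.indicator (measurableSet_latticeCell _ n)
  have hlim1 : Tendsto (fun m => ∫⁻ w, ‖F m w‖ₑ ^ p) atTop (𝓝 (∫⁻ w, ‖f w‖ₑ ^ p)) := by
    refine tendsto_lintegral_of_dominated_convergence
      (S.indicator fun _ => ENNReal.ofReal B ^ p) (fun m => (hFmeas m).enorm.pow_const p)
      (fun m => .of_forall fun w => ?_) ?_ (.of_forall fun w => ?_)
    · by_cases hw : w ∈ S
      · have := hFbd m w
        rw [Set.indicator_of_mem hw] at this ⊢
        refine ENNReal.rpow_le_rpow ?_ hp0.le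
        rw [← ofReal_norm]
        exact ENNReal.ofReal_le_ofReal this
      · have := hFbd m w
        rw [Set.indicator_of_notMem hw] at this ⊢
        simp only [norm_le_zero_iff.1 this, enorm_zero]
        rw [ENNReal.zero_rpow_of_pos hp0]
    · rw [lintegral_indicator hSm, setLIntegral_const]
      exact (ENNReal.mul_lt_top (ENNReal.rpow_lt_top_of_nonneg hp0.le ENNReal.ofReal_ne_top)
        hSfin).ne
    · exact ((ENNReal.continuous_rpow_const (y := p)).tendsto _).comp
        ((continuous_enorm.tendsto _).comp (hFlim w))
  have hlim2 : ∀ z, Tendsto (fun m => ∫ w, K z w * F m w) atTop (𝓝 (∫ w, K z w * f w)) :=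
    fun z => by
    have hp : Continuous fun w : ℝ × EuclideanSpace ℝ (Fin d) => (z, w) := by fun_prop
    have hc := Continuous.comp h.continuous hp
    refine tendsto_integral_of_dominated_convergence (fun w => M * S.indicator (fun _ => B) w)
      (fun m => hc.aestronglyMeasurable.mul (hFmeas m).aestronglyMeasurable) ?_
      (fun m => .of_forall fun w => ?_) (.of_forall fun w => (hFlim w).const_mul _)
    · refine Integrable.const_mul ?_ M
      exact (integrable_indicator_iff hSm).2 (integrableOn_const hSfin.ne)
    · rw [norm_mul]
      exact mul_le_mul (h.bounded z w) (hFbd m w) (norm_nonneg _) hM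
  have hTm : ∀ m, Measurable fun z => ‖∫ w, K z w * F m w‖ₑ ^ p := fun m => by
    rw [hF]
    simp only [h.integral_mul_stepFun (hε m)]
    exact ((h.czFamily (hε m)).measurable_sum _ _).enorm.pow_const p
  calc _ = ∫⁻ z, liminf (fun m => ‖∫ w, K z w * F m w‖ₑ ^ p) atTop := by
        refine lintegral_congr fun z => (Tendsto.liminf_eq ?_).symm
        exact ((ENNReal.continuous_rpow_const (y := p)).tendsto _).comp
          ((continuous_enorm.tendsto _).comp (hlim2 z))
    _ ≤ liminf (fun m => ∫⁻ z, ‖∫ w, K z w * F m w‖ₑ ^ p) atTop := lintegral_liminf_le hTm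
    _ ≤ liminf (fun m => czConst d p B₁ B₂ * ∫⁻ w, ‖F m w‖ₑ ^ p) atTop := by
        refine liminf_le_liminf (.of_forall fun m => ?_)
        rw [hF]
        exact h.lintegral_stepFun_rpow_le (hε m) _ _ hp1 hp2
    _ = _ := (ENNReal.Tendsto.const_mul hlim1 (Or.inr hB.ne)).liminf_eq

end PartialOscillator

namespace PartialOscillator

open Filter Topology

/-! ### Duality -/

variable {d : ℕ} {K : ℝ × EuclideanSpace ℝ (Fin d) → ℝ × EuclideanSpace ℝ (Fin d) → ℂ} {M : ℝ}

theorem continuous_integral_mul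
    (hK : Continuous fun p : (ℝ × EuclideanSpace ℝ (Fin d)) × (ℝ × EuclideanSpace ℝ (Fin d)) =>
      K p.1 p.2) (hM : ∀ z w, ‖K z w‖ ≤ M) {f : ℝ × EuclideanSpace ℝ (Fin d) → ℂ}
    (hf : Integrable f) : Continuous fun z => ∫ w, K z w * f w := by
  refine continuous_of_dominated (bound := fun w => M * ‖f w‖) (fun z => ?_)
    (fun z => .of_forall fun w => ?_) (hf.norm.const_mul M) (.of_forall fun w => ?_)
  · have hp : Continuous fun w : ℝ × EuclideanSpace ℝ (Fin d) => (z, w) := by fun_prop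
    exact (Continuous.comp hK hp).aestronglyMeasurable.mul hf.1
  · rw [norm_mul]
    exact mul_le_mul_of_nonneg_right (hM z w) (norm_nonneg _)
  · have hp : Continuous fun z : ℝ × EuclideanSpace ℝ (Fin d) => (z, w) := by fun_prop
    exact (Continuous.comp hK hp).mul continuous_const

/-- Division by x^{1/q}, which is legitimate only because x is finite, and then the p-th power, with
p/q = p-1. -/
theorem ENNReal_le_of_le_mul_rpow {x a C : ℝ≥0∞} {p q : ℝ} (hpq : p.HolderConjugate q) (hx : x < ⊤)
    (h : x ≤ a ^ (1 / p) * (C * x) ^ (1 / q)) : x ≤ C ^ (p - 1) * a := by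
  have hp := hpq.pos
  have hq := hpq.symm.pos
  rcases eq_or_ne x 0 with h0 | h0
  · simp [h0]
  have e1 : x = x ^ (1 / p) * x ^ (1 / q) := by
    rw [← ENNReal.rpow_add _ _ h0 hx.ne]
    have : 1 / p + 1 / q = 1 := by simpa using hpq.inv_add_inv_eq_one
    rw [this, ENNReal.rpow_one]
  have hq0 : x ^ (1 / q) ≠ 0 := (ENNReal.rpow_pos (pos_iff_ne_zero.2 h0) hx.ne).ne'
  have hqt : x ^ (1 / q) ≠ ⊤ := ENNReal.rpow_ne_top_of_nonneg (by positivity) hx.ne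
  have h2 : x ^ (1 / p) ≤ a ^ (1 / p) * C ^ (1 / q) := by
    rw [ENNReal.mul_rpow_of_nonneg _ _ (by positivity), ← mul_assoc] at h
    nth_rewrite 1 [e1] at h
    exact (ENNReal.mul_le_mul_iff_left hq0 hqt).1 h
  have h3 := ENNReal.rpow_le_rpow h2 hp.le
  rw [ENNReal.mul_rpow_of_nonneg _ _ hp.le, ← ENNReal.rpow_mul, ← ENNReal.rpow_mul,
    ← ENNReal.rpow_mul, one_div_mul_cancel hp.ne', ENNReal.rpow_one, ENNReal.rpow_one] at h3
  have e2 : 1 / q * p = p - 1 := by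
    have := hpq.inv_add_inv_eq_one
    field_simp at this ⊢
    linarith
  rw [e2, mul_comm] at h3
  exact h3

/-- Pair F = Kf with the function that is extremal in Hölder's inequality, cut off to compact
support. Fubini moves the kernel to the other side, the bound for the transpose applies, and the
norm of F reappears on the right with a smaller power. The cutoff guarantees finiteness for that
division and is then removed by Fatou. -/
theorem lintegral_rpow_le_of_transpose
    (hK : Continuous fun p : (ℝ × EuclideanSpace ℝ (Fin d)) × (ℝ × EuclideanSpace ℝ (Fin d)) =>
      K p.1 p.2) (hM : ∀ z w, ‖K z w‖ ≤ M) {p q : ℝ} (hpq : p.HolderConjugate q) (hp2 : 2 ≤ p)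
    {C : ℝ≥0∞}
    (hT : ∀ g : ℝ × EuclideanSpace ℝ (Fin d) → ℂ, Continuous g → HasCompactSupport g →
      ∫⁻ w, ‖∫ z, K z w * g z‖ₑ ^ q ≤ C * ∫⁻ z, ‖g z‖ₑ ^ q)
    {f : ℝ × EuclideanSpace ℝ (Fin d) → ℂ} (hf : Continuous f) (hfc : HasCompactSupport f) :
    ∫⁻ z, ‖∫ w, K z w * f w‖ₑ ^ p ≤ C ^ (p - 1) * ∫⁻ w, ‖f w‖ₑ ^ p := by
  have hp := hpq.pos
  have hq := hpq.symm.pos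
  have hfi : Integrable f := hf.integrable_of_hasCompactSupport hfc
  have hFc := continuous_integral_mul hK hM hfi
  obtain ⟨F, hF⟩ : ∃ F : ℝ × EuclideanSpace ℝ (Fin d) → ℂ, F = fun z => ∫ w, K z w * f w :=
    ⟨_, rfl⟩
  rw [← hF] at hFc
  have hFz : ∀ z, ∫ w, K z w * f w = F z := fun z => by rw [hF]
  simp only [hFz]
  obtain ⟨χ, hχ⟩ : ∃ χ : ℕ → ℝ × EuclideanSpace ℝ (Fin d) → ℝ, χ = fun (n : ℕ) z =>
    max 0 (min 1 (n + 1 - ‖z‖)) := ⟨_, rfl⟩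
  have hχc : ∀ n, Continuous (χ n) := fun n => by
    rw [hχ]
    fun_prop
  have hχ0 : ∀ n z, 0 ≤ χ n z := fun n z => by rw [hχ]; exact le_max_left _ _
  have hχ1 : ∀ n z, χ n z ≤ 1 := fun n z => by
    rw [hχ]; exact max_le zero_le_one (min_le_left _ _)
  have hχs : ∀ n, HasCompactSupport (χ n) := fun n => by
    refine HasCompactSupport.intro (isCompact_closedBall 0 ((n : ℝ) + 1)) fun z hz => ?_
    rw [mem_closedBall_zero_iff, not_le] at hz
    rw [hχ]
    exact max_eq_left ((min_le_right _ _).trans (by linarith))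
  have hχlim : ∀ z, ∀ᶠ n in atTop, χ n z = 1 := fun z => by
    obtain ⟨N, hN⟩ := exists_nat_ge ‖z‖
    refine eventually_atTop.2 ⟨N, fun n hn => ?_⟩
    have : (N : ℝ) ≤ n := by exact_mod_cast hn
    rw [hχ]
    simp only
    rw [min_eq_left (by linarith), max_eq_right zero_le_one]
  have key : ∀ n, ∫⁻ z, ‖F z‖ₑ ^ p * ENNReal.ofReal (χ n z) ≤ C ^ (p - 1) * ∫⁻ w, ‖f w‖ₑ ^ p := by
    intro n
    -- The extremal function; it is continuous even where F vanishes because p ≥ 2.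
    obtain ⟨G, hG⟩ : ∃ G : ℝ × EuclideanSpace ℝ (Fin d) → ℂ, G = fun z =>
      starRingEnd ℂ (F z) * ((‖F z‖ ^ (p - 2) * χ n z : ℝ) : ℂ) := ⟨_, rfl⟩
    have hGc : Continuous G := by
      rw [hG]
      exact (Complex.continuous_conj.comp hFc).mul (Complex.continuous_ofReal.comp
        ((hFc.norm.rpow_const fun z => Or.inr (by linarith)).mul (hχc n)))
    have hGs : HasCompactSupport G := by
      refine (hχs n).mono fun z hz => ?_
      rw [Function.mem_support] at hz ⊢
      intro h0
      exact hz (by rw [hG]; simp [h0])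
    have hGi : Integrable G := hGc.integrable_of_hasCompactSupport hGs
    have hGn : ∀ z, ‖G z‖ = ‖F z‖ ^ (p - 1) * χ n z := fun z => by
      rw [hG]
      simp only
      rw [norm_mul, RCLike.norm_conj, Complex.norm_real, Real.norm_of_nonneg
        (mul_nonneg (Real.rpow_nonneg (norm_nonneg _) _) (hχ0 n z)), ← mul_assoc]
      congr 1
      rcases (norm_nonneg (F z)).eq_or_lt with h0 | h0
      · rw [← h0, zero_mul, Real.zero_rpow (by linarith)]
      · rw [mul_comm, ← Real.rpow_add_one h0.ne']
        ring_nf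
    have hFG : ∀ z, F z * G z = ((‖F z‖ ^ p * χ n z : ℝ) : ℂ) := fun z => by
      rw [hG]
      simp only
      rw [← mul_assoc, Complex.mul_conj, Complex.normSq_eq_norm_sq, ← Complex.ofReal_mul,
        ← mul_assoc]
      congr 2
      rcases (norm_nonneg (F z)).eq_or_lt with h0 | h0
      · rw [← h0, Real.zero_rpow hp.ne']
        simp
      · rw [mul_comm, ← Real.rpow_add_natCast h0.ne']
        push_cast
        ring_nf
    have hFGi : Integrable fun z => F z * G z :=
      (hFc.mul hGc).integrable_of_hasCompactSupport hGs.mul_left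
    have hX : ∫⁻ z, ‖F z‖ₑ ^ p * ENNReal.ofReal (χ n z) = ‖∫ z, F z * G z‖ₑ := by
      have h1 : ∀ z, ‖F z‖ₑ ^ p * ENNReal.ofReal (χ n z) =
          ENNReal.ofReal (‖F z‖ ^ p * χ n z) := fun z => by
        rw [← ofReal_norm, ENNReal.ofReal_rpow_of_nonneg (norm_nonneg _) hp.le,
          ENNReal.ofReal_mul (Real.rpow_nonneg (norm_nonneg _) _)]
      have h0 : ∀ z, 0 ≤ ‖F z‖ ^ p * χ n z := fun z =>
        mul_nonneg (Real.rpow_nonneg (norm_nonneg _) _) (hχ0 n z)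
      have hint : Integrable fun z => ‖F z‖ ^ p * χ n z := by
        have := hFGi.norm
        simp only [hFG, Complex.norm_real, Real.norm_of_nonneg (h0 _)] at this
        exact this
      simp only [h1, hFG]
      rw [integral_complex_ofReal, ← ofReal_norm, Complex.norm_real,
        Real.norm_of_nonneg (integral_nonneg h0),
        ofReal_integral_eq_lintegral_ofReal hint (.of_forall h0)]
    have hHc : Continuous fun w => ∫ z, K z w * G z := by
      have hsw : Continuous fun p : (ℝ × EuclideanSpace ℝ (Fin d)) ×
          (ℝ × EuclideanSpace ℝ (Fin d)) => K p.2 p.1 := by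
        have hp : Continuous fun p : (ℝ × EuclideanSpace ℝ (Fin d)) ×
          (ℝ × EuclideanSpace ℝ (Fin d)) => (p.2, p.1) := by fun_prop
        exact Continuous.comp hK hp
      exact continuous_integral_mul (K := fun w z => K z w) hsw (fun w z => hM z w) hGi
    have hswap : ∫ z, F z * G z = ∫ w, f w * ∫ z, K z w * G z := by
      have hprod : Integrable (Function.uncurry fun z w => K z w * f w * G z)
          ((volume : Measure (ℝ × EuclideanSpace ℝ (Fin d))).prod volume) := by
        refine Integrable.mono' ((hGi.norm.mul_prod hfi.norm).const_mul M)
          (((hK.aestronglyMeasurable.mul (hf.comp continuous_snd).aestronglyMeasurable)).mul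
            (hGc.comp continuous_fst).aestronglyMeasurable) (.of_forall fun x => ?_)
        simp only [Function.uncurry]
        rw [norm_mul, norm_mul, mul_assoc, mul_comm ‖f x.2‖]
        exact mul_le_mul_of_nonneg_right (hM _ _) (by positivity)
      calc ∫ z, F z * G z = ∫ z, ∫ w, K z w * f w * G z := by
            rw [hF]
            simp only [integral_mul_const]
        _ = ∫ w, ∫ z, K z w * f w * G z := integral_integral_swap hprod
        _ = _ := by
            refine integral_congr_ae (.of_forall fun w => ?_)
            simp only
            rw [← integral_const_mul]
            refine integral_congr_ae (.of_forall fun z => ?_)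
            simp only
            ring
    have hfin : ∫⁻ z, ‖F z‖ₑ ^ p * ENNReal.ofReal (χ n z) < ⊤ := by
      rw [hX]
      exact enorm_lt_top
    refine ENNReal_le_of_le_mul_rpow hpq hfin ?_
    calc _ = ‖∫ w, f w * ∫ z, K z w * G z‖ₑ := by rw [hX, hswap]
      _ ≤ ∫⁻ w, ‖f w‖ₑ * ‖∫ z, K z w * G z‖ₑ := by
          refine (enorm_integral_le_lintegral_enorm _).trans (le_of_eq ?_)
          simp only [enorm_mul]
      _ ≤ (∫⁻ w, ‖f w‖ₑ ^ p) ^ (1 / p) * (∫⁻ w, ‖∫ z, K z w * G z‖ₑ ^ q) ^ (1 / q) :=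
          ENNReal.lintegral_mul_le_Lp_mul_Lq volume hpq hf.enorm.measurable.aemeasurable
            hHc.enorm.measurable.aemeasurable
      _ ≤ (∫⁻ w, ‖f w‖ₑ ^ p) ^ (1 / p) *
          (C * ∫⁻ z, ‖F z‖ₑ ^ p * ENNReal.ofReal (χ n z)) ^ (1 / q) := by
          refine mul_le_mul_right (ENNReal.rpow_le_rpow ((hT G hGc hGs).trans
            (mul_le_mul_right (lintegral_mono fun z => ?_) _)) (by positivity)) _
          -- Hence |G|^q = |F|^p χ^q, and χ^q ≤ χ because 0 ≤ χ ≤ 1 and q ≥ 1.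
          have h5 : (p - 1) * q = p := hpq.sub_one_mul_conj
          rw [← ofReal_norm, ← ofReal_norm, hGn, ENNReal.ofReal_rpow_of_nonneg
            (mul_nonneg (Real.rpow_nonneg (norm_nonneg _) _) (hχ0 n z)) hq.le,
            ENNReal.ofReal_rpow_of_nonneg (norm_nonneg _) hp.le,
            ← ENNReal.ofReal_mul (Real.rpow_nonneg (norm_nonneg _) _),
            Real.mul_rpow (Real.rpow_nonneg (norm_nonneg _) _) (hχ0 n z),
            ← Real.rpow_mul (norm_nonneg _), h5]
          refine ENNReal.ofReal_le_ofReal (mul_le_mul_of_nonneg_left ?_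
            (Real.rpow_nonneg (norm_nonneg _) _))
          conv_rhs => rw [← Real.rpow_one (χ n z)]
          exact Real.rpow_le_rpow_of_exponent_ge_of_imp (hχ0 n z) (hχ1 n z) hpq.symm.lt.le
            (fun _ h => absurd h hq.ne')
  calc ∫⁻ z, ‖F z‖ₑ ^ p = ∫⁻ z, liminf (fun n => ‖F z‖ₑ ^ p * ENNReal.ofReal (χ n z)) atTop := by
        refine lintegral_congr fun z => (Tendsto.liminf_eq ?_).symm
        refine tendsto_const_nhds.congr' ?_
        filter_upwards [hχlim z] with n hn
        rw [hn, ENNReal.ofReal_one, mul_one]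
    _ ≤ liminf (fun n => ∫⁻ z, ‖F z‖ₑ ^ p * ENNReal.ofReal (χ n z)) atTop :=
        lintegral_liminf_le fun n => (hFc.enorm.measurable.pow_const p).mul
          (hχc n).measurable.ennreal_ofReal
    _ ≤ liminf (fun _ : ℕ => C ^ (p - 1) * ∫⁻ w, ‖f w‖ₑ ^ p) atTop :=
        liminf_le_liminf (.of_forall key)
    _ = _ := liminf_const _

end PartialOscillator

/-! ### Mikhlin–Hörmander multipliers cut into dyadic symbols -/

namespace PartialOscillator

/-! ### Symbol classes -/

/-- A twisted derivation `D` on functions, such as the derivative (`θ = 0`) or the forward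
difference (`θ = 1`), together with a size function `L`. -/
structure SymbolCalculus (X : Type) where
  D : (X → ℂ) → X → ℂ
  Dom : (X → ℂ) → Prop
  L : X → ℝ
  θ : ℂ
  one_le : ∀ x, 1 ≤ L x
  norm_θ : ‖θ‖ ≤ 1
  dom_const : ∀ c, Dom fun _ => c
  dom_add : ∀ {F G}, Dom F → Dom G → Dom fun x => F x + G x
  dom_mul : ∀ {F G}, Dom F → Dom G → Dom fun x => F x * G x
  D_const : ∀ c, D (fun _ => c) = fun _ => 0
  D_add : ∀ {F G}, Dom F → Dom G → D (fun x => F x + G x) = fun x => D F x + D G x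
  D_mul : ∀ {F G}, Dom F → Dom G →
    D (fun x => F x * G x) = fun x => D F x * G x + F x * D G x + θ * (D F x * D G x)

namespace SymbolCalculus

variable {X : Type} (S : SymbolCalculus X)

/-- The functions with `|D^i F| ≤ C W L^{-i}` for `i ≤ N`. -/
def Bd : ℕ → (X → ℂ) → ℝ → (X → ℝ) → Prop
  | 0, F, C, W => ∀ x, ‖F x‖ ≤ C * W x
  | N + 1, F, C, W => (∀ x, ‖F x‖ ≤ C * W x) ∧ S.Dom F ∧ Bd N (S.D F) C fun x => W x / S.L x

variable {S} {N : ℕ} {F G : X → ℂ} {C C' : ℝ} {W W' : X → ℝ}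

theorem L_pos (x : X) : 0 < S.L x := zero_lt_one.trans_le (S.one_le x)

theorem Bd.norm_le (h : S.Bd N F C W) (x : X) : ‖F x‖ ≤ C * W x := by
  cases N with
  | zero => exact h x
  | succ N => exact h.1 x

theorem Bd.mono (h : S.Bd N F C W) (hW : ∀ x, C * W x ≤ C' * W' x) : S.Bd N F C' W' := by
  induction N generalizing F W W' with
  | zero => exact fun x => (h x).trans (hW x)
  | succ N ih =>
    refine ⟨fun x => (h.1 x).trans (hW x), h.2.1, ih h.2.2 fun x => ?_⟩
    rw [← mul_div_assoc, ← mul_div_assoc]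
    exact div_le_div_of_nonneg_right (hW x) (L_pos x).le

theorem Bd.pred (h : S.Bd (N + 1) F C W) : S.Bd N F C W := by
  induction N generalizing F W with
  | zero => exact h.1
  | succ N ih => exact ⟨h.1, h.2.1, ih h.2.2⟩

theorem Bd.add (h : S.Bd N F C W) (h' : S.Bd N G C' W) :
    S.Bd N (fun x => F x + G x) (C + C') W := by
  induction N generalizing F G W with
  | zero =>
    intro x
    rw [add_mul]
    exact (norm_add_le _ _).trans (add_le_add (h x) (h' x))
  | succ N ih =>
    refine ⟨fun x => ?_, S.dom_add h.2.1 h'.2.1, ?_⟩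
    · rw [add_mul]
      exact (norm_add_le _ _).trans (add_le_add (h.1 x) (h'.1 x))
    · rw [S.D_add h.2.1 h'.2.1]
      exact ih h.2.2 h'.2.2

theorem Bd.zero (hC : 0 ≤ C) (hW : ∀ x, 0 ≤ W x) : S.Bd N (fun _ => 0) C W := by
  induction N generalizing W with
  | zero =>
    intro x
    rw [norm_zero]
    exact mul_nonneg hC (hW x)
  | succ N ih =>
    refine ⟨fun x => ?_, S.dom_const 0, ?_⟩
    · rw [norm_zero]
      exact mul_nonneg hC (hW x)
    · rw [S.D_const]
      exact ih fun x => div_nonneg (hW x) (L_pos x).le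

theorem Bd.const (c : ℂ) (hW : ∀ x, ‖c‖ ≤ C * W x) (hC : 0 ≤ C) (hW0 : ∀ x, 0 ≤ W x) :
    S.Bd N (fun _ => c) C W := by
  cases N with
  | zero => exact hW
  | succ N =>
    refine ⟨hW, S.dom_const c, ?_⟩
    rw [S.D_const]
    exact Bd.zero hC fun x => div_nonneg (hW0 x) (L_pos x).le

/-- Each application of the twisted Leibniz rule produces three terms, whence 3^N. The term with θ
carries one more factor 1/L than needed, and L ≥ 1. -/
theorem Bd.mul (h : S.Bd N F C W) (h' : S.Bd N G C' W') :
    S.Bd N (fun x => F x * G x) (3 ^ N * (C * C')) fun x => W x * W' x := by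
  induction N generalizing F G W W' with
  | zero =>
    intro x
    rw [norm_mul, pow_zero, one_mul, mul_mul_mul_comm]
    exact mul_le_mul (h x) (h' x) (norm_nonneg _) ((norm_nonneg _).trans (h x))
  | succ N ih =>
    have hb := fun x => mul_le_mul (h.1 x) (h'.1 x) (norm_nonneg _) ((norm_nonneg _).trans (h.1 x))
    have hnn : ∀ x, 0 ≤ C * C' * (W x * W' x) := fun x => by
      rw [mul_mul_mul_comm]
      exact (mul_nonneg (norm_nonneg _) (norm_nonneg _)).trans (hb x)
    refine ⟨fun x => ?_, S.dom_mul h.2.1 h'.2.1, ?_⟩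
    · rw [norm_mul, mul_assoc]
      refine ((hb x).trans (le_of_eq (mul_mul_mul_comm _ _ _ _))).trans ?_
      exact le_mul_of_one_le_left (hnn x) (one_le_pow₀ (by norm_num))
    · rw [S.D_mul h.2.1 h'.2.1]
      have h1 := ih h.2.2 h'.pred
      have h2 := ih h.pred h'.2.2
      have h3 := ih h.2.2 h'.2.2
      have hp : (0 : ℝ) ≤ 3 ^ N := by positivity
      have e1 : ∀ x, W x / S.L x * W' x = W x * W' x / S.L x := fun x => by ring
      have e2 : ∀ x, W x * (W' x / S.L x) = W x * W' x / S.L x := fun x => by ring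
      simp only [e1] at h1
      simp only [e2] at h2
      have h4 : S.Bd N (fun x => S.θ * (S.D F x * S.D G x)) (3 ^ N * (C * C'))
          fun x => W x * W' x / S.L x := by
        have hmono : ∀ {M : ℕ} {E : X → ℂ} {B : ℝ} {V : X → ℝ}, S.Bd M E B V →
            S.Bd M (fun x => S.θ * E x) B V := by
          intro M
          induction M with
          | zero =>
            intro E B V hE x
            rw [norm_mul]
            exact (mul_le_of_le_one_left (norm_nonneg _) S.norm_θ).trans (hE x)
          | succ M ihM =>
            intro E B V hE
            refine ⟨fun x => ?_, S.dom_mul (S.dom_const _) hE.2.1, ?_⟩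
            · rw [norm_mul]
              exact (mul_le_of_le_one_left (norm_nonneg _) S.norm_θ).trans (hE.1 x)
            · rw [S.D_mul (S.dom_const _) hE.2.1, S.D_const]
              simp only [zero_mul, mul_zero, zero_add, add_zero]
              exact ihM hE.2.2
        refine hmono (h3.mono fun x => ?_)
        have e3 : 3 ^ N * (C * C') * (W x / S.L x * (W' x / S.L x)) =
            3 ^ N * (C * C' * (W x * W' x)) / S.L x / S.L x := by ring
        have e4 : 3 ^ N * (C * C') * (W x * W' x / S.L x) =
            3 ^ N * (C * C' * (W x * W' x)) / S.L x := by ring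
        rw [e3, e4]
        exact div_le_self (div_nonneg (mul_nonneg hp (hnn x)) (L_pos x).le) (S.one_le x)
      refine ((h1.add h2).add h4).mono fun x => le_of_eq ?_
      ring

theorem Bd.pow (h : S.Bd N F C W) (n : ℕ) :
    S.Bd N (fun x => F x ^ n) ((3 ^ N * C) ^ n) fun x => W x ^ n := by
  induction n with
  | zero =>
    simp only [pow_zero]
    exact Bd.const 1 (fun x => by simp) zero_le_one fun x => zero_le_one
  | succ n ih =>
    simp only [pow_succ']
    exact (h.mul ih).mono fun x => le_of_eq (by ring)

theorem Bd.sum_pow (h : S.Bd N F C fun _ => 1) (M : ℕ) :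
    S.Bd N (fun x => ∑ i ∈ Finset.range M, F x ^ i) (∑ i ∈ Finset.range M, (3 ^ N * C) ^ i)
      fun _ => 1 := by
  induction M with
  | zero =>
    simp only [Finset.range_zero, Finset.sum_empty]
    exact Bd.zero le_rfl fun _ => zero_le_one
  | succ M ih =>
    simp only [Finset.sum_range_succ]
    have := h.pow M
    simp only [one_pow] at this
    exact ih.add this

/-- The recursive form is convenient for the product rule; this explicit form is where the
hypotheses on m enter and the symbol estimates come out. -/
theorem bd_iff : S.Bd N F C W ↔ (∀ i ≤ N, ∀ x, ‖S.D^[i] F x‖ ≤ C * (W x / S.L x ^ i)) ∧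
    ∀ i < N, S.Dom (S.D^[i] F) := by
  induction N generalizing F W with
  | zero =>
    constructor
    · intro h
      refine ⟨fun i hi x => ?_, fun i hi => absurd hi (Nat.not_lt_zero i)⟩
      rw [Nat.le_zero.1 hi]
      simpa using h x
    · intro h x
      simpa using h.1 0 le_rfl x
  | succ N ih =>
    have e : ∀ i x, W x / S.L x / S.L x ^ i = W x / S.L x ^ (i + 1) := fun i x => by
      rw [div_div, ← pow_succ']
    rw [Bd, ih]
    simp only [e, ← Function.iterate_succ_apply]
    constructor
    · rintro ⟨h1, h2, h3, h4⟩
      refine ⟨fun i hi x => ?_, fun i hi => ?_⟩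
      · cases i with
        | zero => simpa using h1 x
        | succ i => exact h3 i (Nat.le_of_succ_le_succ hi) x
      · cases i with
        | zero => exact h2
        | succ i => exact h4 i (Nat.lt_of_succ_lt_succ hi)
    · rintro ⟨h1, h2⟩
      exact ⟨fun x => by simpa using h1 0 (Nat.zero_le _) x, h2 0 (Nat.succ_pos N),
        fun i hi x => h1 (i + 1) (Nat.succ_le_succ hi) x,
        fun i hi => h2 (i + 1) (Nat.succ_lt_succ hi)⟩

end SymbolCalculus

open SymbolCalculus

/-- The function `e^{-tλ}` is a symbol: its derivation is multiplication by the function `H`. -/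
structure HeatSymbol {X : Type} (S : SymbolCalculus X) (lam : X → ℝ) (t : ℝ) (H : X → ℂ) :
    Prop where
  pos : 0 < t
  nonneg : ∀ x, 0 ≤ lam x
  dom : S.Dom fun x => (Real.exp (-(t * lam x)) : ℂ)
  D_exp : S.D (fun x => (Real.exp (-(t * lam x)) : ℂ)) =
    fun x => H x * (Real.exp (-(t * lam x)) : ℂ)
  bd : ∀ N, S.Bd N H 2 fun x => t * lam x / S.L x

/-- Each derivation multiplies e^{-tλ} by H, of size tλ/L. The factor tλ is absorbed by giving up a
little of the exponent, so any γ < 1 is possible. -/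
theorem exists_bd_exp (N : ℕ) : ∀ γ : ℝ, γ < 1 → ∃ C : ℝ, 0 ≤ C ∧
    ∀ (X : Type) (S : SymbolCalculus X) (lam : X → ℝ) (t : ℝ) (H : X → ℂ), HeatSymbol S lam t H →
    S.Bd N (fun x => (Real.exp (-(t * lam x)) : ℂ)) C fun x => Real.exp (-(γ * (t * lam x))) := by
  have hexp : ∀ γ : ℝ, γ < 1 → ∀ (X : Type) (S : SymbolCalculus X) (lam : X → ℝ) (t : ℝ)
      (H : X → ℂ), HeatSymbol S lam t H → ∀ x,
      ‖(Real.exp (-(t * lam x)) : ℂ)‖ ≤ Real.exp (-(γ * (t * lam x))) := by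
    intro γ hγ X S lam t H h x
    rw [Complex.norm_real, Real.norm_of_nonneg (Real.exp_pos _).le, Real.exp_le_exp]
    have : 0 ≤ t * lam x := mul_nonneg h.pos.le (h.nonneg x)
    nlinarith
  induction N with
  | zero =>
    intro γ hγ
    refine ⟨1, zero_le_one, fun X S lam t H h x => ?_⟩
    rw [one_mul]
    exact hexp γ hγ X S lam t H h x
  | succ N ih =>
    intro γ hγ
    -- The intermediate exponent lies strictly between γ and 1; the difference (1-γ)/2 pays for tλ.
    obtain ⟨C, hC, ihC⟩ := ih ((1 + γ) / 2) (by linarith)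
    have hδ : 0 < (1 - γ) / 2 := by linarith
    refine ⟨max 1 (3 ^ N * (2 * C) / ((1 - γ) / 2)), zero_le_one.trans (le_max_left _ _),
      fun X S lam t H h => ⟨fun x => ?_, h.dom, ?_⟩⟩
    · exact (hexp γ hγ X S lam t H h x).trans
        (le_mul_of_one_le_left (Real.exp_pos _).le (le_max_left _ _))
    · rw [h.D_exp]
      refine ((h.bd N).mul (ihC X S lam t H h)).mono fun x => ?_
      have hy : 0 ≤ t * lam x := mul_nonneg h.pos.le (h.nonneg x)
      beta_reduce
      generalize t * lam x = y at hy
      have hL := L_pos (S := S) x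
      have h1 : y * Real.exp (-((1 + γ) / 2 * y)) ≤ ((1 - γ) / 2)⁻¹ * Real.exp (-(γ * y)) := by
        have e : Real.exp (-(γ * y)) =
            Real.exp ((1 - γ) / 2 * y) * Real.exp (-((1 + γ) / 2 * y)) := by
          rw [← Real.exp_add]
          ring_nf
        rw [e, ← mul_assoc]
        refine mul_le_mul_of_nonneg_right ?_ (Real.exp_pos _).le
        rw [inv_mul_eq_div, le_div_iff₀ hδ, mul_comm]
        linarith [Real.add_one_le_exp ((1 - γ) / 2 * y)]
      calc _ = 3 ^ N * (2 * C) * (y * Real.exp (-((1 + γ) / 2 * y))) / S.L x := by ring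
        _ ≤ 3 ^ N * (2 * C) * (((1 - γ) / 2)⁻¹ * Real.exp (-(γ * y))) / S.L x := by gcongr
        _ = 3 ^ N * (2 * C) / ((1 - γ) / 2) * (Real.exp (-(γ * y)) / S.L x) := by ring
        _ ≤ max 1 (3 ^ N * (2 * C) / ((1 - γ) / 2)) * (Real.exp (-(γ * y)) / S.L x) :=
            mul_le_mul_of_nonneg_right (le_max_right _ _) (by positivity)

/-- The function itself is at most tλ, and its derivation is -H e^{-tλ}, which again has the size
tλ/L. -/
theorem exists_bd_one_sub_exp (N : ℕ) : ∃ C : ℝ, 0 ≤ C ∧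
    ∀ (X : Type) (S : SymbolCalculus X) (lam : X → ℝ) (t : ℝ) (H : X → ℂ), HeatSymbol S lam t H →
    S.Bd N (fun x => 1 + -1 * (Real.exp (-(t * lam x)) : ℂ)) C fun x => t * lam x := by
  have hle : ∀ (X : Type) (S : SymbolCalculus X) (lam : X → ℝ) (t : ℝ) (H : X → ℂ),
      HeatSymbol S lam t H → ∀ x,
      ‖1 + -1 * (Real.exp (-(t * lam x)) : ℂ)‖ ≤ t * lam x := by
    intro X S lam t H h x
    have : 0 ≤ t * lam x := mul_nonneg h.pos.le (h.nonneg x)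
    generalize t * lam x = y at this
    rw [show 1 + -1 * (Real.exp (-y) : ℂ) = ((1 - Real.exp (-y) : ℝ) : ℂ) by push_cast; ring,
      Complex.norm_real, Real.norm_of_nonneg (by
        rw [sub_nonneg, Real.exp_le_one_iff]; linarith)]
    linarith [Real.add_one_le_exp (-y)]
  cases N with
  | zero =>
    refine ⟨1, zero_le_one, fun X S lam t H h x => ?_⟩
    rw [one_mul]
    exact hle X S lam t H h x
  | succ N =>
    obtain ⟨C, hC, hexp⟩ := exists_bd_exp N 0 zero_lt_one
    refine ⟨max 1 (3 ^ N * (3 ^ N * (2 * C))), zero_le_one.trans (le_max_left _ _),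
      fun X S lam t H h => ⟨fun x => ?_, S.dom_add (S.dom_const _)
        (S.dom_mul (S.dom_const _) h.dom), ?_⟩⟩
    · exact (hle X S lam t H h x).trans (le_mul_of_one_le_left
        (mul_nonneg h.pos.le (h.nonneg x)) (le_max_left _ _))
    · rw [S.D_add (S.dom_const _) (S.dom_mul (S.dom_const _) h.dom), S.D_const,
        S.D_mul (S.dom_const _) h.dom, S.D_const, h.D_exp]
      simp only [zero_mul, mul_zero, zero_add, add_zero]
      have h1 := hexp X S lam t H h
      simp only [zero_mul, neg_zero, Real.exp_zero] at h1
      have h2 : S.Bd N (fun _ => (-1 : ℂ)) 1 fun _ => 1 :=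
        Bd.const _ (by simp) zero_le_one fun _ => zero_le_one
      refine (h2.mul ((h.bd N).mul h1)).mono fun x => ?_
      rw [one_mul, one_mul, mul_one]
      exact mul_le_mul_of_nonneg_right (le_max_right _ _)
        (div_nonneg (mul_nonneg h.pos.le (h.nonneg x)) (L_pos x).le)

/-- With u = e^{-tλ} one has 1-u² = (1-u)(1+u) and (1+u)^M - 1 = u ∑_{i<M} (1+u)^i. The factor
(1-u)^M gives vanishing of order M at λ = 0, and u gives exponential decay. -/
theorem exists_bd_dyadic_piece (N M : ℕ) : ∃ C : ℝ, 0 ≤ C ∧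
    ∀ (X : Type) (S : SymbolCalculus X) (lam : X → ℝ) (t : ℝ) (H : X → ℂ), HeatSymbol S lam t H →
    ∀ (m : X → ℂ) (A : ℝ), S.Bd N m A (fun _ => 1) →
    S.Bd N (fun x => m x * ((1 - (Real.exp (-(t * lam x)) : ℂ) ^ 2) ^ M -
        (1 - (Real.exp (-(t * lam x)) : ℂ)) ^ M)) (C * A)
      fun x => (t * lam x) ^ M * Real.exp (-(3 / 4 * (t * lam x))) := by
  obtain ⟨C1, hC1, h1⟩ := exists_bd_exp N (3 / 4) (by norm_num)
  obtain ⟨C0, hC0, h0⟩ := exists_bd_exp N 0 (by norm_num)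
  obtain ⟨C2, hC2, h2⟩ := exists_bd_one_sub_exp N
  refine ⟨3 ^ N * (3 ^ N * ((3 ^ N * C2) ^ M) *
    (3 ^ N * ((∑ i ∈ Finset.range M, (3 ^ N * (1 + C0)) ^ i) * C1))), ?_,
    fun X S lam t H h m A hm => ?_⟩
  · have : 0 ≤ ∑ i ∈ Finset.range M, (3 ^ N * (1 + C0)) ^ i :=
      Finset.sum_nonneg fun i _ => by positivity
    positivity
  have i1 := h1 X S lam t H h
  have i0 := h0 X S lam t H h
  simp only [zero_mul, neg_zero, Real.exp_zero] at i0
  have i2 := (h2 X S lam t H h).pow M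
  have i3 : S.Bd N (fun _ => (1 : ℂ)) 1 fun _ => 1 :=
    Bd.const _ (by simp) zero_le_one fun _ => zero_le_one
  have i4 := ((i3.add i0).sum_pow M).mul i1
  have i5 := hm.mul (i2.mul i4)
  have e : ∀ x, m x * ((1 - (Real.exp (-(t * lam x)) : ℂ) ^ 2) ^ M -
        (1 - (Real.exp (-(t * lam x)) : ℂ)) ^ M) =
      m x * ((1 + -1 * (Real.exp (-(t * lam x)) : ℂ)) ^ M *
        ((∑ i ∈ Finset.range M, (1 + (Real.exp (-(t * lam x)) : ℂ)) ^ i) *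
          (Real.exp (-(t * lam x)) : ℂ))) := fun x => by
    generalize (Real.exp (-(t * lam x)) : ℂ) = u
    have hg := geom_sum_mul (1 + u) M
    rw [add_sub_cancel_left] at hg
    rw [hg, show 1 - u ^ 2 = (1 - u) * (1 + u) by ring, mul_pow]
    ring
  simp only [e]
  refine i5.mono fun x => le_of_eq ?_
  ring

/-- With u = e^{-tλ}, the geometric sum 1 - (1-u)^M = u ∑_{i<M} (1-u)^i exhibits the decaying factor
u. -/
theorem exists_bd_low_piece (N M : ℕ) : ∃ C : ℝ, 0 ≤ C ∧
    ∀ (X : Type) (S : SymbolCalculus X) (lam : X → ℝ) (t : ℝ) (H : X → ℂ), HeatSymbol S lam t H →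
    ∀ (m : X → ℂ) (A : ℝ), S.Bd N m A (fun _ => 1) →
    S.Bd N (fun x => m x * (1 - (1 - (Real.exp (-(t * lam x)) : ℂ)) ^ M)) (C * A)
      fun x => Real.exp (-(3 / 4 * (t * lam x))) := by
  obtain ⟨C1, hC1, h1⟩ := exists_bd_exp N (3 / 4) (by norm_num)
  obtain ⟨C0, hC0, h0⟩ := exists_bd_exp N 0 (by norm_num)
  refine ⟨3 ^ N * (3 ^ N *
    ((∑ i ∈ Finset.range M, (3 ^ N * (1 + 3 ^ N * (1 * C0))) ^ i) * C1)), ?_,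
    fun X S lam t H h m A hm => ?_⟩
  · have : 0 ≤ ∑ i ∈ Finset.range M, (3 ^ N * (1 + 3 ^ N * (1 * C0))) ^ i :=
      Finset.sum_nonneg fun i _ => by positivity
    positivity
  have i1 := h1 X S lam t H h
  have i0 := h0 X S lam t H h
  simp only [zero_mul, neg_zero, Real.exp_zero] at i0
  have i3 : S.Bd N (fun _ => (1 : ℂ)) 1 fun _ => 1 :=
    Bd.const _ (by simp) zero_le_one fun _ => zero_le_one
  have i6 : S.Bd N (fun _ => (-1 : ℂ)) 1 fun _ => 1 :=
    Bd.const _ (by simp) zero_le_one fun _ => zero_le_one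
  have i7 := i6.mul i0
  simp only [mul_one] at i7
  have i4 := ((i3.add i7).sum_pow M).mul i1
  have i5 := hm.mul i4
  have e : ∀ x, m x * (1 - (1 - (Real.exp (-(t * lam x)) : ℂ)) ^ M) =
      m x * ((∑ i ∈ Finset.range M, (1 + -1 * (Real.exp (-(t * lam x)) : ℂ)) ^ i) *
          (Real.exp (-(t * lam x)) : ℂ)) := fun x => by
    generalize (Real.exp (-(t * lam x)) : ℂ) = u
    have hg := geom_sum_mul (1 + -1 * u) M
    rw [add_sub_cancel_left] at hg
    rw [show 1 - u = 1 + -1 * u by ring]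
    linear_combination m x * hg
  simp only [e]
  refine i5.mono fun x => le_of_eq ?_
  ring

end PartialOscillator

namespace PartialOscillator

open SymbolCalculus

/-! ### The dyadic pieces of a Mikhlin–Hörmander multiplier -/

/-- The calculus of the derivative in `τ`, for the size function `(τ² + c)^{1/2}`. -/
noncomputable def derivCalculus (c : ℝ) (hc : 1 ≤ c) : SymbolCalculus ℝ where
  D := deriv
  Dom F := Differentiable ℝ F
  L τ := √(τ ^ 2 + c)
  θ := 0
  one_le τ := Real.one_le_sqrt.2 (by nlinarith [sq_nonneg τ])
  norm_θ := by simp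
  dom_const c := differentiable_const c
  dom_add hF hG := hF.fun_add hG
  dom_mul hF hG := hF.fun_mul hG
  D_const c := by simp
  D_add hF hG := funext fun x => deriv_fun_add (hF x) (hG x)
  D_mul hF hG := funext fun x => by rw [deriv_fun_mul (hF x) (hG x)]; ring

/-- The calculus of the forward difference in `k`, for the size function `2k + c`. -/
noncomputable def diffCalculus (c : ℝ) (hc : 1 ≤ c) : SymbolCalculus ℕ where
  D := fwdDiff 1
  Dom _ := True
  L k := 2 * k + c
  θ := 1
  one_le k := by
    have : (0 : ℝ) ≤ k := Nat.cast_nonneg k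
    linarith
  norm_θ := by simp
  dom_const _ := trivial
  dom_add _ _ := trivial
  dom_mul _ _ := trivial
  D_const c := funext fun x => by simp [fwdDiff]
  D_add _ _ := funext fun x => by simp only [fwdDiff]; ring
  D_mul _ _ := funext fun x => by simp only [fwdDiff]; ring

/-- Here λ = L², and multiplication by -2tτ has size at most 2tL = 2tλ/L. Its derivative is a
constant of size 2t, and all further ones vanish. -/
theorem heatSymbol_deriv {c : ℝ} (hc : 1 ≤ c) {t : ℝ} (ht : 0 < t) :
    HeatSymbol (derivCalculus c hc) (fun τ => τ ^ 2 + c) t fun τ => ((-(2 * t * τ) : ℝ) : ℂ) where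
  pos := ht
  nonneg τ := by nlinarith [sq_nonneg τ]
  dom := by
    have h : Differentiable ℝ fun τ : ℝ => Real.exp (-(t * (τ ^ 2 + c))) := by fun_prop
    exact Complex.ofRealCLM.differentiable.comp h
  D_exp := by
    funext τ
    have h : HasDerivAt (fun τ : ℝ => Real.exp (-(t * (τ ^ 2 + c))))
        (-(2 * t * τ) * Real.exp (-(t * (τ ^ 2 + c)))) τ := by
      have h1 : HasDerivAt (fun τ : ℝ => -(t * (τ ^ 2 + c))) (-(2 * t * τ)) τ := by
        have := ((((hasDerivAt_id τ).fun_pow 2).add_const c).const_mul t).fun_neg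
        refine this.congr_deriv ?_
        simp
        ring
      exact h1.exp.congr_deriv (mul_comm _ _)
    have := h.ofReal_comp.deriv
    rw [Complex.ofReal_mul] at this
    exact this
  bd N := by
    have hW : ∀ τ : ℝ, t * (τ ^ 2 + c) / √(τ ^ 2 + c) = t * √(τ ^ 2 + c) := fun τ => by
      rw [mul_div_assoc, Real.div_sqrt]
    have h0 : ∀ τ : ℝ, ‖((-(2 * t * τ) : ℝ) : ℂ)‖ ≤ 2 * (t * (τ ^ 2 + c) / √(τ ^ 2 + c)) := by
      intro τ
      rw [hW, Complex.norm_real, norm_neg, Real.norm_eq_abs, abs_mul, abs_of_pos (by positivity),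
        mul_assoc]
      gcongr
      exact Real.abs_le_sqrt (by linarith)
    cases N with
    | zero => exact h0
    | succ N =>
      refine ⟨h0, ?_, ?_⟩
      · have h : Differentiable ℝ fun τ : ℝ => -(2 * t * τ) := by fun_prop
        exact Complex.ofRealCLM.differentiable.comp h
      · have hd : (derivCalculus c hc).D (fun τ : ℝ => ((-(2 * t * τ) : ℝ) : ℂ)) =
            fun _ => ((-(2 * t) : ℝ) : ℂ) := by
          funext τ
          have h1 : HasDerivAt (fun τ : ℝ => -(2 * t * τ)) (-(2 * t)) τ := by
            have := ((hasDerivAt_id τ).const_mul (2 * t)).fun_neg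
            refine this.congr_deriv ?_
            simp
          exact h1.ofReal_comp.deriv
        rw [hd]
        have hpos : ∀ τ : ℝ, 0 < τ ^ 2 + c := fun τ => by nlinarith [sq_nonneg τ]
        have hW2 : ∀ τ : ℝ, t * (τ ^ 2 + c) / √(τ ^ 2 + c) / √(τ ^ 2 + c) = t := fun τ => by
          rw [hW, mul_div_assoc, div_self (Real.sqrt_pos.2 (hpos τ)).ne', mul_one]
        refine Bd.const _ (fun τ => ?_) zero_le_two fun τ => ?_
        · change _ ≤ 2 * (t * (τ ^ 2 + c) / √(τ ^ 2 + c) / √(τ ^ 2 + c))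
          rw [hW2, Complex.norm_real, norm_neg, Real.norm_of_nonneg (by positivity)]
        · change 0 ≤ t * (τ ^ 2 + c) / √(τ ^ 2 + c) / √(τ ^ 2 + c)
          rw [hW2]
          exact ht.le

/-- Here λ = L, and the difference of an exponential is multiplication by the constant e^{-2t} - 1,
of size at most 2t. -/
theorem heatSymbol_diff {c : ℝ} (hc : 1 ≤ c) {t : ℝ} (ht : 0 < t) :
    HeatSymbol (diffCalculus c hc) (fun k => 2 * k + c) t
      fun _ => ((Real.exp (-(2 * t)) - 1 : ℝ) : ℂ) where
  pos := ht
  nonneg k := by positivity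
  dom := trivial
  D_exp := by
    funext k
    have e : Real.exp (-(t * (2 * ((k + 1 : ℕ) : ℝ) + c))) =
        Real.exp (-(2 * t)) * Real.exp (-(t * (2 * k + c))) := by
      rw [← Real.exp_add]
      push_cast
      ring_nf
    simp only [diffCalculus, fwdDiff]
    rw [e]
    push_cast
    ring
  bd N := by
    have hpos : ∀ k : ℕ, (0 : ℝ) < 2 * k + c := fun k => by positivity
    have hW : ∀ k : ℕ, t * (2 * k + c) / (2 * k + c) = t := fun k => by
      rw [mul_div_assoc, div_self (hpos k).ne', mul_one]
    refine Bd.const _ (fun k => ?_) zero_le_two fun k => ?_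
    · change _ ≤ 2 * (t * (2 * k + c) / (2 * k + c))
      rw [hW, Complex.norm_real, Real.norm_eq_abs, abs_sub_comm, abs_of_nonneg]
      · linarith [Real.add_one_le_exp (-(2 * t))]
      · rw [sub_nonneg, Real.exp_le_one_iff]
        linarith
    · change 0 ≤ t * (2 * k + c) / (2 * k + c)
      rw [hW]
      exact ht.le

/-- The eigenvalue `τ² + 2k + d`. -/
def eigenvalue (d : ℕ) (τ : ℝ) (k : ℕ) : ℝ := τ ^ 2 + 2 * k + d

/-- The scale `2^{-j/2}`. -/
noncomputable def scale (j : ℕ) : ℝ := (√2)⁻¹ ^ j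

theorem scale_pos (j : ℕ) : 0 < scale j := by unfold scale; positivity

theorem scale_le_one (j : ℕ) : scale j ≤ 1 :=
  pow_le_one₀ (by positivity) (inv_le_one_of_one_le₀ (Real.one_le_sqrt.2 one_le_two))

theorem scale_zero : scale 0 = 1 := pow_zero _

theorem scale_sq (j : ℕ) : scale j ^ 2 = 2⁻¹ ^ j := by
  rw [scale, pow_right_comm, inv_pow, Real.sq_sqrt zero_le_two]

/-- The order `⌊(d+1)/2⌋ + 1` of the symbol estimates. -/
def symbolOrder (d : ℕ) : ℕ := (d + 1) / 2 + 1

/-- The function `1 - e^{-tλ}` at `t = 2^{-j}`. -/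
noncomputable def heatComplement (d j : ℕ) (τ : ℝ) (k : ℕ) : ℂ :=
  1 - (Real.exp (-(scale j ^ 2 * eigenvalue d τ k)) : ℂ)

/-- The dyadic pieces of the multiplier `m`. -/
noncomputable def dyadicPiece (d : ℕ) (m : ℝ → ℕ → ℂ) : ℕ → ℝ → ℕ → ℂ
  | 0, τ, k => m τ k * (1 - heatComplement d 0 τ k ^ symbolOrder d)
  | j + 1, τ, k => m τ k * (heatComplement d j τ k ^ symbolOrder d -
      heatComplement d (j + 1) τ k ^ symbolOrder d)

theorem sum_dyadicPiece (d : ℕ) (m : ℝ → ℕ → ℂ) (n : ℕ) (τ : ℝ) (k : ℕ) :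
    ∑ j ∈ Finset.range (n + 1), dyadicPiece d m j τ k =
      m τ k * (1 - heatComplement d n τ k ^ symbolOrder d) := by
  induction n with
  | zero => simp [dyadicPiece]
  | succ n ih =>
    rw [Finset.sum_range_succ, ih, dyadicPiece]
    ring

/-- Consecutive times differ by a factor 2, so the heat factor at level j is the square of the one
at level j+1. -/
theorem dyadicPiece_succ (d : ℕ) (m : ℝ → ℕ → ℂ) (j : ℕ) (τ : ℝ) (k : ℕ) :
    dyadicPiece d m (j + 1) τ k = m τ k *
      ((1 - (Real.exp (-(scale (j + 1) ^ 2 * eigenvalue d τ k)) : ℂ) ^ 2) ^ symbolOrder d -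
        (1 - (Real.exp (-(scale (j + 1) ^ 2 * eigenvalue d τ k)) : ℂ)) ^ symbolOrder d) := by
  rw [dyadicPiece, heatComplement, heatComplement, ← Complex.ofReal_pow, ← Real.exp_nat_mul,
    scale_sq, scale_sq, pow_succ]
  ring_nf

theorem dyadicPiece_zero (d : ℕ) (m : ℝ → ℕ → ℂ) (τ : ℝ) (k : ℕ) :
    dyadicPiece d m 0 τ k = m τ k *
      (1 - (1 - (Real.exp (-(1 * eigenvalue d τ k)) : ℂ)) ^ symbolOrder d) := by
  rw [dyadicPiece, heatComplement, scale_zero, one_pow]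

variable {d : ℕ} {A : ℝ} {m : ℝ → ℕ → ℂ}

theorem one_le_eigenvalue_deriv (hd : 1 ≤ d) (k : ℕ) : (1 : ℝ) ≤ 2 * k + d := by
  have h1 : (1 : ℝ) ≤ d := by exact_mod_cast hd
  have : (0 : ℝ) ≤ k := Nat.cast_nonneg k
  linarith

theorem one_le_eigenvalue_diff (hd : 1 ≤ d) (τ : ℝ) : (1 : ℝ) ≤ τ ^ 2 + d := by
  have h1 : (1 : ℝ) ≤ d := by exact_mod_cast hd
  nlinarith [sq_nonneg τ]

theorem MikhlinHormander.bd_deriv (h : MikhlinHormander d A m) (hd : 1 ≤ d) (k : ℕ) :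
    (derivCalculus (2 * k + d) (one_le_eigenvalue_deriv hd k)).Bd (symbolOrder d)
      (fun τ => m τ k) A fun _ => 1 := by
  refine bd_iff.2 ⟨fun i hi τ => ?_, fun i hi => ?_⟩
  · have h1 := h.deriv_le i hi τ k
    rw [iteratedDeriv_eq_iterate] at h1
    refine h1.trans (le_of_eq ?_)
    have hpos : (0 : ℝ) ≤ τ ^ 2 + (2 * k + d) := by positivity
    change _ = A * (1 / √(τ ^ 2 + (2 * k + d)) ^ i)
    rw [add_assoc]
    generalize τ ^ 2 + (2 * (k : ℝ) + d) = y at hpos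
    rw [Real.sqrt_eq_rpow, ← Real.rpow_natCast, ← Real.rpow_mul hpos, one_div,
      ← Real.rpow_neg hpos]
    ring_nf
  · have := h.differentiable k i hi
    rw [iteratedDeriv_eq_iterate] at this
    exact this

theorem MikhlinHormander.bd_diff (h : MikhlinHormander d A m) (hd : 1 ≤ d) (τ : ℝ) :
    (diffCalculus (τ ^ 2 + d) (one_le_eigenvalue_diff hd τ)).Bd (symbolOrder d) (m τ) A
      fun _ => 1 := by
  refine bd_iff.2 ⟨fun i hi k => (h.diff_le i hi τ k).trans (le_of_eq ?_), fun i hi => trivial⟩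
  have hpos : (0 : ℝ) ≤ τ ^ 2 + 2 * k + d := by positivity
  change _ = A * (1 / (2 * (k : ℝ) + (τ ^ 2 + d)) ^ i)
  rw [Real.rpow_neg hpos, Real.rpow_natCast, one_div]
  ring_nf

theorem one_add_pow_mul_exp_le (n : ℕ) {y : ℝ} (hy : 0 ≤ y) :
    (1 + y) ^ n * Real.exp (-(3 / 4 * y)) ≤
      4 ^ n * n.factorial * Real.exp (1 / 4) * Real.exp (-(1 / 2 * y)) := by
  have h1 := Real.pow_div_factorial_le_exp (x := (1 + y) / 4) (by positivity) n
  have h2 : (1 + y) ^ n ≤ 4 ^ n * n.factorial * Real.exp ((1 + y) / 4) := by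
    rw [div_pow, div_div, div_le_iff₀ (by positivity)] at h1
    linarith
  calc _ ≤ 4 ^ n * n.factorial * Real.exp ((1 + y) / 4) * Real.exp (-(3 / 4 * y)) := by gcongr
    _ = 4 ^ n * n.factorial * (Real.exp ((1 + y) / 4) * Real.exp (-(3 / 4 * y))) := by ring
    _ = 4 ^ n * n.factorial * (Real.exp (1 / 4) * Real.exp (-(1 / 2 * y))) := by
        rw [← Real.exp_add, ← Real.exp_add]
        ring_nf
    _ = _ := by ring

theorem exp_neg_half_eigenvalue_le {t : ℝ} (ht : 0 ≤ t) (τ : ℝ) (k : ℕ) :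
    Real.exp (-(1 / 2 * (t * eigenvalue d τ k))) ≤
      Real.exp (-(t / 2 * τ ^ 2)) * Real.exp (-(t * k)) := by
  rw [← Real.exp_add, Real.exp_le_exp, eigenvalue]
  have : 0 ≤ t * d := by positivity
  linarith

theorem measurable_iterate_fwdDiff {g : ℝ → ℕ → ℂ} (hg : ∀ k, Measurable fun τ => g τ k) (l : ℕ) :
    ∀ k, Measurable fun τ => (fwdDiff 1)^[l] (g τ) k := by
  induction l with
  | zero => exact hg
  | succ l ih =>
    intro k
    simp only [Function.iterate_succ_apply']
    exact (ih (k + 1)).sub (ih k)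

theorem measurable_iteratedDeriv {g : ℝ → ℂ} (hg : Measurable g) (l : ℕ) :
    Measurable (iteratedDeriv l g) := by
  cases l with
  | zero => rwa [iteratedDeriv_zero]
  | succ l =>
    rw [iteratedDeriv_succ]
    exact measurable_deriv _

/-- Assembles the two calculi, in τ with k fixed and in k with τ fixed. The decay e^{-s²λ/2} splits
into the Gaussian in τ and the exponential in k required of a heat bound. -/
theorem symbolBound_of_bd {N : ℕ} {g : ℝ → ℕ → ℂ} {B s : ℝ} (hN : 0 < N) (hd : 1 ≤ d)
    (hs : 0 < s) {W : ℝ → ℕ → ℝ}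
    (h1 : ∀ k : ℕ, (derivCalculus (2 * k + d) (one_le_eigenvalue_deriv hd k)).Bd N
      (fun τ => g τ k) B fun τ => W τ k)
    (h2 : ∀ τ, (diffCalculus (τ ^ 2 + d) (one_le_eigenvalue_diff hd τ)).Bd N (g τ) B (W τ))
    (R : ℝ)
    (h3 : ∀ i ≤ N, ∀ τ k, B * (W τ k / √(eigenvalue d τ k) ^ i) ≤
      R * s ^ i * Real.exp (-(1 / 2 * (s ^ 2 * eigenvalue d τ k))))
    (h4 : ∀ i ≤ N, ∀ τ k, B * (W τ k / eigenvalue d τ k ^ i) ≤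
      R * (s ^ 2) ^ i * Real.exp (-(1 / 2 * (s ^ 2 * eigenvalue d τ k))))
    (hR : 0 ≤ R) : SymbolBound N g R s := by
  have hdiff : ∀ k, ∀ l < N, Differentiable ℝ (iteratedDeriv l fun τ => g τ k) := fun k l hl => by
    rw [iteratedDeriv_eq_iterate]
    exact (bd_iff.1 (h1 k)).2 l hl
  have hmeas : ∀ k, Measurable fun τ => g τ k := fun k => by
    have := (hdiff k 0 hN).continuous.measurable
    rwa [iteratedDeriv_zero] at this
  have hexp := exp_neg_half_eigenvalue_le (d := d) (sq_nonneg s)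
  refine ⟨hdiff, fun l hl => ⟨measurable_iterate_fwdDiff hmeas l, fun τ k => ?_⟩,
    fun l hl => ⟨fun k => measurable_iteratedDeriv (hmeas k) l, fun τ k => ?_⟩⟩
  · have h5 := (bd_iff.1 (h2 τ)).1 l hl k
    have e : (diffCalculus (τ ^ 2 + d) (one_le_eigenvalue_diff hd τ)).L k = eigenvalue d τ k := by
      simp only [diffCalculus, eigenvalue]
      ring
    rw [e] at h5
    rw [mul_assoc]
    exact h5.trans ((h4 l hl τ k).trans (mul_le_mul_of_nonneg_left (hexp τ k) (by positivity)))
  · have h5 := (bd_iff.1 (h1 k)).1 l hl τ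
    have e : (derivCalculus (2 * k + d) (one_le_eigenvalue_deriv hd k)).L τ =
        √(eigenvalue d τ k) := by
      simp only [derivCalculus, eigenvalue, add_assoc]
    rw [e] at h5
    rw [mul_assoc, iteratedDeriv_eq_iterate]
    exact h5.trans ((h3 l hl τ k).trans (mul_le_mul_of_nonneg_left (hexp τ k) (by positivity)))

theorem MikhlinHormander.nonneg (h : MikhlinHormander d A m) (hd : 1 ≤ d) : 0 ≤ A := by
  have h1 := (h.bd_deriv hd 0).norm_le 0
  rw [mul_one] at h1
  exact (norm_nonneg _).trans h1

/-- The symbol estimates lose negative powers of λ, which have to become powers of s also where s²λ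
is small. The vanishing of order M in s²λ provides this for up to M derivatives or differences; the
remaining positive powers of s²λ are absorbed by the exponential. -/
theorem exists_symbolBound_dyadicPiece (hd : 1 ≤ d) : ∃ C : ℝ, 0 ≤ C ∧
    ∀ (m : ℝ → ℕ → ℂ) (A : ℝ), MikhlinHormander d A m → ∀ j,
      SymbolBound (symbolOrder d) (dyadicPiece d m j) (C * A) (scale j) := by
  have hN : 0 < symbolOrder d := Nat.succ_pos _
  obtain ⟨C1, hC1, h1⟩ := exists_bd_dyadic_piece (symbolOrder d) (symbolOrder d)
  obtain ⟨C2, hC2, h2⟩ := exists_bd_low_piece (symbolOrder d) (symbolOrder d)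
  -- The price for absorbing (1+s²λ)^{2M} when the exponent is lowered from 3/4 to 1/2.
  obtain ⟨C3, hC3, hK3⟩ : ∃ C3 : ℝ, 0 ≤ C3 ∧ C3 = 4 ^ (2 * symbolOrder d) *
    (2 * symbolOrder d).factorial * Real.exp (1 / 4) := ⟨_, by positivity, rfl⟩
  refine ⟨C1 * C3 + C2, by positivity, fun m A hm j => ?_⟩
  have hA := hm.nonneg hd
  have hlam : ∀ τ k, 1 ≤ eigenvalue d τ k := fun τ k => by
    have := one_le_eigenvalue_deriv hd k
    rw [eigenvalue]
    nlinarith [sq_nonneg τ]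
  have e1 : ∀ (k : ℕ) τ, τ ^ 2 + (2 * (k : ℝ) + d) = eigenvalue d τ k := fun k τ => by
    rw [eigenvalue, add_assoc]
  have e2 : ∀ (k : ℕ) τ, 2 * (k : ℝ) + (τ ^ 2 + d) = eigenvalue d τ k := fun k τ => by
    rw [eigenvalue]; ring
  cases j with
  | zero =>
    rw [scale_zero]
    refine symbolBound_of_bd (B := C2 * A)
      (W := fun τ k => Real.exp (-(3 / 4 * (1 * eigenvalue d τ k)))) hN hd one_pos (fun k => ?_)
      (fun τ => ?_) _ (fun i hi τ k => ?_) (fun i hi τ k => ?_) (by positivity)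
    · have := h2 _ _ _ _ _ (heatSymbol_deriv (one_le_eigenvalue_deriv hd k) one_pos) _ A
        (hm.bd_deriv hd k)
      simp only [e1, ← dyadicPiece_zero] at this
      exact this
    · have := h2 _ _ _ _ _ (heatSymbol_diff (one_le_eigenvalue_diff hd τ) one_pos) _ A
        (hm.bd_diff hd τ)
      simp only [e2, ← dyadicPiece_zero] at this
      exact this
    all_goals
      have hl := hlam τ k
      have hsq : 1 ≤ √(eigenvalue d τ k) := Real.one_le_sqrt.2 hl
      generalize eigenvalue d τ k = y at hl hsq
      simp only [one_pow, one_mul, mul_one]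
      have h6 : Real.exp (-(3 / 4 * y)) ≤ Real.exp (-(1 / 2 * y)) := by
        rw [Real.exp_le_exp]
        linarith
      refine mul_le_mul (mul_le_mul_of_nonneg_right (by linarith [mul_nonneg hC1 hC3]) hA)
        ((div_le_self (Real.exp_pos _).le (one_le_pow₀ ?_)).trans h6) (by positivity)
        (by positivity)
      assumption
  | succ j =>
    have hs := scale_pos (j + 1)
    have hs2 : 0 < scale (j + 1) ^ 2 := by positivity
    refine symbolBound_of_bd (B := C1 * A)
      (W := fun τ k => (scale (j + 1) ^ 2 * eigenvalue d τ k) ^ symbolOrder d *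
        Real.exp (-(3 / 4 * (scale (j + 1) ^ 2 * eigenvalue d τ k)))) hN hd hs (fun k => ?_)
      (fun τ => ?_) _ (fun i hi τ k => ?_) (fun i hi τ k => ?_) (by positivity)
    · have := h1 _ _ _ _ _ (heatSymbol_deriv (one_le_eigenvalue_deriv hd k) hs2) _ A
        (hm.bd_deriv hd k)
      simp only [e1, ← dyadicPiece_succ] at this
      exact this
    · have := h1 _ _ _ _ _ (heatSymbol_diff (one_le_eigenvalue_diff hd τ) hs2) _ A
        (hm.bd_diff hd τ)
      simp only [e2, ← dyadicPiece_succ] at this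
      exact this
    all_goals
      have hl := hlam τ k
      generalize eigenvalue d τ k = l at hl
      generalize scale (j + 1) = s at hs
      have hl0 : 0 < l := by linarith
      have hy : 0 < s ^ 2 * l := by positivity
      have h7 := one_add_pow_mul_exp_le (2 * symbolOrder d) hy.le
      rw [← hK3] at h7
      have hfin : ∀ P Q : ℝ, 0 ≤ P → Q ≤ P * (1 + s ^ 2 * l) ^ (2 * symbolOrder d) →
          C1 * A * (Q * Real.exp (-(3 / 4 * (s ^ 2 * l)))) ≤
          (C1 * C3 + C2) * A * P * Real.exp (-(1 / 2 * (s ^ 2 * l))) := fun P Q hP hQ => by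
        calc _ ≤ C1 * A * (P * (1 + s ^ 2 * l) ^ (2 * symbolOrder d) *
              Real.exp (-(3 / 4 * (s ^ 2 * l)))) := by gcongr
          _ = C1 * A * P * ((1 + s ^ 2 * l) ^ (2 * symbolOrder d) *
              Real.exp (-(3 / 4 * (s ^ 2 * l)))) := by ring
          _ ≤ C1 * A * P * (C3 * Real.exp (-(1 / 2 * (s ^ 2 * l)))) := by gcongr
          _ = (C1 * C3) * A * P * Real.exp (-(1 / 2 * (s ^ 2 * l))) := by ring
          _ ≤ _ := by
            gcongr
            linarith
    · rw [mul_div_right_comm]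
      refine hfin _ _ (by positivity) ?_
      have hr : 0 < s * √l := by positivity
      have hr2 : (s * √l) ^ 2 = s ^ 2 * l := by rw [mul_pow, Real.sq_sqrt hl0.le]
      -- The exponent 2M-i is a genuine difference because i ≤ M.
      have e3 : (s ^ 2 * l) ^ symbolOrder d / √l ^ i =
          s ^ i * (s * √l) ^ (2 * symbolOrder d - i) := by
        rw [← hr2, ← pow_mul, div_eq_iff (by positivity), mul_right_comm, ← mul_pow, ← pow_add,
          Nat.add_sub_cancel' (by omega)]
      rw [e3]
      refine mul_le_mul_of_nonneg_left ?_ (by positivity)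
      rw [← hr2]
      generalize s * √l = r at hr
      calc r ^ (2 * symbolOrder d - i) ≤ (1 + r ^ 2) ^ (2 * symbolOrder d - i) := by
            gcongr
            nlinarith [sq_nonneg (r - 1)]
        _ ≤ _ := pow_le_pow_right₀ (by nlinarith) (Nat.sub_le _ _)
    · rw [mul_div_right_comm]
      refine hfin _ _ (by positivity) ?_
      have e3 : (s ^ 2 * l) ^ symbolOrder d / l ^ i =
          (s ^ 2) ^ i * (s ^ 2 * l) ^ (symbolOrder d - i) := by
        rw [div_eq_iff (by positivity), mul_right_comm, ← mul_pow, ← pow_add,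
          Nat.add_sub_cancel' hi]
      rw [e3]
      refine mul_le_mul_of_nonneg_left ?_ (by positivity)
      generalize s ^ 2 * l = r at hy
      calc r ^ (symbolOrder d - i) ≤ (1 + r) ^ (symbolOrder d - i) := by
            gcongr
            linarith
        _ ≤ _ := pow_le_pow_right₀ (by linarith) (by omega)

end PartialOscillator

/-! ### From truncated multipliers to the operator on L^p -/

namespace PartialOscillator

/-! ### Multiplier operators with heat decay -/

variable {d : ℕ} {g : ℝ → ℕ → ℂ} {R t : ℝ} {f : ℝ × EuclideanSpace ℝ (Fin d) → ℂ}

/-- The coefficient `∫ Φ_μ(y) f(ρ, y) dy`. -/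
noncomputable def sliceCoeff (f : ℝ × EuclideanSpace ℝ (Fin d) → ℂ) (μ : Fin d → ℕ) (ρ : ℝ) : ℂ :=
  ∫ y, (hermitePhi μ y : ℂ) * f (ρ, y)

/-- The coefficient `∫ e^{-iτρ} Φ_μ(y) f(ρ, y) dρ dy`. -/
noncomputable def hermiteCoeff (f : ℝ × EuclideanSpace ℝ (Fin d) → ℂ) (μ : Fin d → ℕ) (τ : ℝ) : ℂ :=
  expIntegral (sliceCoeff f μ) (-τ)

theorem abs_hermitePhi_le (μ : Fin d → ℕ) (x : EuclideanSpace ℝ (Fin d)) :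
    |hermitePhi μ x| ≤ √(∏ i, (2 * (μ i : ℝ) + 2)) := Real.abs_le_sqrt (sq_hermitePhi_le μ x)

theorem integrable_hermitePhi_snd_mul (hf : Integrable f) (μ : Fin d → ℕ) :
    Integrable fun w : ℝ × EuclideanSpace ℝ (Fin d) => (hermitePhi μ w.2 : ℂ) * f w := by
  have hc : Continuous fun w : ℝ × EuclideanSpace ℝ (Fin d) => (hermitePhi μ w.2 : ℂ) :=
    Complex.continuous_ofReal.comp ((continuous_hermitePhi μ).comp continuous_snd)
  refine hf.bdd_mul (c := √(∏ i, (2 * (μ i : ℝ) + 2))) hc.aestronglyMeasurable (.of_forall fun w => ?_)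
  rw [Complex.norm_real, Real.norm_eq_abs]
  exact abs_hermitePhi_le μ _

theorem integrable_sliceCoeff (hf : Integrable f) (μ : Fin d → ℕ) : Integrable (sliceCoeff f μ) :=
  (integrable_hermitePhi_snd_mul hf μ).integral_prod_left

/-- Bessel's inequality in x for almost every ρ, then integration in ρ. -/
theorem tsum_lintegral_sliceCoeff_sq_le (hf : Integrable f) :
    ∑' μ : Fin d → ℕ, ∫⁻ ρ, ‖sliceCoeff f μ ρ‖ₑ ^ 2 ≤ ∫⁻ w, ‖f w‖ₑ ^ 2 := by
  rw [← lintegral_tsum fun μ => (integrable_sliceCoeff hf μ).1.enorm.pow_const 2,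
    Measure.volume_eq_prod, lintegral_prod _ (hf.1.enorm.pow_const 2)]
  refine lintegral_mono_ae ?_
  filter_upwards [hf.1.prodMk_left] with ρ hρ
  exact tsum_enorm_integral_hermitePhi_mul_sq_le hρ

theorem memLp_sliceCoeff (hf : Integrable f) (h2 : MemLp f 2 volume) (μ : Fin d → ℕ) :
    MemLp (sliceCoeff f μ) 2 volume := by
  refine ⟨(integrable_sliceCoeff hf μ).1, ?_⟩
  rw [eLpNorm_lt_top_iff_lintegral_rpow_enorm_lt_top two_ne_zero ENNReal.ofNat_ne_top]
  have h := h2.2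
  rw [eLpNorm_lt_top_iff_lintegral_rpow_enorm_lt_top two_ne_zero ENNReal.ofNat_ne_top] at h
  simp only [ENNReal.toReal_ofNat, ENNReal.rpow_two] at h ⊢
  exact ((ENNReal.le_tsum μ).trans (tsum_lintegral_sliceCoeff_sq_le hf)).trans_lt h

theorem lintegral_hermiteCoeff_sq (hf : Integrable f) (h2 : MemLp f 2 volume) (μ : Fin d → ℕ) :
    ∫⁻ τ, ‖hermiteCoeff f μ τ‖ₑ ^ 2 =
      ENNReal.ofReal (2 * Real.pi) * ∫⁻ ρ, ‖sliceCoeff f μ ρ‖ₑ ^ 2 := by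
  rw [← lintegral_enorm_expIntegral_sq (integrable_sliceCoeff hf μ) (memLp_sliceCoeff hf h2 μ)]
  exact lintegral_neg_eq_self (μ := volume) (f := fun τ => ‖expIntegral (sliceCoeff f μ) τ‖ₑ ^ 2)

theorem continuous_hermiteCoeff (hf : Integrable f) (μ : Fin d → ℕ) :
    Continuous (hermiteCoeff f μ) :=
  (continuous_expIntegral (integrable_sliceCoeff hf μ)).comp continuous_neg

theorem norm_hermiteCoeff_le (f : ℝ × EuclideanSpace ℝ (Fin d) → ℂ) (μ : Fin d → ℕ) (τ : ℝ) :
    ‖hermiteCoeff f μ τ‖ ≤ ∫ ρ, ‖sliceCoeff f μ ρ‖ := norm_expIntegral_le _ _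

theorem integrable_mul_hermiteCoeff (hf : Integrable f) {a : ℝ → ℂ} (ha : Integrable a)
    (μ : Fin d → ℕ) : Integrable fun τ => a τ * hermiteCoeff f μ τ :=
  ha.mul_bdd (c := ∫ ρ, ‖sliceCoeff f μ ρ‖) (continuous_hermiteCoeff hf μ).aestronglyMeasurable
    (.of_forall fun τ => norm_hermiteCoeff_le f μ τ)

theorem memLp_mul_hermiteCoeff (hf : Integrable f) {a : ℝ → ℂ} (ha : MemLp a 2 volume)
    (μ : Fin d → ℕ) : MemLp (fun τ => a τ * hermiteCoeff f μ τ) 2 volume := by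
  refine MemLp.of_le_mul (c := ∫ ρ, ‖sliceCoeff f μ ρ‖) ha
    (ha.1.mul (continuous_hermiteCoeff hf μ).aestronglyMeasurable) (.of_forall fun τ => ?_)
  rw [norm_mul, mul_comm]
  exact mul_le_mul_of_nonneg_right (norm_hermiteCoeff_le f μ τ) (norm_nonneg _)

theorem integral_expIntegral_sub_mul {a c : ℝ → ℂ} (ha : Integrable a) (hc : Integrable c) (ρ : ℝ) :
    ∫ s, expIntegral a (ρ - s) * c s = expIntegral (fun τ => a τ * expIntegral c (-τ)) ρ := by
  have hi : Integrable fun p : ℝ × ℝ =>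
      Complex.exp (Complex.I * p.2 * (ρ - p.1 : ℝ)) * (c p.1 * a p.2) := by
    refine (hc.mul_prod ha).bdd_mul (c := 1) ?_ (.of_forall fun p => ?_)
    · exact Continuous.aestronglyMeasurable (by fun_prop)
    · exact (norm_exp_I_mul_mul _ _).le
  calc ∫ s, expIntegral a (ρ - s) * c s
      = ∫ s, ∫ τ : ℝ, Complex.exp (Complex.I * τ * (ρ - s : ℝ)) * (c s * a τ) := by
        refine integral_congr_ae (.of_forall fun s => ?_)
        simp only [expIntegral]
        rw [← integral_mul_const]
        exact integral_congr_ae (.of_forall fun τ => by simp only; ring)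
    _ = ∫ τ : ℝ, ∫ s : ℝ, Complex.exp (Complex.I * τ * (ρ - s : ℝ)) * (c s * a τ) :=
        integral_integral_swap hi
    _ = _ := by
        refine integral_congr_ae (.of_forall fun τ => ?_)
        simp only [expIntegral]
        rw [← integral_const_mul, ← integral_const_mul]
        refine integral_congr_ae (.of_forall fun s => ?_)
        have : Complex.exp (Complex.I * τ * (ρ - s : ℝ)) =
            Complex.exp (Complex.I * τ * ρ) * Complex.exp (Complex.I * s * (-τ : ℝ)) := by
          rw [← Complex.exp_add]
          push_cast
          ring_nf
        simp only
        rw [this]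
        ring

theorem HeatBound.norm_term_le (h : HeatBound g R t) (h0 : 0 < t) (hd : 1 ≤ d) (μ : Fin d → ℕ)
    (z w : ℝ × EuclideanSpace ℝ (Fin d)) :
    ‖expIntegral (fun τ => g τ (∑ i, μ i)) (z.1 - w.1) *
      ((hermitePhi μ z.2 * hermitePhi μ w.2 : ℝ) : ℂ)‖ ≤
    R * (∫ τ : ℝ, Real.exp (-(t / 2 * τ ^ 2))) *
      (Real.exp (-(t * (∑ i, μ i : ℕ))) * raiseBound ⟨0, hd⟩ 0 μ +
        Real.exp (-(t * (∑ i, μ i : ℕ))) * raiseBound ⟨0, hd⟩ 0 μ) := by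
  have := norm_mul_raisePhi_mul_le ⟨0, hd⟩ 0 0
    (c := fun k => expIntegral (fun τ => g τ k) (z.1 - w.1))
    (h.norm_expIntegral_le h0 (z.1 - w.1)) μ z.2 w.2
  simpa only [raisePhi_zero] using this

theorem summable_term_bound (h0 : 0 < t) (h1 : t ≤ 1) (hd : 1 ≤ d) (c : ℝ) :
    Summable fun μ : Fin d → ℕ => c *
      (Real.exp (-(t * (∑ i, μ i : ℕ))) * raiseBound ⟨0, hd⟩ 0 μ +
        Real.exp (-(t * (∑ i, μ i : ℕ))) * raiseBound ⟨0, hd⟩ 0 μ) :=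
  ((summable_exp_mul_raiseBound _ 0 h0 h1).add (summable_exp_mul_raiseBound _ 0 h0 h1)).mul_left _

theorem HeatBound.exists_norm_multKer_le (h : HeatBound g R t) (h0 : 0 < t) (h1 : t ≤ 1)
    (hd : 1 ≤ d) : ∃ M, ∀ z w : ℝ × EuclideanSpace ℝ (Fin d), ‖multKer g z w‖ ≤ M :=
  ⟨_, fun z w => tsum_of_norm_bounded (summable_term_bound h0 h1 hd _).hasSum
    fun μ => h.norm_term_le h0 hd μ z w⟩

/-- Heat decay allows termwise integration against f. Each term is a convolution in ρ, hence a
product on the Fourier side. This links the kernel to the spectral definition of the operator. -/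
theorem HeatBound.hasSum_integral_multKer (h : HeatBound g R t) (h0 : 0 < t) (h1 : t ≤ 1)
    (hd : 1 ≤ d) (hf : Integrable f) (z : ℝ × EuclideanSpace ℝ (Fin d)) :
    HasSum (fun μ : Fin d → ℕ => expIntegral (fun τ => g τ (∑ i, μ i) * hermiteCoeff f μ τ) z.1 *
      (hermitePhi μ z.2 : ℂ)) (∫ w, multKer g z w * f w) := by
  have hcont : ∀ μ : Fin d → ℕ, Continuous fun w : ℝ × EuclideanSpace ℝ (Fin d) =>
      expIntegral (fun τ => g τ (∑ i, μ i)) (z.1 - w.1) *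
      ((hermitePhi μ z.2 * hermitePhi μ w.2 : ℝ) : ℂ) := fun μ =>
    ((continuous_expIntegral (h.integrable h0 _)).comp (continuous_const.sub continuous_fst)).mul
      (Complex.continuous_ofReal.comp (continuous_const.mul
        ((continuous_hermitePhi μ).comp continuous_snd)))
  have hint : ∀ μ : Fin d → ℕ, Integrable fun w : ℝ × EuclideanSpace ℝ (Fin d) =>
      expIntegral (fun τ => g τ (∑ i, μ i)) (z.1 - w.1) *
      ((hermitePhi μ z.2 * hermitePhi μ w.2 : ℝ) : ℂ) * f w := fun μ =>
    hf.bdd_mul (hcont μ).aestronglyMeasurable (.of_forall fun w => h.norm_term_le h0 hd μ z w)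
  have hsum := hasSum_integral_of_summable_integral_norm hint (by
    refine Summable.of_nonneg_of_le (fun μ => integral_nonneg fun w => norm_nonneg _) (fun μ => ?_)
      ((summable_term_bound h0 h1 hd (R * ∫ τ : ℝ, Real.exp (-(t / 2 * τ ^ 2)))).mul_right
        (∫ w, ‖f w‖))
    rw [← integral_const_mul]
    refine integral_mono (hint μ).norm (hf.norm.const_mul _) fun w => ?_
    simp only [norm_mul _ (f w)]
    exact mul_le_mul_of_nonneg_right (h.norm_term_le h0 hd μ z w) (norm_nonneg _))
  have e : (∫ w, ∑' μ : Fin d → ℕ, expIntegral (fun τ => g τ (∑ i, μ i)) (z.1 - w.1) *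
      ((hermitePhi μ z.2 * hermitePhi μ w.2 : ℝ) : ℂ) * f w) = ∫ w, multKer g z w * f w := by
    simp only [multKer, tsum_mul_right]
  rw [e] at hsum
  refine Eq.subst (motive := fun F : (Fin d → ℕ) → ℂ => HasSum F _) (funext fun μ => ?_) hsum
  symm
  simp only [hermiteCoeff]
  rw [← integral_expIntegral_sub_mul (h.integrable h0 _) (integrable_sliceCoeff hf μ),
    ← integral_mul_const, Measure.volume_eq_prod, integral_prod _ (hint μ)]
  refine integral_congr_ae (.of_forall fun s => ?_)
  simp only [sliceCoeff]
  rw [mul_assoc, ← integral_mul_const, ← integral_const_mul]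
  refine integral_congr_ae (.of_forall fun y => ?_)
  simp only
  push_cast
  ring

/-- Parseval in x and Plancherel in ρ on the output, the pointwise bound of g, then Plancherel and
Bessel on the input. Only the supremum of g enters, not the constant of its heat bound; each use of
Plancherel contributes a factor 2π. -/
theorem HeatBound.lintegral_integral_multKer_sq_le (h : HeatBound g R t) (h0 : 0 < t) (h1 : t ≤ 1)
    (hd : 1 ≤ d) {A : ℝ} (hA : ∀ τ k, ‖g τ k‖ ≤ A) (hf : Integrable f) (h2 : MemLp f 2 volume) :
    ∫⁻ z, ‖∫ w, multKer g z w * f w‖ₑ ^ 2 ≤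
      ENNReal.ofReal ((2 * Real.pi * A) ^ 2) * ∫⁻ w, ‖f w‖ₑ ^ 2 := by
  obtain ⟨M, hM⟩ := h.exists_norm_multKer_le h0 h1 hd
  have hA0 : 0 ≤ A := (norm_nonneg _).trans (hA 0 0)
  have hpi := Real.pi_pos
  have hc : Continuous fun z : ℝ × EuclideanSpace ℝ (Fin d) => ∫ w, multKer g z w * f w :=
    continuous_integral_mul (h.continuous_multKer h0 h1 hd) hM hf
  have hG : ∀ μ : Fin d → ℕ, Integrable fun τ => g τ (∑ i, μ i) * hermiteCoeff f μ τ :=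
    fun μ => integrable_mul_hermiteCoeff hf (h.integrable h0 _) μ
  refine (lintegral_prod (μ := volume) (ν := volume) _
    (hc.measurable.enorm.pow_const 2).aemeasurable).trans_le ?_
  calc ∫⁻ ρ, ∫⁻ y, ‖∫ w, multKer g (ρ, y) w * f w‖ₑ ^ 2
      ≤ ∫⁻ ρ, ∑' μ : Fin d → ℕ,
          ‖expIntegral (fun τ => g τ (∑ i, μ i) * hermiteCoeff f μ τ) ρ‖ₑ ^ 2 :=
        lintegral_mono fun ρ => lintegral_enorm_hasSum_hermitePhi_sq_le Function.injective_id
          fun y => h.hasSum_integral_multKer h0 h1 hd hf (ρ, y)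
    _ = ∑' μ : Fin d → ℕ, ENNReal.ofReal (2 * Real.pi) *
          ∫⁻ τ, ‖g τ (∑ i, μ i) * hermiteCoeff f μ τ‖ₑ ^ 2 := by
        rw [lintegral_tsum fun μ =>
          ((continuous_expIntegral (hG μ)).measurable.enorm.pow_const 2).aemeasurable]
        exact tsum_congr fun μ => lintegral_enorm_expIntegral_sq (hG μ)
          (memLp_mul_hermiteCoeff hf (h.memLp h0 _) μ)
    _ ≤ ∑' μ : Fin d → ℕ, ENNReal.ofReal ((2 * Real.pi * A) ^ 2) *
          ∫⁻ ρ, ‖sliceCoeff f μ ρ‖ₑ ^ 2 := by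
        refine ENNReal.tsum_le_tsum fun μ => ?_
        have e : ENNReal.ofReal ((2 * Real.pi * A) ^ 2) = ENNReal.ofReal (2 * Real.pi) *
            (ENNReal.ofReal (A ^ 2) * ENNReal.ofReal (2 * Real.pi)) := by
          rw [← ENNReal.ofReal_mul (by positivity), ← ENNReal.ofReal_mul (by positivity)]
          ring_nf
        rw [e, mul_assoc, mul_assoc, ← lintegral_hermiteCoeff_sq hf h2 μ,
          ← lintegral_const_mul _ ((continuous_hermiteCoeff hf μ).measurable.enorm.pow_const 2)]
        gcongr with τ
        rw [enorm_mul, mul_pow]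
        gcongr
        exact enorm_sq_le_ofReal_sq (hA _ _)
    _ ≤ _ := by
        rw [ENNReal.tsum_mul_left]
        gcongr
        exact tsum_lintegral_sliceCoeff_sq_le hf

end PartialOscillator

namespace PartialOscillator

/-! ### `L^p` bounds for truncated multipliers -/

variable {d : ℕ} {g : ℝ → ℕ → ℂ} {R t A : ℝ} {m : ℝ → ℕ → ℂ}
  {f : ℝ × EuclideanSpace ℝ (Fin d) → ℂ}

theorem HeatBound.mono {R' t' : ℝ} (h : HeatBound g R t) (hR : R ≤ R') (ht : t' ≤ t) :
    HeatBound g R' t' := by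
  refine ⟨h.measurable, fun τ k => (h.bound τ k).trans ?_⟩
  have := h.nonneg
  have := this.trans hR
  gcongr

theorem HeatBound.sum {g : ℕ → ℝ → ℕ → ℂ} {n : ℕ} (h : ∀ j ∈ Finset.range n, HeatBound (g j) R t) :
    HeatBound (fun τ k => ∑ j ∈ Finset.range n, g j τ k) (n * R) t := by
  refine ⟨fun k => Finset.measurable_fun_sum _ fun j hj => (h j hj).measurable k, fun τ k => ?_⟩
  refine (norm_sum_le_of_le _ fun j hj => (h j hj).bound τ k).trans (le_of_eq ?_)
  rw [Finset.sum_const, Finset.card_range, nsmul_eq_mul]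
  ring

theorem multKer_sum {g : ℕ → ℝ → ℕ → ℂ} {n : ℕ} (h : ∀ j ∈ Finset.range n, HeatBound (g j) R t)
    (h0 : 0 < t) (h1 : t ≤ 1) (hd : 1 ≤ d) (z w : ℝ × EuclideanSpace ℝ (Fin d)) :
    ∑ j ∈ Finset.range n, multKer (g j) z w =
      multKer (fun τ k => ∑ j ∈ Finset.range n, g j τ k) z w := by
  unfold multKer
  rw [← Summable.tsum_finsetSum fun j hj => Summable.of_norm_bounded
    (summable_term_bound h0 h1 hd _) fun μ => (h j hj).norm_term_le h0 hd μ z w]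
  refine tsum_congr fun μ => ?_
  rw [← Finset.sum_mul]
  congr 1
  simp only [expIntegral, Finset.mul_sum]
  rw [integral_finsetSum _ fun j hj => integrable_exp_mul ((h j hj).integrable h0 _) _]

/-- The Hermite part is symmetric and ρ-ρ' changes sign, so the transposed kernel belongs to the
multiplier reflected in τ. This is what makes duality stay within the class. -/
theorem multKer_swap (g : ℝ → ℕ → ℂ) (z w : ℝ × EuclideanSpace ℝ (Fin d)) :
    multKer g w z = multKer (fun τ k => g (-τ) k) z w := by
  unfold multKer
  refine tsum_congr fun μ => ?_
  rw [mul_comm (hermitePhi μ w.2)]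
  congr 1
  unfold expIntegral
  rw [← integral_neg_eq_self]
  refine integral_congr_ae (.of_forall fun τ => ?_)
  simp only
  congr 2
  push_cast
  ring

/-- The multiplier `m` truncated by the low frequency cutoff at scale `j`. -/
noncomputable def truncation (d : ℕ) (m : ℝ → ℕ → ℂ) (n : ℕ) (τ : ℝ) (k : ℕ) : ℂ :=
  m τ k * (1 - heatComplement d n τ k ^ symbolOrder d)

theorem heatComplement_eq (d n : ℕ) (τ : ℝ) (k : ℕ) : heatComplement d n τ k =
    ((1 - Real.exp (-(scale n ^ 2 * eigenvalue d τ k)) : ℝ) : ℂ) := by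
  rw [heatComplement]
  push_cast
  rfl

theorem eigenvalue_nonneg (d : ℕ) (τ : ℝ) (k : ℕ) : 0 ≤ eigenvalue d τ k := by
  unfold eigenvalue
  positivity

theorem norm_truncation_le (d : ℕ) (m : ℝ → ℕ → ℂ) (n : ℕ) (τ : ℝ) (k : ℕ) :
    ‖truncation d m n τ k‖ ≤ ‖m τ k‖ := by
  rw [truncation, norm_mul, heatComplement_eq]
  refine mul_le_of_le_one_right (norm_nonneg _) ?_
  have h1 : Real.exp (-(scale n ^ 2 * eigenvalue d τ k)) ≤ 1 := by
    rw [Real.exp_le_one_iff]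
    have := eigenvalue_nonneg d τ k
    nlinarith [sq_nonneg (scale n)]
  have h2 := Real.exp_pos (-(scale n ^ 2 * eigenvalue d τ k))
  rw [← Complex.ofReal_pow, ← Complex.ofReal_one, ← Complex.ofReal_sub, Complex.norm_real,
    Real.norm_eq_abs, abs_le]
  have h3 := pow_le_one₀ (n := symbolOrder d) (sub_nonneg.2 h1) (by linarith)
  have h4 := pow_nonneg (sub_nonneg.2 h1) (symbolOrder d)
  constructor <;> linarith

theorem truncation_reflect (d : ℕ) (m : ℝ → ℕ → ℂ) (n : ℕ) (τ : ℝ) (k : ℕ) :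
    truncation d m n (-τ) k = truncation d (fun τ k => m (-τ) k) n τ k := by
  simp only [truncation, heatComplement, eigenvalue, neg_sq]

theorem MikhlinHormander.norm_le (h : MikhlinHormander d A m) (τ : ℝ) (k : ℕ) : ‖m τ k‖ ≤ A := by
  simpa using h.deriv_le 0 (Nat.zero_le _) τ k

theorem MikhlinHormander.reflect (h : MikhlinHormander d A m) :
    MikhlinHormander d A fun τ k => m (-τ) k := by
  have e : ∀ N k, iteratedDeriv N (fun τ => m (-τ) k) =
      fun τ => (-1 : ℝ) ^ N • iteratedDeriv N (fun τ => m τ k) (-τ) := fun N k =>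
    funext fun τ => iteratedDeriv_comp_neg N (fun τ => m τ k) τ
  refine ⟨fun k N hN => ?_, fun N hN τ k => ?_, fun N hN τ k => ?_⟩
  · rw [e]
    have := ((h.differentiable k N hN).comp differentiable_neg).const_smul ((-1 : ℝ) ^ N)
    exact this
  · rw [e, norm_smul, norm_pow, norm_neg, norm_one, one_pow, one_mul]
    simpa only [neg_sq] using h.deriv_le N hN (-τ) k
  · simpa only [neg_sq] using h.diff_le N hN (-τ) k

theorem scale_le_scale {i j : ℕ} (h : i ≤ j) : scale j ≤ scale i :=
  pow_le_pow_of_le_one (by positivity)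
    (inv_le_one_of_one_le₀ (Real.one_le_sqrt.2 one_le_two)) h

/-- A truncation is a finite sum of dyadic pieces, so its kernel is bounded and continuous. That
bound may depend on n, but the constants for L² and for the Hörmander condition do not. -/
theorem exists_czKernel_truncation (hd : 1 ≤ d) (A : ℝ) : ∃ C : ℝ, 0 ≤ C ∧
    ∀ m, MikhlinHormander d A m → ∀ n, ∃ M, HeatBound (truncation d m n) M (scale n ^ 2) ∧
      ∃ M', CZKernel (d := d) (multKer (truncation d m n)) M' (ENNReal.ofReal C)
        (ENNReal.ofReal ((2 * Real.pi * A) ^ 2)) := by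
  obtain ⟨C₁, hC₁, h₁⟩ := exists_symbolBound_dyadicPiece hd
  -- The order ⌊(d+1)/2⌋+1, doubled, is at least d+2.
  obtain ⟨C₂, hC₂, h₂⟩ := exists_lintegral_sum_multKer_sub_le hd (N := symbolOrder d)
    (by unfold symbolOrder; omega)
  -- The absolute value makes the constant nonnegative for every real A; once a multiplier is given,
  -- A is itself nonnegative.
  refine ⟨C₂ * (C₁ * |A|), by positivity, fun m hm n => ?_⟩
  have hA : |A| = A := abs_of_nonneg (hm.nonneg hd)
  rw [hA]
  have hs := scale_pos n
  have h0 : 0 < scale n ^ 2 := by positivity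
  have h1 : scale n ^ 2 ≤ 1 := pow_le_one₀ hs.le (scale_le_one n)
  have hb : ∀ j ∈ Finset.range (n + 1), HeatBound (dyadicPiece d m j) (C₁ * A) (scale n ^ 2) :=
    fun j hj => (h₁ m A hm j).heatBound.mono le_rfl (pow_le_pow_left₀ hs.le
      (scale_le_scale (Nat.lt_succ_iff.1 (Finset.mem_range.1 hj))) 2)
  have hsum : (fun τ k => ∑ j ∈ Finset.range (n + 1), dyadicPiece d m j τ k) =
      truncation d m n := by
    funext τ k
    exact sum_dyadicPiece d m n τ k
  have hB := HeatBound.sum hb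
  rw [hsum] at hB
  refine ⟨_, hB, ?_⟩
  obtain ⟨M, hM⟩ := hB.exists_norm_multKer_le h0 h1 hd
  refine ⟨M, hB.continuous_multKer h0 h1 hd, hM, fun f hf h2 => hB.lintegral_integral_multKer_sq_le
    h0 h1 hd (fun τ k => (norm_truncation_le d m n τ k).trans (hm.norm_le τ k)) hf h2,
    fun w₁ w₂ => ?_⟩
  have := h₂ (C₁ * A) (n + 1) (dyadicPiece d m) (mul_nonneg hC₁ (hm.nonneg hd))
    (fun j _ => h₁ m A hm j) w₁ w₂
  simpa only [multKer_sum hb h0 h1 hd, hsum] using this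

/-- Calderón–Zygmund theory for p < 2, Plancherel for p = 2, and for p > 2 the bound at the
conjugate exponent for the reflected multiplier. -/
theorem exists_lintegral_truncation_le (hd : 1 ≤ d) (A : ℝ) {p : ℝ} (hp : 1 < p) :
    ∃ C : ℝ≥0∞, C < ⊤ ∧ ∀ m, MikhlinHormander d A m → ∀ n,
      ∀ f : ℝ × EuclideanSpace ℝ (Fin d) → ℂ, Continuous f → HasCompactSupport f →
      ∫⁻ z, ‖∫ w, multKer (truncation d m n) z w * f w‖ₑ ^ p ≤ C * ∫⁻ w, ‖f w‖ₑ ^ p := by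
  obtain ⟨C, hC, h⟩ := exists_czKernel_truncation hd A
  have hlt : ∀ q : ℝ, czConst d q (ENNReal.ofReal C)
      (ENNReal.ofReal ((2 * Real.pi * A) ^ 2)) < ⊤ := fun q =>
    czConst_lt_top d q ENNReal.ofReal_lt_top ENNReal.ofReal_lt_top
  have hsmall : ∀ {q : ℝ}, 1 < q → q < 2 → ∀ m, MikhlinHormander d A m → ∀ n,
      ∀ f : ℝ × EuclideanSpace ℝ (Fin d) → ℂ, Continuous f → HasCompactSupport f →
      ∫⁻ z, ‖∫ w, multKer (truncation d m n) z w * f w‖ₑ ^ q ≤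
        czConst d q (ENNReal.ofReal C) (ENNReal.ofReal ((2 * Real.pi * A) ^ 2)) *
          ∫⁻ w, ‖f w‖ₑ ^ q := by
    intro q h1 h2 m hm n f hf hfc
    obtain ⟨-, -, M, hK⟩ := h m hm n
    exact hK.lintegral_rpow_le hf hfc h1 h2 (hlt q)
  rcases lt_trichotomy p 2 with hp2 | rfl | hp2
  · exact ⟨_, hlt p, fun m hm n f hf hfc => hsmall hp hp2 m hm n f hf hfc⟩
  · refine ⟨ENNReal.ofReal ((2 * Real.pi * A) ^ 2), ENNReal.ofReal_lt_top,
      fun m hm n f hf hfc => ?_⟩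
    obtain ⟨-, -, M, hK⟩ := h m hm n
    simp only [ENNReal.rpow_two]
    exact hK.l2 f (hf.integrable_of_hasCompactSupport hfc) (hf.memLp_of_hasCompactSupport hfc)
  · have hpq := Real.HolderConjugate.conjExponent hp
    have hq2 : p.conjExponent < 2 := by
      rw [Real.conjExponent, div_lt_iff₀ (by linarith)]
      linarith
    refine ⟨_, ENNReal.rpow_lt_top_of_nonneg (sub_nonneg.2 hp.le) (hlt p.conjExponent).ne,
      fun m hm n f hf hfc => ?_⟩
    obtain ⟨-, -, M, hK⟩ := h m hm n
    refine lintegral_rpow_le_of_transpose hK.continuous hK.bounded hpq hp2.le (fun g hg hgc => ?_)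
      hf hfc
    have := hsmall hpq.symm.lt hq2 _ hm.reflect n g hg hgc
    simpa only [multKer_swap (truncation d m n), truncation_reflect] using this

end PartialOscillator

namespace PartialOscillator

/-! ### Coefficients of test functions -/

variable {d : ℕ} {f : ℝ × EuclideanSpace ℝ (Fin d) → ℂ}

theorem integrable_mul_of_hasCompactSupport {ψ : ℝ × EuclideanSpace ℝ (Fin d) → ℂ}
    (hψ : Continuous ψ) (hf : Continuous f) (hfc : HasCompactSupport f) :
    Integrable fun z => ψ z * f z :=
  (hψ.mul hf).integrable_of_hasCompactSupport hfc.mul_left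

theorem contDiff_fderiv_apply (hf : ContDiff ℝ ∞ f) (v : ℝ × EuclideanSpace ℝ (Fin d)) :
    ContDiff ℝ ∞ fun z => fderiv ℝ f z v :=
  (hf.fderiv_right (m := ∞) (by simp)).clm_apply contDiff_const

theorem integral_mul_fderiv_eq_neg {ψ ψ' : ℝ × EuclideanSpace ℝ (Fin d) → ℂ}
    {v : ℝ × EuclideanSpace ℝ (Fin d)} (hψ : Continuous ψ) (hψ' : Continuous ψ')
    (h : ∀ z, HasLineDerivAt ℝ ψ (ψ' z) z v) (hf : ContDiff ℝ ∞ f) (hfc : HasCompactSupport f) :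
    ∫ z, ψ z * fderiv ℝ f z v = -∫ z, ψ' z * f z :=
  integral_bilinear_hasLineDerivAt_right_eq_neg_left_of_integrable
    (B := ContinuousLinearMap.mul ℝ ℂ) (v := v)
    (integrable_mul_of_hasCompactSupport hψ' hf.continuous hfc)
    (integrable_mul_of_hasCompactSupport hψ (contDiff_fderiv_apply hf v).continuous
      (hfc.fderiv_apply ℝ v))
    (integrable_mul_of_hasCompactSupport hψ hf.continuous hfc) (fun z _ => h z)
    fun z _ => ((hf.differentiable (by simp) z).hasFDerivAt.hasLineDerivAt v)

/-- The second derivative in the direction `v`. -/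
noncomputable def secondDeriv (v : ℝ × EuclideanSpace ℝ (Fin d))
    (f : ℝ × EuclideanSpace ℝ (Fin d) → ℂ) (z : ℝ × EuclideanSpace ℝ (Fin d)) : ℂ :=
  fderiv ℝ (fun z => fderiv ℝ f z v) z v

theorem integral_mul_secondDeriv {ψ ψ' ψ'' : ℝ × EuclideanSpace ℝ (Fin d) → ℂ}
    {v : ℝ × EuclideanSpace ℝ (Fin d)} (hψ : Continuous ψ) (hψ' : Continuous ψ')
    (hψ'' : Continuous ψ'') (h : ∀ z, HasLineDerivAt ℝ ψ (ψ' z) z v)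
    (h' : ∀ z, HasLineDerivAt ℝ ψ' (ψ'' z) z v) (hf : ContDiff ℝ ∞ f) (hfc : HasCompactSupport f) :
    ∫ z, ψ z * secondDeriv v f z = ∫ z, ψ'' z * f z := by
  unfold secondDeriv
  rw [integral_mul_fderiv_eq_neg hψ hψ' h (contDiff_fderiv_apply hf v) (hfc.fderiv_apply ℝ v),
    integral_mul_fderiv_eq_neg hψ' hψ'' h' hf hfc, neg_neg]

/-- The partial harmonic oscillator `-∂_ρ² - Δ_x + |x|²`. -/
noncomputable def oscillator (f : ℝ × EuclideanSpace ℝ (Fin d) → ℂ)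
    (z : ℝ × EuclideanSpace ℝ (Fin d)) : ℂ :=
  -secondDeriv (1, 0) f z + ∑ j, (-secondDeriv (0, EuclideanSpace.single j 1) f z +
    ((z.2 j ^ 2 : ℝ) : ℂ) * f z)

theorem contDiff_oscillator (hf : ContDiff ℝ ∞ f) : ContDiff ℝ ∞ (oscillator f) := by
  have h : ∀ v, ContDiff ℝ ∞ (secondDeriv v f) := fun v =>
    contDiff_fderiv_apply (contDiff_fderiv_apply hf v) v
  refine (h _).neg.add (ContDiff.sum fun j _ => (h _).neg.add (ContDiff.mul ?_ hf))
  have hj : ContDiff ℝ ∞ fun z : ℝ × EuclideanSpace ℝ (Fin d) => z.2 j := by fun_prop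
  exact Complex.ofRealCLM.contDiff.comp (hj.pow 2)

theorem hasCompactSupport_oscillator (hfc : HasCompactSupport f) :
    HasCompactSupport (oscillator f) := by
  refine HasCompactSupport.intro hfc fun z hz => ?_
  have h : ∀ v, secondDeriv v f z = 0 := fun v => image_eq_zero_of_notMem_tsupport fun hz' =>
    hz (tsupport_fderiv_apply_subset ℝ v (tsupport_fderiv_apply_subset ℝ v hz'))
  simp [oscillator, h, image_eq_zero_of_notMem_tsupport hz]

theorem hasDerivAt_hermiteFun_lower (n : ℕ) (x : ℝ) : HasDerivAt (hermiteFun n)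
    (√(2 * n) * hermiteFun (n - 1) x - x * hermiteFun n x) x := by
  refine (hasDerivAt_hermiteFun n x).congr_deriv ?_
  linarith [two_mul_hermiteFun n x]

/-- Apply the lowering form of the derivative to h_{n+1}: this is the eigenvalue equation -h_n'' +
x² h_n = (2n+1) h_n. -/
theorem hasDerivAt_deriv_hermiteFun (n : ℕ) (x : ℝ) :
    HasDerivAt (fun x => x * hermiteFun n x - √(2 * (n + 1)) * hermiteFun (n + 1) x)
      ((x ^ 2 - (2 * n + 1)) * hermiteFun n x) x := by
  have h := ((hasDerivAt_id x).fun_mul (hasDerivAt_hermiteFun_raise n x)).fun_sub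
    ((hasDerivAt_hermiteFun_lower (n + 1) x).const_mul (√(2 * (n + 1))))
  refine h.congr_deriv ?_
  have e := Real.mul_self_sqrt (show (0 : ℝ) ≤ 2 * (n + 1) by positivity)
  simp only [id, Nat.add_sub_cancel]
  push_cast
  linear_combination (-hermiteFun n x) * e

/-- The generalized eigenfunction `e^{-iτρ} Φ_μ(x)`. -/
noncomputable def planeWave (μ : Fin d → ℕ) (τ : ℝ) (z : ℝ × EuclideanSpace ℝ (Fin d)) : ℂ :=
  Complex.exp (Complex.I * z.1 * (-τ : ℝ)) * hermitePhi μ z.2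

theorem continuous_planeWave (μ : Fin d → ℕ) (τ : ℝ) : Continuous (planeWave μ τ) := by
  have h : Continuous fun z : ℝ × EuclideanSpace ℝ (Fin d) => (hermitePhi μ z.2 : ℂ) :=
    Complex.continuous_ofReal.comp ((continuous_hermitePhi μ).comp continuous_snd)
  unfold planeWave
  exact Continuous.mul (by fun_prop) h

theorem hasLineDerivAt_planeWave_fst (μ : Fin d → ℕ) (τ : ℝ) (c : ℂ)
    (z : ℝ × EuclideanSpace ℝ (Fin d)) : HasLineDerivAt ℝ (fun z => c * planeWave μ τ z)
      (-(Complex.I * τ) * c * planeWave μ τ z) z (1, 0) := by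
  have h1 : HasDerivAt (fun t : ℝ => Complex.I * ((z.1 + t : ℝ) : ℂ) * (-τ : ℝ))
      (Complex.I * 1 * (-τ : ℝ)) 0 := by
    have := ((hasDerivAt_id (0 : ℝ)).const_add z.1).ofReal_comp
    simpa using (this.const_mul Complex.I).mul_const (((-τ : ℝ) : ℂ))
  have h2 := (h1.cexp.mul_const (hermitePhi μ z.2 : ℂ)).const_mul c
  have e : (fun t : ℝ => c * planeWave μ τ (z + t • ((1 : ℝ), (0 : EuclideanSpace ℝ (Fin d))))) =
      fun t : ℝ => c * (Complex.exp (Complex.I * ((z.1 + t : ℝ) : ℂ) * (-τ : ℝ)) *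
        (hermitePhi μ z.2 : ℂ)) := by
    funext t
    simp [planeWave]
  unfold HasLineDerivAt
  rw [e]
  refine h2.congr_deriv ?_
  simp only [planeWave]
  push_cast
  simp only [add_zero]
  ring

/-- The product of the plane wave and the Hermite functions in the coordinates other than `j`. -/
noncomputable def planeWaveErase (j : Fin d) (μ : Fin d → ℕ) (τ : ℝ)
    (z : ℝ × EuclideanSpace ℝ (Fin d)) : ℂ :=
  Complex.exp (Complex.I * z.1 * (-τ : ℝ)) *
    ((∏ i ∈ Finset.univ.erase j, hermiteFun (μ i) (z.2 i) : ℝ) : ℂ)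

theorem planeWaveErase_mul (j : Fin d) (μ : Fin d → ℕ) (τ : ℝ)
    (z : ℝ × EuclideanSpace ℝ (Fin d)) :
    planeWaveErase j μ τ z * (hermiteFun (μ j) (z.2 j) : ℂ) = planeWave μ τ z := by
  rw [planeWave, hermitePhi_eq_erase_mul j, planeWaveErase]
  push_cast
  ring

theorem continuous_planeWaveErase (j : Fin d) (μ : Fin d → ℕ) (τ : ℝ) :
    Continuous (planeWaveErase j μ τ) := by
  have h : Continuous fun z : ℝ × EuclideanSpace ℝ (Fin d) =>
      ((∏ i ∈ Finset.univ.erase j, hermiteFun (μ i) (z.2 i) : ℝ) : ℂ) :=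
    Complex.continuous_ofReal.comp (continuous_finsetProd _ fun i _ =>
      (continuous_hermiteFun _).comp (by fun_prop))
  unfold planeWaveErase
  exact Continuous.mul (by fun_prop) h

theorem hasLineDerivAt_planeWaveErase_mul (j : Fin d) (μ : Fin d → ℕ) (τ : ℝ) {u u' : ℝ → ℝ}
    (hu : ∀ x, HasDerivAt u (u' x) x) (z : ℝ × EuclideanSpace ℝ (Fin d)) :
    HasLineDerivAt ℝ (fun z => planeWaveErase j μ τ z * (u (z.2 j) : ℂ))
      (planeWaveErase j μ τ z * (u' (z.2 j) : ℂ)) z (0, EuclideanSpace.single j 1) := by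
  have h1 : HasDerivAt (fun t : ℝ => u (z.2 j + t)) (u' (z.2 j)) 0 := by
    have := (hu (z.2 j + 0)).comp_const_add (z.2 j) 0
    simpa using this
  have e : (fun t : ℝ => planeWaveErase j μ τ (z + t • ((0 : ℝ), EuclideanSpace.single j (1 : ℝ))) *
      (u ((z + t • ((0 : ℝ), EuclideanSpace.single j (1 : ℝ))).2 j) : ℂ)) =
      fun t : ℝ => planeWaveErase j μ τ z * (u (z.2 j + t) : ℂ) := by
    funext t
    have e1 : (∏ i ∈ Finset.univ.erase j, hermiteFun (μ i)
        ((z + t • ((0 : ℝ), EuclideanSpace.single j (1 : ℝ))).2 i)) =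
        ∏ i ∈ Finset.univ.erase j, hermiteFun (μ i) (z.2 i) := by
      refine Finset.prod_congr rfl fun i hi => ?_
      simp [Finset.ne_of_mem_erase hi]
    rw [planeWaveErase, planeWaveErase, e1]
    simp
  unfold HasLineDerivAt
  rw [e]
  exact h1.ofReal_comp.const_mul _

theorem integral_planeWave_mul_secondDeriv_fst (μ : Fin d → ℕ) (τ : ℝ) (hf : ContDiff ℝ ∞ f)
    (hfc : HasCompactSupport f) : ∫ z, planeWave μ τ z * secondDeriv (1, 0) f z =
      ∫ z, (-(τ ^ 2 : ℝ) : ℂ) * (planeWave μ τ z * f z) := by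
  have hc := continuous_planeWave μ τ
  have := integral_mul_secondDeriv (ψ := fun z => 1 * planeWave μ τ z) (by fun_prop)
    (by fun_prop) (by fun_prop) (hasLineDerivAt_planeWave_fst μ τ 1)
    (hasLineDerivAt_planeWave_fst μ τ (-(Complex.I * τ) * 1)) hf hfc
  simp only [one_mul] at this
  rw [this]
  refine integral_congr_ae (.of_forall fun z => ?_)
  simp only
  push_cast
  linear_combination (τ ^ 2 * planeWave μ τ z * f z) * Complex.I_sq

theorem integral_planeWave_mul_secondDeriv_snd (j : Fin d) (μ : Fin d → ℕ) (τ : ℝ)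
    (hf : ContDiff ℝ ∞ f) (hfc : HasCompactSupport f) :
    ∫ z, planeWave μ τ z * secondDeriv (0, EuclideanSpace.single j 1) f z =
      ∫ z, ((z.2 j ^ 2 - (2 * μ j + 1) : ℝ) : ℂ) * (planeWave μ τ z * f z) := by
  have hc := continuous_planeWaveErase j μ τ
  have hu : ∀ {u : ℝ → ℝ}, Continuous u → Continuous fun z : ℝ × EuclideanSpace ℝ (Fin d) =>
      planeWaveErase j μ τ z * (u (z.2 j) : ℂ) := fun hu =>
    hc.mul (Complex.continuous_ofReal.comp (hu.comp (by fun_prop)))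
  have hh := continuous_hermiteFun
  have := integral_mul_secondDeriv (hu (hh (μ j))) (hu (u := fun x => x * hermiteFun (μ j) x -
      √(2 * (μ j + 1)) * hermiteFun (μ j + 1) x) (by fun_prop))
    (hu (u := fun x => (x ^ 2 - (2 * μ j + 1)) * hermiteFun (μ j) x) (by fun_prop))
    (hasLineDerivAt_planeWaveErase_mul j μ τ (hasDerivAt_hermiteFun_raise (μ j)))
    (hasLineDerivAt_planeWaveErase_mul j μ τ (hasDerivAt_deriv_hermiteFun (μ j))) hf hfc
  simp only [planeWaveErase_mul] at this
  rw [this]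
  refine integral_congr_ae (.of_forall fun z => ?_)
  simp only [← planeWaveErase_mul j μ τ z]
  push_cast
  ring

/-- The oscillator is symmetric, and e^{-iτρ} Φ_μ(x) is an eigenfunction with eigenvalue τ²+2|μ|+d.
The compact support of f removes all boundary terms. -/
theorem integral_planeWave_mul_oscillator (μ : Fin d → ℕ) (τ : ℝ) (hf : ContDiff ℝ ∞ f)
    (hfc : HasCompactSupport f) : ∫ z, planeWave μ τ z * oscillator f z =
      (eigenvalue d τ (∑ i, μ i) : ℂ) * ∫ z, planeWave μ τ z * f z := by
  have hc := continuous_planeWave μ τ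
  have h2 : ∀ v, Integrable fun z => planeWave μ τ z * secondDeriv v f z := fun v =>
    integrable_mul_of_hasCompactSupport hc (contDiff_fderiv_apply (contDiff_fderiv_apply hf v)
      v).continuous ((hfc.fderiv_apply ℝ v).fderiv_apply ℝ v)
  have h1 := integrable_mul_of_hasCompactSupport hc hf.continuous hfc
  have h3 : ∀ j : Fin d, Integrable fun z : ℝ × EuclideanSpace ℝ (Fin d) =>
      planeWave μ τ z * (((z.2 j ^ 2 : ℝ) : ℂ) * f z) := fun j => by
    have : Continuous fun z : ℝ × EuclideanSpace ℝ (Fin d) =>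
        planeWave μ τ z * ((z.2 j ^ 2 : ℝ) : ℂ) :=
      hc.mul (Complex.continuous_ofReal.comp (by fun_prop))
    simpa only [mul_assoc] using integrable_mul_of_hasCompactSupport this hf.continuous hfc
  have e : ∀ j : Fin d, ∫ z, (planeWave μ τ z * (((z.2 j ^ 2 : ℝ) : ℂ) * f z) -
      planeWave μ τ z * secondDeriv (0, EuclideanSpace.single j 1) f z) =
      (2 * μ j + 1) * ∫ z, planeWave μ τ z * f z := fun j => by
    rw [integral_sub (h3 j) (h2 _), integral_planeWave_mul_secondDeriv_snd j μ τ hf hfc,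
      ← integral_const_mul, ← integral_sub (h3 j)]
    · refine integral_congr_ae (.of_forall fun z => ?_)
      simp only
      push_cast
      ring
    · refine ((h3 j).sub (h1.const_mul (2 * μ j + 1 : ℂ))).congr (.of_forall fun z => ?_)
      simp only [Pi.sub_apply]
      push_cast
      ring
  calc ∫ z, planeWave μ τ z * oscillator f z
      = ∫ z, (-(planeWave μ τ z * secondDeriv (1, 0) f z) +
          ∑ j, (planeWave μ τ z * (((z.2 j ^ 2 : ℝ) : ℂ) * f z) -
            planeWave μ τ z * secondDeriv (0, EuclideanSpace.single j 1) f z)) := by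
        refine integral_congr_ae (.of_forall fun z => ?_)
        simp only [oscillator]
        rw [mul_add, Finset.mul_sum, mul_neg]
        congr 1
        exact Finset.sum_congr rfl fun j _ => by ring
    _ = _ := by
        have h4 : ∀ j : Fin d, Integrable fun z => planeWave μ τ z * (((z.2 j ^ 2 : ℝ) : ℂ) * f z) -
            planeWave μ τ z * secondDeriv (0, EuclideanSpace.single j 1) f z :=
          fun j => (h3 j).sub (h2 _)
        rw [integral_add (h2 _).fun_neg (integrable_finsetSum _ fun j _ => h4 j),
          integral_finsetSum _ fun j _ => h4 j, integral_neg,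
          integral_planeWave_mul_secondDeriv_fst μ τ hf hfc, integral_const_mul]
        simp only [e]
        rw [← Finset.sum_mul, Finset.sum_add_distrib, ← Finset.mul_sum]
        simp only [Finset.sum_const, Finset.card_univ, Fintype.card_fin, nsmul_eq_mul, mul_one,
          eigenvalue]
        push_cast
        ring

theorem integrable_planeWave_mul (hf : Integrable f) (μ : Fin d → ℕ) (τ : ℝ) :
    Integrable fun z => planeWave μ τ z * f z := by
  have := (integrable_hermitePhi_snd_mul hf μ).bdd_mul (c := 1)
    (f := fun z => Complex.exp (Complex.I * z.1 * (-τ : ℝ)))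
    (Continuous.aestronglyMeasurable (by fun_prop))
    (.of_forall fun z => (norm_exp_I_mul_mul _ _).le)
  simpa only [planeWave, mul_assoc] using this

theorem hermiteCoeff_eq_integral (hf : Integrable f) (μ : Fin d → ℕ) (τ : ℝ) :
    hermiteCoeff f μ τ = ∫ z, planeWave μ τ z * f z := by
  have hi := integrable_planeWave_mul hf μ τ
  rw [hermiteCoeff, expIntegral]
  refine Eq.trans ?_ (integral_prod (μ := volume) (ν := volume) _ hi).symm
  refine integral_congr_ae (.of_forall fun ρ => ?_)
  simp only [sliceCoeff, planeWave, mul_assoc]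
  rw [integral_const_mul]

theorem hermiteCoeff_oscillator (hf : ContDiff ℝ ∞ f) (hfc : HasCompactSupport f) (μ : Fin d → ℕ)
    (τ : ℝ) : hermiteCoeff (oscillator f) μ τ =
      (eigenvalue d τ (∑ i, μ i) : ℂ) * hermiteCoeff f μ τ := by
  rw [hermiteCoeff_eq_integral (hf.continuous.integrable_of_hasCompactSupport hfc),
    hermiteCoeff_eq_integral ((contDiff_oscillator hf).continuous.integrable_of_hasCompactSupport
      (hasCompactSupport_oscillator hfc)), integral_planeWave_mul_oscillator μ τ hf hfc]

theorem norm_hermiteCoeff_le_integral (hf : Integrable f) (μ : Fin d → ℕ) (τ : ℝ) :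
    ‖hermiteCoeff f μ τ‖ ≤ √(∏ i, (2 * (μ i : ℝ) + 2)) * ∫ z, ‖f z‖ := by
  rw [hermiteCoeff_eq_integral hf, ← integral_const_mul]
  refine norm_integral_le_of_norm_le (hf.norm.const_mul _) (.of_forall fun z => ?_)
  rw [norm_mul, planeWave, norm_mul, norm_exp_I_mul_mul, one_mul, Complex.norm_real,
    Real.norm_eq_abs]
  exact mul_le_mul_of_nonneg_right (abs_hermitePhi_le μ _) (norm_nonneg _)

/-- The oscillator preserves test functions and multiplies the coefficients by the eigenvalue; apply
it n times and use the trivial bound. -/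
theorem exists_eigenvalue_pow_mul_norm_hermiteCoeff_le (n : ℕ) (hf : ContDiff ℝ ∞ f)
    (hfc : HasCompactSupport f) : ∃ C : ℝ, 0 ≤ C ∧ ∀ (μ : Fin d → ℕ) (τ : ℝ),
      eigenvalue d τ (∑ i, μ i) ^ n * ‖hermiteCoeff f μ τ‖ ≤ √(∏ i, (2 * (μ i : ℝ) + 2)) * C := by
  induction n generalizing f with
  | zero =>
    refine ⟨∫ z, ‖f z‖, integral_nonneg fun z => norm_nonneg _, fun μ τ => ?_⟩
    rw [pow_zero, one_mul]
    exact norm_hermiteCoeff_le_integral (hf.continuous.integrable_of_hasCompactSupport hfc) μ τ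
  | succ n ih =>
    obtain ⟨C, hC, h⟩ := ih (contDiff_oscillator hf) (hasCompactSupport_oscillator hfc)
    refine ⟨C, hC, fun μ τ => le_of_eq_of_le ?_ (h μ τ)⟩
    rw [hermiteCoeff_oscillator hf hfc, norm_mul, Complex.norm_real, Real.norm_eq_abs,
      abs_of_nonneg (eigenvalue_nonneg _ _ _)]
    ring

theorem summable_prod_inv_sq : Summable fun μ : Fin d → ℕ => ∏ i, (((μ i : ℝ) + 1) ^ 2)⁻¹ := by
  have h1 : Summable fun n : ℕ => (((n : ℝ) + 1) ^ 2)⁻¹ := by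
    have := (summable_nat_add_iff 1).2 (Real.summable_nat_pow_inv.2 one_lt_two)
    simpa using this
  have h2 : ∑' μ : Fin d → ℕ, ENNReal.ofReal (∏ i, (((μ i : ℝ) + 1) ^ 2)⁻¹) ≠ ⊤ := by
    rw [tsum_ofReal_pi_prod (fun _ n => (((n : ℝ) + 1) ^ 2)⁻¹) fun _ _ => by positivity]
    exact (ENNReal.prod_lt_top fun i _ => h1.tsum_ofReal_lt_top).ne
  exact (ENNReal.summable_toReal h2).congr fun μ => ENNReal.toReal_ofReal (by positivity)

/-- Rapid decay of the coefficients of test functions. -/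
theorem exists_norm_hermiteCoeff_mul_le (hd : 1 ≤ d) (hf : ContDiff ℝ ∞ f)
    (hfc : HasCompactSupport f) : ∃ C : ℝ, 0 ≤ C ∧ ∀ (μ : Fin d → ℕ) (τ : ℝ)
      (x : EuclideanSpace ℝ (Fin d)), ‖hermiteCoeff f μ τ‖ * |hermitePhi μ x| ≤
        C * (1 + τ ^ 2)⁻¹ * ∏ i, (((μ i : ℝ) + 1) ^ 2)⁻¹ := by
  -- One power of the eigenvalue for 1+τ². With P = ∏(μ_i+1) ≤ λ^d, three further times d powers: P²
  -- for the inverse squares, and one P for the growth of the two Hermite factors, each of size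
  -- √(2^d P).
  obtain ⟨C, hC, h⟩ := exists_eigenvalue_pow_mul_norm_hermiteCoeff_le (1 + 3 * d) hf hfc
  refine ⟨2 ^ d * C, by positivity, fun μ τ x => ?_⟩
  have hd' : (1 : ℝ) ≤ d := by exact_mod_cast hd
  obtain ⟨L, hL⟩ : ∃ L, L = eigenvalue d τ (∑ i, μ i) := ⟨_, rfl⟩
  have hL' := hL
  unfold eigenvalue at hL'
  have hs : (0 : ℝ) ≤ (∑ i, μ i : ℕ) := Nat.cast_nonneg _
  have hLτ : 1 + τ ^ 2 ≤ L := by rw [hL']; linarith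
  have hLμ : ∀ i, (μ i : ℝ) + 1 ≤ L := fun i => by
    have : (μ i : ℝ) ≤ (∑ i, μ i : ℕ) := by exact_mod_cast apply_le_sum μ i
    nlinarith [sq_nonneg τ]
  have hL0 : 0 < L := by nlinarith [sq_nonneg τ]
  have hP : ∏ i, ((μ i : ℝ) + 1) ≤ L ^ d := by
    refine (Finset.prod_le_prod (fun i _ => by positivity) fun i _ => hLμ i).trans (le_of_eq ?_)
    simp
  obtain ⟨P, hPe⟩ : ∃ P, P = ∏ i, ((μ i : ℝ) + 1) := ⟨_, rfl⟩
  have hP0 : 0 < P := hPe ▸ Finset.prod_pos fun i _ => by positivity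
  have e1 : ∏ i, (2 * (μ i : ℝ) + 2) = 2 ^ d * P := by
    rw [hPe, ← Fin.prod_const, ← Finset.prod_mul_distrib]
    exact Finset.prod_congr rfl fun i _ => by ring
  have e2 : ∏ i, (((μ i : ℝ) + 1) ^ 2)⁻¹ = (P ^ 2)⁻¹ := by
    rw [Finset.prod_inv_distrib, Finset.prod_pow, hPe]
  have h1 := h μ τ
  have h2 := abs_hermitePhi_le μ x
  rw [← hL, e1] at h1
  rw [e1] at h2
  rw [← hPe] at hP
  rw [e2, mul_assoc, ← mul_inv, ← div_eq_mul_inv, le_div_iff₀ (by positivity)]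
  have h3 : L ^ (1 + 3 * d) * (‖hermiteCoeff f μ τ‖ * |hermitePhi μ x|) ≤ 2 ^ d * P * C := by
    calc L ^ (1 + 3 * d) * (‖hermiteCoeff f μ τ‖ * |hermitePhi μ x|)
        = L ^ (1 + 3 * d) * ‖hermiteCoeff f μ τ‖ * |hermitePhi μ x| := by ring
      _ ≤ √(2 ^ d * P) * C * √(2 ^ d * P) := by gcongr
      _ = 2 ^ d * P * C := by
          rw [mul_right_comm, Real.mul_self_sqrt (by positivity)]
  have h4 : (1 + τ ^ 2) * P ^ 2 * P ≤ L ^ (1 + 3 * d) := by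
    calc (1 + τ ^ 2) * P ^ 2 * P ≤ L * (L ^ d) ^ 2 * L ^ d := by gcongr
      _ = L ^ (1 + 3 * d) := by ring
  refine le_of_mul_le_mul_right ?_ hP0
  calc ‖hermiteCoeff f μ τ‖ * |hermitePhi μ x| * ((1 + τ ^ 2) * P ^ 2) * P
      = (1 + τ ^ 2) * P ^ 2 * P * (‖hermiteCoeff f μ τ‖ * |hermitePhi μ x|) := by ring
    _ ≤ L ^ (1 + 3 * d) * (‖hermiteCoeff f μ τ‖ * |hermitePhi μ x|) := by gcongr
    _ ≤ _ := h3.trans (le_of_eq (by ring))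

end PartialOscillator

namespace PartialOscillator

open Filter Topology

/-! ### The multiplier operator on test functions -/

variable {d : ℕ} {m : ℝ → ℕ → ℂ} {A C : ℝ} {f : ℝ × EuclideanSpace ℝ (Fin d) → ℂ}

theorem hermiteProj_partialFourier (hf : Integrable f) (k : ℕ) (τ : ℝ)
    (x : EuclideanSpace ℝ (Fin d)) : hermiteProj k (partialFourier f τ) x =
      ((√(2 * Real.pi))⁻¹ : ℂ) * ∑ μ ∈ Finset.Nat.antidiagonalTuple d k,
        hermiteCoeff f μ τ * hermitePhi μ x := by
  have hi := fun μ : Fin d → ℕ => integrable_planeWave_mul hf μ τ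
  have e : ∀ μ y, ∫ ρ, planeWave μ τ (ρ, y) * f (ρ, y) =
      (hermitePhi μ y : ℂ) * ∫ ρ : ℝ, Complex.exp (-(Complex.I * τ * ρ)) * f (ρ, y) := by
    intro μ y
    rw [← integral_const_mul]
    refine integral_congr_ae (.of_forall fun ρ => ?_)
    simp only [planeWave]
    have : Complex.I * ρ * (-τ : ℝ) = -(Complex.I * τ * ρ) := by push_cast; ring
    rw [this]
    ring
  have hs : ∀ μ : Fin d → ℕ, Integrable fun y => ∫ ρ, planeWave μ τ (ρ, y) * f (ρ, y) :=
    fun μ => (hi μ).integral_prod_right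
  have e2 : ∀ μ : Fin d → ℕ, hermiteCoeff f μ τ = ∫ y, ∫ ρ, planeWave μ τ (ρ, y) * f (ρ, y) :=
    fun μ => (hermiteCoeff_eq_integral hf μ τ).trans (integral_prod_symm _ (hi μ))
  calc hermiteProj k (partialFourier f τ) x
      = ∫ y, ∑ μ ∈ Finset.Nat.antidiagonalTuple d k, ((√(2 * Real.pi))⁻¹ : ℂ) *
          ((∫ ρ, planeWave μ τ (ρ, y) * f (ρ, y)) * hermitePhi μ x) := by
        refine integral_congr_ae (.of_forall fun y => ?_)
        simp only [hermiteKernel, partialFourier, e]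
        push_cast
        rw [Finset.sum_mul]
        exact Finset.sum_congr rfl fun μ _ => by ring
    _ = _ := by
        rw [integral_finsetSum _ fun μ _ => ((hs μ).mul_const _).const_mul _, Finset.mul_sum]
        refine Finset.sum_congr rfl fun μ _ => ?_
        rw [integral_const_mul, integral_mul_const, e2]

/-- The contribution of `μ` to the multiplier operator, up to the factor `2π`. -/
noncomputable def multiplierTerm (m : ℝ → ℕ → ℂ) (f : ℝ × EuclideanSpace ℝ (Fin d) → ℂ)
    (z : ℝ × EuclideanSpace ℝ (Fin d)) (μ : Fin d → ℕ) : ℂ :=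
  expIntegral (fun τ => m τ (∑ i, μ i) * hermiteCoeff f μ τ) z.1 * hermitePhi μ z.2

/-- Rapid decay of the Hermite coefficients. -/
def RapidDecay (f : ℝ × EuclideanSpace ℝ (Fin d) → ℂ) (C : ℝ) : Prop :=
  ∀ (μ : Fin d → ℕ) (τ : ℝ) (x : EuclideanSpace ℝ (Fin d)),
    ‖hermiteCoeff f μ τ‖ * |hermitePhi μ x| ≤
      C * (1 + τ ^ 2)⁻¹ * ∏ i, (((μ i : ℝ) + 1) ^ 2)⁻¹

theorem exists_rapidDecay (hd : 1 ≤ d) (hf : ContDiff ℝ ∞ f) (hfc : HasCompactSupport f) :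
    ∃ C, RapidDecay f C :=
  (exists_norm_hermiteCoeff_mul_le hd hf hfc).imp fun _ h => h.2

theorem hermiteCoeff_add {g : ℝ × EuclideanSpace ℝ (Fin d) → ℂ} (hf : Integrable f)
    (hg : Integrable g) (μ : Fin d → ℕ) (τ : ℝ) :
    hermiteCoeff (f + g) μ τ = hermiteCoeff f μ τ + hermiteCoeff g μ τ := by
  rw [hermiteCoeff_eq_integral hf, hermiteCoeff_eq_integral hg,
    hermiteCoeff_eq_integral (hf.add hg),
    ← integral_add (integrable_planeWave_mul hf μ τ) (integrable_planeWave_mul hg μ τ)]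
  simp only [Pi.add_apply, mul_add]

theorem hermiteCoeff_smul (c : ℂ) (μ : Fin d → ℕ) (τ : ℝ) :
    hermiteCoeff (c • f) μ τ = c * hermiteCoeff f μ τ := by
  have : ∀ ρ, sliceCoeff (c • f) μ ρ = c * sliceCoeff f μ ρ := fun ρ => by
    simp only [sliceCoeff, Pi.smul_apply, smul_eq_mul, mul_left_comm _ c]
    exact integral_const_mul _ _
  simp only [hermiteCoeff, expIntegral, this, mul_left_comm _ c]
  exact integral_const_mul _ _

theorem RapidDecay.norm_mul_le (hB : RapidDecay f C) (hA : ∀ τ k, ‖m τ k‖ ≤ A)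
    (z : ℝ × EuclideanSpace ℝ (Fin d)) (μ : Fin d → ℕ) (τ : ℝ) :
    ‖Complex.exp (Complex.I * τ * z.1) * (m τ (∑ i, μ i) * hermiteCoeff f μ τ) *
      hermitePhi μ z.2‖ ≤ A * C * (∏ i, (((μ i : ℝ) + 1) ^ 2)⁻¹) * (1 + τ ^ 2)⁻¹ := by
  have hA0 : 0 ≤ A := (norm_nonneg _).trans (hA 0 0)
  rw [norm_mul, norm_mul, norm_mul, norm_exp_I_mul_mul, one_mul, Complex.norm_real,
    Real.norm_eq_abs, mul_assoc]
  calc _ ≤ A * (C * (1 + τ ^ 2)⁻¹ * ∏ i, (((μ i : ℝ) + 1) ^ 2)⁻¹) :=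
        mul_le_mul (hA _ _) (hB μ τ z.2) (by positivity) hA0
    _ = _ := by ring

theorem RapidDecay.integrable (hf : Integrable f) (hB : RapidDecay f C)
    (hm : ∀ k, Measurable fun τ => m τ k) (hA : ∀ τ k, ‖m τ k‖ ≤ A)
    (z : ℝ × EuclideanSpace ℝ (Fin d)) (μ : Fin d → ℕ) :
    Integrable fun τ : ℝ => Complex.exp (Complex.I * τ * z.1) *
      (m τ (∑ i, μ i) * hermiteCoeff f μ τ) * hermitePhi μ z.2 := by
  refine Integrable.mono' (integrable_inv_one_add_sq.const_mul _) ?_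
    (.of_forall fun τ => hB.norm_mul_le hA z μ τ)
  have h1 : Measurable fun τ : ℝ => Complex.exp (Complex.I * τ * z.1) := by fun_prop
  exact ((h1.mul ((hm _).mul (continuous_hermiteCoeff hf μ).measurable)).mul_const
    _).aestronglyMeasurable

theorem multiplierTerm_eq_integral (z : ℝ × EuclideanSpace ℝ (Fin d)) (μ : Fin d → ℕ) :
    multiplierTerm m f z μ = ∫ τ : ℝ, Complex.exp (Complex.I * τ * z.1) *
      (m τ (∑ i, μ i) * hermiteCoeff f μ τ) * hermitePhi μ z.2 := by
  rw [multiplierTerm, expIntegral, integral_mul_const]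

theorem RapidDecay.norm_multiplierTerm_le (hB : RapidDecay f C) (hA : ∀ τ k, ‖m τ k‖ ≤ A)
    (z : ℝ × EuclideanSpace ℝ (Fin d)) (μ : Fin d → ℕ) :
    ‖multiplierTerm m f z μ‖ ≤
      A * C * (∫ τ : ℝ, (1 + τ ^ 2)⁻¹) * ∏ i, (((μ i : ℝ) + 1) ^ 2)⁻¹ := by
  rw [multiplierTerm_eq_integral]
  refine (norm_integral_le_of_norm_le (integrable_inv_one_add_sq.const_mul _)
    (.of_forall fun τ => hB.norm_mul_le hA z μ τ)).trans (le_of_eq ?_)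
  rw [integral_const_mul]
  ring

theorem RapidDecay.summable_multiplierTerm (hB : RapidDecay f C) (hA : ∀ τ k, ‖m τ k‖ ≤ A)
    (z : ℝ × EuclideanSpace ℝ (Fin d)) : Summable (multiplierTerm m f z) :=
  Summable.of_norm_bounded (summable_prod_inv_sq.mul_left _)
    fun μ => hB.norm_multiplierTerm_le hA z μ

theorem multiplierIntegrand_eq (hf : Integrable f) (k : ℕ) (z : ℝ × EuclideanSpace ℝ (Fin d)) :
    multiplierIntegrand m f k z = fun τ : ℝ => ∑ μ ∈ Finset.Nat.antidiagonalTuple d k,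
      ((√(2 * Real.pi))⁻¹ : ℂ) * (Complex.exp (Complex.I * τ * z.1) *
        (m τ (∑ i, μ i) * hermiteCoeff f μ τ) * hermitePhi μ z.2) := by
  funext τ
  rw [multiplierIntegrand, hermiteProj_partialFourier hf, Finset.mul_sum, Finset.mul_sum]
  refine Finset.sum_congr rfl fun μ hμ => ?_
  rw [Finset.Nat.mem_antidiagonalTuple.1 hμ]
  ring

theorem RapidDecay.integrable_multiplierIntegrand (hf : Integrable f) (hB : RapidDecay f C)
    (hm : ∀ k, Measurable fun τ => m τ k) (hA : ∀ τ k, ‖m τ k‖ ≤ A) (k : ℕ)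
    (z : ℝ × EuclideanSpace ℝ (Fin d)) : Integrable (multiplierIntegrand m f k z) := by
  rw [multiplierIntegrand_eq hf]
  exact integrable_finsetSum _ fun μ _ => (hB.integrable hf hm hA z μ).const_mul _

theorem RapidDecay.integral_multiplierIntegrand (hf : Integrable f) (hB : RapidDecay f C)
    (hm : ∀ k, Measurable fun τ => m τ k) (hA : ∀ τ k, ‖m τ k‖ ≤ A) (k : ℕ)
    (z : ℝ × EuclideanSpace ℝ (Fin d)) : ∫ τ, multiplierIntegrand m f k z τ =
      ∑ μ ∈ Finset.Nat.antidiagonalTuple d k,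
        ((√(2 * Real.pi))⁻¹ : ℂ) * multiplierTerm m f z μ := by
  rw [multiplierIntegrand_eq hf,
    integral_finsetSum _ fun μ _ => (hB.integrable hf hm hA z μ).const_mul _]
  refine Finset.sum_congr rfl fun μ _ => ?_
  rw [integral_const_mul, multiplierTerm_eq_integral]

/-- An unconditionally convergent sum over multi-indices may be grouped by |μ|, as in the spectral
definition. -/
theorem hasSum_sum_antidiagonalTuple {T : (Fin d → ℕ) → ℂ} (hT : Summable T) :
    HasSum (fun k => ∑ μ ∈ Finset.Nat.antidiagonalTuple d k, T μ) (∑' μ, T μ) := by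
  have h1 := (Finset.Nat.sigmaAntidiagonalTupleEquivTuple d).hasSum_iff.2 hT.hasSum
  refine h1.sigma fun k => ?_
  exact Finset.hasSum (Finset.Nat.antidiagonalTuple d k) T

theorem RapidDecay.hasSum_integral_multiplierIntegrand (hf : Integrable f) (hB : RapidDecay f C)
    (hm : ∀ k, Measurable fun τ => m τ k) (hA : ∀ τ k, ‖m τ k‖ ≤ A)
    (z : ℝ × EuclideanSpace ℝ (Fin d)) : HasSum (fun k => ∫ τ, multiplierIntegrand m f k z τ)
      (((√(2 * Real.pi))⁻¹ : ℂ) * ∑' μ, multiplierTerm m f z μ) := by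
  have := (hasSum_sum_antidiagonalTuple (hB.summable_multiplierTerm hA z)).mul_left
    ((√(2 * Real.pi))⁻¹ : ℂ)
  simpa only [hB.integral_multiplierIntegrand hf hm hA, Finset.mul_sum] using this

/-- The two factors (2π)^{-1/2}, from the Fourier transform and from its inverse, combine to
(2π)^{-1}. -/
theorem RapidDecay.multiplierOp_eq (hf : Integrable f) (hB : RapidDecay f C)
    (hm : ∀ k, Measurable fun τ => m τ k) (hA : ∀ τ k, ‖m τ k‖ ≤ A)
    (z : ℝ × EuclideanSpace ℝ (Fin d)) : multiplierOp m f z =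
      ((2 * Real.pi)⁻¹ : ℂ) * ∑' μ, multiplierTerm m f z μ := by
  rw [multiplierOp, tsum_mul_left,
    (hB.hasSum_integral_multiplierIntegrand hf hm hA z).tsum_eq, ← mul_assoc]
  congr 1
  rw [← mul_inv, ← Complex.ofReal_mul, Real.mul_self_sqrt (by positivity)]
  push_cast
  rfl

theorem RapidDecay.multiplierOp_add {C' : ℝ} {g : ℝ × EuclideanSpace ℝ (Fin d) → ℂ}
    (hf : Integrable f) (hB : RapidDecay f C) (hg : Integrable g) (hB' : RapidDecay g C')
    {C'' : ℝ} (hBs : RapidDecay (f + g) C'')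
    (hm : ∀ k, Measurable fun τ => m τ k) (hA : ∀ τ k, ‖m τ k‖ ≤ A) :
    multiplierOp m (f + g) = multiplierOp m f + multiplierOp m g := by
  funext z
  rw [Pi.add_apply, hB.multiplierOp_eq hf hm hA, hB'.multiplierOp_eq hg hm hA,
    hBs.multiplierOp_eq (hf.add hg) hm hA, ← mul_add,
    ← (hB.summable_multiplierTerm hA z).tsum_add (hB'.summable_multiplierTerm hA z)]
  congr 1
  refine tsum_congr fun μ => ?_
  rw [multiplierTerm_eq_integral, multiplierTerm_eq_integral, multiplierTerm_eq_integral,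
    ← integral_add (hB.integrable hf hm hA z μ) (hB'.integrable hg hm hA z μ)]
  simp only [hermiteCoeff_add hf hg]
  refine integral_congr_ae (.of_forall fun τ => ?_)
  simp only
  ring

theorem multiplierOp_smul (hf : Integrable f) (hB : RapidDecay f C) (c : ℂ) {C' : ℝ}
    (hB' : RapidDecay (c • f) C') (hm : ∀ k, Measurable fun τ => m τ k)
    (hA : ∀ τ k, ‖m τ k‖ ≤ A) : multiplierOp m (c • f) = c • multiplierOp m f := by
  funext z
  rw [Pi.smul_apply, hB.multiplierOp_eq hf hm hA, hB'.multiplierOp_eq (hf.smul c) hm hA,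
    smul_eq_mul, mul_left_comm, ← tsum_mul_left (a := c)]
  congr 1
  refine tsum_congr fun μ => ?_
  rw [multiplierTerm_eq_integral, multiplierTerm_eq_integral, ← integral_const_mul]
  simp only [hermiteCoeff_smul]
  refine integral_congr_ae (.of_forall fun τ => ?_)
  simp only
  ring

theorem tendsto_truncation (d : ℕ) (m : ℝ → ℕ → ℂ) (τ : ℝ) (k : ℕ) :
    Tendsto (fun n => truncation d m n τ k) atTop (𝓝 (m τ k)) := by
  have h1 : Tendsto (fun n => scale n ^ 2) atTop (𝓝 0) := by
    simp only [scale_sq]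
    exact tendsto_pow_atTop_nhds_zero_of_lt_one (by norm_num) (by norm_num)
  have h2 : Continuous fun s : ℝ => m τ k * (1 - (1 - (Real.exp (-(s * eigenvalue d τ k)) : ℂ)) ^
      symbolOrder d) := by fun_prop
  have h3 := (h2.tendsto 0).comp h1
  simpa [Function.comp_def, truncation, heatComplement, symbolOrder] using h3

theorem HeatBound.continuous_integral_multKer {g : ℝ → ℕ → ℂ} {M : ℝ} (n : ℕ)
    (h : HeatBound g M (scale n ^ 2)) (hd : 1 ≤ d) (hf : Integrable f) :
    Continuous fun z => ∫ w, multKer g z w * f w := by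
  have hs := scale_pos n
  have h1 : scale n ^ 2 ≤ 1 := pow_le_one₀ hs.le (scale_le_one n)
  obtain ⟨M', hM'⟩ := h.exists_norm_multKer_le (by positivity) h1 hd
  exact continuous_integral_mul (h.continuous_multKer (by positivity) h1 hd) hM' hf

/-- The truncations converge pointwise to m and are bounded by |m|. The rapid decay of the
coefficients dominates first the τ-integral and then the sum over μ. The factor 2π is the
normalization of the kernel. -/
theorem RapidDecay.tendsto_integral_multKer (hd : 1 ≤ d) (hf : Integrable f) (hB : RapidDecay f C)
    (hm : ∀ k, Measurable fun τ => m τ k) (hA : ∀ τ k, ‖m τ k‖ ≤ A)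
    (hH : ∀ n, ∃ M, HeatBound (truncation d m n) M (scale n ^ 2))
    (z : ℝ × EuclideanSpace ℝ (Fin d)) :
    Tendsto (fun n => ∫ w, multKer (truncation d m n) z w * f w) atTop
      (𝓝 (2 * Real.pi * multiplierOp m f z)) := by
  have hA' : ∀ n τ k, ‖truncation d m n τ k‖ ≤ A := fun n τ k =>
    (norm_truncation_le d m n τ k).trans (hA τ k)
  have hm' : ∀ n k, Measurable fun τ => truncation d m n τ k := fun n k => by
    obtain ⟨M, hM⟩ := hH n
    exact hM.measurable k
  have e : ∀ n, ∫ w, multKer (truncation d m n) z w * f w =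
      ∑' μ, multiplierTerm (truncation d m n) f z μ := fun n => by
    obtain ⟨M, hM⟩ := hH n
    have hs := scale_pos n
    exact (hM.hasSum_integral_multKer (by positivity) (pow_le_one₀ hs.le (scale_le_one n)) hd hf
      z).tsum_eq.symm
  have hpi : (2 * Real.pi : ℂ) ≠ 0 := by
    exact_mod_cast (by positivity : (2 * Real.pi : ℝ) ≠ 0)
  simp only [e]
  rw [hB.multiplierOp_eq hf hm hA, mul_inv_cancel_left₀ hpi]
  refine tendsto_tsum_of_dominated_convergence (summable_prod_inv_sq.mul_left _) (fun μ => ?_)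
    (.of_forall fun n μ => hB.norm_multiplierTerm_le (hA' n) z μ)
  simp only [multiplierTerm_eq_integral]
  refine tendsto_integral_of_dominated_convergence _
    (fun n => (hB.integrable hf (hm' n) (hA' n) z μ).1) (integrable_inv_one_add_sq.const_mul _)
    (fun n => .of_forall fun τ => hB.norm_mul_le (hA' n) z μ τ) (.of_forall fun τ => ?_)
  exact ((tendsto_const_nhds.mul ((tendsto_truncation d m τ _).mul
    tendsto_const_nhds)).mul tendsto_const_nhds)

theorem RapidDecay.measurable_multiplierOp (hd : 1 ≤ d) (hf : Integrable f) (hB : RapidDecay f C)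
    (hm : ∀ k, Measurable fun τ => m τ k) (hA : ∀ τ k, ‖m τ k‖ ≤ A)
    (hH : ∀ n, ∃ M, HeatBound (truncation d m n) M (scale n ^ 2)) :
    Measurable (multiplierOp m f) := by
  have h1 : Measurable fun z => 2 * Real.pi * multiplierOp m f z := by
    refine measurable_of_tendsto_metrizable (fun n => ?_)
      (tendsto_pi_nhds.2 fun z => hB.tendsto_integral_multKer hd hf hm hA hH z)
    obtain ⟨M, hM⟩ := hH n
    exact (hM.continuous_integral_multKer n hd hf).measurable
  have hpi : (2 * Real.pi : ℂ) ≠ 0 := by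
    exact_mod_cast (by positivity : (2 * Real.pi : ℝ) ≠ 0)
  simpa only [inv_mul_cancel_left₀ hpi] using h1.const_mul ((2 * Real.pi : ℂ)⁻¹)

theorem MikhlinHormander.measurable (h : MikhlinHormander d A m) (k : ℕ) :
    Measurable fun τ => m τ k := by
  have := h.differentiable k 0 (Nat.succ_pos _)
  rw [iteratedDeriv_zero] at this
  exact this.continuous.measurable

/-- Uniform `L^p` bound for the multiplier operators on test functions. -/
theorem exists_lintegral_multiplierOp_le (hd : 1 ≤ d) (A : ℝ) {p : ℝ} (hp : 1 < p) :
    ∃ C : ℝ≥0∞, C < ⊤ ∧ ∀ m, MikhlinHormander d A m →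
      ∀ f : ℝ × EuclideanSpace ℝ (Fin d) → ℂ, ContDiff ℝ ∞ f → HasCompactSupport f →
      Measurable (multiplierOp m f) ∧
        ∫⁻ z, ‖multiplierOp m f z‖ₑ ^ p ≤ C * ∫⁻ w, ‖f w‖ₑ ^ p := by
  obtain ⟨C, hC, h⟩ := exists_lintegral_truncation_le hd A hp
  obtain ⟨C', -, hK⟩ := exists_czKernel_truncation hd A
  refine ⟨C, hC, fun m hm f hf hfc => ?_⟩
  have hfi : Integrable f := hf.continuous.integrable_of_hasCompactSupport hfc
  obtain ⟨B, hB⟩ := exists_rapidDecay hd hf hfc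
  have hH : ∀ n, ∃ M, HeatBound (truncation d m n) M (scale n ^ 2) := fun n =>
    (hK m hm n).imp fun _ h => h.1
  have ht := hB.tendsto_integral_multKer hd hfi hm.measurable hm.norm_le hH
  refine ⟨hB.measurable_multiplierOp hd hfi hm.measurable hm.norm_le hH, ?_⟩
  have hp0 : 0 < p := by linarith
  have hle : ∀ z, ‖multiplierOp m f z‖ₑ ^ p ≤
      liminf (fun n => ‖∫ w, multKer (truncation d m n) z w * f w‖ₑ ^ p) atTop := fun z => by
    have h1 := (ENNReal.continuous_rpow_const (y := p)).continuousAt.tendsto.comp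
      ((continuous_enorm.tendsto _).comp (ht z))
    refine le_trans ?_ h1.liminf_eq.ge
    refine ENNReal.rpow_le_rpow ?_ hp0.le
    rw [enorm_mul]
    -- The limit is 2π times the operator; the factor is at least one and is simply dropped.
    refine le_mul_of_one_le_left' ?_
    rw [← ofReal_norm, ← Complex.ofReal_ofNat, ← Complex.ofReal_mul, Complex.norm_real,
      Real.norm_of_nonneg (by positivity), ENNReal.one_le_ofReal]
    linarith [Real.pi_gt_three]
  refine (lintegral_mono hle).trans ((lintegral_liminf_le fun n => ?_).trans ?_)
  · obtain ⟨M, hM, -⟩ := hK m hm n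
    exact (hM.continuous_integral_multKer n hd hfi).measurable.enorm.pow_const p
  · refine liminf_le_of_le (by isBoundedDefault) fun b hb => ?_
    obtain ⟨n, hn⟩ := hb.exists
    exact hn.trans (h m hm n f hf.continuous hfc)

end PartialOscillator

namespace PartialOscillator

/-! ### Extension to `L^p` -/

/-- The space of test functions. -/
def testFun (E : Type*) [NormedAddCommGroup E] [NormedSpace ℝ E] : Submodule ℂ (E → ℂ) where
  carrier := {f | ContDiff ℝ ∞ f ∧ HasCompactSupport f}
  zero_mem' := ⟨contDiff_const, HasCompactSupport.zero⟩
  add_mem' hf hg := ⟨hf.1.add hg.1, hf.2.add hg.2⟩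
  smul_mem' c _ hf := ⟨hf.1.const_smul c, hf.2.smul_left (f := fun _ => c)⟩

/-- Test functions are dense in L^p for p < ∞, and an operator bounded on a dense subspace extends
with the same norm bound. The estimate also makes it independent of the representative. -/
theorem exists_continuousLinearMap_of_testFun {E : Type*} [NormedAddCommGroup E] [NormedSpace ℝ E]
    [FiniteDimensional ℝ E] [MeasurableSpace E] [BorelSpace E] {ν : Measure E}
    [IsFiniteMeasureOnCompacts ν] {p : ℝ≥0∞} [Fact (1 ≤ p)] (hp : p ≠ ⊤)
    (T : testFun E →ₗ[ℂ] (E → ℂ)) {C : ℝ≥0} (hT : ∀ f, MemLp (T f) p ν)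
    (hC : ∀ f, eLpNorm (T f) p ν ≤ C * eLpNorm (f : E → ℂ) p ν) :
    ∃ S : Lp ℂ p ν →L[ℂ] Lp ℂ p ν, ‖S‖ ≤ C ∧
      ∀ (f : testFun E) (hf : MemLp (f : E → ℂ) p ν), S (hf.toLp f) =ᵐ[ν] T f := by
  have hmem : ∀ f : testFun E, MemLp (f : E → ℂ) p ν := fun f =>
    f.2.1.continuous.memLp_of_hasCompactSupport f.2.2
  let e : testFun E →ₗ[ℂ] Lp ℂ p ν :=
    { toFun := fun f => (hmem f).toLp f
      map_add' := fun f g => MemLp.toLp_add (hmem f) (hmem g)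
      map_smul' := fun c f => MemLp.toLp_const_smul c (hmem f) }
  let F : testFun E →ₗ[ℂ] Lp ℂ p ν :=
    { toFun := fun f => (hT f).toLp (T f)
      map_add' := fun f g => by
        rw [← MemLp.toLp_add (hT f) (hT g)]
        simp only [map_add]
      map_smul' := fun c f => by
        rw [RingHom.id_apply, ← MemLp.toLp_const_smul c (hT f)]
        simp only [map_smul] }
  have hdense : DenseRange e := by
    refine (Lp.dense_hasCompactSupport_contDiff (F := ℂ) (μ := ν) hp).mono ?_
    rintro f ⟨g, hfg, hgc, hg⟩
    exact ⟨⟨g, hg, hgc⟩, Lp.ext ((hmem ⟨g, hg, hgc⟩).coeFn_toLp.trans hfg.symm)⟩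
  have hnorm : ∀ f, ‖F f‖ ≤ C * ‖e f‖ := fun f => by
    change ‖(hT f).toLp (T f)‖ ≤ C * ‖(hmem f).toLp (f : E → ℂ)‖
    rw [Lp.norm_toLp, Lp.norm_toLp, ← ENNReal.coe_toReal, ← ENNReal.toReal_mul]
    exact ENNReal.toReal_mono (ENNReal.mul_ne_top ENNReal.coe_ne_top (hmem f).2.ne) (hC f)
  refine ⟨F.extendOfNorm e, LinearMap.opNorm_extendOfNorm_le hdense C.2 hnorm, fun f hf => ?_⟩
  have h1 : F.extendOfNorm e (e f) = F f := LinearMap.extendOfNorm_eq hdense ⟨C, hnorm⟩ f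
  change F.extendOfNorm e (hf.toLp f) = (hT f).toLp (T f) at h1
  rw [h1]
  exact (hT f).coeFn_toLp

end PartialOscillator

theorem theorem1p1 (d : ℕ) (hd : 1 ≤ d) (p : ℝ≥0∞) [Fact (1 ≤ p)] (hp : 1 < p) (hp' : p < ⊤)
    (A : ℝ) :
    ∃ C : ℝ≥0, ∀ m : ℝ → ℕ → ℂ, MikhlinHormander d A m →
      -- on test functions: `T_m f` is well defined by its formula, and bounded in `L^p`
      (∀ f : ℝ × EuclideanSpace ℝ (Fin d) → ℂ, ContDiff ℝ ∞ f → HasCompactSupport f →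
        (∀ k z, Integrable (multiplierIntegrand m f k z)) ∧
        (∀ z, Summable fun k : ℕ => ∫ τ : ℝ, multiplierIntegrand m f k z τ) ∧
        MemLp (multiplierOp m f) p volume ∧
        eLpNorm (multiplierOp m f) p volume ≤ C * eLpNorm f p volume) ∧
      -- hence `T_m` extends to a bounded operator on `L^p`
      (∃ T : Lp (α := ℝ × EuclideanSpace ℝ (Fin d)) ℂ p volume →L[ℂ]
            Lp (α := ℝ × EuclideanSpace ℝ (Fin d)) ℂ p volume,
        ‖T‖ ≤ C ∧
        ∀ f : ℝ × EuclideanSpace ℝ (Fin d) → ℂ, ContDiff ℝ ∞ f → HasCompactSupport f →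
          ∀ hf : MemLp f p volume, T (hf.toLp f) =ᵐ[volume] multiplierOp m f) := by
  have hp1 : 1 < p.toReal := by
    rw [← ENNReal.toReal_one]
    exact ENNReal.toReal_strict_mono hp'.ne hp
  have hp0 : p ≠ 0 := (zero_lt_one.trans hp).ne'
  obtain ⟨B, hB, h⟩ := exists_lintegral_multiplierOp_le hd A hp1
  have hBt : B ^ (1 / p.toReal) ≠ ⊤ := (ENNReal.rpow_lt_top_of_nonneg (by positivity) hB.ne).ne
  -- B bounds the p-th powers of the norms, so its p-th root bounds the norms; it was chosen before
  -- m and depends only on d, p and A.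
  refine ⟨(B ^ (1 / p.toReal)).toNNReal, fun m hm => ?_⟩
  have hle : ∀ f : ℝ × EuclideanSpace ℝ (Fin d) → ℂ, ContDiff ℝ ∞ f → HasCompactSupport f →
      MemLp (multiplierOp m f) p volume ∧ eLpNorm (multiplierOp m f) p volume ≤
        (B ^ (1 / p.toReal)).toNNReal * eLpNorm f p volume := fun f hf hfc => by
    obtain ⟨hmeas, hb⟩ := h m hm f hf hfc
    have hn : eLpNorm (multiplierOp m f) p volume ≤
        (B ^ (1 / p.toReal)).toNNReal * eLpNorm f p volume := by
      rw [eLpNorm_eq_lintegral_rpow_enorm_toReal hp0 hp'.ne,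
        eLpNorm_eq_lintegral_rpow_enorm_toReal hp0 hp'.ne, ENNReal.coe_toNNReal hBt,
        ← ENNReal.mul_rpow_of_nonneg _ _ (by positivity)]
      exact ENNReal.rpow_le_rpow hb (by positivity)
    exact ⟨⟨hmeas.aestronglyMeasurable, hn.trans_lt (ENNReal.mul_lt_top ENNReal.coe_lt_top
      (hf.continuous.memLp_of_hasCompactSupport hfc).2)⟩, hn⟩
  have hint : ∀ f : testFun (ℝ × EuclideanSpace ℝ (Fin d)),
      Integrable (f : ℝ × EuclideanSpace ℝ (Fin d) → ℂ) := fun f =>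
    f.2.1.continuous.integrable_of_hasCompactSupport f.2.2
  have hdec : ∀ f : testFun (ℝ × EuclideanSpace ℝ (Fin d)), ∃ C,
      RapidDecay (f : ℝ × EuclideanSpace ℝ (Fin d) → ℂ) C := fun f =>
    exists_rapidDecay hd f.2.1 f.2.2
  refine ⟨fun f hf hfc => ?_, ?_⟩
  · have hfi : Integrable f := hint ⟨f, hf, hfc⟩
    obtain ⟨C, hC⟩ := exists_rapidDecay hd hf hfc
    exact ⟨hC.integrable_multiplierIntegrand hfi hm.measurable hm.norm_le, fun z =>
      (hC.hasSum_integral_multiplierIntegrand hfi hm.measurable hm.norm_le z).summable,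
      hle f hf hfc⟩
  · let T : testFun (ℝ × EuclideanSpace ℝ (Fin d)) →ₗ[ℂ] (ℝ × EuclideanSpace ℝ (Fin d) → ℂ) :=
      { toFun := fun f => multiplierOp m f
        map_add' := fun f g => by
          obtain ⟨C₁, h₁⟩ := hdec f
          obtain ⟨C₂, h₂⟩ := hdec g
          obtain ⟨C₃, h₃⟩ := hdec (f + g)
          exact h₁.multiplierOp_add (hint f) (hint g) h₂ h₃ hm.measurable hm.norm_le
        map_smul' := fun c f => by
          obtain ⟨C₁, h₁⟩ := hdec f
          obtain ⟨C₂, h₂⟩ := hdec (c • f)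
          exact multiplierOp_smul (hint f) h₁ c h₂ hm.measurable hm.norm_le }
    obtain ⟨S, hS, hST⟩ := exists_continuousLinearMap_of_testFun hp'.ne T
      (fun f => (hle f f.2.1 f.2.2).1) fun f => (hle f f.2.1 f.2.2).2
    exact ⟨S, hS, fun f hf hfc hfp => hST ⟨f, hf, hfc⟩ hfp⟩
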